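/- Let $\Omega\subset\mathbb R^3$ be a bounded Lipschitz domain, $T>0$, $\nu>0$, $a>0$ and $\lambda\ge 0$. **Constitutive relations.** For $\rho,\theta>0$ let $$P=P_F+\tfrac a3\theta^4,\quad P_F=\theta^{5/2}p\big(\rho\theta^{-3/2}\big),\quad e=\tfrac{3P_F}{2\rho}+\tfrac{a\theta^4}{\rho},\quad s=S\big(\rho\theta^{-3/2}\big)+\tfrac{4a}{3\rho}\theta^3,$$ where $\rho e$ and $\rho s$ are extended to $\rho=0$ by $\rho e=\frac32P_F+a\theta^4$ and $\rho s=\rho S(\rho\theta^{-3/2})+\frac{4a}3\theta^3$ with $0\cdot S(0)=0$. Assume: $p\in C^1[0,\infty)$ with $p'$ locally Lipschitz on $(0,\infty)$, $p(0)=0$, $p'(Z)>0$ for all $Z\ge0$; $\partial_\rho P>0$ and $\partial_\theta e>0$ for all $\rho,\theta>0$; for some constant $c$, $0<\frac{\frac53p(Z)-p'(Z)Z}{Z}<c$ for all $Z>0$; $\lim_{Z\to\infty}p(Z)Z^{-5/3}=p_\infty>0$; $S'(Z)=-\frac32\,\frac{\frac53p(Z)-p'(Z)Z}{Z^2}<0$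 for $Z>0$ and $\lim_{Z\to\infty}S(Z)=0$. Let $\mathbf S(\theta,\nabla u)=\mu(\theta)\big(\nabla u+\nabla^{T}u-\frac23\operatorname{div}u\,\mathbf I\big)+\eta(\theta)\operatorname{div}u\,\mathbf I$ and $q(\theta,\nabla\theta)=-\kappa(\theta)\nabla\theta$ with $\mu(\theta)=\mu_0+\mu_1\theta$, $\eta=0$, $\kappa(\theta)=\kappa_0+\kappa_2\theta^2+\kappa_3\theta^3$, where $\mu_0,\mu_1,\kappa_0,\kappa_2,\kappa_3>0$. **Weak solutions.** $(\rho,u,\theta,H)$ is a weak solution on $(0,T)\times\Omega$ with initial data $(\rho_0,u_0,\theta_0,H_0)$, $\rho_0\ge0$, $\theta_0>0$ (with integrable initial mass, momentum, entropy, energy and magnetic field), if $\rho\ge0$, $\rho\in C_{weak}([0,T];L^{5/3}(\Omega))$, $u\in L^2(0,T;W^{1,2}_0(\Omega;\mathbb R^3))$, $\rho u\in C_{weak}([0,T];L^{5/4}(\Omega;\mathbb R^3))$, $\theta>0$ a.e., $\theta\in L^\infty(0,T;L^4(\Omega))\cap L^2(0,T;W^{1,2}(\Omega))$, $H\in L^2(0,T;W_0^{1,2}(\Omega;\mathbb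 R^3))$, all quantities in the following integrals are integrable, and * for all $\varphi\in C^1([0,T]\times\overline\Omega)$ and all $\tau\in[0,T]$: $\int_\Omega\rho\varphi(\tau)-\int_\Omega\rho_0\varphi(0)=\int_0^\tau\!\int_\Omega(\rho\,\partial_t\varphi+\rho u\cdot\nabla\varphi)$; * for all $\varphi\in C^1([0,T]\times\overline\Omega;\mathbb R^3)$ with $\varphi|_{\partial\Omega}=0$ and all $\tau\in[0,T]$: $\int_\Omega\rho u\cdot\varphi(\tau)-\int_\Omega\rho_0u_0\cdot\varphi(0)=\int_0^\tau\!\int_\Omega\big(\rho u\cdot\partial_t\varphi+\rho u\otimes u:\nabla\varphi+P\operatorname{div}\varphi-\mathbf S:\nabla\varphi+((\nabla\times H)\times H)\cdot\varphi\big)$; * for all $\varphi\in C^1([0,T]\times\overline\Omega)$, $\varphi\ge0$, and almost all $\tau\in[0,T]$: $\int_\Omega\rho_0s(\rho_0,\theta_0)\varphi(0)-\int_\Omega\rho s(\rho,\theta)\varphi(\tau)+\int_0^\tau\!\int_\Omega\frac\varphi\theta\big(\mathbf S:\nabla u-\frac{q\cdot\nabla\theta}\theta\big)\le-\int_0^\tau\!\int_\Omega\big(\rho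 s\,\partial_t\varphi+\rho s\,u\cdot\nabla\varphi+\frac{q\cdot\nabla\varphi}\theta\big)$; * for almost all $\tau\in[0,T]$: $\int_\Omega\big(\frac12\rho|u|^2+\rho e+\frac12|H|^2\big)(\tau)+\int_0^\tau\!\int_\Omega(\lambda|\nabla u|^2+\nu|\nabla\times H|^2)\le\int_\Omega\big(\frac12\rho_0|u_0|^2+\rho_0e(\rho_0,\theta_0)+\frac12|H_0|^2\big)$; * for all $\varphi\in C^1([0,T]\times\overline\Omega;\mathbb R^3)$ with $\varphi|_{\partial\Omega}=0$ and all $\tau\in[0,T]$: $\int_\Omega H\cdot\varphi(\tau)-\int_\Omega H_0\cdot\varphi(0)=\int_0^\tau\!\int_\Omega\big(H\cdot\partial_t\varphi-(H\times u+\nu\nabla\times H)\cdot(\nabla\times\varphi)\big)$. **Classical solutions.** $(\rho',u',\theta',H')$ is a classical solution on $(0,T)\times\Omega$ if $\rho'\in C^1([0,T]\times\overline\Omega)$, if $u',\theta',H'$ and their first derivatives in $(t,x)$ and second derivatives in $x$ are continuous on $[0,T]\times\overline\Omega$, if $\rho'$ and $\theta'$ are bounded below by positive constants, if on $(0,T)\times\Omega$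 $$\partial_t\rho'+\operatorname{div}(\rho'u')=0,\qquad \partial_t(\rho'u')+\operatorname{div}(\rho'u'\otimes u')+\nabla P=\operatorname{div}\mathbf S+(\nabla\times H')\times H',$$ $$\partial_t(\rho's)+\operatorname{div}(\rho's\,u')+\operatorname{div}\frac q{\theta'}=\frac1{\theta'}\Big(\mathbf S:\nabla u'-\frac{q\cdot\nabla\theta'}{\theta'}\Big),\qquad \partial_tH'-\nabla\times(u'\times H')+\nabla\times(\nu\nabla\times H')=0$$ (with $P,s,\mathbf S,q$ evaluated at the primed quantities), and if $u'=0$, $H'=0$ and $q\cdot n=0$ on $\partial\Omega$ (the last one wherever the outer normal $n$ exists). **Theorem.** Let $(\rho,u,\theta,H)$ be a weak solution with initial data $(\rho_0,u_0,\theta_0,H_0)$, and let $(\rho',u',\theta',H')$ be a classical solution with $(\rho',u',\theta',H')(0,\cdot)=(\rho_0,u_0,\theta_0,H_0)$ in $\Omega$. Then $\rho=\rho'$, $u=u'$, $\theta=\theta'$ and $H=H'$ almost everywhere in $(0,T)\times\Omega$. -/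

import Mathlib

open MeasureTheory Set Filter Topology
open scoped ENNReal ContDiff

namespace MHD

noncomputable section

/-- Physical space `ℝ³` with its Euclidean structure. -/
abbrev E3 : Type := EuclideanSpace ℝ (Fin 3)

/-- Values of vector fields; only components and dot products of them are used. -/
abbrev V3 : Type := Fin 3 → ℝ

/-! ### Differential operators -/

/-- The partial derivative `∂_j f (x)`. -/
def pd {F : Type} [NormedAddCommGroup F] [NormedSpace ℝ F] (j : Fin 3) (f : E3 → F) (x : E3) : F :=
  fderiv ℝ f x (EuclideanSpace.single j (1 : ℝ))

/-- The gradient of a scalar function. -/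
def grad (f : E3 → ℝ) (x : E3) : V3 := fun j => pd j f x

/-- The Jacobian `(∇ f)_{ij} = ∂_j f_i` of a vector field. -/
def jac (f : E3 → V3) (x : E3) : Fin 3 → Fin 3 → ℝ := fun i j => pd j f x i

/-- The trace of a `3 × 3` array; the trace of a Jacobian is the divergence. -/
def tr (A : Fin 3 → Fin 3 → ℝ) : ℝ := ∑ i, A i i

/-- The divergence of a vector field. -/
def divg (f : E3 → V3) (x : E3) : ℝ := tr (jac f x)

/-- The curl expressed through the Jacobian `A i j = ∂_j f_i`. -/
def curlOf (A : Fin 3 → Fin 3 → ℝ) : V3 :=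
  ![A 2 1 - A 1 2, A 0 2 - A 2 0, A 1 0 - A 0 1]

/-- The curl of a vector field. -/
def curl (f : E3 → V3) (x : E3) : V3 := curlOf (jac f x)

/-- The contraction `A : B = ∑_{ij} A_{ij} B_{ij}`. -/
def ddot (A B : Fin 3 → Fin 3 → ℝ) : ℝ := ∑ i, ∑ j, A i j * B i j

/-! ### Domains -/

/-- Bounded Lipschitz domain: a bounded, open, connected, nonempty set which near each boundary
point is, after a rigid motion, the strict epigraph of a Lipschitz function `g` of the component
orthogonal to a unit vector `e`. -/
structure IsBoundedLipschitzDomain (Ω : Set E3) : Prop where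
  isOpen : IsOpen Ω
  isConnected : IsConnected Ω
  isBounded : Bornology.IsBounded Ω
  graph : ∀ x₀ ∈ frontier Ω, ∃ (e : E3) (g : E3 → ℝ) (K : NNReal) (r : ℝ),
    ‖e‖ = 1 ∧ LipschitzWith K g ∧ 0 < r ∧
      ∀ x ∈ Metric.ball x₀ r, (x ∈ Ω ↔ g (x - inner ℝ x e • e) < inner ℝ x e)

/-- `n` is the outer unit normal to `Ω` at `x`: up to an error of arbitrarily small aperture, `Ω`
looks near `x` like the half space `(y - x) · n < 0`. For a Lipschitz domain this happens exactly
at the boundary points where the graph function is differentiable. -/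
def IsOuterNormal (Ω : Set E3) (x n : E3) : Prop :=
  ‖n‖ = 1 ∧ ∀ ε > (0 : ℝ), ∃ δ > (0 : ℝ), ∀ y ∈ Metric.ball x δ,
    (inner ℝ (y - x) n < -(ε * ‖y - x‖) → y ∈ Ω) ∧
    (ε * ‖y - x‖ < inner ℝ (y - x) n → y ∉ Ω)

/-! ### Function spaces -/

/-- Lebesgue measure on the space-time cylinder `(0,T) × Ω`. -/
def cylMeasure (T : ℝ) (Ω : Set E3) : Measure (ℝ × E3) :=
  volume.restrict (Ioo (0 : ℝ) T ×ˢ Ω)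

/-- `f` and `G` are square integrable on `Ω` and `G` is the weak gradient of `f`, so that
`f ∈ W^{1,2}(Ω)` with `∇ f = G`. -/
structure MemW12 (Ω : Set E3) (f : E3 → ℝ) (G : E3 → V3) : Prop where
  memLp : MemLp f 2 (volume.restrict Ω)
  memLp_grad : MemLp G 2 (volume.restrict Ω)
  weak_grad : ∀ ψ : E3 → ℝ, ContDiff ℝ ∞ ψ → HasCompactSupport ψ → tsupport ψ ⊆ Ω →
    ∀ j, ∫ x in Ω, f x * pd j ψ x = -∫ x in Ω, G x j * ψ x

/-- `f ∈ W^{1,2}_0(Ω)` with `∇ f = G`: moreover `f` is a limit in `W^{1,2}(Ω)` of smooth functions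
with compact support in `Ω`. -/
structure MemW12Zero (Ω : Set E3) (f : E3 → ℝ) (G : E3 → V3) : Prop extends MemW12 Ω f G where
  approx : ∃ ψ : ℕ → E3 → ℝ,
    (∀ n, ContDiff ℝ ∞ (ψ n) ∧ HasCompactSupport (ψ n) ∧ tsupport (ψ n) ⊆ Ω) ∧
    Tendsto (fun n => eLpNorm (fun x => f x - ψ n x) 2 (volume.restrict Ω)) atTop (𝓝 0) ∧
    Tendsto (fun n => eLpNorm (fun x => G x - grad (ψ n) x) 2 (volume.restrict Ω)) atTop (𝓝 0)

/-- `f ∈ L²(0,T; W^{1,2}(Ω))` with spatial gradient `G`. -/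
structure MemL2W12 (T : ℝ) (Ω : Set E3) (f : ℝ → E3 → ℝ) (G : ℝ → E3 → V3) : Prop where
  memLp : MemLp (fun z : ℝ × E3 => f z.1 z.2) 2 (cylMeasure T Ω)
  memLp_grad : MemLp (fun z : ℝ × E3 => G z.1 z.2) 2 (cylMeasure T Ω)
  slice : ∀ᵐ t ∂(volume.restrict (Ioo (0 : ℝ) T)), MemW12 Ω (f t) (G t)

/-- `f ∈ L²(0,T; W^{1,2}_0(Ω; ℝ³))` with spatial Jacobian `G i j = ∂_j f_i`. -/
structure MemL2W12ZeroVec (T : ℝ) (Ω : Set E3) (f : ℝ → E3 → V3)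
    (G : ℝ → E3 → Fin 3 → Fin 3 → ℝ) : Prop where
  memLp : MemLp (fun z : ℝ × E3 => f z.1 z.2) 2 (cylMeasure T Ω)
  memLp_grad : MemLp (fun z : ℝ × E3 => G z.1 z.2) 2 (cylMeasure T Ω)
  slice : ∀ᵐ t ∂(volume.restrict (Ioo (0 : ℝ) T)),
    ∀ i, MemW12Zero Ω (fun x => f t x i) (fun x => G t x i)

/-- `f ∈ C_weak([0,T]; L^p(Ω))`, where `q` is the exponent conjugate to `p`. -/
structure MemCWeak (T : ℝ) (Ω : Set E3) (p q : ℝ≥0∞) (f : ℝ → E3 → ℝ) : Prop where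
  memLp : ∀ t ∈ Icc (0 : ℝ) T, MemLp (f t) p (volume.restrict Ω)
  weak_cont : ∀ ψ : E3 → ℝ, MemLp ψ q (volume.restrict Ω) →
    ContinuousOn (fun t => ∫ x in Ω, f t x * ψ x) (Icc (0 : ℝ) T)

/-- `f ∈ C¹([0,T] × closure Ω)`. -/
def IsC1 {F : Type} [NormedAddCommGroup F] [NormedSpace ℝ F] (T : ℝ) (Ω : Set E3)
    (f : ℝ → E3 → F) : Prop :=
  ContDiffOn ℝ 1 (fun z : ℝ × E3 => f z.1 z.2) (Icc (0 : ℝ) T ×ˢ closure Ω)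

/-- `f`, its first derivatives and its second spatial derivatives are continuous on
`[0,T] × closure Ω` (that is, those on the open cylinder extend continuously). -/
structure IsC12 {F : Type} [NormedAddCommGroup F] [NormedSpace ℝ F] (T : ℝ) (Ω : Set E3)
    (f : ℝ → E3 → F) : Prop where
  c1 : IsC1 T Ω f
  second : ∃ D2 : ℝ → E3 → (E3 →L[ℝ] E3 →L[ℝ] F),
    ContinuousOn (fun z : ℝ × E3 => D2 z.1 z.2) (Icc (0 : ℝ) T ×ˢ closure Ω) ∧
    ∀ t ∈ Ioo (0 : ℝ) T, ∀ x ∈ Ω, HasFDerivAt (fderiv ℝ (f t)) (D2 t x) x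

/-! ### Constitutive relations -/

/-- The data of the model: radiation constant `a`, resistivity `ν`, the structural functions `p`
(pressure) and `S` (entropy), and the transport coefficients. -/
structure Model where
  a : ℝ
  ν : ℝ
  p : ℝ → ℝ
  S : ℝ → ℝ
  μ : ℝ → ℝ
  η : ℝ → ℝ
  κ : ℝ → ℝ

namespace Model

variable (M : Model)

/-- `P_F = θ^{5/2} p(ρ / θ^{3/2})`. -/
def pressureF (ρ θ : ℝ) : ℝ := θ ^ (5 / 2 : ℝ) * M.p (ρ / θ ^ (3 / 2 : ℝ))

/-- `P = P_F + (a/3) θ⁴`. -/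
def pressure (ρ θ : ℝ) : ℝ := M.pressureF ρ θ + M.a / 3 * θ ^ 4

/-- The specific internal energy `e = e_F + a θ⁴ / ρ`, with `P_F = (2/3) ρ e_F`; for `ρ > 0`. -/
def energy (ρ θ : ℝ) : ℝ := 3 / 2 * M.pressureF ρ θ / ρ + M.a * θ ^ 4 / ρ

/-- The specific entropy `s = S(ρ / θ^{3/2}) + (4a/3) θ³ / ρ`; for `ρ > 0`. -/
def entropy (ρ θ : ℝ) : ℝ := M.S (ρ / θ ^ (3 / 2 : ℝ)) + 4 * M.a / (3 * ρ) * θ ^ 3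

/-- The internal energy per unit volume `ρ e(ρ,θ)`, which also makes sense at `ρ = 0`. -/
def energyDensity (ρ θ : ℝ) : ℝ := 3 / 2 * M.pressureF ρ θ + M.a * θ ^ 4

/-- The entropy per unit volume `ρ s(ρ,θ)`, which also makes sense at `ρ = 0`. -/
def entropyDensity (ρ θ : ℝ) : ℝ :=
  ρ * M.S (ρ / θ ^ (3 / 2 : ℝ)) + 4 * M.a / 3 * θ ^ 3

theorem energyDensity_eq (ρ θ : ℝ) (h : 0 < ρ) : M.energyDensity ρ θ = ρ * M.energy ρ θ := by
  unfold energyDensity energy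
  field_simp

theorem entropyDensity_eq (ρ θ : ℝ) (h : 0 < ρ) : M.entropyDensity ρ θ = ρ * M.entropy ρ θ := by
  unfold entropyDensity entropy
  field_simp

/-- The viscous stress tensor for velocity gradient `A i j = ∂_j u_i`. -/
def stress (θ : ℝ) (A : Fin 3 → Fin 3 → ℝ) : Fin 3 → Fin 3 → ℝ := fun i j =>
  M.μ θ * (A i j + A j i - (if i = j then 2 / 3 * tr A else 0)) +
    (if i = j then M.η θ * tr A else 0)

/-- The heat flux for temperature gradient `g`. -/
def heatFlux (θ : ℝ) (g : V3) : V3 := fun j => -(M.κ θ * g j)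

/-- The entropy production rate `θ⁻¹ (S : ∇u - q · ∇θ / θ)`. -/
def production (θ : ℝ) (A : Fin 3 → Fin 3 → ℝ) (g : V3) : ℝ :=
  1 / θ * (ddot (M.stress θ A) A - (M.heatFlux θ g ⬝ᵥ g) / θ)

/-- The hypotheses on the thermodynamic functions and on the transport coefficients. -/
structure Admissible : Prop where
  a_pos : 0 < M.a
  ν_pos : 0 < M.ν
  p_C1 : ContDiffOn ℝ 1 M.p (Ici 0)
  /-- makes `P` and `s` of class `C^{1,1}` locally, so that their first order Taylor expansions at
  positive states have quadratic remainders -/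
  p_deriv_lip : LocallyLipschitzOn (Ioi 0) (deriv M.p)
  p_zero : M.p 0 = 0
  p_deriv_pos : ∀ Z, 0 ≤ Z → 0 < derivWithin M.p (Ici 0) Z
  /-- thermodynamic stability -/
  stable_pressure : ∀ ρ θ, 0 < ρ → 0 < θ → 0 < deriv (fun r => M.pressure r θ) ρ
  stable_energy : ∀ ρ θ, 0 < ρ → 0 < θ → 0 < deriv (fun τ => M.energy ρ τ) θ
  p_bound : ∃ c : ℝ, ∀ Z, 0 < Z →
    0 < (5 / 3 * M.p Z - deriv M.p Z * Z) / Z ∧ (5 / 3 * M.p Z - deriv M.p Z * Z) / Z < c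
  p_limit : ∃ pinf : ℝ, 0 < pinf ∧ Tendsto (fun Z => M.p Z / Z ^ (5 / 3 : ℝ)) atTop (𝓝 pinf)
  S_deriv : ∀ Z, 0 < Z →
    HasDerivAt M.S (-(3 / 2) * ((5 / 3 * M.p Z - deriv M.p Z * Z) / Z ^ 2)) Z
  S_deriv_neg : ∀ Z, 0 < Z → deriv M.S Z < 0
  /-- third law of thermodynamics -/
  S_limit : Tendsto M.S atTop (𝓝 0)
  viscosity : ∃ μ₀ μ₁ : ℝ, 0 < μ₀ ∧ 0 < μ₁ ∧ ∀ θ, 0 < θ → M.μ θ = μ₀ + μ₁ * θ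
  bulk_viscosity : ∀ θ, 0 < θ → M.η θ = 0
  conductivity : ∃ κ₀ κ₂ κ₃ : ℝ, 0 < κ₀ ∧ 0 < κ₂ ∧ 0 < κ₃ ∧
    ∀ θ, 0 < θ → M.κ θ = κ₀ + κ₂ * θ ^ 2 + κ₃ * θ ^ 3

/-- The total energy per unit volume `½ ρ |u|² + ρ e(ρ,θ) + ½ |H|²`. -/
def totalEnergy (ρ : ℝ) (u : V3) (θ : ℝ) (H : V3) : ℝ :=
  1 / 2 * ρ * (u ⬝ᵥ u) + M.energyDensity ρ θ + 1 / 2 * (H ⬝ᵥ H)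

end Model

/-! ### Solutions -/

/-- Initial data `(ρ₀, u₀, θ₀, H₀)` with nonnegative density and positive temperature for which the
initial mass, momentum, entropy, energy and magnetic field are integrable. -/
structure IsInitialData (M : Model) (Ω : Set E3) (ρ₀ : E3 → ℝ) (u₀ : E3 → V3) (θ₀ : E3 → ℝ)
    (H₀ : E3 → V3) : Prop where
  density_nonneg : ∀ᵐ x ∂(volume.restrict Ω), 0 ≤ ρ₀ x
  temperature_pos : ∀ᵐ x ∂(volume.restrict Ω), 0 < θ₀ x
  int_density : Integrable ρ₀ (volume.restrict Ω)
  int_momentum : Integrable (fun x => ρ₀ x • u₀ x) (volume.restrict Ω)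
  int_entropy : Integrable (fun x => M.entropyDensity (ρ₀ x) (θ₀ x)) (volume.restrict Ω)
  int_energy : Integrable (fun x => M.totalEnergy (ρ₀ x) (u₀ x) (θ₀ x) (H₀ x)) (volume.restrict Ω)
  int_magnetic : Integrable H₀ (volume.restrict Ω)

/-- The defining properties of a weak solution `(ρ, u, θ, H)` with spatial gradients
`Du i j = ∂_j u_i`, `Dθ`, `DH i j = ∂_j H_i`, where `m` is the weakly continuous representative of
the momentum `ρ u`. The number `lam` is the coefficient of `|∇u|²` in the energy inequality. -/
structure WeakSolutionProps (M : Model) (lam T : ℝ) (Ω : Set E3)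
    (ρ₀ : E3 → ℝ) (u₀ : E3 → V3) (θ₀ : E3 → ℝ) (H₀ : E3 → V3)
    (ρ : ℝ → E3 → ℝ) (u : ℝ → E3 → V3) (θ : ℝ → E3 → ℝ) (H : ℝ → E3 → V3)
    (m : ℝ → E3 → V3) (Du : ℝ → E3 → Fin 3 → Fin 3 → ℝ) (Dθ : ℝ → E3 → V3)
    (DH : ℝ → E3 → Fin 3 → Fin 3 → ℝ) : Prop where
  initial : IsInitialData M Ω ρ₀ u₀ θ₀ H₀
  -- regularity
  density_meas : AEStronglyMeasurable (fun z : ℝ × E3 => ρ z.1 z.2) (cylMeasure T Ω)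
  density_nonneg : ∀ t ∈ Icc (0 : ℝ) T, ∀ᵐ x ∂(volume.restrict Ω), 0 ≤ ρ t x
  density_space : MemCWeak T Ω (5 / 3) (5 / 2) ρ
  velocity_space : MemL2W12ZeroVec T Ω u Du
  momentum_space : ∀ i, MemCWeak T Ω (5 / 4) 5 (fun t x => m t x i)
  momentum_eq : ∀ᵐ z ∂(cylMeasure T Ω), m z.1 z.2 = ρ z.1 z.2 • u z.1 z.2
  temperature_pos : ∀ᵐ z ∂(cylMeasure T Ω), 0 < θ z.1 z.2
  temperature_bound : ∃ C : NNReal, ∀ᵐ t ∂(volume.restrict (Ioo (0 : ℝ) T)),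
    eLpNorm (θ t) 4 (volume.restrict Ω) ≤ C
  temperature_space : MemL2W12 T Ω θ Dθ
  magnetic_space : MemL2W12ZeroVec T Ω H DH
  -- integrability of all quantities that occur in the integral relations
  int_momentum : Integrable (fun z : ℝ × E3 => ρ z.1 z.2 • u z.1 z.2) (cylMeasure T Ω)
  int_convection : ∀ i j,
    Integrable (fun z : ℝ × E3 => ρ z.1 z.2 * u z.1 z.2 i * u z.1 z.2 j) (cylMeasure T Ω)
  int_pressure : Integrable (fun z : ℝ × E3 => M.pressure (ρ z.1 z.2) (θ z.1 z.2)) (cylMeasure T Ω)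
  int_stress : Integrable (fun z : ℝ × E3 => M.stress (θ z.1 z.2) (Du z.1 z.2)) (cylMeasure T Ω)
  int_lorentz : Integrable
    (fun z : ℝ × E3 => crossProduct (curlOf (DH z.1 z.2)) (H z.1 z.2)) (cylMeasure T Ω)
  int_entropy : Integrable
    (fun z : ℝ × E3 => M.entropyDensity (ρ z.1 z.2) (θ z.1 z.2)) (cylMeasure T Ω)
  int_entropy_flux : Integrable
    (fun z : ℝ × E3 => M.entropyDensity (ρ z.1 z.2) (θ z.1 z.2) • u z.1 z.2) (cylMeasure T Ω)
  int_heat_flux : Integrable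
    (fun z : ℝ × E3 => (1 / θ z.1 z.2) • M.heatFlux (θ z.1 z.2) (Dθ z.1 z.2)) (cylMeasure T Ω)
  int_production : Integrable
    (fun z : ℝ × E3 => M.production (θ z.1 z.2) (Du z.1 z.2) (Dθ z.1 z.2)) (cylMeasure T Ω)
  int_electric : Integrable (fun z : ℝ × E3 => crossProduct (H z.1 z.2) (u z.1 z.2))
    (cylMeasure T Ω)
  int_energy : ∀ᵐ τ ∂(volume.restrict (Icc (0 : ℝ) T)),
    Integrable (fun x => M.totalEnergy (ρ τ x) (u τ x) (θ τ x) (H τ x)) (volume.restrict Ω)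
  int_magnetic : ∀ τ ∈ Icc (0 : ℝ) T, Integrable (H τ) (volume.restrict Ω)
  /-- balance of mass -/
  mass : ∀ φ : ℝ → E3 → ℝ, IsC1 T Ω φ → ∀ τ ∈ Icc (0 : ℝ) T,
    (∫ x in Ω, ρ τ x * φ τ x) - (∫ x in Ω, ρ₀ x * φ 0 x) =
      ∫ t in (0 : ℝ)..τ, ∫ x in Ω,
        (ρ t x * deriv (fun s => φ s x) t + ρ t x * (u t x ⬝ᵥ grad (φ t) x))
  /-- balance of momentum -/
  momentum : ∀ φ : ℝ → E3 → V3, IsC1 T Ω φ →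
    (∀ t ∈ Icc (0 : ℝ) T, ∀ x ∈ frontier Ω, φ t x = 0) → ∀ τ ∈ Icc (0 : ℝ) T,
    (∫ x in Ω, m τ x ⬝ᵥ φ τ x) - (∫ x in Ω, ρ₀ x * (u₀ x ⬝ᵥ φ 0 x)) =
      ∫ t in (0 : ℝ)..τ, ∫ x in Ω,
        (ρ t x * (u t x ⬝ᵥ deriv (fun s => φ s x) t)
          + ddot (fun i j => ρ t x * u t x i * u t x j) (jac (φ t) x)
          + M.pressure (ρ t x) (θ t x) * divg (φ t) x
          - ddot (M.stress (θ t x) (Du t x)) (jac (φ t) x)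
          + crossProduct (curlOf (DH t x)) (H t x) ⬝ᵥ φ t x)
  /-- entropy inequality -/
  entropy : ∀ φ : ℝ → E3 → ℝ, IsC1 T Ω φ →
    (∀ t ∈ Icc (0 : ℝ) T, ∀ x ∈ closure Ω, 0 ≤ φ t x) →
    ∀ᵐ τ ∂(volume.restrict (Icc (0 : ℝ) T)),
      (∫ x in Ω, M.entropyDensity (ρ₀ x) (θ₀ x) * φ 0 x)
        - (∫ x in Ω, M.entropyDensity (ρ τ x) (θ τ x) * φ τ x)
        + (∫ t in (0 : ℝ)..τ, ∫ x in Ω, φ t x * M.production (θ t x) (Du t x) (Dθ t x))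
      ≤ -∫ t in (0 : ℝ)..τ, ∫ x in Ω,
          (M.entropyDensity (ρ t x) (θ t x) * deriv (fun s => φ s x) t
            + M.entropyDensity (ρ t x) (θ t x) * (u t x ⬝ᵥ grad (φ t) x)
            + (M.heatFlux (θ t x) (Dθ t x) ⬝ᵥ grad (φ t) x) / θ t x)
  /-- total energy inequality -/
  energy : ∀ᵐ τ ∂(volume.restrict (Icc (0 : ℝ) T)),
    (∫ x in Ω, M.totalEnergy (ρ τ x) (u τ x) (θ τ x) (H τ x))
      + (∫ t in (0 : ℝ)..τ, ∫ x in Ω,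
          (lam * ddot (Du t x) (Du t x) + M.ν * (curlOf (DH t x) ⬝ᵥ curlOf (DH t x))))
    ≤ ∫ x in Ω, M.totalEnergy (ρ₀ x) (u₀ x) (θ₀ x) (H₀ x)
  /-- induction equation -/
  induction_eq : ∀ φ : ℝ → E3 → V3, IsC1 T Ω φ →
    (∀ t ∈ Icc (0 : ℝ) T, ∀ x ∈ frontier Ω, φ t x = 0) → ∀ τ ∈ Icc (0 : ℝ) T,
    (∫ x in Ω, H τ x ⬝ᵥ φ τ x) - (∫ x in Ω, H₀ x ⬝ᵥ φ 0 x) =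
      ∫ t in (0 : ℝ)..τ, ∫ x in Ω,
        (H t x ⬝ᵥ deriv (fun s => φ s x) t
          - (crossProduct (H t x) (u t x) + M.ν • curlOf (DH t x)) ⬝ᵥ curl (φ t) x)

/-- `(ρ, u, θ, H)` is a weak solution on `(0,T) × Ω` with initial data `(ρ₀, u₀, θ₀, H₀)`. -/
def IsWeakSolution (M : Model) (lam T : ℝ) (Ω : Set E3)
    (ρ₀ : E3 → ℝ) (u₀ : E3 → V3) (θ₀ : E3 → ℝ) (H₀ : E3 → V3)
    (ρ : ℝ → E3 → ℝ) (u : ℝ → E3 → V3) (θ : ℝ → E3 → ℝ) (H : ℝ → E3 → V3) : Prop :=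
  ∃ (m : ℝ → E3 → V3) (Du : ℝ → E3 → Fin 3 → Fin 3 → ℝ) (Dθ : ℝ → E3 → V3)
    (DH : ℝ → E3 → Fin 3 → Fin 3 → ℝ),
    WeakSolutionProps M lam T Ω ρ₀ u₀ θ₀ H₀ ρ u θ H m Du Dθ DH

/-- `(ρ, u, θ, H)` is a classical solution on `(0,T) × Ω`. -/
structure IsClassicalSolution (M : Model) (T : ℝ) (Ω : Set E3)
    (ρ : ℝ → E3 → ℝ) (u : ℝ → E3 → V3) (θ : ℝ → E3 → ℝ) (H : ℝ → E3 → V3) : Prop where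
  density_reg : IsC1 T Ω ρ
  velocity_reg : IsC12 T Ω u
  temperature_reg : IsC12 T Ω θ
  magnetic_reg : IsC12 T Ω H
  density_lower : ∃ c > (0 : ℝ), ∀ t ∈ Icc (0 : ℝ) T, ∀ x ∈ closure Ω, c ≤ ρ t x
  temperature_lower : ∃ c > (0 : ℝ), ∀ t ∈ Icc (0 : ℝ) T, ∀ x ∈ closure Ω, c ≤ θ t x
  /-- `∂_t ρ + div (ρ u) = 0` -/
  mass : ∀ t ∈ Ioo (0 : ℝ) T, ∀ x ∈ Ω,
    deriv (fun s => ρ s x) t + divg (fun y => ρ t y • u t y) x = 0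
  /-- `∂_t (ρ u) + div (ρ u ⊗ u) + ∇ P = div S + (curl H) × H` -/
  momentum : ∀ t ∈ Ioo (0 : ℝ) T, ∀ x ∈ Ω, ∀ i,
    deriv (fun s => ρ s x * u s x i) t
      + (∑ j, pd j (fun y => ρ t y * u t y i * u t y j) x)
      + pd i (fun y => M.pressure (ρ t y) (θ t y)) x
    = (∑ j, pd j (fun y => M.stress (θ t y) (jac (u t) y) i j) x)
      + crossProduct (curl (H t) x) (H t x) i
  /-- `∂_t (ρ s) + div (ρ s u) + div (q / θ) = θ⁻¹ (S : ∇u - q · ∇θ / θ)` -/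
  entropy : ∀ t ∈ Ioo (0 : ℝ) T, ∀ x ∈ Ω,
    deriv (fun s => ρ s x * M.entropy (ρ s x) (θ s x)) t
      + divg (fun y => (ρ t y * M.entropy (ρ t y) (θ t y)) • u t y) x
      + divg (fun y => (1 / θ t y) • M.heatFlux (θ t y) (grad (θ t) y)) x
    = M.production (θ t x) (jac (u t) x) (grad (θ t) x)
  /-- `∂_t H - curl (u × H) + curl (ν curl H) = 0` -/
  induction_eq : ∀ t ∈ Ioo (0 : ℝ) T, ∀ x ∈ Ω,
    deriv (fun s => H s x) t - curl (fun y => crossProduct (u t y) (H t y)) x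
      + curl (fun y => M.ν • curl (H t) y) x = 0
  velocity_bdry : ∀ t ∈ Ioo (0 : ℝ) T, ∀ x ∈ frontier Ω, u t x = 0
  magnetic_bdry : ∀ t ∈ Ioo (0 : ℝ) T, ∀ x ∈ frontier Ω, H t x = 0
  /-- `q · n = 0` wherever the boundary has a normal; the gradient at a boundary point is the
  derivative relative to `closure Ω`. -/
  heat_flux_bdry : ∀ t ∈ Ioo (0 : ℝ) T, ∀ x ∈ frontier Ω, ∀ n, IsOuterNormal Ω x n →
    ∑ j, M.heatFlux (θ t x)
      (fun k => fderivWithin ℝ (θ t) (closure Ω) x (EuclideanSpace.single k (1 : ℝ))) j * n j = 0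

end

end MHD

namespace MHD

/-! ### Mollification and Lipschitz test functions -/

open scoped Convolution
open ContinuousLinearMap (lsmul)


/-! The proof is the relative energy method. Write (r, U, ϑ, K) for the classical solution. The
distance between the two solutions is measured by the density ½ρ|u − U|² + E + ½|H − K|², where E =
ρe(ρ,θ) − ϑ ρs(ρ,θ) − ρ g(r,ϑ) + P(r,ϑ) (`Model.relEnergy`) and g = e + P/ρ − θs is the chemical
potential (`Model.chemPot`). Since p' > 0 and (5/3)p − p'Z > 0, E is nonnegative and coercive in (ρ
− r, θ − ϑ) (`Model.Admissible.exists_relEnergy_coercive`), so it suffices to show that the integral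
of this density vanishes.

When the squares are expanded (`relDensity_eq`), the density becomes the total energy minus ρs·ϑ,
plus ρ(½|U|² − g), minus ρu·U, minus H·K, plus a term of the classical solution alone. Each summand
is governed by one of the weak relations: the energy inequality, and the entropy, mass, momentum and
induction relations tested with ϑ, ½|U|² − g, U and K. Together with the equality of the initial
data this bounds the relative energy at time τ by the space-time integral of an explicit remainder
(`ae_integral_relDensity_le`).

The remainder is quadratic in the differences once some terms of integral zero are added. These
terms are the classical equations integrated by parts against u − U, θ − ϑ and H − K. After that,
the Maxwell and Gibbs–Duhem relations cancel everything linear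
(`PointData.remainder_add_nullTerms`). What remains consists of Taylor remainders of P and ρs,
convective and flux terms, and the viscous and thermal dissipation. A state (ρ, θ) is either near
(r, ϑ), where E controls the squared distance, or E controls 1 + ρ^{5/3} + θ⁴
(`Model.Admissible.exists_dichotomy`). This handles all terms except a part of the flux terms. The
worst contribution is the radiative entropy flux, of size θ³|u − U|, which is split into θ⁴ and δ
θ²|u − U|².

The term δ(1 + θ²)|u − U|² is absorbed by viscosity. Because μ grows linearly in θ, the viscous
terms leave a fixed multiple of the squared traceless symmetric gradient of u − U
(`Model.Admissible.exists_viscous_bound`). Korn's inequality turns this into the full gradient, and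
the boundedness of θ in L⁴ with the embedding of W^{1,2}_0 into L⁴ yields a weighted Poincaré
inequality. For small δ, Grönwall's inequality closes the argument.

On a domain that is only Lipschitz, two facts need separate proofs: C¹ functions vanishing on the
boundary lie in W^{1,2}_0, and the divergence theorem holds for the tangential field q/θ against θ −
ϑ, which does not vanish on the boundary. -/

theorem pd_eq_lineDeriv {f : E3 → ℝ} {x : E3} (h : DifferentiableAt ℝ f x) (j : Fin 3) :
    pd j f x = lineDeriv ℝ f x (EuclideanSpace.single j 1) :=
  h.lineDeriv_eq_fderiv.symm

/-- The mollification of a Lipschitz function has as derivative the mollified line derivative. -/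
theorem pd_convolution_of_lipschitz {ψ : E3 → ℝ} {C : NNReal} (hψ : LipschitzWith C ψ)
    (φ : ContDiffBump (0 : E3)) (j : Fin 3) (x : E3) :
    pd j (φ.normed volume ⋆[lsmul ℝ ℝ, volume] ψ) x =
      (φ.normed volume ⋆[lsmul ℝ ℝ, volume]
        (fun y => lineDeriv ℝ ψ y (EuclideanSpace.single j 1))) x := by
  have hli : LocallyIntegrable ψ (volume : Measure E3) := hψ.continuous.locallyIntegrable
  have hφ : ContDiff ℝ 1 (φ.normed (volume : Measure E3)) := φ.contDiff_normed
  have hcs := φ.hasCompactSupport_normed (μ := (volume : Measure E3))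
  have h1 := (hcs.hasFDerivAt_convolution_left (lsmul ℝ ℝ) hφ hli x).fderiv
  unfold pd
  have hex := (hcs.fderiv (𝕜 := ℝ)).convolutionExists_left
    (ContinuousLinearMap.precompL E3 (lsmul ℝ ℝ)) (hφ.continuous_fderiv one_ne_zero) hli x
  rw [h1, convolution_def, ContinuousLinearMap.integral_apply hex.integrable]
  have hΨ : LipschitzWith C (fun t => ψ (x - t)) := by
    refine LipschitzWith.of_dist_le_mul fun s t => ?_
    have := hψ.dist_le_mul (x - s) (x - t)
    rwa [dist_sub_left] at this
  obtain ⟨D, hD⟩ := hφ.lipschitzWith_of_hasCompactSupport hcs one_ne_zero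
  -- Integration by parts between two Lipschitz functions, one of them compactly supported. The
  -- direction −e_j compensates the sign produced by the reflection t ↦ x − t.
  have h2 := hΨ.integral_lineDeriv_mul_eq (μ := volume) hD hcs (-(EuclideanSpace.single j 1))
  rw [convolution_def]
  simp only [ContinuousLinearMap.precompL_apply, ContinuousLinearMap.lsmul_apply, smul_eq_mul, neg_neg] at h2 ⊢
  have h3 : ∀ t, lineDeriv ℝ (φ.normed volume) t (EuclideanSpace.single j 1)
      = fderiv ℝ (φ.normed volume) t (EuclideanSpace.single j 1) :=
    fun t => (hφ.differentiable one_ne_zero t).lineDeriv_eq_fderiv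
  have h4 : ∀ t, lineDeriv ℝ (fun t => ψ (x - t)) t (-(EuclideanSpace.single j 1))
      = lineDeriv ℝ ψ (x - t) (EuclideanSpace.single j 1) := by
    intro t
    unfold lineDeriv
    congr 1
    ext s
    simp [sub_add_eq_sub_sub]
  simp only [h3, h4] at h2
  rw [← h2]
  exact integral_congr_ae (.of_forall fun t => mul_comm _ _)

/-- Mollify with kernels of radius at most δ, where the closed δ-thickening of the support still
lies in Ω. A mollified derivative is an average of line derivatives, so it keeps the Lipschitz
bound. By Rademacher's theorem and Lebesgue differentiation it converges almost everywhere. -/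
theorem exists_smooth_approx {Ω : Set E3} (hΩ : IsOpen Ω) {ψ : E3 → ℝ} {C : NNReal}
    (hψ : LipschitzWith C ψ) (hc : HasCompactSupport ψ) (hs : tsupport ψ ⊆ Ω) :
    ∃ f : ℕ → E3 → ℝ,
      (∀ n, ContDiff ℝ ∞ (f n) ∧ HasCompactSupport (f n) ∧ tsupport (f n) ⊆ Ω) ∧
      (∃ B, ∀ n x, |f n x| ≤ B) ∧ (∀ n x j, |pd j (f n) x| ≤ C) ∧
      (∀ x, Tendsto (fun n => f n x) atTop (𝓝 (ψ x))) ∧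
      (∀ j, ∀ᵐ x, Tendsto (fun n => pd j (f n) x) atTop (𝓝 (pd j ψ x))) := by
  obtain ⟨δ, hδ, hδΩ⟩ := hc.isCompact.exists_cthickening_subset_open hΩ hs
  let φ : ℕ → ContDiffBump (0 : E3) := fun n =>
    { rIn := δ / (n + 1) / 2
      rOut := δ / (n + 1)
      rIn_pos := by positivity
      rIn_lt_rOut := half_lt_self (by positivity) }
  have hr : Tendsto (fun n => (φ n).rOut) atTop (𝓝 0) :=
    tendsto_const_nhds.div_atTop (tendsto_atTop_add_const_right _ _ tendsto_natCast_atTop_atTop)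
  have hrδ : ∀ n, (φ n).rOut ≤ δ := fun n => div_le_self hδ.le (by simp)
  have hli : LocallyIntegrable ψ (volume : Measure E3) := hψ.continuous.locallyIntegrable
  have hsupp : ∀ n, tsupport ((φ n).normed volume ⋆[lsmul ℝ ℝ, volume] ψ) ⊆
      Metric.cthickening δ (tsupport ψ) := by
    intro n
    refine closure_minimal ?_ Metric.isClosed_cthickening
    refine (support_convolution_subset _).trans ?_
    rintro _ ⟨y, hy, z, hz, rfl⟩
    rw [(φ n).support_normed_eq] at hy
    refine Metric.mem_cthickening_of_dist_le _ z _ _ (subset_tsupport _ hz) ?_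
    have : dist (y + z) z = dist y 0 := by simp [dist_eq_norm]
    simp only [this]
    exact (Metric.mem_ball.1 hy).le.trans (hrδ n)
  have hdist : ∀ n x, dist (((φ n).normed volume ⋆[lsmul ℝ ℝ, volume] ψ) x) (ψ x) ≤ C * δ := by
    intro n x
    refine ContDiffBump.dist_normed_convolution_le hψ.continuous.aestronglyMeasurable ?_
    intro y hy
    refine (hψ.dist_le_mul y x).trans ?_
    gcongr
    exact (Metric.mem_ball.1 hy).le.trans (hrδ n)
  obtain ⟨B, hB⟩ := hc.exists_bound_of_continuous hψ.continuous
  have hsm : ∀ n, ContDiff ℝ ∞ ((φ n).normed volume ⋆[lsmul ℝ ℝ, volume] ψ) := fun n =>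
    ((φ n).hasCompactSupport_normed).contDiff_convolution_left _ (φ n).contDiff_normed hli
  refine ⟨fun n => (φ n).normed volume ⋆[lsmul ℝ ℝ, volume] ψ, fun n => ⟨hsm n, ?_, ?_⟩,
    ⟨B + C * δ, fun n x => ?_⟩, fun n x j => ?_, fun x => ?_, fun j => ?_⟩
  · exact (hc.isCompact.cthickening).of_isClosed_subset (isClosed_tsupport _) (hsupp n)
  · exact (hsupp n).trans hδΩ
  · have h1 := hdist n x
    rw [Real.dist_eq] at h1
    have h2 := hB x
    rw [Real.norm_eq_abs] at h2
    have := abs_sub_abs_le_abs_sub (((φ n).normed volume ⋆[lsmul ℝ ℝ, volume] ψ) x) (ψ x)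
    linarith
  · rw [pd_convolution_of_lipschitz hψ, convolution_def]
    have hintg : Integrable ((φ n).normed (volume : Measure E3)) := (φ n).integrable_normed
    have : ∀ t, ‖lsmul ℝ ℝ ((φ n).normed volume t)
        (lineDeriv ℝ ψ (x - t) (EuclideanSpace.single j (1 : ℝ)))‖
        ≤ (φ n).normed volume t * C := by
      intro t
      have h1 := norm_lineDeriv_le_of_lipschitz ℝ hψ (x₀ := x - t)
        (v := EuclideanSpace.single j (1 : ℝ))
      simp only [PiLp.norm_single, norm_one, mul_one] at h1
      rw [ContinuousLinearMap.lsmul_apply, norm_smul, Real.norm_of_nonneg ((φ n).nonneg_normed t)]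
      exact mul_le_mul_of_nonneg_left h1 ((φ n).nonneg_normed t)
    have h2 := norm_integral_le_of_norm_le (hintg.mul_const (C : ℝ)) (.of_forall this)
    rw [integral_mul_const, (φ n).integral_normed, one_mul] at h2
    exact h2
  · exact ContDiffBump.convolution_tendsto_right_of_continuous hr hψ.continuous x
  -- The bumps have outer radius exactly twice the inner one, the bounded ratio that Lebesgue
  -- differentiation requires.
  · have h1 := ContDiffBump.ae_convolution_tendsto_right_of_locallyIntegrable (φ := φ) (K := 2) hr
      (.of_forall fun n => by simp only [φ]; linarith)
      (hψ.locallyIntegrable_lineDeriv (μ := volume) (EuclideanSpace.single j 1))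
    filter_upwards [h1, hψ.ae_differentiableAt (μ := volume)] with x hx hd
    rw [pd_eq_lineDeriv hd]
    simpa only [pd_convolution_of_lipschitz hψ] using hx

theorem IsBoundedLipschitzDomain.measure_ne_top {Ω : Set E3} (hΩ : IsBoundedLipschitzDomain Ω) :
    volume Ω ≠ ⊤ := hΩ.isBounded.measure_lt_top.ne

/-- Dominated convergence along the smooth approximants: values and derivatives are uniformly
bounded and Ω has finite measure. Lipschitz test functions are needed later because the cutoffs near
the boundary are built from the graph function. -/
theorem MemW12.integral_mul_pd_of_lipschitz {Ω : Set E3} (hΩ : IsOpen Ω) (hfin : volume Ω ≠ ⊤)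
    {w : E3 → ℝ} {G : E3 → V3} (h : MemW12 Ω w G) {ψ : E3 → ℝ} {C : NNReal}
    (hψ : LipschitzWith C ψ) (hc : HasCompactSupport ψ) (hs : tsupport ψ ⊆ Ω) (j : Fin 3) :
    ∫ x in Ω, w x * pd j ψ x = -∫ x in Ω, G x j * ψ x := by
  have : IsFiniteMeasure (volume.restrict Ω) := ⟨by simpa using hfin.lt_top⟩
  obtain ⟨f, hf, ⟨B, hB⟩, hC, hlim, hlim'⟩ := exists_smooth_approx hΩ hψ hc hs
  have hw : Integrable w (volume.restrict Ω) := h.memLp.integrable one_le_two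
  have hG : Integrable (fun x => G x j) (volume.restrict Ω) :=
    (h.memLp_grad.eval j).integrable one_le_two
  have hpdm : ∀ n, Continuous (pd j (f n)) := fun n =>
    ((hf n).1.continuous_fderiv (by simp)).clm_apply continuous_const
  have h1 : Tendsto (fun n => ∫ x in Ω, w x * pd j (f n) x) atTop
      (𝓝 (∫ x in Ω, w x * pd j ψ x)) := by
    refine tendsto_integral_of_dominated_convergence (fun x => ‖w x‖ * C)
      (fun n => hw.aestronglyMeasurable.mul (hpdm n).aestronglyMeasurable)
      (hw.norm.mul_const _) (fun n => .of_forall fun x => ?_) ?_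
    · rw [norm_mul]
      exact mul_le_mul_of_nonneg_left (hC n x j) (norm_nonneg _)
    · filter_upwards [ae_restrict_of_ae (hlim' j)] with x hx using hx.const_mul _
  have h2 : Tendsto (fun n => -∫ x in Ω, G x j * f n x) atTop
      (𝓝 (-∫ x in Ω, G x j * ψ x)) := by
    refine Tendsto.neg <| tendsto_integral_of_dominated_convergence (fun x => ‖G x j‖ * B)
      (fun n => hG.aestronglyMeasurable.mul (hf n).1.continuous.aestronglyMeasurable)
      (hG.norm.mul_const _) (fun n => .of_forall fun x => ?_) (.of_forall fun x => ?_)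
    · rw [norm_mul]
      exact mul_le_mul_of_nonneg_left (hB n x) (norm_nonneg _)
    · exact (hlim x).const_mul _
  refine tendsto_nhds_unique h1 (h2.congr fun n => ?_)
  exact (h.weak_grad (f n) (hf n).1 (hf n).2.1 (hf n).2.2 j).symm

/-! ### Integration by parts in W^{1,2}_0, Sobolev embedding and Korn's inequality -/

theorem tendsto_integral_mul_of_tendsto_L2 {α : Type*} [MeasurableSpace α] {μ : Measure α}
    {a b : α → ℝ} {f g : ℕ → α → ℝ} (ha : MemLp a 2 μ) (hb : MemLp b 2 μ)
    (hf : ∀ n, MemLp (f n) 2 μ) (hg : ∀ n, MemLp (g n) 2 μ)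
    (hfa : Tendsto (fun n => eLpNorm (fun x => a x - f n x) 2 μ) atTop (𝓝 0))
    (hgb : Tendsto (fun n => eLpNorm (fun x => b x - g n x) 2 μ) atTop (𝓝 0)) :
    Tendsto (fun n => ∫ x, f n x * g n x ∂μ) atTop (𝓝 (∫ x, a x * b x ∂μ)) := by
  have key : ∀ {c d : α → ℝ} (hc : MemLp c 2 μ) (hd : MemLp d 2 μ),
      ∫ x, c x * d x ∂μ = inner ℝ (hc.toLp c) (hd.toLp d) := by
    intro c d hc hd
    rw [L2.inner_def]
    refine integral_congr_ae ?_
    filter_upwards [hc.coeFn_toLp, hd.coeFn_toLp] with x h1 h2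
    rw [h1, h2]
    simp [mul_comm]
  have hL : ∀ {c : α → ℝ} {k : ℕ → α → ℝ} (hc : MemLp c 2 μ) (hk : ∀ n, MemLp (k n) 2 μ),
      Tendsto (fun n => eLpNorm (fun x => c x - k n x) 2 μ) atTop (𝓝 0) →
      Tendsto (fun n => (hk n).toLp (k n)) atTop (𝓝 (hc.toLp c)) := by
    intro c k hc hk h
    rw [Lp.tendsto_Lp_iff_tendsto_eLpNorm'']
    refine h.congr fun n => ?_
    exact eLpNorm_sub_comm c (k n) 2 μ
  rw [key ha hb]
  simp only [fun n => key (hf n) (hg n)]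
  exact (hL ha hf hfa).inner (hL hb hg hgb)

/-- Functions that are continuously differentiable on `Ω` and bounded there together with their
derivative. -/
structure C1Bdd (Ω : Set E3) (F : E3 → ℝ) : Prop where
  diff : ∀ x ∈ Ω, DifferentiableAt ℝ F x
  cont : ContinuousOn (fderiv ℝ F) Ω
  bdd : ∃ N, ∀ x ∈ Ω, |F x| ≤ N ∧ ‖fderiv ℝ F x‖ ≤ N

theorem abs_pd_le (F : E3 → ℝ) (x : E3) (j : Fin 3) : |pd j F x| ≤ ‖fderiv ℝ F x‖ := by
  have := (fderiv ℝ F x).le_opNorm (EuclideanSpace.single j (1 : ℝ))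
  rwa [PiLp.norm_single, norm_one, mul_one] at this

theorem C1Bdd.memLp {Ω : Set E3} (hΩ : IsOpen Ω) (hfin : volume Ω ≠ ⊤) {F : E3 → ℝ}
    (h : C1Bdd Ω F) (p : ℝ≥0∞) : MemLp F p (volume.restrict Ω) := by
  have : IsFiniteMeasure (volume.restrict Ω) := ⟨by simpa using hfin.lt_top⟩
  obtain ⟨N, hN⟩ := h.bdd
  refine MemLp.of_bound ?_ N ?_
  · exact ContinuousOn.aestronglyMeasurable
      (fun x hx => (h.diff x hx).continuousAt.continuousWithinAt) hΩ.measurableSet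
  · filter_upwards [ae_restrict_mem hΩ.measurableSet] with x hx using (hN x hx).1

theorem C1Bdd.memLp_pd {Ω : Set E3} (hΩ : IsOpen Ω) (hfin : volume Ω ≠ ⊤) {F : E3 → ℝ}
    (h : C1Bdd Ω F) (p : ℝ≥0∞) (j : Fin 3) : MemLp (pd j F) p (volume.restrict Ω) := by
  have : IsFiniteMeasure (volume.restrict Ω) := ⟨by simpa using hfin.lt_top⟩
  obtain ⟨N, hN⟩ := h.bdd
  refine MemLp.of_bound ?_ N ?_
  · exact (h.cont.clm_apply continuousOn_const).aestronglyMeasurable hΩ.measurableSet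
  · filter_upwards [ae_restrict_mem hΩ.measurableSet] with x hx
    exact (abs_pd_le F x j).trans (hN x hx).2

theorem C1Bdd.of_contDiff_compactSupport {F : E3 → ℝ} (Ω : Set E3) (h : ContDiff ℝ 1 F)
    (hc : HasCompactSupport F) : C1Bdd Ω F := by
  obtain ⟨N, hN⟩ := hc.exists_bound_of_continuous h.continuous
  obtain ⟨N', hN'⟩ := (hc.fderiv (𝕜 := ℝ)).exists_bound_of_continuous
    (h.continuous_fderiv one_ne_zero)
  exact ⟨fun x _ => h.differentiable one_ne_zero x, (h.continuous_fderiv one_ne_zero).continuousOn,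
    max N N', fun x _ => ⟨(hN x).trans (le_max_left _ _), (hN' x).trans (le_max_right _ _)⟩⟩

/-- F is differentiable only on Ω, but every integrand carries ψ or a derivative of ψ and therefore
vanishes off Ω. The integrals may be taken over the whole space, where integration by parts asks for
the derivative of F only on the support of ψ. -/
theorem integral_mul_pd_of_compactSupport {Ω : Set E3} (hΩ : IsOpen Ω) (hfin : volume Ω ≠ ⊤)
    {ψ F : E3 → ℝ} (hψ : ContDiff ℝ 1 ψ) (hc : HasCompactSupport ψ) (hs : tsupport ψ ⊆ Ω)
    (hF : C1Bdd Ω F) (j : Fin 3) :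
    ∫ x in Ω, ψ x * pd j F x = -∫ x in Ω, pd j ψ x * F x := by
  have hz : ∀ x, x ∉ Ω → ψ x = 0 := fun x hx => image_eq_zero_of_notMem_tsupport fun h => hx (hs h)
  have hz' : ∀ x, x ∉ Ω → pd j ψ x = 0 := by
    intro x hx
    have : fderiv ℝ ψ x = 0 := by
      by_contra h
      exact hx (hs (support_fderiv_subset ℝ h))
    simp [pd, this]
  have hC := C1Bdd.of_contDiff_compactSupport Ω hψ hc
  have key : ∀ {a b : E3 → ℝ}, (∀ x, x ∉ Ω → a x = 0) → MemLp a 2 (volume.restrict Ω) →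
      MemLp b 2 (volume.restrict Ω) → Integrable (fun x => a x * b x) volume := by
    intro a b h0 ha hb
    have h1 : IntegrableOn (fun x => a x * b x) Ω := ha.integrable_mul hb
    rw [← integrableOn_univ]
    refine h1.of_forall_sdiff_eq_zero MeasurableSet.univ ?_
    intro x hx
    simp [h0 x hx.2]
  rw [setIntegral_eq_integral_of_forall_compl_eq_zero (fun x hx => by simp [hz x hx]),
    setIntegral_eq_integral_of_forall_compl_eq_zero (fun x hx => by simp [hz' x hx])]
  have := integral_bilinear_hasLineDerivAt_right_eq_neg_left_of_integrable (μ := volume)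
    (f := ψ) (f' := pd j ψ) (g := F) (g' := pd j F) (v := EuclideanSpace.single j (1 : ℝ))
    (B := ContinuousLinearMap.mul ℝ ℝ) ?_ ?_ ?_ ?_ ?_
  · simpa using this
  · exact key hz' (hC.memLp_pd hΩ hfin 2 j) (hF.memLp hΩ hfin 2)
  · exact key hz (hC.memLp hΩ hfin 2) (hF.memLp_pd hΩ hfin 2 j)
  · exact key hz (hC.memLp hΩ hfin 2) (hF.memLp hΩ hfin 2)
  · exact fun x _ => (hψ.differentiable one_ne_zero x).hasFDerivAt.hasLineDerivAt _
  · exact fun x hx => (hF.diff x (hs hx)).hasFDerivAt.hasLineDerivAt _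

theorem eLpNorm_apply_le {α : Type*} [MeasurableSpace α] {μ : Measure α} (f : α → V3)
    (p : ℝ≥0∞) (j : Fin 3) : eLpNorm (fun x => f x j) p μ ≤ eLpNorm f p μ :=
  eLpNorm_mono fun x => norm_le_pi_norm (f x) j

theorem tendsto_eLpNorm_apply {α : Type*} [MeasurableSpace α] {μ : Measure α} {G : α → V3}
    {f : ℕ → α → V3} (h : Tendsto (fun n => eLpNorm (fun x => G x - f n x) 2 μ) atTop (𝓝 0))
    (j : Fin 3) : Tendsto (fun n => eLpNorm (fun x => G x j - f n x j) 2 μ) atTop (𝓝 0) :=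
  tendsto_of_tendsto_of_tendsto_of_le_of_le tendsto_const_nhds h (fun _ => zero_le)
    fun n => eLpNorm_apply_le (fun x => G x - f n x) 2 j

/-- F need not vanish on the boundary: the boundary term is killed by the compactly supported
approximants of w, and both sides pass to the L² limit. -/
theorem MemW12Zero.integral_mul_pd {Ω : Set E3} (hΩ : IsOpen Ω) (hfin : volume Ω ≠ ⊤)
    {w : E3 → ℝ} {G : E3 → V3} (h : MemW12Zero Ω w G) {F : E3 → ℝ} (hF : C1Bdd Ω F) (j : Fin 3) :
    ∫ x in Ω, w x * pd j F x = -∫ x in Ω, G x j * F x := by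
  obtain ⟨ψ, hψ, h1, h2⟩ := h.approx
  have hC : ∀ n, C1Bdd Ω (ψ n) := fun n =>
    C1Bdd.of_contDiff_compactSupport Ω ((hψ n).1.of_le (by simp)) (hψ n).2.1
  have t1 := tendsto_integral_mul_of_tendsto_L2 h.memLp (hF.memLp_pd hΩ hfin 2 j)
    (fun n => (hC n).memLp hΩ hfin 2) (fun _ => hF.memLp_pd hΩ hfin 2 j) h1 (by simp)
  have t2 := tendsto_integral_mul_of_tendsto_L2 (h.memLp_grad.eval j) (hF.memLp hΩ hfin 2)
    (fun n => (hC n).memLp_pd hΩ hfin 2 j) (fun _ => hF.memLp hΩ hfin 2)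
    (tendsto_eLpNorm_apply h2 j) (by simp)
  refine tendsto_nhds_unique t1 (t2.neg.congr fun n => ?_)
  exact (integral_mul_pd_of_compactSupport hΩ hfin ((hψ n).1.of_le (by simp)) (hψ n).2.1
    (hψ n).2.2 hF j).symm

/-- The determinant structure of null Lagrangians: mixed products of first derivatives of
`W^{1,2}_0` functions have symmetric integrals. -/
theorem MemW12Zero.integral_grad_mul_grad_comm {Ω : Set E3} (hΩ : IsOpen Ω)
    (hfin : volume Ω ≠ ⊤) {f g : E3 → ℝ} {F G : E3 → V3} (hf : MemW12Zero Ω f F)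
    (hg : MemW12Zero Ω g G) (i j : Fin 3) :
    ∫ x in Ω, F x i * G x j = ∫ x in Ω, F x j * G x i := by
  obtain ⟨φ, hφ, -, h2⟩ := hf.approx
  obtain ⟨ψ, hψ, -, h2'⟩ := hg.approx
  have hC : ∀ n, C1Bdd Ω (φ n) := fun n =>
    C1Bdd.of_contDiff_compactSupport Ω ((hφ n).1.of_le (by simp)) (hφ n).2.1
  have hC' : ∀ n, C1Bdd Ω (ψ n) := fun n =>
    C1Bdd.of_contDiff_compactSupport Ω ((hψ n).1.of_le (by simp)) (hψ n).2.1
  have t : ∀ i j, Tendsto (fun n => ∫ x in Ω, pd i (φ n) x * pd j (ψ n) x) atTop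
      (𝓝 (∫ x in Ω, F x i * G x j)) := fun i j =>
    tendsto_integral_mul_of_tendsto_L2 (hf.memLp_grad.eval i) (hg.memLp_grad.eval j)
      (fun n => (hC n).memLp_pd hΩ hfin 2 i) (fun n => (hC' n).memLp_pd hΩ hfin 2 j)
      (tendsto_eLpNorm_apply h2 i) (tendsto_eLpNorm_apply h2' j)
  have hpd : ∀ n k, ContDiff ℝ 1 (pd k (ψ n)) := fun n k =>
    (((hψ n).1.fderiv_right (m := 1) (by norm_cast)).clm_apply contDiff_const)
  have hpdc : ∀ n k, HasCompactSupport (pd k (ψ n)) := fun n k =>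
    ((hψ n).2.1.fderiv (𝕜 := ℝ)).comp_left
      (g := fun L : E3 →L[ℝ] ℝ => L (EuclideanSpace.single k (1 : ℝ))) (by simp)
  have ibp : ∀ n i j, ∫ x in Ω, pd i (φ n) x * pd j (ψ n) x
      = -∫ x in Ω, φ n x * pd i (pd j (ψ n)) x := by
    intro n i j
    rw [integral_mul_pd_of_compactSupport hΩ hfin ((hφ n).1.of_le (by simp)) (hφ n).2.1
      (hφ n).2.2 (C1Bdd.of_contDiff_compactSupport Ω (hpd n j) (hpdc n j)) i, neg_neg]
  have sym : ∀ n i j x, pd i (pd j (ψ n)) x = pd j (pd i (ψ n)) x := by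
    intro n i j x
    have hs : IsSymmSndFDerivAt ℝ (ψ n) x :=
      (hψ n).1.contDiffAt.isSymmSndFDerivAt (by
        rw [minSmoothness_of_isRCLikeNormedField]
        exact WithTop.coe_le_coe.2 (le_top : (2 : ℕ∞) ≤ ⊤))
    have hd : DifferentiableAt ℝ (fderiv ℝ (ψ n)) x :=
      ((hψ n).1.fderiv_right (m := 1) (by norm_cast)).differentiable one_ne_zero x
    have e : ∀ i j, pd i (pd j (ψ n)) x = fderiv ℝ (fderiv ℝ (ψ n)) x
        (EuclideanSpace.single i 1) (EuclideanSpace.single j 1) := by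
      intro i j
      have := hd.hasFDerivAt.clm_apply
        (hasFDerivAt_const (EuclideanSpace.single j (1 : ℝ) : E3) x)
      unfold pd
      rw [this.fderiv]
      simp
    rw [e, e]
    exact hs.eq _ _
  -- For the approximants both integrals equal −∫ φ_n ∂_i∂_j ψ_n by integration by parts and the
  -- symmetry of second derivatives.
  refine tendsto_nhds_unique (t i j) ((t j i).congr fun n => ?_)
  rw [ibp, ibp]
  simp only [sym n j i]

theorem norm_fderiv_le_norm_grad (f : E3 → ℝ) (x : E3) : ‖fderiv ℝ f x‖ ≤ 3 * ‖grad f x‖ := by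
  refine ContinuousLinearMap.opNorm_le_bound _ (by positivity) fun v => ?_
  have hv : v = ∑ j, v j • (EuclideanSpace.single j (1 : ℝ) : E3) := by
    ext i
    fin_cases i <;> simp [Fin.sum_univ_three]
  have h1 : fderiv ℝ f x v = ∑ j, v j * grad f x j := by
    conv_lhs => rw [hv]
    simp [grad, pd]
  rw [h1]
  refine (norm_sum_le _ _).trans ?_
  have : ∀ j ∈ (Finset.univ : Finset (Fin 3)), ‖v j * grad f x j‖ ≤ ‖v‖ * ‖grad f x‖ := by
    intro j _
    rw [norm_mul]
    exact mul_le_mul (PiLp.norm_apply_le v j) (norm_le_pi_norm _ j) (norm_nonneg _) (norm_nonneg _)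
  refine (Finset.sum_le_sum this).trans ?_
  simp only [Finset.sum_const, Finset.card_univ, Fintype.card_fin, nsmul_eq_mul]
  push_cast
  linarith

/-- Gagliardo–Nirenberg–Sobolev for the approximants, where 4 is below the critical exponent 6 and
the boundedness of Ω lowers 6 to 4. Since L² convergence gives almost everywhere convergence along a
subsequence, Fatou's lemma carries the bound to w. The exponent 4 is the one that pairs with θ ∈ L⁴.
-/
theorem exists_eLpNorm_four_le {Ω : Set E3} (hb : Bornology.IsBounded Ω) :
    ∃ C : NNReal, ∀ (w : E3 → ℝ) (G : E3 → V3), MemW12Zero Ω w G →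
      eLpNorm w 4 (volume.restrict Ω) ≤ C * eLpNorm G 2 (volume.restrict Ω) := by
  refine ⟨eLpNormLESNormFDerivOfLeConst ℝ (volume : Measure E3) Ω 2 4 * 3, fun w G h => ?_⟩
  set C := eLpNormLESNormFDerivOfLeConst ℝ (volume : Measure E3) Ω 2 4 with hC
  obtain ⟨ψ, hψ, h1, h2⟩ := h.approx
  have hgm : ∀ n, Continuous (grad (ψ n)) := fun n => continuous_pi fun j =>
    ((hψ n).1.continuous_fderiv (by simp)).clm_apply continuous_const
  have bound : ∀ n, eLpNorm (ψ n) 4 (volume.restrict Ω) ≤ ((C * 3 : NNReal) : ℝ≥0∞) *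
      (eLpNorm G 2 (volume.restrict Ω)
        + eLpNorm (fun x => G x - grad (ψ n) x) 2 (volume.restrict Ω)) := by
    intro n
    have hsub : Function.support (ψ n) ⊆ Ω := (subset_tsupport _).trans (hψ n).2.2
    have hsub' : Function.support (fderiv ℝ (ψ n)) ⊆ Ω :=
      (support_fderiv_subset ℝ).trans (hψ n).2.2
    have s1 := eLpNorm_le_eLpNorm_fderiv_of_le (volume : Measure E3) (u := ψ n)
      ((hψ n).1.of_le (by simp)) hsub (p := 2) (q := 4) (by norm_num) (by simp; norm_num)
      (by simp; norm_num) hb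
    rw [← hC] at s1
    have e1 : eLpNorm (ψ n) ((4 : NNReal) : ℝ≥0∞) volume = eLpNorm (ψ n) 4 (volume.restrict Ω) := by
      rw [eLpNorm_restrict_eq_of_support_subset hsub]; rfl
    have e2 : eLpNorm (fderiv ℝ (ψ n)) ((2 : NNReal) : ℝ≥0∞) volume
        = eLpNorm (fderiv ℝ (ψ n)) 2 (volume.restrict Ω) := by
      rw [← eLpNorm_norm (fderiv ℝ (ψ n)), ← eLpNorm_norm (fderiv ℝ (ψ n)),
        eLpNorm_restrict_eq_of_support_subset (f := fun x => ‖fderiv ℝ (ψ n) x‖)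
          (fun x hx => hsub' fun h0 => hx (by simp [h0]))]
      rfl
    rw [e1, e2] at s1
    refine s1.trans ?_
    rw [ENNReal.coe_mul, mul_assoc]
    gcongr
    have s2 : eLpNorm (fderiv ℝ (ψ n)) 2 (volume.restrict Ω)
        ≤ (3 : NNReal) • eLpNorm (grad (ψ n)) 2 (volume.restrict Ω) :=
      eLpNorm_le_nnreal_smul_eLpNorm_of_ae_le_mul
        (.of_forall fun x => norm_fderiv_le_norm_grad (ψ n) x) 2
    refine s2.trans ?_
    rw [ENNReal.smul_def, smul_eq_mul]
    gcongr
    have s3 : grad (ψ n) = G - (fun x => G x - grad (ψ n) x) := by ext x j; simp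
    conv_lhs => rw [s3]
    exact eLpNorm_sub_le h.memLp_grad.aestronglyMeasurable
      (h.memLp_grad.aestronglyMeasurable.sub (hgm n).aestronglyMeasurable) one_le_two
  have hm : TendstoInMeasure (volume.restrict Ω) ψ atTop w := by
    refine tendstoInMeasure_of_tendsto_eLpNorm (p := 2) (by norm_num)
      (fun n => (hψ n).1.continuous.aestronglyMeasurable) h.memLp.aestronglyMeasurable ?_
    exact h1.congr fun n => eLpNorm_sub_comm w (ψ n) 2 _
  obtain ⟨ns, hns, hae⟩ := hm.exists_seq_tendsto_ae
  refine (Lp.eLpNorm_lim_le_liminf_eLpNorm (f := fun k => ψ (ns k))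
    (fun k => (hψ _).1.continuous.aestronglyMeasurable) w hae).trans ?_
  have hlim : Tendsto (fun k => ((C * 3 : NNReal) : ℝ≥0∞) * (eLpNorm G 2 (volume.restrict Ω)
        + eLpNorm (fun x => G x - grad (ψ (ns k)) x) 2 (volume.restrict Ω))) atTop
      (𝓝 (((C * 3 : NNReal) : ℝ≥0∞) * (eLpNorm G 2 (volume.restrict Ω) + 0))) := by
    refine ENNReal.Tendsto.const_mul ?_ (Or.inr ENNReal.coe_ne_top)
    exact tendsto_const_nhds.add (h2.comp hns.tendsto_atTop)
  rw [add_zero] at hlim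
  rw [← hlim.liminf_eq]
  exact liminf_le_liminf (.of_forall fun k => bound (ns k))

theorem MemW12Zero.sub {Ω : Set E3} {f g : E3 → ℝ} {F G : E3 → V3} (hf : MemW12Zero Ω f F)
    (hg : MemW12Zero Ω g G) (hfin : volume Ω ≠ ⊤) :
    MemW12Zero Ω (fun x => f x - g x) (fun x => F x - G x) := by
  have : IsFiniteMeasure (volume.restrict Ω) := ⟨by simpa using hfin.lt_top⟩
  have hbd : ∀ ψ : E3 → ℝ, ContDiff ℝ ∞ ψ → HasCompactSupport ψ →
      MemLp ψ 2 (volume.restrict Ω) ∧ ∀ j, MemLp (pd j ψ) 2 (volume.restrict Ω) := by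
    intro ψ hψ hc
    refine ⟨hψ.continuous.memLp_of_hasCompactSupport hc, fun j => ?_⟩
    refine Continuous.memLp_of_hasCompactSupport
      ((hψ.continuous_fderiv (by simp)).clm_apply continuous_const) ?_
    exact (hc.fderiv (𝕜 := ℝ)).comp_left
      (g := fun L : E3 →L[ℝ] ℝ => L (EuclideanSpace.single j (1 : ℝ))) (by simp)
  refine ⟨⟨hf.memLp.sub hg.memLp, hf.memLp_grad.sub hg.memLp_grad, ?_⟩, ?_⟩
  · intro ψ h1 h2 h3 j
    obtain ⟨b1, b2⟩ := hbd ψ h1 h2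
    simp only [Pi.sub_apply, sub_mul]
    have k : ∀ {a b : E3 → ℝ}, MemLp a 2 (volume.restrict Ω) → MemLp b 2 (volume.restrict Ω) →
      Integrable (fun x => a x * b x) (volume.restrict Ω) := fun ha hb => ha.integrable_mul hb
    rw [integral_sub (k hf.memLp (b2 j)) (k hg.memLp (b2 j)),
      integral_sub (k (hf.memLp_grad.eval j) b1) (k (hg.memLp_grad.eval j) b1),
      hf.weak_grad ψ h1 h2 h3 j, hg.weak_grad ψ h1 h2 h3 j]
    ring
  · obtain ⟨φ, hφ, h1, h2⟩ := hf.approx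
    obtain ⟨ψ, hψ, h1', h2'⟩ := hg.approx
    have hgm : ∀ χ : E3 → ℝ, ContDiff ℝ ∞ χ → Continuous (grad χ) := fun χ hχ =>
      continuous_pi fun j => (hχ.continuous_fderiv (by simp)).clm_apply continuous_const
    refine ⟨fun n x => φ n x - ψ n x, fun n => ⟨(hφ n).1.sub (hψ n).1,
      (hφ n).2.1.sub (hψ n).2.1, (tsupport_sub _ _).trans (union_subset (hφ n).2.2 (hψ n).2.2)⟩,
      ?_, ?_⟩
    · refine tendsto_of_tendsto_of_tendsto_of_le_of_le tendsto_const_nhds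
        (by simpa using h1.add h1') (fun _ => zero_le) fun n => ?_
      have e : (fun x => f x - g x - (φ n x - ψ n x))
        = (fun x => f x - φ n x) - (fun x => g x - ψ n x) := by ext x; simp; ring
      simp only [e]
      exact eLpNorm_sub_le (hf.memLp.sub (hbd _ (hφ n).1 (hφ n).2.1).1).aestronglyMeasurable
        (hg.memLp.sub (hbd _ (hψ n).1 (hψ n).2.1).1).aestronglyMeasurable one_le_two
    · refine tendsto_of_tendsto_of_tendsto_of_le_of_le tendsto_const_nhds
        (by simpa using h2.add h2') (fun _ => zero_le) fun n => ?_
      have e : (fun x => F x - G x - grad (fun x => φ n x - ψ n x) x)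
          = (fun x => F x - grad (φ n) x) - (fun x => G x - grad (ψ n) x) := by
        ext x j
        have : grad (fun x => φ n x - ψ n x) x j = grad (φ n) x j - grad (ψ n) x j := by
          simp only [grad, pd]
          rw [fderiv_fun_sub ((hφ n).1.differentiable (by simp) x)
            ((hψ n).1.differentiable (by simp) x)]
          rfl
        simp only [Pi.sub_apply, this]
        ring
      simp only [e]
      exact eLpNorm_sub_le
        (hf.memLp_grad.aestronglyMeasurable.sub (hgm _ (hφ n).1).aestronglyMeasurable)
        (hg.memLp_grad.aestronglyMeasurable.sub (hgm _ (hψ n).1).aestronglyMeasurable) one_le_two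

/-- The traceless symmetrized gradient. -/
noncomputable def devSym (A : Fin 3 → Fin 3 → ℝ) : Fin 3 → Fin 3 → ℝ := fun i j =>
  A i j + A j i - (if i = j then 2 / 3 * tr A else 0)

/-- **Korn's inequality** for traceless symmetric gradients of `W^{1,2}_0` vector fields. -/
theorem korn {Ω : Set E3} (hΩ : IsOpen Ω) (hfin : volume Ω ≠ ⊤) {v : E3 → V3}
    {D : E3 → Fin 3 → Fin 3 → ℝ}
    (h : ∀ i, MemW12Zero Ω (fun x => v x i) (fun x => D x i)) :
    2 * ∫ x in Ω, ddot (D x) (D x) ≤ ∫ x in Ω, ddot (devSym (D x)) (devSym (D x)) := by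
  have hL : ∀ i j k l, Integrable (fun x => D x i j * D x k l) (volume.restrict Ω) :=
    fun i j k l => ((h i).memLp_grad.eval j).integrable_mul ((h k).memLp_grad.eval l)
  -- The last sum consists of the null Lagrangians ∂_j v_i ∂_i v_j − ∂_i v_i ∂_j v_j, which
  -- integrate to zero for W^{1,2}_0 fields. The trace term is nonnegative and is dropped.
  have e : ∀ x, ddot (devSym (D x)) (devSym (D x)) = 2 * ddot (D x) (D x) + 2 / 3 * tr (D x) ^ 2
      + 2 * ∑ i, ∑ j, (D x i j * D x j i - D x i i * D x j j) := by
    intro x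
    simp only [ddot, devSym, tr, Fin.sum_univ_three]
    simp
    ring
  have i1 : Integrable (fun x => ddot (D x) (D x)) (volume.restrict Ω) :=
    integrable_finsetSum _ fun i _ => integrable_finsetSum _ fun j _ => hL i j i j
  have i2 : Integrable (fun x => tr (D x) ^ 2) (volume.restrict Ω) := by
    simp only [tr, sq, Finset.sum_mul_sum]
    exact integrable_finsetSum _ fun i _ => integrable_finsetSum _ fun j _ => hL i i j j
  have i3 : ∀ i j, Integrable (fun x => D x i j * D x j i - D x i i * D x j j)
      (volume.restrict Ω) := fun i j => (hL i j j i).sub (hL i i j j)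
  have i4 : Integrable (fun x => ∑ i, ∑ j, (D x i j * D x j i - D x i i * D x j j))
      (volume.restrict Ω) :=
    integrable_finsetSum _ fun i _ => integrable_finsetSum _ fun j _ => i3 i j
  have z : ∫ x in Ω, ∑ i, ∑ j, (D x i j * D x j i - D x i i * D x j j) = 0 := by
    rw [integral_finsetSum _ fun i _ => integrable_finsetSum _ fun j _ => i3 i j]
    refine Finset.sum_eq_zero fun i _ => ?_
    rw [integral_finsetSum _ fun j _ => i3 i j]
    refine Finset.sum_eq_zero fun j _ => ?_
    rw [integral_sub (hL i j j i) (hL i i j j), sub_eq_zero]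
    exact (h i).integral_grad_mul_grad_comm hΩ hfin (h j) j i
  simp only [e]
  have i5 : Integrable (fun x => 2 * ddot (D x) (D x) + 2 / 3 * tr (D x) ^ 2)
    (volume.restrict Ω) := (i1.const_mul 2).add (i2.const_mul _)
  rw [integral_add i5 (i4.const_mul 2), integral_add (i1.const_mul 2) (i2.const_mul _),
    integral_const_mul, integral_const_mul,
    integral_const_mul, z]
  have : 0 ≤ ∫ x in Ω, tr (D x) ^ 2 := integral_nonneg fun x => sq_nonneg _
  linarith

/-! ### Lipschitz domains -/

/-- The height of `x` above the graph of `g`, measured in the direction `e`. -/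
noncomputable def graphHeight (e : E3) (g : E3 → ℝ) (x : E3) : ℝ :=
  inner ℝ x e - g (x - inner ℝ x e • e)

theorem graphHeight_add_smul {e : E3} (he : ‖e‖ = 1) (g : E3 → ℝ) (x : E3) (s : ℝ) :
    graphHeight e g (x + s • e) = graphHeight e g x + s := by
  have h1 : inner ℝ (x + s • e) e = inner ℝ x e + s := by
    rw [inner_add_left, inner_smul_left, real_inner_self_eq_norm_sq, he]
    simp
  unfold graphHeight
  rw [h1]
  have : x + s • e - (inner ℝ x e + s) • e = x - inner ℝ x e • e := by
    rw [add_smul]; abel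
  rw [this]
  ring

/-- This is the interior cone property in algebraic form: the height grows whenever the component of
z − x along e exceeds K times the transverse component. -/
theorem sub_le_graphHeight_sub {e : E3} {g : E3 → ℝ} {K : NNReal} (hg : LipschitzWith K g)
    (x z : E3) : inner ℝ (z - x) e - K * ‖(z - x) - inner ℝ (z - x) e • e‖
      ≤ graphHeight e g z - graphHeight e g x := by
  have h1 := hg.dist_le_mul (z - inner ℝ z e • e) (x - inner ℝ x e • e)
  have h2 : z - inner ℝ z e • e - (x - inner ℝ x e • e) = (z - x) - inner ℝ (z - x) e • e := by
    rw [inner_sub_left, sub_smul]; abel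
  rw [dist_eq_norm, dist_eq_norm, h2, Real.norm_eq_abs] at h1
  have h3 := (abs_le.1 h1).2
  unfold graphHeight
  rw [inner_sub_left] at *
  linarith

theorem lipschitzWith_graphHeight {e : E3} (he : ‖e‖ = 1) {g : E3 → ℝ} {K : NNReal}
    (hg : LipschitzWith K g) : LipschitzWith (1 + 2 * K) (graphHeight e g) := by
  refine LipschitzWith.of_dist_le_mul fun x z => ?_
  have key : ∀ x z : E3, graphHeight e g x - graphHeight e g z ≤ (1 + 2 * K) * ‖x - z‖ := by
    intro x z
    have h := sub_le_graphHeight_sub (e := e) hg x z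
    have h1 : |inner ℝ (z - x) e| ≤ ‖z - x‖ := by
      simpa [he] using abs_real_inner_le_norm (z - x) e
    have h2 : ‖(z - x) - inner ℝ (z - x) e • e‖ ≤ 2 * ‖z - x‖ := by
      refine (norm_sub_le _ _).trans ?_
      rw [norm_smul, he, Real.norm_eq_abs]
      linarith
    have h3 := mul_le_mul_of_nonneg_left h2 K.coe_nonneg
    have h4 := neg_abs_le (inner ℝ (z - x) e)
    rw [norm_sub_rev x z]
    linarith
  rw [dist_eq_norm, Real.norm_eq_abs, dist_eq_norm, abs_le]
  push_cast
  have := key x z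
  have h2 := key z x
  rw [norm_sub_rev z x] at h2
  constructor <;> linarith

theorem graphHeight_eq_zero_of_mem_frontier {Ω : Set E3} (hΩ : IsOpen Ω) {e : E3} (he : ‖e‖ = 1)
    {g : E3 → ℝ} {K : NNReal} (hg : LipschitzWith K g) {x₀ : E3} {r : ℝ}
    (h : ∀ x ∈ Metric.ball x₀ r, (x ∈ Ω ↔ g (x - inner ℝ x e • e) < inner ℝ x e))
    {x : E3} (hx : x ∈ Metric.ball x₀ r) (hxΩ : x ∈ frontier Ω) : graphHeight e g x = 0 := by
  have hcont := (lipschitzWith_graphHeight he hg).continuous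
  rw [hΩ.frontier_eq] at hxΩ
  refine le_antisymm ?_ ?_
  · have := mt (h x hx).2 hxΩ.2
    unfold graphHeight
    linarith
  · have h1 : x ∈ closure (Metric.ball x₀ r ∩ Ω) :=
      Metric.isOpen_ball.inter_closure ⟨hx, hxΩ.1⟩
    have h2 : closure (Metric.ball x₀ r ∩ Ω) ⊆ {z | 0 ≤ graphHeight e g z} := by
      refine closure_minimal (fun z hz => ?_) (isClosed_le continuous_const hcont)
      have := (h z hz.1).1 hz.2
      simp only [mem_ofPred_eq, graphHeight]
      linarith
    exact h2 h1

/-- At a boundary point a truncated open convex cone with vertex x, opening in the direction e, lies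
in Ω, and a convex set with nonempty interior determines derivatives at its closure points. This
gives meaning to derivatives relative to the closed cylinder and to the gradient in the boundary
condition for the heat flux. -/
theorem IsBoundedLipschitzDomain.uniqueDiffOn_closure {Ω : Set E3}
    (hΩ : IsBoundedLipschitzDomain Ω) : UniqueDiffOn ℝ (closure Ω) := by
  intro x hx
  by_cases hxΩ : x ∈ Ω
  · exact (hΩ.isOpen.uniqueDiffWithinAt hxΩ).mono subset_closure
  have hxf : x ∈ frontier Ω := by rw [hΩ.isOpen.frontier_eq]; exact ⟨hx, hxΩ⟩
  obtain ⟨e, g, K, r, he, hg, hr, h⟩ := hΩ.graph x hxf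
  have h0 := graphHeight_eq_zero_of_mem_frontier hΩ.isOpen he hg h (Metric.mem_ball_self hr) hxf
  let C : Set E3 := {z | (K : ℝ) * ‖(z - x) - inner ℝ (z - x) e • e‖ - inner ℝ (z - x) e < 0}
    ∩ Metric.ball x r
  have hopen : IsOpen C := (isOpen_lt (by fun_prop) continuous_const).inter Metric.isOpen_ball
  have hsub : C ⊆ closure Ω := by
    intro z hz
    refine subset_closure ((h z hz.2).2 ?_)
    have h1 := sub_le_graphHeight_sub (e := e) hg x z
    have h2 : (K : ℝ) * ‖(z - x) - inner ℝ (z - x) e • e‖ - inner ℝ (z - x) e < 0 := hz.1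
    have h3 : 0 < graphHeight e g z := by linarith
    unfold graphHeight at h3
    linarith
  have hconv : Convex ℝ C := by
    refine Convex.inter ?_ (convex_ball x r)
    rw [convex_iff_forall_pos]
    intro z hz y hy a b ha hb hab
    simp only [mem_ofPred_eq] at hz hy ⊢
    have e1 : a • z + b • y - x = a • (z - x) + b • (y - x) := by
      have : x = a • x + b • x := by rw [← add_smul, hab, one_smul]
      conv_lhs => rw [this]
      simp only [smul_sub]
      abel
    have e2 : inner ℝ (a • z + b • y - x) e = a * inner ℝ (z - x) e + b * inner ℝ (y - x) e := by
      rw [e1, inner_add_left, inner_smul_left, inner_smul_left]; simp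
    have e3 : a • z + b • y - x - inner ℝ (a • z + b • y - x) e • e
        = a • ((z - x) - inner ℝ (z - x) e • e) + b • ((y - x) - inner ℝ (y - x) e • e) := by
      rw [e2, e1]
      simp only [smul_sub, add_smul, smul_smul]
      abel
    have e4 : ‖a • z + b • y - x - inner ℝ (a • z + b • y - x) e • e‖
        ≤ a * ‖(z - x) - inner ℝ (z - x) e • e‖ + b * ‖(y - x) - inner ℝ (y - x) e • e‖ := by
      rw [e3]
      refine (norm_add_le _ _).trans ?_
      rw [norm_smul, norm_smul, Real.norm_of_nonneg ha.le, Real.norm_of_nonneg hb.le]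
    have e5 := mul_le_mul_of_nonneg_left e4 K.coe_nonneg
    rw [e2] at *
    nlinarith [mul_neg_of_pos_of_neg ha hz, mul_neg_of_pos_of_neg hb hy]
  have hin : ∀ s : ℝ, 0 < s → s < r → x + s • e ∈ C := by
    intro s hs hsr
    have : inner ℝ (x + s • e - x) e = s := by
      rw [add_sub_cancel_left, inner_smul_left, real_inner_self_eq_norm_sq, he]; simp
    refine ⟨?_, ?_⟩
    · simp only [mem_ofPred_eq, this]
      simp [hs]
    · simpa [norm_smul, he, abs_of_pos hs] using hsr
  refine (uniqueDiffWithinAt_convex hconv ?_ ?_).mono hsub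
  · rw [hopen.interior_eq]
    exact ⟨_, hin (r / 2) (by linarith) (by linarith)⟩
  · have ht : Tendsto (fun s : ℝ => x + s • e) (𝓝[>] 0) (𝓝 x) := by
      have : Continuous fun s : ℝ => x + s • e := by fun_prop
      have h2 := this.tendsto 0
      simp only [zero_smul, add_zero] at h2
      exact h2.mono_left nhdsWithin_le_nhds
    refine mem_closure_of_tendsto ht ?_
    filter_upwards [Ioo_mem_nhdsGT hr] with s hs using hin s hs.1 hs.2

/-- Where the graph function is differentiable, the domain has an outer normal. -/
theorem isOuterNormal_of_hasFDerivAt {Ω : Set E3} {Φ : E3 → ℝ} {x₀ y : E3} {r : ℝ}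
    (h : ∀ x ∈ Metric.ball x₀ r, (x ∈ Ω ↔ 0 < Φ x)) (hy : y ∈ Metric.ball x₀ r) (hy0 : Φ y = 0)
    {L : E3 →L[ℝ] ℝ} (hL : HasFDerivAt Φ L y) (hL0 : L ≠ 0) :
    IsOuterNormal Ω y (-(‖L‖⁻¹ • (InnerProductSpace.toDual ℝ E3).symm L)) := by
  have hpos : 0 < ‖L‖ := norm_pos_iff.2 hL0
  have hin : ∀ z : E3, inner ℝ z (-(‖L‖⁻¹ • (InnerProductSpace.toDual ℝ E3).symm L))
      = -(‖L‖⁻¹ * L z) := by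
    intro z
    rw [inner_neg_right, inner_smul_right, real_inner_comm, InnerProductSpace.toDual_symm_apply]
  refine ⟨?_, fun ε hε => ?_⟩
  · rw [norm_neg, norm_smul, LinearIsometryEquiv.norm_map, norm_inv, norm_norm,
      inv_mul_cancel₀ hpos.ne']
  -- The error is taken as ε‖L‖ because the normal is −L/‖L‖; after normalization it becomes ε.
  · have h1 := hL.isLittleO.def (c := ε * ‖L‖) (by positivity)
    have h2 : ∀ᶠ z in 𝓝 y, z ∈ Metric.ball x₀ r := Metric.isOpen_ball.mem_nhds hy
    obtain ⟨δ, hδ, hball⟩ := Metric.eventually_nhds_iff_ball.1 (h1.and h2)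
    refine ⟨δ, hδ, fun z hz => ?_⟩
    obtain ⟨a1, a2⟩ := hball z hz
    rw [hy0, sub_zero, Real.norm_eq_abs, abs_le] at a1
    rw [hin, h z a2]
    have a3 : ‖L‖ * (‖L‖⁻¹ * L (z - y)) = L (z - y) := by
      rw [← mul_assoc, mul_inv_cancel₀ hpos.ne', one_mul]
    constructor
    · intro hlt
      have := mul_lt_mul_of_pos_left hlt hpos
      nlinarith
    · intro hlt
      have := mul_lt_mul_of_pos_left hlt hpos
      rw [not_lt]
      nlinarith

/-! ### Integration by parts for tangential fields -/

theorem exists_lipschitzOnWith_mul {f g : E3 → ℝ} {x : E3}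
    (hf : ∃ K : NNReal, ∃ t ∈ 𝓝 x, LipschitzOnWith K f t)
    (hg : ∃ K : NNReal, ∃ t ∈ 𝓝 x, LipschitzOnWith K g t) :
    ∃ K : NNReal, ∃ t ∈ 𝓝 x, LipschitzOnWith K (fun y => f y * g y) t := by
  obtain ⟨K, s, hs, hK⟩ := hf
  obtain ⟨K', s', hs', hK'⟩ := hg
  have cf : ContinuousAt f x := (hK.continuousOn.continuousAt hs)
  have cg : ContinuousAt g x := (hK'.continuousOn.continuousAt hs')
  have b1 : ∀ᶠ y in 𝓝 x, ‖f y‖ < ‖f x‖ + 1 := cf.norm.eventually_lt_const (by linarith)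
  have b2 : ∀ᶠ y in 𝓝 x, ‖g y‖ < ‖g x‖ + 1 := cg.norm.eventually_lt_const (by linarith)
  refine ⟨(‖f x‖₊ + 1) * K' + (‖g x‖₊ + 1) * K, _,
    inter_mem (inter_mem hs hs') (inter_mem b1 b2), LipschitzOnWith.of_dist_le_mul ?_⟩
  rintro y ⟨⟨ys, ys'⟩, yb1, yb2⟩ z ⟨⟨zs, zs'⟩, zb1, zb2⟩
  have d1 := hK.dist_le_mul y ys z zs
  have d2 := hK'.dist_le_mul y ys' z zs'
  rw [Real.dist_eq] at *
  simp only [mem_ofPred_eq, Real.norm_eq_abs] at yb1 zb2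
  have e : f y * g y - f z * g z = f y * (g y - g z) + g z * (f y - f z) := by ring
  rw [e]
  refine (abs_add_le _ _).trans ?_
  rw [abs_mul, abs_mul]
  have q1 := mul_le_mul yb1.le d2 (abs_nonneg _) (by positivity)
  have q2 := mul_le_mul zb2.le d1 (abs_nonneg _) (by positivity)
  push_cast
  rw [add_mul]
  refine add_le_add (q1.trans_eq ?_) (q2.trans_eq ?_)
  · rw [Real.norm_eq_abs]; ring
  · rw [Real.norm_eq_abs]; ring

/-- On the closed unit thickening of the support, compactness gives one Lipschitz constant. A point
outside it is at distance at least 1 from the support, so the sup bound B is at most B times the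
distance. -/
theorem exists_lipschitzWith_of_hasCompactSupport {f : E3 → ℝ} (hf : LocallyLipschitz f)
    (hc : HasCompactSupport f) : ∃ K : NNReal, LipschitzWith K f := by
  obtain ⟨K, hK⟩ := (locallyLipschitzOn_univ.2 hf |>.mono
    (subset_univ (Metric.cthickening 1 (tsupport f)))).exists_lipschitzOnWith_of_compact
    hc.isCompact.cthickening
  obtain ⟨B, hB⟩ := hc.exists_bound_of_continuous hf.continuous
  have hB0 : 0 ≤ B := (norm_nonneg _).trans (hB 0)
  have key : ∀ x ∈ tsupport f, ∀ y, dist (f x) (f y) ≤ (K + B) * dist x y := by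
    intro x hx y
    by_cases hy : y ∈ Metric.cthickening 1 (tsupport f)
    · have := hK.dist_le_mul x (Metric.self_subset_cthickening _ hx) y hy
      have h2 : 0 ≤ B * dist x y := by positivity
      linarith
    · have h1 : 1 ≤ dist x y := by
        by_contra h
        rw [not_le] at h
        exact hy (Metric.mem_cthickening_of_dist_le y x _ _ hx (by rw [dist_comm]; exact h.le))
      have h2 : f y = 0 := image_eq_zero_of_notMem_tsupport fun h =>
        hy (Metric.self_subset_cthickening _ h)
      rw [h2, dist_zero_right]
      have h3 := hB x
      have h4 : 0 ≤ (K : ℝ) * dist x y := by positivity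
      nlinarith
  refine ⟨K + ⟨B, hB0⟩, LipschitzWith.of_dist_le_mul fun x y => ?_⟩
  by_cases hx : x ∈ tsupport f
  · exact key x hx y
  · by_cases hy : y ∈ tsupport f
    · rw [dist_comm, dist_comm x y]; exact key y hy x
    · rw [image_eq_zero_of_notMem_tsupport hx, image_eq_zero_of_notMem_tsupport hy, dist_self]
      positivity

theorem exists_abs_deriv_smoothTransition_le :
    ∃ M : ℝ, ∀ s, |deriv Real.smoothTransition s| ≤ M := by
  have hs : ContDiff ℝ 1 Real.smoothTransition := Real.smoothTransition.contDiff
  have hz : ∀ s, s ∉ Icc (0 : ℝ) 1 → deriv Real.smoothTransition s = 0 := by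
    intro s hs
    rw [mem_Icc, not_and_or, not_le, not_le] at hs
    rcases hs with h | h
    · have : Real.smoothTransition =ᶠ[𝓝 s] fun _ => 0 := by
        filter_upwards [gt_mem_nhds h] with t ht using Real.smoothTransition.zero_of_nonpos ht.le
      rw [this.deriv_eq, deriv_const]
    · have : Real.smoothTransition =ᶠ[𝓝 s] fun _ => 1 := by
        filter_upwards [lt_mem_nhds h] with t ht using Real.smoothTransition.one_of_one_le ht.le
      rw [this.deriv_eq, deriv_const]
  obtain ⟨M, hM⟩ := (HasCompactSupport.intro isCompact_Icc hz).exists_bound_of_continuous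
    (hs.continuous_deriv le_rfl)
  exact ⟨M, hM⟩

/-- A field which is tangential to the boundary has a normal component of the order of the distance
to the boundary. -/
theorem abs_sum_mul_pd_graphHeight_le {Ω : Set E3} (hΩ : IsOpen Ω) {e : E3} (he : ‖e‖ = 1)
    {g : E3 → ℝ} {K : NNReal} (hg : LipschitzWith K g) {x₀ : E3} {r : ℝ}
    (h : ∀ x ∈ Metric.ball x₀ r, (x ∈ Ω ↔ g (x - inner ℝ x e • e) < inner ℝ x e))
    {X : E3 → V3} (hX : ∀ j, ContinuousOn (fun x => X x j) (closure Ω))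
    (hXd : ∀ j, ∀ x ∈ Ω, DifferentiableAt ℝ (fun x => X x j) x) {N : ℝ}
    (hN : ∀ j, ∀ x ∈ Ω, ‖fderiv ℝ (fun x => X x j) x‖ ≤ N)
    (hb : ∀ y ∈ frontier Ω, ∀ n, IsOuterNormal Ω y n → ∑ j, X y j * n j = 0)
    {x : E3} (hx : x ∈ Metric.ball x₀ (r / 2)) (hxΩ : x ∈ Ω) (hsmall : graphHeight e g x < r / 2)
    (hd : DifferentiableAt ℝ (graphHeight e g) x) :
    |∑ j, X x j * pd j (graphHeight e g) x| ≤ 3 * (N * (1 + 2 * K)) * graphHeight e g x := by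
  set Φ := graphHeight e g with hΦ
  have hN0 : 0 ≤ N := (norm_nonneg _).trans (hN 0 x hxΩ)
  have h' : ∀ z ∈ Metric.ball x₀ r, (z ∈ Ω ↔ 0 < Φ z) := by
    intro z hz
    rw [h z hz, hΦ, graphHeight, sub_pos]
  have hr : 0 < r := by
    have := dist_nonneg.trans_lt (Metric.mem_ball.1 hx)
    linarith
  have hxr : x ∈ Metric.ball x₀ r := Metric.ball_subset_ball (by linarith) hx
  have hpos : 0 < Φ x := (h' x hxr).1 hxΩ
  have hseg : ∀ s, 0 ≤ s → s ≤ Φ x → x - Φ x • e + s • e ∈ Metric.ball x₀ r := by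
    intro s hs hs'
    rw [Metric.mem_ball] at hx ⊢
    have e1 : x - Φ x • e + s • e = x + (s - Φ x) • e := by rw [sub_smul]; abel
    rw [e1]
    have e2 : dist (x + (s - Φ x) • e) x ≤ Φ x := by
      rw [dist_eq_norm, add_sub_cancel_left, norm_smul, he, mul_one, Real.norm_eq_abs, abs_le]
      constructor <;> linarith
    have := dist_triangle (x + (s - Φ x) • e) x x₀
    linarith
  have hΦs : ∀ s, Φ (x - Φ x • e + s • e) = s := by
    intro s
    have e1 : x - Φ x • e + s • e = x + (s - Φ x) • e := by rw [sub_smul]; abel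
    rw [e1, hΦ, graphHeight_add_smul he]; ring
  have hsegΩ : ∀ s, 0 < s → s ≤ Φ x → x - Φ x • e + s • e ∈ Ω := by
    intro s hs hs'
    rw [h' _ (hseg s hs.le hs'), hΦs]
    exact hs
  -- The boundary point below x in the direction e. The smallness of the height keeps the whole
  -- segment from y to x inside the graph chart.
  set y := x - Φ x • e with hy
  have hyr : y ∈ Metric.ball x₀ r := by simpa using hseg 0 le_rfl hpos.le
  have hy0 : Φ y = 0 := by simpa using hΦs 0
  have hcont : Continuous fun s : ℝ => y + s • e := by fun_prop
  have hyc : y ∈ closure Ω := by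
    have ht : Tendsto (fun s : ℝ => y + s • e) (𝓝[>] 0) (𝓝 y) := by
      have h2 := hcont.tendsto 0
      simp only [zero_smul, add_zero] at h2
      exact h2.mono_left nhdsWithin_le_nhds
    refine mem_closure_of_tendsto ht ?_
    filter_upwards [Ioo_mem_nhdsGT hpos] with s hs using hsegΩ s hs.1 hs.2.le
  have hyf : y ∈ frontier Ω := by
    rw [hΩ.frontier_eq]
    exact ⟨hyc, fun hyΩ => by have := (h' y hyr).1 hyΩ; linarith⟩
  set L := fderiv ℝ Φ x with hLdef
  -- Translation along e changes Φ by a constant, so differentiability at x is differentiability at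
  -- y with the same L. Hence a normal exists at y, and X(y) annihilates L. The difference X(x) −
  -- X(y) is of the order of the height.
  have hLy : HasFDerivAt Φ L y := by
    have e1 : Φ = fun z => Φ (z + Φ x • e) - Φ x := by
      ext z; rw [hΦ, graphHeight_add_smul he]; ring
    rw [e1]
    refine HasFDerivAt.sub_const _ ?_
    have e2 : y + Φ x • e = x := by rw [hy]; abel
    have := hd.hasFDerivAt
    rw [← e2] at this
    have h3 := this.comp y ((hasFDerivAt_id y).add_const (Φ x • e))
    rw [e2, ContinuousLinearMap.comp_id] at h3
    exact h3
  have hLe : L e = 1 := by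
    have h1 := hd.hasFDerivAt.hasLineDerivAt e
    have h2 : HasLineDerivAt ℝ Φ 1 x e := by
      unfold HasLineDerivAt
      have e1 : (fun t : ℝ => Φ (x + t • e)) = fun t => Φ x + t := by
        ext t; rw [hΦ, graphHeight_add_smul he]
      rw [e1]
      exact (hasDerivAt_id 0).const_add _
    exact h1.unique h2
  have hL0 : L ≠ 0 := by intro h0; rw [h0] at hLe; simp at hLe
  have hn := hb y hyf _ (isOuterNormal_of_hasFDerivAt h' hyr hy0 hLy hL0)
  have hLj : ∀ j, (InnerProductSpace.toDual ℝ E3).symm L j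
      = L (EuclideanSpace.single j 1) := by
    intro j
    rw [← InnerProductSpace.toDual_symm_apply (𝕜 := ℝ), EuclideanSpace.inner_single_right]
    simp
  have hn' : ∑ j, X y j * L (EuclideanSpace.single j 1) = 0 := by
    have e1 : ∑ j, X y j * (-(‖L‖⁻¹ • (InnerProductSpace.toDual ℝ E3).symm L)) j
        = -‖L‖⁻¹ * ∑ j, X y j * L (EuclideanSpace.single j 1) := by
      rw [Finset.mul_sum]
      refine Finset.sum_congr rfl fun j _ => ?_
      rw [← hLj]
      simp
      ring
    rw [e1] at hn
    have := norm_pos_iff.2 hL0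
    rcases mul_eq_zero.1 hn with h1 | h1
    · simp at h1
      exact absurd h1 hL0
    · exact h1
  have hmv : ∀ j, |X x j - X y j| ≤ N * Φ x := by
    intro j
    obtain ⟨c, hc, hc'⟩ := exists_hasDerivAt_eq_slope (fun s : ℝ => X (y + s • e) j)
      (fun s => fderiv ℝ (fun x => X x j) (y + s • e) e) hpos
      ((hX j).comp hcont.continuousOn (by
        intro s hs
        rcases hs.1.eq_or_lt with h0 | h0
        · rw [← h0]; simpa using hyc
        · exact subset_closure (hsegΩ s h0 hs.2)))
      (by
        intro s hs
        have h1 := (hXd j _ (hsegΩ s hs.1 hs.2.le)).hasFDerivAt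
        have h2 : HasDerivAt (fun s : ℝ => y + s • e) e s := by
          simpa using ((hasDerivAt_id s).smul_const e).const_add y
        exact h1.comp_hasDerivAt s h2)
    have e2 : y + Φ x • e = x := by rw [hy]; abel
    simp only [e2, zero_smul, add_zero, sub_zero] at hc'
    rw [eq_div_iff hpos.ne'] at hc'
    rw [← hc', abs_mul, abs_of_pos hpos]
    have h3 := (fderiv ℝ (fun x => X x j) (y + c • e)).le_opNorm e
    rw [he, mul_one, Real.norm_eq_abs] at h3
    exact mul_le_mul_of_nonneg_right (h3.trans (hN j _ (hsegΩ c hc.1 hc.2.le))) hpos.le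
  have hLn : ‖L‖ ≤ 1 + 2 * K := by
    have := norm_fderiv_le_of_lipschitz ℝ (lipschitzWith_graphHeight he hg) (x₀ := x)
    simpa using this
  have e3 : ∑ j, X x j * pd j Φ x
      = ∑ j, (X x j - X y j) * L (EuclideanSpace.single j 1) := by
    simp only [sub_mul, Finset.sum_sub_distrib, hn', sub_zero]
    rfl
  rw [e3]
  refine (Finset.abs_sum_le_sum_abs _ _).trans ?_
  have : ∀ j ∈ (Finset.univ : Finset (Fin 3)),
      |(X x j - X y j) * L (EuclideanSpace.single j 1)| ≤ N * (1 + 2 * K) * Φ x := by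
    intro j _
    rw [abs_mul]
    have h4 := L.le_opNorm (EuclideanSpace.single j 1)
    rw [PiLp.norm_single, norm_one, mul_one, Real.norm_eq_abs] at h4
    have := mul_le_mul (hmv j) (h4.trans hLn) (abs_nonneg _) (by positivity)
    linarith
  refine (Finset.sum_le_sum this).trans ?_
  simp only [Finset.sum_const, Finset.card_univ, Fintype.card_fin, nsmul_eq_mul]
  push_cast
  linarith

/-- The integrand of the localized divergence identity. -/
noncomputable def divIntegrand (w : E3 → ℝ) (G X : E3 → V3) (χ : E3 → ℝ) (x : E3) : ℝ :=
  w x * (χ x * ∑ j, pd j (fun y => X y j) x + ∑ j, pd j χ x * X x j) + χ x * ∑ j, G x j * X x j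

theorem integrable_divIntegrand {Ω : Set E3} (hΩ : IsOpen Ω) (hfin : volume Ω ≠ ⊤)
    {w : E3 → ℝ} {G : E3 → V3} (hw : MemW12 Ω w G) {X : E3 → V3}
    (hX : ∀ j, C1Bdd Ω (fun x => X x j)) {χ : E3 → ℝ} (hχ : C1Bdd Ω χ) :
    Integrable (divIntegrand w G X χ) (volume.restrict Ω) := by
  have i1 : ∀ j, MemLp (fun x => χ x * pd j (fun y => X y j) x) 2 (volume.restrict Ω) := fun j =>
    MemLp.mul (p := 2) (q := ⊤) (r := 2) ((hX j).memLp_pd hΩ hfin ⊤ j) (hχ.memLp hΩ hfin 2)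
  have i2 : ∀ j, MemLp (fun x => pd j χ x * X x j) 2 (volume.restrict Ω) := fun j =>
    MemLp.mul (p := 2) (q := ⊤) (r := 2) ((hX j).memLp hΩ hfin ⊤) (hχ.memLp_pd hΩ hfin 2 j)
  have i3 : ∀ j, MemLp (fun x => χ x * X x j) 2 (volume.restrict Ω) := fun j =>
    MemLp.mul (p := 2) (q := ⊤) (r := 2) ((hX j).memLp hΩ hfin ⊤) (hχ.memLp hΩ hfin 2)
  have e : divIntegrand w G X χ = fun x => (∑ j, w x * (χ x * pd j (fun y => X y j) x)
      + ∑ j, w x * (pd j χ x * X x j)) + ∑ j, G x j * (χ x * X x j) := by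
    ext x
    simp only [divIntegrand, Fin.sum_univ_three]
    ring
  rw [e]
  refine ((integrable_finsetSum _ fun j _ => ?_).add (integrable_finsetSum _ fun j _ => ?_)).add
    (integrable_finsetSum _ fun j _ => ?_)
  · exact hw.memLp.integrable_mul (i1 j)
  · exact hw.memLp.integrable_mul (i2 j)
  · exact (hw.memLp_grad.eval j).integrable_mul (i3 j)

theorem exists_lipschitzOnWith_nhds_of_C1Bdd {Ω : Set E3} (hΩ : IsOpen Ω) {F : E3 → ℝ}
    (hF : C1Bdd Ω F) {x : E3} (hx : x ∈ Ω) :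
    ∃ K : NNReal, ∃ t ∈ 𝓝 x, LipschitzOnWith K F t := by
  obtain ⟨ε, hε, hball⟩ := Metric.isOpen_iff.1 hΩ x hx
  obtain ⟨N, hN⟩ := hF.bdd
  have hN0 : 0 ≤ N := (norm_nonneg _).trans (hN x hx).2
  refine ⟨⟨N, hN0⟩, Metric.ball x ε, Metric.ball_mem_nhds x hε, ?_⟩
  refine (convex_ball x ε).lipschitzOnWith_of_nnnorm_fderiv_le (𝕜 := ℝ)
    (fun y hy => hF.diff y (hball hy)) fun y hy => ?_
  exact (hN y (hball hy)).2

/-- The weak gradient of w is tested with the compactly supported Lipschitz functions ζ χ X_j and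
the results are summed over j. The product rule splits off the term containing ∇ζ, the only trace of
the cutoff. -/
theorem integral_cutoff_divIntegrand_eq_zero {Ω : Set E3} (hΩ : IsOpen Ω) (hfin : volume Ω ≠ ⊤)
    {w : E3 → ℝ} {G : E3 → V3} (hw : MemW12 Ω w G) {X : E3 → V3}
    (hX : ∀ j, C1Bdd Ω (fun x => X x j)) {χ ζ : E3 → ℝ} (hχ : ContDiff ℝ 1 χ)
    (hχc : HasCompactSupport χ) (hζ : LocallyLipschitz ζ)
    (hs : tsupport (fun x => ζ x * χ x) ⊆ Ω)
    (hζd : ∀ᵐ x, DifferentiableAt ℝ ζ x) :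
    ∫ x in Ω, (ζ x * divIntegrand w G X χ x + w x * (χ x * ∑ j, X x j * pd j ζ x)) = 0 := by
  have : IsFiniteMeasure (volume.restrict Ω) := ⟨by simpa using hfin.lt_top⟩
  set ψ : Fin 3 → E3 → ℝ := fun j x => ζ x * χ x * X x j with hψ
  have hsupp : ∀ j, tsupport (ψ j) ⊆ tsupport (fun x => ζ x * χ x) := fun j =>
    closure_mono fun x hx h0 => hx (by simp [hψ, h0])
  have hψc : ∀ j, HasCompactSupport (ψ j) := fun j =>
    (HasCompactSupport.mul_left (f := ζ) hχc).of_isClosed_subset (isClosed_tsupport _) (hsupp j)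
  have hψl : ∀ j, ∃ K : NNReal, LipschitzWith K (ψ j) := by
    intro j
    refine exists_lipschitzWith_of_hasCompactSupport (fun x => ?_) (hψc j)
    -- X is controlled only inside Ω; at other points ζ χ X_j vanishes in a whole neighbourhood.
    by_cases hx : x ∈ Ω
    · exact exists_lipschitzOnWith_mul (exists_lipschitzOnWith_mul (hζ x)
        (hχ.locallyLipschitz x)) (exists_lipschitzOnWith_nhds_of_C1Bdd hΩ (hX j) hx)
    · refine ⟨0, (tsupport (ψ j))ᶜ, (isClosed_tsupport _).isOpen_compl.mem_nhds
        fun h => hx (hs (hsupp j h)), ?_⟩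
      refine LipschitzOnWith.of_dist_le_mul fun y hy z hz => ?_
      rw [image_eq_zero_of_notMem_tsupport hy, image_eq_zero_of_notMem_tsupport hz]
      simp
  choose K hK using hψl
  have t1 : ∀ j, MemLp (pd j (ψ j)) 2 (volume.restrict Ω) := by
    intro j
    refine MemLp.of_bound (measurable_fderiv_apply_const ℝ (ψ j) _).aestronglyMeasurable (K j)
      (.of_forall fun x => ?_)
    exact (abs_pd_le _ _ _).trans (norm_fderiv_le_of_lipschitz ℝ (hK j))
  have t2 : ∀ j, MemLp (ψ j) 2 (volume.restrict Ω) := fun j =>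
    ((hK j).continuous.memLp_of_hasCompactSupport (hψc j))
  have i1 : ∀ j, Integrable (fun x => w x * pd j (ψ j) x) (volume.restrict Ω) := fun j =>
    hw.memLp.integrable_mul (t1 j)
  have i2 : ∀ j, Integrable (fun x => G x j * ψ j x) (volume.restrict Ω) := fun j =>
    (hw.memLp_grad.eval j).integrable_mul (t2 j)
  have hz : ∫ x in Ω, ∑ j, (w x * pd j (ψ j) x + G x j * ψ j x) = 0 := by
    have i3 : ∀ j, Integrable (fun x => w x * pd j (ψ j) x + G x j * ψ j x)
      (volume.restrict Ω) := fun j => (i1 j).add (i2 j)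
    rw [integral_finsetSum _ fun j _ => i3 j]
    refine Finset.sum_eq_zero fun j _ => ?_
    rw [integral_add (i1 j) (i2 j), hw.integral_mul_pd_of_lipschitz hΩ hfin (hK j) (hψc j)
      ((hsupp j).trans hs) j, neg_add_cancel]
  rw [← hz]
  refine integral_congr_ae ?_
  filter_upwards [ae_restrict_of_ae hζd, ae_restrict_mem hΩ.measurableSet] with x hx hxΩ
  have hp : ∀ j, pd j (ψ j) x = ζ x * χ x * pd j (fun y => X y j) x
      + X x j * (ζ x * pd j χ x + χ x * pd j ζ x) := by
    intro j
    have h1 := (hx.hasFDerivAt.mul (hχ.differentiable one_ne_zero x).hasFDerivAt).mul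
      ((hX j).diff x hxΩ).hasFDerivAt
    have h2 : fderiv ℝ (ψ j) x = _ := h1.fderiv
    simp only [pd, h2]
    simp
    ring
  simp only [hp, divIntegrand, Fin.sum_univ_three]
  simp only [hψ]
  ring

/-- The cutoff ζ_n vanishes for height below ε_n and equals 1 above 2ε_n. Its gradient is of order
1/ε_n, but only in this layer, and there X·∇Φ is of order ε_n since X is tangential. The extra term
is thus dominated by a multiple of |w| and tends to zero pointwise, so dominated convergence removes
the cutoff. -/
theorem integral_divIntegrand_eq_zero_of_boundary {Ω : Set E3} (hΩ : IsOpen Ω)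
    (hfin : volume Ω ≠ ⊤) {w : E3 → ℝ} {G : E3 → V3} (hw : MemW12 Ω w G) {X : E3 → V3}
    (hX : ∀ j, C1Bdd Ω (fun x => X x j)) (hXc : ∀ j, ContinuousOn (fun x => X x j) (closure Ω))
    (hb : ∀ y ∈ frontier Ω, ∀ n, IsOuterNormal Ω y n → ∑ j, X y j * n j = 0)
    {e : E3} (he : ‖e‖ = 1) {g : E3 → ℝ} {K : NNReal} (hg : LipschitzWith K g) {x₀ : E3} {r : ℝ}
    (hr : 0 < r)
    (h : ∀ x ∈ Metric.ball x₀ r, (x ∈ Ω ↔ g (x - inner ℝ x e • e) < inner ℝ x e))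
    {χ : E3 → ℝ} (hχ : ContDiff ℝ 1 χ) (hχs : tsupport χ ⊆ Metric.ball x₀ (r / 2)) :
    ∫ x in Ω, divIntegrand w G X χ x = 0 := by
  have hχc : HasCompactSupport χ := (isCompact_closedBall x₀ (r / 2)).of_isClosed_subset
    (isClosed_tsupport _) (hχs.trans Metric.ball_subset_closedBall)
  set Φ := graphHeight e g with hΦ
  have hΦl := lipschitzWith_graphHeight he hg
  have hΦd : ∀ᵐ x, DifferentiableAt ℝ Φ x := hΦl.ae_differentiableAt
  have h' : ∀ z ∈ Metric.ball x₀ r, (z ∈ Ω ↔ 0 < Φ z) := by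
    intro z hz
    rw [h z hz, hΦ, graphHeight, sub_pos]
  have hsub : Metric.ball x₀ (r / 2) ⊆ Metric.ball x₀ r := Metric.ball_subset_ball (by linarith)
  obtain ⟨M, hM⟩ := exists_abs_deriv_smoothTransition_le
  have hM0 : 0 ≤ M := (abs_nonneg _).trans (hM 0)
  choose N₀ hN₀ using fun j => (hX j).bdd
  set N := ∑ j, |N₀ j| with hN
  have hNj : ∀ j, ∀ x ∈ Ω, ‖fderiv ℝ (fun x => X x j) x‖ ≤ N := fun j x hx =>
    ((hN₀ j x hx).2.trans (le_abs_self _)).trans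
      (Finset.single_le_sum (f := fun j => |N₀ j|) (fun _ _ => abs_nonneg _) (Finset.mem_univ j))
  have hNn : 0 ≤ N := Finset.sum_nonneg fun _ _ => abs_nonneg _
  obtain ⟨B, hB⟩ := hχc.exists_bound_of_continuous hχ.continuous
  have hB0 : 0 ≤ B := (norm_nonneg _).trans (hB 0)
  -- With ε_n ≤ r/8 the layer of height at most 2ε_n stays below r/2, as the tangency estimate
  -- requires.
  let ε : ℕ → ℝ := fun n => r / 8 / (n + 1)
  have hε : ∀ n, 0 < ε n := fun n => by positivity
  have hεr : ∀ n, ε n ≤ r / 8 := fun n => div_le_self (by positivity) (by simp)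
  have hε0 : Tendsto ε atTop (𝓝 0) :=
    tendsto_const_nhds.div_atTop (tendsto_atTop_add_const_right _ _ tendsto_natCast_atTop_atTop)
  let ζ : ℕ → E3 → ℝ := fun n x => Real.smoothTransition (Φ x / ε n - 1)
  have hst : ContDiff ℝ 1 Real.smoothTransition := Real.smoothTransition.contDiff
  have hζl : ∀ n, LocallyLipschitz (ζ n) := by
    intro n
    have h1 : LipschitzWith (‖(ε n)⁻¹‖₊ * (1 + 2 * K)) (fun x => Φ x / ε n - 1) := by
      refine LipschitzWith.of_dist_le_mul fun x y => ?_
      have := hΦl.dist_le_mul x y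
      rw [Real.dist_eq] at this ⊢
      have e1 : Φ x / ε n - 1 - (Φ y / ε n - 1) = (ε n)⁻¹ * (Φ x - Φ y) := by
        rw [div_eq_inv_mul, div_eq_inv_mul]; ring
      rw [e1, abs_mul]
      push_cast at this ⊢
      rw [mul_assoc]
      exact mul_le_mul_of_nonneg_left this (abs_nonneg _)
    exact hst.locallyLipschitz.comp h1.locallyLipschitz
  have hζder : ∀ n x, DifferentiableAt ℝ Φ x → HasFDerivAt (ζ n)
      ((deriv Real.smoothTransition (Φ x / ε n - 1) * (ε n)⁻¹) • fderiv ℝ Φ x) x := by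
    intro n x hx
    have h1 : HasFDerivAt (fun x => Φ x / ε n - 1) ((ε n)⁻¹ • fderiv ℝ Φ x) x := by
      simp only [div_eq_inv_mul]
      exact (hx.hasFDerivAt.const_mul _).sub_const _
    have h2 := (hst.differentiable one_ne_zero (Φ x / ε n - 1)).hasDerivAt
    have h3 := h2.comp_hasFDerivAt x h1
    rwa [smul_smul] at h3
  have hcut : ∀ n, ∫ x in Ω, (ζ n x * divIntegrand w G X χ x
      + w x * (χ x * ∑ j, X x j * pd j (ζ n) x)) = 0 := by
    intro n
    refine integral_cutoff_divIntegrand_eq_zero hΩ hfin hw hX hχ hχc (hζl n) ?_ ?_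
    · have h1 : tsupport (fun x => ζ n x * χ x) ⊆ {x | ε n ≤ Φ x} ∩ tsupport χ := by
        refine closure_minimal (fun x hx => ⟨?_, subset_tsupport _ fun h0 => hx (by simp [h0])⟩)
          ((isClosed_le continuous_const hΦl.continuous).inter (isClosed_tsupport _))
        by_contra hlt
        simp only [mem_ofPred_eq, not_le] at hlt
        refine hx ?_
        have : ζ n x = 0 := Real.smoothTransition.zero_of_nonpos (by
          have := (div_lt_one (hε n)).2 hlt
          linarith)
        simp [this]
      intro x hx
      obtain ⟨h2, h3⟩ := h1 hx
      exact (h' x (hsub (hχs h3))).2 ((hε n).trans_le h2)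
    · filter_upwards [hΦd] with x hx using (hζder n x hx).differentiableAt
  have hintg := integrable_divIntegrand hΩ hfin hw hX
    (C1Bdd.of_contDiff_compactSupport Ω hχ hχc)
  have : IsFiniteMeasure (volume.restrict Ω) := ⟨by simpa using hfin.lt_top⟩
  have hwi : Integrable w (volume.restrict Ω) := hw.memLp.integrable one_le_two
  set A : ℝ := 3 * (N * (1 + 2 * K)) with hA
  have hA0 : 0 ≤ A := by positivity
  have hR : ∀ n, ∀ x ∈ Ω, DifferentiableAt ℝ Φ x →
      |w x * (χ x * ∑ j, X x j * pd j (ζ n) x)| ≤ ‖w x‖ * (B * (M * (2 * A))) := by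
    intro n x hxΩ hd
    rw [abs_mul]
    refine mul_le_mul_of_nonneg_left ?_ (abs_nonneg _)
    have e1 : ∑ j, X x j * pd j (ζ n) x = deriv Real.smoothTransition (Φ x / ε n - 1) * (ε n)⁻¹
        * ∑ j, X x j * pd j Φ x := by
      rw [Finset.mul_sum]
      refine Finset.sum_congr rfl fun j _ => ?_
      simp only [pd, (hζder n x hd).fderiv]
      simp
      ring
    by_cases hχx : x ∈ tsupport χ
    swap
    · rw [image_eq_zero_of_notMem_tsupport hχx]
      simp only [zero_mul, abs_zero]
      positivity
    rw [abs_mul]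
    refine mul_le_mul (hB x) ?_ (abs_nonneg _) hB0
    by_cases h2 : Φ x ≤ 2 * ε n
    · have h3 := abs_sum_mul_pd_graphHeight_le hΩ he hg h hXc (fun j => (hX j).diff) hNj hb
        (hχs hχx) hxΩ (by have := hεr n; rw [← hΦ]; linarith) hd
      rw [e1, abs_mul, abs_mul, mul_assoc]
      refine mul_le_mul (hM _) ?_ (by positivity) hM0
      rw [abs_inv, abs_of_pos (hε n), inv_mul_le_iff₀ (hε n)]
      refine h3.trans ?_
      rw [← hA, ← hΦ]
      have := mul_le_mul_of_nonneg_left h2 hA0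
      linarith
    · have h3 : 1 < Φ x / ε n - 1 := by
        rw [not_le] at h2
        have := (lt_div_iff₀ (hε n)).2 h2
        linarith
      have h4 : deriv Real.smoothTransition (Φ x / ε n - 1) = 0 := by
        have : Real.smoothTransition =ᶠ[𝓝 (Φ x / ε n - 1)] fun _ => 1 := by
          filter_upwards [lt_mem_nhds h3] with t ht using Real.smoothTransition.one_of_one_le ht.le
        rw [this.deriv_eq, deriv_const]
      rw [e1, h4]
      simp only [zero_mul, abs_zero]
      positivity
  have hlim : Tendsto (fun n => ∫ x in Ω, (ζ n x * divIntegrand w G X χ x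
      + w x * (χ x * ∑ j, X x j * pd j (ζ n) x))) atTop
      (𝓝 (∫ x in Ω, divIntegrand w G X χ x)) := by
    refine tendsto_integral_of_dominated_convergence
      (fun x => ‖divIntegrand w G X χ x‖ + ‖w x‖ * (B * (M * (2 * A)))) (fun n => ?_)
      (hintg.norm.add (hwi.norm.mul_const _)) (fun n => ?_) ?_
    · have hXm : ∀ j, AEStronglyMeasurable (fun x => X x j) (volume.restrict Ω) := fun j =>
        ((hX j).memLp hΩ hfin 2).aestronglyMeasurable
      refine ((hζl n).continuous.aestronglyMeasurable.mul hintg.aestronglyMeasurable).add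
        (hwi.aestronglyMeasurable.mul (hχ.continuous.aestronglyMeasurable.mul ?_))
      refine Finset.aestronglyMeasurable_fun_sum _ fun j _ => (hXm j).mul ?_
      exact (measurable_fderiv_apply_const ℝ (ζ n) _).aestronglyMeasurable
    · filter_upwards [ae_restrict_of_ae hΦd, ae_restrict_mem hΩ.measurableSet] with x hd hxΩ
      refine (norm_add_le _ _).trans (add_le_add ?_ (hR n x hxΩ hd))
      rw [norm_mul]
      refine mul_le_of_le_one_left (norm_nonneg _) ?_
      rw [Real.norm_of_nonneg (Real.smoothTransition.nonneg _)]
      exact Real.smoothTransition.le_one _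
    · filter_upwards [ae_restrict_of_ae hΦd, ae_restrict_mem hΩ.measurableSet] with x hd hxΩ
      by_cases hχx : x ∈ tsupport χ
      swap
      · have h1 : χ x = 0 := image_eq_zero_of_notMem_tsupport hχx
        have h2 : fderiv ℝ χ x = 0 := by
          by_contra h0
          exact hχx (support_fderiv_subset ℝ h0)
        simp [divIntegrand, h1, pd, h2]
      have hpos : 0 < Φ x := (h' x (hsub (hχs hχx))).1 hxΩ
      have hev : ∀ᶠ n in atTop, ε n < Φ x / 2 := hε0.eventually_lt_const (by linarith)
      refine tendsto_const_nhds.congr' ?_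
      filter_upwards [hev] with n hn
      have h3 : 1 < Φ x / ε n - 1 := by
        have := (lt_div_iff₀ (hε n)).2 (show 2 * ε n < Φ x by linarith)
        linarith
      have h4 : ζ n x = 1 := Real.smoothTransition.one_of_one_le h3.le
      have h5 : deriv Real.smoothTransition (Φ x / ε n - 1) = 0 := by
        have : Real.smoothTransition =ᶠ[𝓝 (Φ x / ε n - 1)] fun _ => 1 := by
          filter_upwards [lt_mem_nhds h3] with t ht using Real.smoothTransition.one_of_one_le ht.le
        rw [this.deriv_eq, deriv_const]
      have h6 : ∀ j, pd j (ζ n) x = 0 := by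
        intro j
        simp [pd, (hζder n x hd).fderiv, h5]
      simp [h4, h6]
  simp only [hcut] at hlim
  exact (tendsto_nhds_unique hlim tendsto_const_nhds)

/-- **Divergence theorem** for fields which are tangential to the boundary of a Lipschitz domain,
tested by a `W^{1,2}` function. -/
theorem integral_mul_div_add_grad_eq_zero {Ω : Set E3} (hΩ : IsBoundedLipschitzDomain Ω)
    {w : E3 → ℝ} {G : E3 → V3} (hw : MemW12 Ω w G) {X : E3 → V3}
    (hX : ∀ j, C1Bdd Ω (fun x => X x j)) (hXc : ∀ j, ContinuousOn (fun x => X x j) (closure Ω))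
    (hb : ∀ y ∈ frontier Ω, ∀ n, IsOuterNormal Ω y n → ∑ j, X y j * n j = 0) :
    ∫ x in Ω, (w x * ∑ j, pd j (fun y => X y j) x + ∑ j, G x j * X x j) = 0 := by
  have hfin := hΩ.measure_ne_top
  have hloc : ∀ x₀ ∈ closure Ω, ∃ ρ > 0, ∀ χ : E3 → ℝ, ContDiff ℝ 1 χ →
      tsupport χ ⊆ Metric.ball x₀ ρ → ∫ x in Ω, divIntegrand w G X χ x = 0 := by
    intro x₀ hx₀
    by_cases hx : x₀ ∈ Ω
    · obtain ⟨ρ, hρ, hball⟩ := Metric.isOpen_iff.1 hΩ.isOpen x₀ hx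
      refine ⟨ρ, hρ, fun χ hχ hχs => ?_⟩
      have hχc : HasCompactSupport χ := (isCompact_closedBall x₀ ρ).of_isClosed_subset
        (isClosed_tsupport _) (hχs.trans Metric.ball_subset_closedBall)
      have := integral_cutoff_divIntegrand_eq_zero hΩ.isOpen hfin hw hX hχ hχc (ζ := fun _ => 1)
        (LipschitzWith.const 1).locallyLipschitz (by simpa using hχs.trans hball)
        (.of_forall fun x => differentiableAt_const 1)
      simpa [pd] using this
    · obtain ⟨e, g, K, r, he, hg, hr, h⟩ := hΩ.graph x₀
        (by rw [hΩ.isOpen.frontier_eq]; exact ⟨hx₀, hx⟩)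
      exact ⟨r / 2, by linarith, fun χ hχ hχs => integral_divIntegrand_eq_zero_of_boundary
        hΩ.isOpen hfin hw hX hXc hb he hg hr h hχ hχs⟩
  choose! ρ hρ hL using hloc
  have hcpt : IsCompact (closure Ω) := hΩ.isBounded.isCompact_closure
  obtain ⟨s, hcov⟩ := hcpt.elim_nhds_subcover' (fun x _ => Metric.ball x (ρ x / 4))
    fun x hx => Metric.ball_mem_nhds x (by have := hρ x hx; linarith)
  let f : ∀ x : closure Ω, ContDiffBump (x : E3) := fun x =>
    { rIn := ρ x / 4
      rOut := ρ x / 2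
      rIn_pos := by have := hρ x x.2; linarith
      rIn_lt_rOut := by have := hρ x x.2; linarith }
  have hfs : ∀ x : closure Ω, tsupport (f x) ⊆ Metric.ball (x : E3) (ρ x) := by
    intro x
    rw [(f x).tsupport_eq]
    exact Metric.closedBall_subset_ball (by have := hρ x x.2; simp only [f]; linarith)
  have hlin : ∀ {χ φ : E3 → ℝ} (hχ : ContDiff ℝ 1 χ) (hφ : ContDiff ℝ 1 φ) (x : E3),
      divIntegrand w G X (fun y => χ y - φ y) x
        = divIntegrand w G X χ x - divIntegrand w G X φ x := by
    intro χ φ hχ hφ x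
    have : ∀ j, pd j (fun y => χ y - φ y) x = pd j χ x - pd j φ x := by
      intro j
      simp only [pd]
      rw [fderiv_fun_sub (hχ.differentiable one_ne_zero x) (hφ.differentiable one_ne_zero x)]
      rfl
    simp only [divIntegrand, this, Fin.sum_univ_three]
    ring
  have hC : ∀ {χ : E3 → ℝ}, ContDiff ℝ 1 χ → C1Bdd Ω χ := by
    intro χ hχ
    obtain ⟨N, hN⟩ := hcpt.exists_bound_of_continuousOn hχ.continuous.continuousOn
    obtain ⟨N', hN'⟩ := hcpt.exists_bound_of_continuousOn
      (hχ.continuous_fderiv one_ne_zero).continuousOn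
    exact ⟨fun x _ => hχ.differentiable one_ne_zero x,
      (hχ.continuous_fderiv one_ne_zero).continuousOn, max N N', fun x hx =>
      ⟨(hN x (subset_closure hx)).trans (le_max_left _ _),
        (hN' x (subset_closure hx)).trans (le_max_right _ _)⟩⟩
  have hprod : ∀ s : Finset (closure Ω), ContDiff ℝ 1 (fun x => ∏ i ∈ s, (1 - f i x)) := fun s =>
    contDiff_prod fun i _ => contDiff_const.sub (f i).contDiff
  -- The test function 1 is replaced by ∏(1 − f_i), one factor at a time. Each step changes it by
  -- f_a times a product, which is supported in one ball of the cover, where the local identity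
  -- applies. No partition of unity is needed.
  have hind : ∀ s : Finset (closure Ω), ∫ x in Ω, divIntegrand w G X (fun _ => 1) x
      = ∫ x in Ω, divIntegrand w G X (fun x => ∏ i ∈ s, (1 - f i x)) x := by
    intro s
    induction s using Finset.induction_on with
    | empty => simp
    | insert a s ha ih =>
      rw [ih]
      have e1 : (fun x => ∏ i ∈ insert a s, (1 - f i x))
          = fun x => (∏ i ∈ s, (1 - f i x)) - f a x * ∏ i ∈ s, (1 - f i x) := by
        ext x; rw [Finset.prod_insert ha]; ring
      have c2 : ContDiff ℝ 1 (fun x => f a x * ∏ i ∈ s, (1 - f i x)) :=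
        (f a).contDiff.mul (hprod s)
      rw [e1]
      simp only [hlin (hprod s) c2]
      rw [integral_sub (integrable_divIntegrand hΩ.isOpen hfin hw hX (hC (hprod s)))
        (integrable_divIntegrand hΩ.isOpen hfin hw hX (hC c2)), hL a a.2 _ c2, sub_zero]
      refine (closure_mono ?_).trans (hfs a)
      intro x hx h0
      exact hx (by simp [h0])
  -- Near every point of Ω some f_i is identically 1, so the product and its derivatives vanish
  -- there.
  have hzero : ∀ x ∈ Ω, divIntegrand w G X (fun x => ∏ i ∈ s, (1 - f i x)) x = 0 := by
    intro x hx
    have hx' := hcov (subset_closure hx)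
    simp only [mem_iUnion] at hx'
    obtain ⟨i, hi, hxi⟩ := hx'
    have hev : (fun x => ∏ i ∈ s, (1 - f i x)) =ᶠ[𝓝 x] fun _ => 0 := by
      filter_upwards [Metric.isOpen_ball.mem_nhds hxi] with y hy
      refine Finset.prod_eq_zero hi ?_
      rw [(f i).one_of_mem_closedBall (Metric.ball_subset_closedBall hy), sub_self]
    have h2 : ∀ j, pd j (fun x => ∏ i ∈ s, (1 - f i x)) x = 0 := by
      intro j
      simp [pd, hev.fderiv_eq]
    simp [divIntegrand, h2, hev.eq_of_nhds]
  have h3 := hind s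
  rw [setIntegral_congr_fun hΩ.isOpen.measurableSet hzero] at h3
  simpa [divIntegrand, pd] using h3

/-! ### Functions vanishing on the boundary belong to W^{1,2}_0 -/

theorem tendsto_eLpNorm_two_of_bounded {α F : Type*} [MeasurableSpace α] [NormedAddCommGroup F]
    {μ : Measure α} [IsFiniteMeasure μ] {g : α → F} {f : ℕ → α → F} {B : ℝ}
    (hm : ∀ n, AEStronglyMeasurable (fun x => g x - f n x) μ)
    (hB : ∀ n, ∀ᵐ x ∂μ, ‖g x - f n x‖ ≤ B)
    (hlim : ∀ᵐ x ∂μ, Tendsto (fun n => f n x) atTop (𝓝 (g x))) :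
    Tendsto (fun n => eLpNorm (fun x => g x - f n x) 2 μ) atTop (𝓝 0) := by
  have h1 : Tendsto (fun n => ∫⁻ x, ‖g x - f n x‖ₑ ^ (2 : ℝ) ∂μ) atTop (𝓝 0) := by
    have := tendsto_lintegral_of_dominated_convergence' (μ := μ)
      (F := fun n x => ‖g x - f n x‖ₑ ^ (2 : ℝ)) (f := fun _ => 0)
      (fun _ => ENNReal.ofReal B ^ (2 : ℝ)) (fun n => (hm n).enorm.pow_const _)
      (fun n => ?_) (by simp [ENNReal.mul_eq_top]) ?_
    · simpa using this
    · filter_upwards [hB n] with x hx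
      gcongr
      rw [← ofReal_norm]
      exact ENNReal.ofReal_le_ofReal hx
    · filter_upwards [hlim] with x hx
      have h2 : Tendsto (fun n => ‖g x - f n x‖ₑ) atTop (𝓝 0) := by
        have := (tendsto_const_nhds (x := g x)).sub hx
        rw [sub_self] at this
        simpa using this.enorm
      have := h2.ennrpow_const 2
      simpa using this
  have h3 := h1.ennrpow_const (1 / 2)
  simp only [one_div, ENNReal.zero_rpow_of_pos (by norm_num : (0 : ℝ) < 2⁻¹)] at h3
  refine h3.congr fun n => ?_
  rw [eLpNorm_eq_lintegral_rpow_enorm_toReal (by norm_num) (by norm_num)]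
  simp

/-- The derivative vanishes almost everywhere on the zero set. -/
theorem ae_fderiv_eq_zero_of_eq_zero {Ω : Set E3} (hΩ : IsOpen Ω) {f : E3 → ℝ}
    (hf : ∀ x ∈ Ω, DifferentiableAt ℝ f x) :
    ∀ᵐ x ∂(volume.restrict Ω), f x = 0 → fderiv ℝ f x = 0 := by
  have hc : ContinuousOn f Ω := fun x hx => (hf x hx).continuousAt.continuousWithinAt
  set s := Ω ∩ f ⁻¹' {0} with hs
  have hsm : MeasurableSet s := by
    have e : s = Ω \ (Ω ∩ f ⁻¹' {0}ᶜ) := by ext x; simp [hs]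
    rw [e]
    exact hΩ.measurableSet.diff (hc.isOpen_inter_preimage hΩ isOpen_compl_singleton).measurableSet
  let v : E3 := EuclideanSpace.single 0 1
  have hv : v ≠ 0 := by simp [v]
  -- On its zero set f·v is approximated by the zero map with constant 0, which forces its
  -- derivative to vanish at almost every point of the set. The factor v only serves to turn f into
  -- a map from the space to itself.
  have h1 : ApproximatesLinearOn (fun x => f x • v) (0 : E3 →L[ℝ] E3) s 0 := by
    intro x hx y hy
    have hx0 : f x = 0 := hx.2
    have hy0 : f y = 0 := hy.2
    simp [hx0, hy0]
  have h2 := h1.norm_fderiv_sub_le (μ := volume) hsm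
    (fun x => (fderiv ℝ f x).smulRight v) fun x hx =>
      ((hf x hx.1).hasFDerivAt.smul_const v).hasFDerivWithinAt
  rw [ae_restrict_iff' hsm] at h2
  rw [ae_restrict_iff' hΩ.measurableSet]
  filter_upwards [h2] with x hx hxΩ hx0
  have h3 := hx ⟨hxΩ, hx0⟩
  simp only [sub_zero, nonpos_iff_eq_zero, nnnorm_eq_zero] at h3
  ext z
  have h4 := congrArg (fun L : E3 →L[ℝ] E3 => L z) h3
  simp only [ContinuousLinearMap.smulRight_apply, zero_apply, smul_eq_zero,
    hv, or_false] at h4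
  simpa using h4

/-- A smooth approximation of the identity that vanishes near the origin. -/
noncomputable def softThreshold (ε s : ℝ) : ℝ := s * Real.smoothTransition (s ^ 2 / ε ^ 2 - 1)

theorem contDiff_softThreshold (ε : ℝ) : ContDiff ℝ 1 (softThreshold ε) :=
  contDiff_id.mul (Real.smoothTransition.contDiff.comp
    (((contDiff_id.pow 2).div_const _).sub contDiff_const))

theorem softThreshold_eq_zero {ε s : ℝ} (hε : 0 < ε) (hs : |s| ≤ ε) : softThreshold ε s = 0 := by
  have : s ^ 2 / ε ^ 2 ≤ 1 := by
    rw [div_le_one (by positivity)]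
    exact sq_le_sq' (by linarith [(abs_le.1 hs).1]) (abs_le.1 hs).2
  rw [softThreshold, Real.smoothTransition.zero_of_nonpos (by linarith), mul_zero]

theorem softThreshold_eq_self {ε s : ℝ} (hε : 0 < ε) (hs : 2 * ε < |s|) :
    softThreshold ε s = s := by
  have : 2 ≤ s ^ 2 / ε ^ 2 := by
    rw [le_div_iff₀ (by positivity), ← sq_abs s]
    nlinarith
  rw [softThreshold, Real.smoothTransition.one_of_one_le (by linarith), mul_one]

theorem abs_softThreshold_le (ε s : ℝ) : |softThreshold ε s| ≤ |s| := by
  rw [softThreshold, abs_mul]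
  refine mul_le_of_le_one_right (abs_nonneg _) ?_
  rw [abs_of_nonneg (Real.smoothTransition.nonneg _)]
  exact Real.smoothTransition.le_one _

theorem exists_abs_deriv_softThreshold_le :
    ∃ M : ℝ, ∀ ε > 0, ∀ s, |deriv (softThreshold ε) s| ≤ M := by
  obtain ⟨M, hM⟩ := exists_abs_deriv_smoothTransition_le
  have hM0 : 0 ≤ M := (abs_nonneg _).trans (hM 0)
  have hst : ContDiff ℝ 1 Real.smoothTransition := Real.smoothTransition.contDiff
  -- The bound is uniform in ε by scaling: the derivative of the transition factor contributes M ·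
  -- 2s²/ε², and s²/ε² ≤ 4 wherever the function is not the identity.
  refine ⟨1 + 8 * M, fun ε hε s => ?_⟩
  by_cases hs : 2 * ε < |s|
  · have : softThreshold ε =ᶠ[𝓝 s] id := by
      filter_upwards [continuous_abs.continuousAt.eventually (lt_mem_nhds hs)] with t ht
        using softThreshold_eq_self hε ht
    rw [this.deriv_eq, deriv_id, abs_one]
    linarith
  · have h1 : HasDerivAt (fun t : ℝ => t ^ 2 / ε ^ 2 - 1) (2 * s / ε ^ 2) s := by
      have := ((hasDerivAt_pow 2 s).div_const (ε ^ 2)).sub_const 1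
      simpa using this
    have h2 := ((hst.differentiable one_ne_zero (s ^ 2 / ε ^ 2 - 1)).hasDerivAt).comp s h1
    have h3 : HasDerivAt (softThreshold ε) _ s := (hasDerivAt_id s).mul h2
    rw [h3.deriv]
    refine (abs_add_le _ _).trans (add_le_add ?_ ?_)
    · simp only [one_mul]
      rw [abs_of_nonneg (Real.smoothTransition.nonneg _)]
      exact Real.smoothTransition.le_one _
    · rw [not_lt] at hs
      have e : id s * (deriv Real.smoothTransition (s ^ 2 / ε ^ 2 - 1) * (2 * s / ε ^ 2))
          = deriv Real.smoothTransition (s ^ 2 / ε ^ 2 - 1) * (2 * s ^ 2 / ε ^ 2) := by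
        simp only [id]; ring
      rw [e, abs_mul]
      have h4 : |2 * s ^ 2 / ε ^ 2| ≤ 8 := by
        rw [abs_of_nonneg (by positivity), div_le_iff₀ (by positivity), ← sq_abs s]
        nlinarith [abs_nonneg s]
      have := mul_le_mul (hM (s ^ 2 / ε ^ 2 - 1)) h4 (abs_nonneg _) hM0
      linarith

theorem MemW12.of_C1Bdd {Ω : Set E3} (hΩ : IsOpen Ω) (hfin : volume Ω ≠ ⊤) {f : E3 → ℝ}
    (hf : C1Bdd Ω f) : MemW12 Ω f (grad f) := by
  refine ⟨hf.memLp hΩ hfin 2, MemLp.of_eval fun j => hf.memLp_pd hΩ hfin 2 j, ?_⟩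
  intro ψ h1 h2 h3 j
  have := integral_mul_pd_of_compactSupport hΩ hfin (h1.of_le (by simp)) h2 h3 hf j
  simp only [grad, mul_comm (f _), mul_comm (pd j f _)]
  rw [this, neg_neg]

/-- No regularity of the boundary enters. Composing f with a soft threshold gives a function
supported where |f| ≥ ε, a compact subset of Ω because f is continuous up to the boundary and
vanishes there. Its gradient converges boundedly to ∇f, since ∇f = 0 almost everywhere on {f = 0}.
The thresholded functions are Lipschitz and can be mollified. -/
theorem MemW12Zero.of_C1Bdd {Ω : Set E3} (hΩ : IsOpen Ω) (hb : Bornology.IsBounded Ω)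
    {f : E3 → ℝ} (hf : C1Bdd Ω f) (hc : ContinuousOn f (closure Ω))
    (h0 : ∀ x ∈ frontier Ω, f x = 0) : MemW12Zero Ω f (grad f) := by
  have hfin : volume Ω ≠ ⊤ := hb.measure_lt_top.ne
  have : IsFiniteMeasure (volume.restrict Ω) := ⟨by simpa using hfin.lt_top⟩
  have hW := MemW12.of_C1Bdd hΩ hfin hf
  refine ⟨hW, ?_⟩
  obtain ⟨N, hN⟩ := hf.bdd
  obtain ⟨M, hM⟩ := exists_abs_deriv_softThreshold_le
  have hM0 : 0 ≤ M := (abs_nonneg _).trans (hM 1 one_pos 0)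
  let ε : ℕ → ℝ := fun n => 1 / (n + 1)
  have hε : ∀ n, 0 < ε n := fun n => by positivity
  have hε0 : Tendsto ε atTop (𝓝 0) := tendsto_one_div_add_atTop_nhds_zero_nat
  -- The indicator discards the values of f outside Ω, about which nothing is assumed beyond the
  -- closure.
  let F : ℕ → E3 → ℝ := fun n => Ω.indicator fun x => softThreshold (ε n) (f x)
  have hFΩ : ∀ n, ∀ x ∈ Ω, F n =ᶠ[𝓝 x] fun x => softThreshold (ε n) (f x) := by
    intro n x hx
    filter_upwards [hΩ.mem_nhds hx] with y hy using indicator_of_mem hy _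
  have hFd : ∀ n, ∀ x ∈ Ω, fderiv ℝ (F n) x = deriv (softThreshold (ε n)) (f x) • fderiv ℝ f x := by
    intro n x hx
    rw [(hFΩ n x hx).fderiv_eq]
    exact (((contDiff_softThreshold (ε n)).differentiable one_ne_zero
      (f x)).hasDerivAt.comp_hasFDerivAt x (hf.diff x hx).hasFDerivAt).fderiv
  have hcl : ∀ n, IsCompact (closure Ω ∩ (fun x => |f x|) ⁻¹' (Ici (ε n))) := by
    intro n
    refine hb.isCompact_closure.of_isClosed_subset ?_ inter_subset_left
    exact (continuous_abs.comp_continuousOn hc).preimage_isClosed_of_isClosed isClosed_closure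
      isClosed_Ici
  have hsub : ∀ n, tsupport (F n) ⊆ closure Ω ∩ (fun x => |f x|) ⁻¹' (Ici (ε n)) := by
    intro n
    refine closure_minimal (fun x hx => ?_) (hcl n).isClosed
    have hxΩ : x ∈ Ω := by
      by_contra h
      exact hx (indicator_of_notMem h _)
    refine ⟨subset_closure hxΩ, ?_⟩
    by_contra h
    simp only [mem_preimage, mem_Ici, not_le] at h
    exact hx ((indicator_of_mem hxΩ _).trans (softThreshold_eq_zero (hε n) h.le))
  have hsΩ : ∀ n, tsupport (F n) ⊆ Ω := by
    intro n x hx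
    obtain ⟨h1, h2⟩ := hsub n hx
    by_contra h
    have h3 := h0 x (by rw [hΩ.frontier_eq]; exact ⟨h1, h⟩)
    simp only [mem_preimage, mem_Ici, h3, abs_zero] at h2
    exact absurd (hε n) (not_lt.2 h2)
  have hFc : ∀ n, HasCompactSupport (F n) := fun n =>
    (hcl n).of_isClosed_subset (isClosed_tsupport _) (hsub n)
  have hFl : ∀ n, ∃ K : NNReal, LipschitzWith K (F n) := by
    intro n
    refine exists_lipschitzWith_of_hasCompactSupport (fun x => ?_) (hFc n)
    by_cases hx : x ∈ Ω
    · obtain ⟨K, t, ht, hK⟩ := exists_lipschitzOnWith_nhds_of_C1Bdd hΩ hf hx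
      obtain ⟨K', t', ht', hK'⟩ := (contDiff_softThreshold (ε n)).locallyLipschitz (f x)
      refine ⟨K' * K, t ∩ f ⁻¹' t' ∩ Ω, inter_mem (inter_mem ht
        ((hf.diff x hx).continuousAt ht')) (hΩ.mem_nhds hx), ?_⟩
      have := hK'.comp (hK.mono (inter_subset_left (t := f ⁻¹' t'))) fun y hy => hy.2
      intro y hy z hz
      have h1 := this hy.1 hz.1
      simp only [F, indicator_of_mem hy.2, indicator_of_mem hz.2]
      exact h1
    · refine ⟨0, (tsupport (F n))ᶜ, (isClosed_tsupport _).isOpen_compl.mem_nhds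
        fun h => hx (hsΩ n h), ?_⟩
      refine LipschitzOnWith.of_dist_le_mul fun y hy z hz => ?_
      rw [image_eq_zero_of_notMem_tsupport hy, image_eq_zero_of_notMem_tsupport hz]
      simp
  have hgm : ∀ φ : E3 → ℝ, AEStronglyMeasurable (grad φ) (volume.restrict Ω) := fun φ =>
    (measurable_pi_lambda _ fun j => measurable_fderiv_apply_const ℝ φ _).aestronglyMeasurable
  have hFm : ∀ n, AEStronglyMeasurable (F n) (volume.restrict Ω) := fun n => by
    obtain ⟨K, hK⟩ := hFl n
    exact hK.continuous.aestronglyMeasurable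
  have hnorm : ∀ {a b : V3} {B : ℝ}, 0 ≤ B → (∀ j, |a j| ≤ B) → (∀ j, |b j| ≤ B) →
      ‖a - b‖ ≤ B + B := by
    intro a b B hB ha hb
    refine (norm_sub_le _ _).trans (add_le_add ?_ ?_)
    · exact (pi_norm_le_iff_of_nonneg hB).2 ha
    · exact (pi_norm_le_iff_of_nonneg hB).2 hb
  have c1 : Tendsto (fun n => eLpNorm (fun x => f x - F n x) 2 (volume.restrict Ω)) atTop (𝓝 0) := by
    refine tendsto_eLpNorm_two_of_bounded (B := N + N)
      (fun n => hW.memLp.aestronglyMeasurable.sub (hFm n)) (fun n => ?_) ?_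
    · filter_upwards [ae_restrict_mem hΩ.measurableSet] with x hx
      refine (norm_sub_le _ _).trans (add_le_add (hN x hx).1 ?_)
      simp only [F, indicator_of_mem hx]
      exact (abs_softThreshold_le _ _).trans (hN x hx).1
    · filter_upwards [ae_restrict_mem hΩ.measurableSet] with x hx
      by_cases hfx : f x = 0
      · refine tendsto_const_nhds.congr fun n => ?_
        simp [F, indicator_of_mem hx, hfx, softThreshold]
      · refine tendsto_const_nhds.congr' ?_
        filter_upwards [hε0.eventually_lt_const (half_pos (abs_pos.2 hfx))] with n hn
        simp only [F, indicator_of_mem hx]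
        rw [softThreshold_eq_self (hε n) (by linarith)]
  have c2 : Tendsto (fun n => eLpNorm (fun x => grad f x - grad (F n) x) 2 (volume.restrict Ω))
      atTop (𝓝 0) := by
    refine tendsto_eLpNorm_two_of_bounded (B := (N + M * N) + (N + M * N))
      (fun n => (hgm f).sub (hgm (F n))) (fun n => ?_) ?_
    · filter_upwards [ae_restrict_mem hΩ.measurableSet] with x hx
      have hN0 : 0 ≤ N := (abs_nonneg _).trans (hN x hx).1
      have hMN : 0 ≤ M * N := by positivity
      refine hnorm (by positivity) (fun j => ?_) fun j => ?_
      · exact ((abs_pd_le f x j).trans (hN x hx).2).trans (by linarith)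
      · refine (abs_pd_le _ x j).trans ?_
        rw [hFd n x hx, norm_smul]
        have := mul_le_mul (hM (ε n) (hε n) (f x)) (hN x hx).2 (norm_nonneg _) hM0
        rw [Real.norm_eq_abs]
        linarith
    · filter_upwards [ae_restrict_mem hΩ.measurableSet, ae_fderiv_eq_zero_of_eq_zero hΩ hf.diff]
        with x hx hz
      by_cases hfx : f x = 0
      · refine tendsto_const_nhds.congr fun n => ?_
        ext j
        simp [grad, pd, hFd n x hx, hz hfx]
      · refine tendsto_const_nhds.congr' ?_
        filter_upwards [hε0.eventually_lt_const (half_pos (abs_pos.2 hfx))] with n hn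
        have : softThreshold (ε n) =ᶠ[𝓝 (f x)] id := by
          filter_upwards [continuous_abs.continuousAt.eventually
            (lt_mem_nhds (show 2 * ε n < |f x| by linarith))] with t ht
            using softThreshold_eq_self (hε n) ht
        ext j
        simp [grad, pd, hFd n x hx, this.deriv_eq]
  have key : ∀ δ : ℝ≥0∞, 0 < δ → ∃ ψ : E3 → ℝ,
      (ContDiff ℝ ∞ ψ ∧ HasCompactSupport ψ ∧ tsupport ψ ⊆ Ω) ∧
      eLpNorm (fun x => f x - ψ x) 2 (volume.restrict Ω) ≤ δ ∧
      eLpNorm (fun x => grad f x - grad ψ x) 2 (volume.restrict Ω) ≤ δ := by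
    intro δ hδ
    have hδ2 : 0 < δ / 2 := ENNReal.half_pos hδ.ne'
    obtain ⟨n, hn1, hn2⟩ :=
      ((c1.eventually (gt_mem_nhds hδ2)).and (c2.eventually (gt_mem_nhds hδ2))).exists
    obtain ⟨K, hK⟩ := hFl n
    obtain ⟨ψ, hψ, ⟨B, hB⟩, hψ', hl, hl'⟩ := exists_smooth_approx hΩ hK (hFc n) (hsΩ n)
    have d1 : Tendsto (fun m => eLpNorm (fun x => F n x - ψ m x) 2 (volume.restrict Ω)) atTop
        (𝓝 0) := by
      obtain ⟨B', hB'⟩ := (hFc n).exists_bound_of_continuous hK.continuous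
      refine tendsto_eLpNorm_two_of_bounded (B := B' + B)
        (fun m => (hFm n).sub (hψ m).1.continuous.aestronglyMeasurable)
        (fun m => .of_forall fun x => ?_) (.of_forall fun x => hl x)
      exact (norm_sub_le _ _).trans (add_le_add (hB' x) (hB m x))
    have d2 : Tendsto (fun m => eLpNorm (fun x => grad (F n) x - grad (ψ m) x) 2
        (volume.restrict Ω)) atTop (𝓝 0) := by
      refine tendsto_eLpNorm_two_of_bounded (B := (K : ℝ) + K)
        (fun m => (hgm _).sub (hgm _)) (fun m => .of_forall fun x => ?_) ?_
      · exact hnorm K.coe_nonneg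
          (fun j => (abs_pd_le _ x j).trans (norm_fderiv_le_of_lipschitz ℝ hK)) fun j => hψ' m x j
      · filter_upwards [ae_restrict_of_ae (ae_all_iff.2 hl')] with x hx
        exact tendsto_pi_nhds.2 hx
    obtain ⟨m, hm1, hm2⟩ :=
      ((d1.eventually (gt_mem_nhds hδ2)).and (d2.eventually (gt_mem_nhds hδ2))).exists
    refine ⟨ψ m, hψ m, ?_, ?_⟩
    · have e : (fun x => f x - ψ m x) = (fun x => f x - F n x) + fun x => F n x - ψ m x := by
        ext x; simp
      rw [e]
      refine (eLpNorm_add_le (hW.memLp.aestronglyMeasurable.sub (hFm n))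
        ((hFm n).sub (hψ m).1.continuous.aestronglyMeasurable) one_le_two).trans ?_
      exact (add_le_add hn1.le hm1.le).trans (ENNReal.add_halves δ).le
    · have e : (fun x => grad f x - grad (ψ m) x)
          = (fun x => grad f x - grad (F n) x) + fun x => grad (F n) x - grad (ψ m) x := by
        ext x; simp
      rw [e]
      refine (eLpNorm_add_le ((hgm _).sub (hgm _)) ((hgm _).sub (hgm _)) one_le_two).trans ?_
      exact (add_le_add hn2.le hm2.le).trans (ENNReal.add_halves δ).le
  choose! ψ hψ using key
  have hpos : ∀ n : ℕ, 0 < ((n : ℝ≥0∞))⁻¹ := fun n => by simp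
  refine ⟨fun n => ψ (n : ℝ≥0∞)⁻¹, fun n => (hψ _ (hpos n)).1, ?_, ?_⟩
  · exact tendsto_of_tendsto_of_tendsto_of_le_of_le tendsto_const_nhds
      ENNReal.tendsto_inv_nat_nhds_zero (fun _ => zero_le) fun n => (hψ _ (hpos n)).2.1
  · exact tendsto_of_tendsto_of_tendsto_of_le_of_le tendsto_const_nhds
      ENNReal.tendsto_inv_nat_nhds_zero (fun _ => zero_le) fun n => (hψ _ (hpos n)).2.2

/-! ### The space-time cylinder -/

theorem cylMeasure_eq_prod (T : ℝ) (Ω : Set E3) :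
    cylMeasure T Ω = (volume.restrict (Ioo (0 : ℝ) T)).prod (volume.restrict Ω) := by
  rw [cylMeasure, Measure.volume_eq_prod, Measure.prod_restrict]

theorem cylMeasure_mono {τ T : ℝ} (h : τ ≤ T) (Ω : Set E3) : cylMeasure τ Ω ≤ cylMeasure T Ω :=
  Measure.restrict_mono (prod_mono (Ioo_subset_Ioo_right h) le_rfl) le_rfl

theorem isFiniteMeasure_cylMeasure (T : ℝ) {Ω : Set E3} (hfin : volume Ω ≠ ⊤) :
    IsFiniteMeasure (cylMeasure T Ω) := by
  have : IsFiniteMeasure (volume.restrict Ω) := ⟨by simpa using hfin.lt_top⟩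
  rw [cylMeasure_eq_prod]
  infer_instance

theorem ae_ae_of_ae_cylMeasure {T : ℝ} {Ω : Set E3} {p : ℝ × E3 → Prop}
    (h : ∀ᵐ z ∂(cylMeasure T Ω), p z) :
    ∀ᵐ t ∂(volume.restrict (Ioo (0 : ℝ) T)), ∀ᵐ x ∂(volume.restrict Ω), p (t, x) := by
  rw [cylMeasure_eq_prod] at h
  exact Measure.ae_ae_of_ae_prod h

theorem integrable_slice {F : Type*} [NormedAddCommGroup F] {T : ℝ} {Ω : Set E3}
    {f : ℝ × E3 → F} (h : Integrable f (cylMeasure T Ω)) :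
    ∀ᵐ t ∂(volume.restrict (Ioo (0 : ℝ) T)), Integrable (fun x => f (t, x)) (volume.restrict Ω) := by
  rw [cylMeasure_eq_prod] at h
  exact h.prod_right_ae

theorem integrable_integral_slice {T : ℝ} {Ω : Set E3} {f : ℝ × E3 → ℝ}
    (h : Integrable f (cylMeasure T Ω)) :
    Integrable (fun t => ∫ x in Ω, f (t, x)) (volume.restrict (Ioo (0 : ℝ) T)) := by
  rw [cylMeasure_eq_prod] at h
  exact h.integral_prod_left

theorem intervalIntegral_integral_eq {T τ : ℝ} (hτ : τ ∈ Icc (0 : ℝ) T) {Ω : Set E3}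
    {f : ℝ × E3 → ℝ} (h : Integrable f (cylMeasure T Ω)) :
    ∫ t in (0 : ℝ)..τ, ∫ x in Ω, f (t, x) = ∫ z, f z ∂(cylMeasure τ Ω) := by
  have h' := h.mono_measure (cylMeasure_mono hτ.2 Ω)
  rw [cylMeasure_eq_prod] at h' ⊢
  rw [integral_prod _ h', intervalIntegral.integral_of_le hτ.1, integral_Ioc_eq_integral_Ioo]

/-- **Grönwall's inequality** for an integrable function, with vanishing initial value. -/
theorem ae_eq_zero_of_le_integral {T C : ℝ} (hC : 0 ≤ C) {f : ℝ → ℝ}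
    (hf : IntegrableOn f (Ioo (0 : ℝ) T))
    (h0 : ∀ᵐ t ∂(volume.restrict (Ioo (0 : ℝ) T)), 0 ≤ f t)
    (h : ∀ᵐ t ∂(volume.restrict (Ioo (0 : ℝ) T)), f t ≤ C * ∫ s in (0 : ℝ)..t, f s) :
    ∀ᵐ t ∂(volume.restrict (Ioo (0 : ℝ) T)), f t = 0 := by
  rcases le_or_gt T 0 with hT | hT
  · simp [Ioo_eq_empty (not_lt.2 hT)]
  have hfI : IntegrableOn f (Icc 0 T) := (integrableOn_Icc_iff_integrableOn_Ioo).2 hf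
  have hsub : ∀ {a b : ℝ}, 0 ≤ a → b ≤ T → a ≤ b → IntervalIntegrable f volume a b := by
    intro a b ha hb hab
    rw [intervalIntegrable_iff_integrableOn_Icc_of_le hab]
    exact hfI.mono_set (Icc_subset_Icc ha hb)
  set F : ℝ → ℝ := fun t => ∫ s in (0 : ℝ)..t, f s with hF
  have hFc : ContinuousOn F (Icc 0 T) := by
    have := intervalIntegral.continuousOn_primitive_interval (μ := volume) (f := f) (a := 0)
      (b := T) (by rwa [uIcc_of_le hT.le])
    rwa [uIcc_of_le hT.le] at this
  have hFI : ∀ {b : ℝ}, 0 ≤ b → b ≤ T → IntervalIntegrable F volume 0 b := by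
    intro b h0 hb
    refine ContinuousOn.intervalIntegrable ?_
    rw [uIcc_of_le h0]
    exact hFc.mono (Icc_subset_Icc_right hb)
  -- The inequality for f holds only almost everywhere, so it is integrated once to obtain one that
  -- holds everywhere for the continuous primitive F.
  have hF1 : ∀ t ∈ Icc 0 T, F t ≤ C * ∫ s in (0 : ℝ)..t, F s := by
    intro t ht
    rw [← intervalIntegral.integral_const_mul]
    simp only [hF]
    refine intervalIntegral.integral_mono_ae_restrict ht.1 (hsub le_rfl ht.2 ht.1)
      ((hFI ht.1 ht.2).const_mul C) ?_
    rw [EventuallyLE, ← restrict_Ioo_eq_restrict_Icc]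
    exact ae_restrict_of_ae_restrict_of_subset (Ioo_subset_Ioo_right ht.2) h
  have hF0 : ∀ t ∈ Icc 0 T, 0 ≤ F t := by
    intro t ht
    refine intervalIntegral.integral_nonneg_of_ae_restrict ht.1 ?_
    rw [EventuallyLE, ← restrict_Ioo_eq_restrict_Icc]
    exact ae_restrict_of_ae_restrict_of_subset (Ioo_subset_Ioo_right ht.2) h0
  obtain ⟨M, hM⟩ := isCompact_Icc.exists_bound_of_continuousOn hFc
  -- Picard iteration: inserting the bound into itself produces one more power of t and the next
  -- factorial, and the bounds tend to zero as n grows.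
  have hit : ∀ n : ℕ, ∀ t ∈ Icc 0 T, F t ≤ M * (C * t) ^ n / n.factorial := by
    intro n
    induction n with
    | zero => intro t ht; simpa using (le_abs_self _).trans (hM t ht)
    | succ n ih =>
      intro t ht
      refine (hF1 t ht).trans ?_
      have h1 : ∫ s in (0 : ℝ)..t, F s ≤ ∫ s in (0 : ℝ)..t, M * (C * s) ^ n / n.factorial := by
        refine intervalIntegral.integral_mono_on ht.1 (hFI ht.1 ht.2)
          (Continuous.intervalIntegrable (by fun_prop) _ _) fun s hs => ih s ⟨hs.1, hs.2.trans ht.2⟩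
      have h2 : ∫ s in (0 : ℝ)..t, M * (C * s) ^ n / n.factorial
          = M * C ^ n / n.factorial * (t ^ (n + 1) / (n + 1)) := by
        have : ∀ s : ℝ, M * (C * s) ^ n / n.factorial = M * C ^ n / n.factorial * s ^ n := by
          intro s; rw [mul_pow]; ring
        simp only [this]
        rw [intervalIntegral.integral_const_mul, integral_pow]
        simp
      rw [h2] at h1
      refine (mul_le_mul_of_nonneg_left h1 hC).trans_eq ?_
      rw [Nat.factorial_succ]
      push_cast
      have : (n.factorial : ℝ) ≠ 0 := by positivity
      field_simp
      ring
  have hz : ∀ t ∈ Icc 0 T, F t = 0 := by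
    intro t ht
    refine le_antisymm ?_ (hF0 t ht)
    have hl : Tendsto (fun n : ℕ => M * (C * t) ^ n / n.factorial) atTop (𝓝 0) := by
      have := (FloorSemiring.tendsto_pow_div_factorial_atTop (C * t)).const_mul M
      simp only [mul_zero] at this
      exact this.congr fun n => by ring
    exact ge_of_tendsto' hl fun n => hit n t ht
  filter_upwards [h0, h, ae_restrict_mem measurableSet_Ioo] with t h1 h2 ht
  have h3 := hz t ⟨ht.1.le, ht.2.le⟩
  simp only [hF] at h3
  rw [h3, mul_zero] at h2
  exact le_antisymm h2 h1

/-! ### Regularity on the closed cylinder -/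

theorem memLp_top_cyl {T : ℝ} {Ω : Set E3} {F : Type*} [NormedAddCommGroup F]
    (hΩ : IsBoundedLipschitzDomain Ω) {g : ℝ × E3 → F}
    (hc : ContinuousOn g (Ioo (0 : ℝ) T ×ˢ Ω)) {N : ℝ}
    (hN : ∀ z ∈ Ioo (0 : ℝ) T ×ˢ Ω, ‖g z‖ ≤ N) : MemLp g ⊤ (cylMeasure T Ω) := by
  have hm : MeasurableSet (Ioo (0 : ℝ) T ×ˢ Ω) := measurableSet_Ioo.prod hΩ.isOpen.measurableSet
  refine memLp_top_of_bound ?_ N ?_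
  · exact hc.aestronglyMeasurable hm
  · exact (ae_restrict_mem hm).mono fun z hz => hN z hz

section Regularity

variable {T : ℝ} {Ω : Set E3} {F : Type} [NormedAddCommGroup F] [NormedSpace ℝ F]

/-- The closed space-time cylinder. -/
def closedCyl (T : ℝ) (Ω : Set E3) : Set (ℝ × E3) := Icc (0 : ℝ) T ×ˢ closure Ω

theorem uniqueDiffOn_closedCyl (hT : 0 < T) (hΩ : IsBoundedLipschitzDomain Ω) :
    UniqueDiffOn ℝ (closedCyl T Ω) :=
  (uniqueDiffOn_Icc hT).prod hΩ.uniqueDiffOn_closure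

theorem isCompact_closedCyl (T : ℝ) (hΩ : IsBoundedLipschitzDomain Ω) :
    IsCompact (closedCyl T Ω) :=
  isCompact_Icc.prod hΩ.isBounded.isCompact_closure

theorem closedCyl_mem_nhds (hΩ : IsBoundedLipschitzDomain Ω) {t : ℝ} (ht : t ∈ Ioo (0 : ℝ) T)
    {x : E3} (hx : x ∈ Ω) : closedCyl T Ω ∈ 𝓝 (t, x) :=
  prod_mem_nhds (Icc_mem_nhds ht.1 ht.2) (mem_of_superset (hΩ.isOpen.mem_nhds hx) subset_closure)

/-- The space-time derivative on the closed cylinder. -/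
noncomputable def stDeriv (T : ℝ) (Ω : Set E3) (f : ℝ → E3 → F) (z : ℝ × E3) : ℝ × E3 →L[ℝ] F :=
  fderivWithin ℝ (fun z : ℝ × E3 => f z.1 z.2) (closedCyl T Ω) z

theorem IsC1.continuousOn {f : ℝ → E3 → F} (hf : IsC1 T Ω f) :
    ContinuousOn (fun z : ℝ × E3 => f z.1 z.2) (closedCyl T Ω) := ContDiffOn.continuousOn hf

theorem IsC1.continuousOn_slice {f : ℝ → E3 → F} (hf : IsC1 T Ω f) {t : ℝ}
    (ht : t ∈ Icc (0 : ℝ) T) : ContinuousOn (f t) (closure Ω) :=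
  hf.continuousOn.comp (f := fun x => (t, x)) (by fun_prop) fun _ hx => ⟨ht, hx⟩

theorem IsC1.continuousOn_stDeriv {f : ℝ → E3 → F} (hf : IsC1 T Ω f) (hT : 0 < T)
    (hΩ : IsBoundedLipschitzDomain Ω) : ContinuousOn (stDeriv T Ω f) (closedCyl T Ω) :=
  ContDiffOn.continuousOn_fderivWithin hf (uniqueDiffOn_closedCyl hT hΩ) le_rfl

theorem IsC1.hasFDerivWithinAt {f : ℝ → E3 → F} (hf : IsC1 T Ω f) {z : ℝ × E3}
    (hz : z ∈ closedCyl T Ω) :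
    HasFDerivWithinAt (fun z : ℝ × E3 => f z.1 z.2) (stDeriv T Ω f z) (closedCyl T Ω) z :=
  (ContDiffOn.differentiableOn hf one_ne_zero z hz).hasFDerivWithinAt

theorem IsC1.hasFDerivAt {f : ℝ → E3 → F} (hf : IsC1 T Ω f) (hΩ : IsBoundedLipschitzDomain Ω)
    {t : ℝ} (ht : t ∈ Ioo (0 : ℝ) T) {x : E3} (hx : x ∈ Ω) :
    HasFDerivAt (fun z : ℝ × E3 => f z.1 z.2) (stDeriv T Ω f (t, x)) (t, x) :=
  (hf.hasFDerivWithinAt ⟨⟨ht.1.le, ht.2.le⟩, subset_closure hx⟩).hasFDerivAt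
    (closedCyl_mem_nhds hΩ ht hx)

theorem IsC1.hasDerivAt {f : ℝ → E3 → F} (hf : IsC1 T Ω f) (hΩ : IsBoundedLipschitzDomain Ω)
    {t : ℝ} (ht : t ∈ Ioo (0 : ℝ) T) {x : E3} (hx : x ∈ Ω) :
    HasDerivAt (fun s => f s x) (stDeriv T Ω f (t, x) (1, 0)) t := by
  have h1 : HasDerivAt (fun s : ℝ => (s, x)) ((1 : ℝ), (0 : E3)) t :=
    (hasDerivAt_id t).prodMk (hasDerivAt_const t x)
  exact (hf.hasFDerivAt hΩ ht hx).comp_hasDerivAt t h1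

theorem IsC1.hasFDerivAt_slice {f : ℝ → E3 → F} (hf : IsC1 T Ω f)
    (hΩ : IsBoundedLipschitzDomain Ω) {t : ℝ} (ht : t ∈ Ioo (0 : ℝ) T) {x : E3} (hx : x ∈ Ω) :
    HasFDerivAt (f t) ((stDeriv T Ω f (t, x)).comp (ContinuousLinearMap.inr ℝ ℝ E3)) x := by
  have h1 : HasFDerivAt (fun y : E3 => (t, y)) (ContinuousLinearMap.inr ℝ ℝ E3) x :=
    hasFDerivAt_prodMk_right t x
  exact (hf.hasFDerivAt hΩ ht hx).comp x h1

theorem IsC1.hasFDerivWithinAt_slice {f : ℝ → E3 → F} (hf : IsC1 T Ω f) {t : ℝ}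
    (ht : t ∈ Icc (0 : ℝ) T) {x : E3} (hx : x ∈ closure Ω) :
    HasFDerivWithinAt (f t) ((stDeriv T Ω f (t, x)).comp (ContinuousLinearMap.inr ℝ ℝ E3))
      (closure Ω) x := by
  have h1 : HasFDerivWithinAt (fun y : E3 => (t, y)) (ContinuousLinearMap.inr ℝ ℝ E3)
    (closure Ω) x := (hasFDerivAt_prodMk_right t x).hasFDerivWithinAt
  exact (hf.hasFDerivWithinAt (z := (t, x)) ⟨ht, hx⟩).comp x h1 fun _ hy => ⟨ht, hy⟩

theorem IsC1.continuousOn_deriv {f : ℝ → E3 → F} (hf : IsC1 T Ω f) (hT : 0 < T)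
    (hΩ : IsBoundedLipschitzDomain Ω) :
    ContinuousOn (fun z : ℝ × E3 => deriv (fun s => f s z.2) z.1) (Ioo (0 : ℝ) T ×ˢ Ω) := by
  have h1 : ContinuousOn (fun z => stDeriv T Ω f z (1, 0)) (Ioo (0 : ℝ) T ×ˢ Ω) :=
    ((hf.continuousOn_stDeriv hT hΩ).mono (prod_mono Ioo_subset_Icc_self subset_closure)).clm_apply
      continuousOn_const
  exact h1.congr fun z hz => (hf.hasDerivAt hΩ hz.1 hz.2).deriv

theorem IsC1.continuousOn_fderiv {f : ℝ → E3 → F} (hf : IsC1 T Ω f) (hT : 0 < T)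
    (hΩ : IsBoundedLipschitzDomain Ω) :
    ContinuousOn (fun z : ℝ × E3 => fderiv ℝ (f z.1) z.2) (Ioo (0 : ℝ) T ×ˢ Ω) := by
  have h1 : ContinuousOn (fun z => (stDeriv T Ω f z).comp (ContinuousLinearMap.inr ℝ ℝ E3))
      (Ioo (0 : ℝ) T ×ˢ Ω) :=
    ((hf.continuousOn_stDeriv hT hΩ).mono (prod_mono Ioo_subset_Icc_self subset_closure)).clm_comp
      continuousOn_const
  exact h1.congr fun z hz => (hf.hasFDerivAt_slice hΩ hz.1 hz.2).fderiv

/-- Interior derivatives are restrictions of the derivative relative to the closed cylinder, which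
is continuous on a compact set. -/
theorem IsC1.exists_bound {f : ℝ → E3 → F} (hf : IsC1 T Ω f) (hT : 0 < T)
    (hΩ : IsBoundedLipschitzDomain Ω) : ∃ N : ℝ, 0 ≤ N ∧
      (∀ t ∈ Icc (0 : ℝ) T, ∀ x ∈ closure Ω, ‖f t x‖ ≤ N) ∧
      (∀ t ∈ Ioo (0 : ℝ) T, ∀ x ∈ Ω, ‖deriv (fun s => f s x) t‖ ≤ N ∧ ‖fderiv ℝ (f t) x‖ ≤ N) := by
  obtain ⟨N, hN⟩ := (isCompact_closedCyl T hΩ).exists_bound_of_continuousOn hf.continuousOn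
  obtain ⟨N', hN'⟩ := (isCompact_closedCyl T hΩ).exists_bound_of_continuousOn
    (hf.continuousOn_stDeriv hT hΩ)
  refine ⟨max (max N N') 0, le_max_right _ _, fun t ht x hx => ?_, fun t ht x hx => ?_⟩
  · exact (hN (t, x) ⟨ht, hx⟩).trans ((le_max_left _ _).trans (le_max_left _ _))
  · have hb := (hN' (t, x) ⟨Ioo_subset_Icc_self ht, subset_closure hx⟩).trans
      ((le_max_right N _).trans (le_max_left _ 0))
    rw [(hf.hasDerivAt hΩ ht hx).deriv, (hf.hasFDerivAt_slice hΩ ht hx).fderiv]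
    constructor
    · refine ((stDeriv T Ω f (t, x)).le_opNorm _).trans ?_
      have : ‖((1 : ℝ), (0 : E3))‖ = 1 := by simp [Prod.norm_def]
      rwa [this, mul_one]
    · refine (ContinuousLinearMap.opNorm_comp_le _ _).trans ?_
      refine (mul_le_of_le_one_right (norm_nonneg _) ?_).trans hb
      exact ContinuousLinearMap.norm_inr_le_one ℝ ℝ E3

theorem IsC1.c1Bdd {f : ℝ → E3 → ℝ} (hf : IsC1 T Ω f) (hΩ : IsBoundedLipschitzDomain Ω)
    {t : ℝ} (ht : t ∈ Ioo (0 : ℝ) T) : C1Bdd Ω (f t) := by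
  have hT : 0 < T := ht.1.trans ht.2
  obtain ⟨N, -, h1, h2⟩ := hf.exists_bound hT hΩ
  refine ⟨fun x hx => (hf.hasFDerivAt_slice hΩ ht hx).differentiableAt, ?_,
    N, fun x hx => ⟨h1 t (Ioo_subset_Icc_self ht) x (subset_closure hx), (h2 t ht x hx).2⟩⟩
  exact (hf.continuousOn_fderiv hT hΩ).comp (f := fun x => (t, x)) (by fun_prop)
    fun _ hx => ⟨ht, hx⟩

theorem IsC1.apply {f : ℝ → E3 → V3} (hf : IsC1 T Ω f) (i : Fin 3) :
    IsC1 T Ω (fun t x => f t x i) :=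
  contDiffOn_pi.1 hf i

/-- The fundamental theorem of calculus on each time line, followed by Fubini. It puts the terms of
the classical solution alone in the same form as the weak balances. -/
theorem IsC1.integral_sub_integral {f : ℝ → E3 → ℝ} (hf : IsC1 T Ω f) (hT : 0 < T)
    (hΩ : IsBoundedLipschitzDomain Ω) {τ : ℝ} (hτ : τ ∈ Icc (0 : ℝ) T) :
    (∫ x in Ω, f τ x) - ∫ x in Ω, f 0 x
      = ∫ t in (0 : ℝ)..τ, ∫ x in Ω, deriv (fun s => f s x) t := by
  have : IsFiniteMeasure (volume.restrict Ω) := ⟨by simpa using hΩ.measure_ne_top.lt_top⟩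
  have hcyl := isFiniteMeasure_cylMeasure T hΩ.measure_ne_top
  obtain ⟨N, hN0, hN1, hN2⟩ := hf.exists_bound hT hΩ
  have hm : MeasurableSet (Ioo (0 : ℝ) T ×ˢ Ω) := measurableSet_Ioo.prod hΩ.isOpen.measurableSet
  have hi : Integrable (fun z : ℝ × E3 => deriv (fun s => f s z.2) z.1) (cylMeasure T Ω) := by
    refine Integrable.of_bound ((hf.continuousOn_deriv hT hΩ).aestronglyMeasurable hm) N ?_
    exact (ae_restrict_mem hm).mono fun z hz => (hN2 z.1 hz.1 z.2 hz.2).1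
  have hsl : ∀ t ∈ Icc (0 : ℝ) T, Integrable (f t) (volume.restrict Ω) := by
    intro t ht
    refine Integrable.of_bound (((hf.continuousOn_slice ht).mono
      subset_closure).aestronglyMeasurable hΩ.isOpen.measurableSet) N ?_
    exact (ae_restrict_mem hΩ.isOpen.measurableSet).mono fun x hx => hN1 t ht x (subset_closure hx)
  rw [← integral_sub (hsl τ hτ) (hsl 0 ⟨le_rfl, hT.le⟩), intervalIntegral_integral_eq hτ
    (f := fun z : ℝ × E3 => deriv (fun s => f s z.2) z.1) hi]
  have hi' := hi.mono_measure (cylMeasure_mono hτ.2 Ω)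
  rw [cylMeasure_eq_prod] at hi' ⊢
  rw [integral_prod_symm _ hi']
  refine integral_congr_ae ((ae_restrict_mem hΩ.isOpen.measurableSet).mono fun x hx => ?_)
  simp only
  rw [← integral_Ioc_eq_integral_Ioo, ← intervalIntegral.integral_of_le hτ.1]
  have hcs : ContinuousOn (fun s => f s x) (Icc 0 τ) :=
    hf.continuousOn.comp (f := fun s => (s, x)) (by fun_prop)
      fun s hs => ⟨⟨hs.1, hs.2.trans hτ.2⟩, subset_closure hx⟩
  symm
  refine intervalIntegral.integral_eq_sub_of_hasDerivAt_of_le hτ.1 hcs (fun s hs => ?_) ?_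
  · have := hf.hasDerivAt hΩ ⟨hs.1, hs.2.trans_le hτ.2⟩ hx
    rwa [← this.deriv] at this
  · rw [intervalIntegrable_iff_integrableOn_Ioo_of_le hτ.1]
    refine Integrable.of_bound (measurable_deriv _).aestronglyMeasurable N ?_
    exact (ae_restrict_mem measurableSet_Ioo).mono fun s hs =>
      (hN2 s ⟨hs.1, hs.2.trans_le hτ.2⟩ x hx).1

end Regularity

/-! ### Thermodynamics -/

namespace Model

variable {M : Model}

theorem Admissible.hasDerivAt_p (hM : M.Admissible) {Z : ℝ} (hZ : 0 < Z) :
    HasDerivAt M.p (deriv M.p Z) Z :=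
  ((hM.p_C1.differentiableOn one_ne_zero Z hZ.le).differentiableAt
    (Ici_mem_nhds hZ)).hasDerivAt

theorem Admissible.derivWithin_p (hM : M.Admissible) {Z : ℝ} (hZ : 0 < Z) :
    derivWithin M.p (Ici 0) Z = deriv M.p Z :=
  ((hM.hasDerivAt_p hZ).hasDerivWithinAt).derivWithin (uniqueDiffOn_Ici 0 Z hZ.le)

theorem Admissible.deriv_p_pos (hM : M.Admissible) {Z : ℝ} (hZ : 0 < Z) : 0 < deriv M.p Z := by
  rw [← hM.derivWithin_p hZ]
  exact hM.p_deriv_pos Z hZ.le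

theorem Admissible.continuousOn_deriv_p (hM : M.Admissible) : ContinuousOn (deriv M.p) (Ioi 0) := by
  have h := hM.p_C1.continuousOn_derivWithin (uniqueDiffOn_Ici 0) le_rfl
  exact (h.mono Ioi_subset_Ici_self).congr fun Z hZ => (hM.derivWithin_p hZ).symm

theorem Admissible.exists_deriv_p_bounds (hM : M.Admissible) (R : ℝ) (hR : 0 < R) :
    ∃ c C : ℝ, 0 < c ∧ 0 < C ∧ ∀ Z, 0 < Z → Z ≤ R → c ≤ deriv M.p Z ∧ deriv M.p Z ≤ C := by
  have h := (hM.p_C1.continuousOn_derivWithin (uniqueDiffOn_Ici 0) le_rfl).mono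
    (Icc_subset_Ici_self : Icc 0 R ⊆ Ici 0)
  have hne : (Icc (0 : ℝ) R).Nonempty := nonempty_Icc.2 hR.le
  obtain ⟨a, ha, ha'⟩ := isCompact_Icc.exists_isMinOn hne h
  obtain ⟨b, hb, hb'⟩ := isCompact_Icc.exists_isMaxOn hne h
  refine ⟨_, _, hM.p_deriv_pos a ha.1, hM.p_deriv_pos b hb.1, fun Z h0 h1 => ?_⟩
  rw [← hM.derivWithin_p h0]
  exact ⟨ha' ⟨h0.le, h1⟩, hb' ⟨h0.le, h1⟩⟩

theorem Admissible.p_mono (hM : M.Admissible) : StrictMonoOn M.p (Ici 0) := by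
  refine strictMonoOn_of_deriv_pos (convex_Ici 0) hM.p_C1.continuousOn fun Z hZ => ?_
  rw [interior_Ici] at hZ
  exact hM.deriv_p_pos hZ

theorem Admissible.p_nonneg (hM : M.Admissible) {Z : ℝ} (hZ : 0 ≤ Z) : 0 ≤ M.p Z := by
  have := hM.p_mono.monotoneOn (mem_Ici.2 le_rfl) hZ hZ
  rwa [hM.p_zero] at this

theorem Admissible.p_pos (hM : M.Admissible) {Z : ℝ} (hZ : 0 < Z) : 0 < M.p Z := by
  have := hM.p_mono (mem_Ici.2 le_rfl) hZ.le hZ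
  rwa [hM.p_zero] at this

/-- On a bounded interval p(0) = 0 and a bound for p' give linear growth; beyond it the limit of
p(Z)/Z^{5/3} gives the power 5/3. -/
theorem Admissible.exists_p_upper (hM : M.Admissible) :
    ∃ C : ℝ, 0 < C ∧ ∀ Z, 0 ≤ Z → M.p Z ≤ C * (Z + Z ^ (5 / 3 : ℝ)) := by
  obtain ⟨pinf, hp, hlim⟩ := hM.p_limit
  obtain ⟨R, hR⟩ := eventually_atTop.1 (hlim.eventually (gt_mem_nhds (show pinf < pinf + 1 by simp)))
  obtain ⟨c, C, -, hC, hb⟩ := hM.exists_deriv_p_bounds (max R 1) (by positivity)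
  refine ⟨C + (pinf + 1), by positivity, fun Z hZ => ?_⟩
  have h53 : 0 ≤ Z ^ (5 / 3 : ℝ) := Real.rpow_nonneg hZ _
  rcases hZ.eq_or_lt with h0 | h0
  · rw [← h0, hM.p_zero]
    have : 0 ≤ (0 : ℝ) ^ (5 / 3 : ℝ) := Real.rpow_nonneg le_rfl _
    positivity
  by_cases hZR : Z ≤ max R 1
  · obtain ⟨ξ, hξ, hξ'⟩ := exists_hasDerivAt_eq_slope M.p (deriv M.p) h0
      (hM.p_C1.continuousOn.mono Icc_subset_Ici_self) fun x hx => hM.hasDerivAt_p hx.1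
    rw [hM.p_zero, sub_zero, sub_zero, eq_div_iff h0.ne'] at hξ'
    have := (hb ξ hξ.1 (hξ.2.le.trans hZR)).2
    rw [← hξ']
    have h1 := mul_le_mul_of_nonneg_right this hZ
    have h2 : 0 ≤ (C + (pinf + 1)) * Z ^ (5 / 3 : ℝ) := by positivity
    have h3 : 0 ≤ (pinf + 1) * Z := by positivity
    linarith
  · rw [not_le] at hZR
    have h1 := hR Z ((le_max_left _ _).trans hZR.le)
    rw [div_lt_iff₀ (Real.rpow_pos_of_pos h0 _)] at h1
    have h2 : 0 ≤ C * Z ^ (5 / 3 : ℝ) := by positivity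
    have h3 : 0 ≤ (C + (pinf + 1)) * Z := by positivity
    linarith

theorem Admissible.exists_p_lower (hM : M.Admissible) :
    ∃ c C : ℝ, 0 < c ∧ 0 < C ∧ ∀ Z, 0 ≤ Z → c * Z ^ (5 / 3 : ℝ) - C ≤ M.p Z := by
  obtain ⟨pinf, hp, hlim⟩ := hM.p_limit
  obtain ⟨R, hR⟩ := eventually_atTop.1 (hlim.eventually (lt_mem_nhds (half_lt_self hp)))
  refine ⟨pinf / 2, pinf / 2 * (max R 1) ^ (5 / 3 : ℝ), by positivity, by positivity, fun Z hZ => ?_⟩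
  by_cases hZR : Z ≤ max R 1
  · have h1 : Z ^ (5 / 3 : ℝ) ≤ (max R 1) ^ (5 / 3 : ℝ) := by gcongr
    have h2 := mul_le_mul_of_nonneg_left h1 (half_pos hp).le
    have h3 := hM.p_nonneg hZ
    linarith
  · rw [not_le] at hZR
    have h0 : 0 < Z := lt_trans (by positivity) hZR
    have h1 := hR Z ((le_max_left _ _).trans hZR.le)
    rw [lt_div_iff₀ (Real.rpow_pos_of_pos h0 _)] at h1
    have : 0 ≤ pinf / 2 * (max R 1) ^ (5 / 3 : ℝ) := by positivity
    linarith

theorem Admissible.S_anti (hM : M.Admissible) : StrictAntiOn M.S (Ioi 0) := by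
  refine strictAntiOn_of_deriv_neg (convex_Ioi 0)
    (fun Z hZ => (hM.S_deriv Z hZ).continuousAt.continuousWithinAt) fun Z hZ => ?_
  rw [interior_Ioi] at hZ
  exact hM.S_deriv_neg Z hZ

theorem Admissible.S_nonneg (hM : M.Admissible) {Z : ℝ} (hZ : 0 < Z) : 0 ≤ M.S Z := by
  refine le_of_tendsto hM.S_limit ?_
  filter_upwards [eventually_ge_atTop Z] with Y hY
  exact hM.S_anti.antitoneOn hZ (hZ.trans_le hY) hY

/-- Since S' ≥ −(3/2)c/Z, the entropy has at most a logarithmic singularity at 0. On (0,1] it is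
compared with 3c/√Z, whose derivative −(3/2)c Z^{−3/2} is still smaller. The cruder power is
convenient, as Z · Z^{−1/2} is a square root; for Z ≥ 1 monotonicity suffices. -/
theorem Admissible.exists_S_upper (hM : M.Admissible) :
    ∃ C : ℝ, 0 < C ∧ ∀ Z, 0 < Z → M.S Z ≤ C * (1 + 1 / √Z) := by
  obtain ⟨c, hc⟩ := hM.p_bound
  have hc0 : 0 < c := (hc 1 one_pos).1.trans (hc 1 one_pos).2
  have hS1 := hM.S_nonneg one_pos
  refine ⟨M.S 1 + 3 * c, by positivity, fun Z hZ => ?_⟩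
  have hsq : 0 < √Z := Real.sqrt_pos.2 hZ
  have h1Z : 0 < 1 / √Z := by positivity
  rcases le_or_gt 1 Z with h | h
  · have := hM.S_anti.antitoneOn (mem_Ioi.2 one_pos) (mem_Ioi.2 hZ) h
    have h2 : 0 ≤ (M.S 1 + 3 * c) * (1 / √Z) := by positivity
    linarith
  · have hd : ∀ x ∈ Ioi (0 : ℝ), HasDerivAt (fun x => M.S x - 3 * c * (√x)⁻¹)
        (-(3 / 2) * ((5 / 3 * M.p x - deriv M.p x * x) / x ^ 2)
          - 3 * c * (-(1 / (2 * √x)) / √x ^ 2)) x := by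
      intro x hx
      have hx0 : (0 : ℝ) < x := hx
      exact (hM.S_deriv x hx).sub
        (((Real.hasDerivAt_sqrt hx0.ne').inv (Real.sqrt_pos.2 hx0).ne').const_mul _)
    have hmono : MonotoneOn (fun x => M.S x - 3 * c * (√x)⁻¹) (Ioc 0 1) := by
      refine monotoneOn_of_deriv_nonneg (convex_Ioc 0 1)
        (fun x hx => (hd x hx.1).continuousAt.continuousWithinAt)
        (fun x hx => ?_) fun x hx => ?_
      · rw [interior_Ioc] at hx
        exact (hd x hx.1).differentiableAt.differentiableWithinAt
      · rw [interior_Ioc] at hx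
        rw [(hd x hx.1).deriv]
        have hx0 : 0 < x := hx.1
        set s := √x with hs
        have hs0 : 0 < s := Real.sqrt_pos.2 hx0
        have hss : x = s ^ 2 := (Real.sq_sqrt hx0.le).symm
        have hs1 : s ≤ 1 := by
          rw [hs, ← Real.sqrt_one]
          exact Real.sqrt_le_sqrt hx.2.le
        have hq := (hc x hx0).2
        have e1 : (5 / 3 * M.p x - deriv M.p x * x) / x ^ 2
            = (5 / 3 * M.p x - deriv M.p x * x) / x * (1 / x) := by field_simp
        have e2 : 3 * c * (-(1 / (2 * s)) / s ^ 2) = -(3 / 2) * (c * (1 / s ^ 3)) := by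
          field_simp
        rw [e1, e2]
        have h4 : (1 : ℝ) / x ≤ 1 / s ^ 3 := by
          rw [hss]
          apply one_div_le_one_div_of_le (by positivity)
          nlinarith [sq_nonneg s]
        have h5 := mul_le_mul hq.le h4 (by positivity) hc0.le
        linarith
    have := hmono ⟨hZ, h.le⟩ ⟨one_pos, le_rfl⟩ h.le
    simp only [Real.sqrt_one, inv_one, mul_one] at this
    rw [one_div]
    have h6 : 0 < (√Z)⁻¹ := by positivity
    nlinarith

/-- `∂_ρ P`. -/
noncomputable def pressureRho (M : Model) (ρ θ : ℝ) : ℝ := θ * deriv M.p (ρ / θ ^ (3 / 2 : ℝ))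

/-- `5/3 p(Z) - p'(Z) Z`, the function that governs the heat capacity. -/
noncomputable def heatFun (M : Model) (Z : ℝ) : ℝ := 5 / 3 * M.p Z - deriv M.p Z * Z

/-- `∂_θ P`. -/
noncomputable def pressureTheta (M : Model) (ρ θ : ℝ) : ℝ :=
  3 / 2 * (θ ^ (3 / 2 : ℝ) * M.heatFun (ρ / θ ^ (3 / 2 : ℝ))) + 4 * M.a / 3 * θ ^ 3

/-- `∂_ρ (ρ s)`. -/
noncomputable def entropyRho (M : Model) (ρ θ : ℝ) : ℝ :=
  M.S (ρ / θ ^ (3 / 2 : ℝ))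
    - 3 / 2 * (M.heatFun (ρ / θ ^ (3 / 2 : ℝ)) / (ρ / θ ^ (3 / 2 : ℝ)))

/-- `∂_θ (ρ s)`. -/
noncomputable def entropyTheta (M : Model) (ρ θ : ℝ) : ℝ :=
  9 / 4 * (√θ * M.heatFun (ρ / θ ^ (3 / 2 : ℝ))) + 4 * M.a * θ ^ 2

/-- The chemical potential `e + P / ρ - θ s`. -/
noncomputable def chemPot (M : Model) (ρ θ : ℝ) : ℝ :=
  5 / 2 * M.pressureF ρ θ / ρ - θ * M.S (ρ / θ ^ (3 / 2 : ℝ))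

/-- Substituting θ = s² makes all fractional powers of θ integer powers of s, so that the
thermodynamic identities become rational ones. -/
theorem rpow_three_halves {θ : ℝ} (h : 0 < θ) : θ ^ (3 / 2 : ℝ) = √θ ^ 3 := by
  rw [Real.sqrt_eq_rpow, ← Real.rpow_natCast, ← Real.rpow_mul h.le]
  norm_num

theorem rpow_five_halves {θ : ℝ} (h : 0 < θ) : θ ^ (5 / 2 : ℝ) = √θ ^ 5 := by
  rw [Real.sqrt_eq_rpow, ← Real.rpow_natCast, ← Real.rpow_mul h.le]
  norm_num

/-- The Maxwell relation ρ² ∂_ρ s = −∂_θ P. It makes the linear terms in the expansions of pressure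
and entropy cancel against each other. -/
theorem maxwell {ρ θ : ℝ} (hρ : 0 < ρ) (hθ : 0 < θ) :
    ρ * M.entropyRho ρ θ - M.entropyDensity ρ θ = -M.pressureTheta ρ θ := by
  have := Real.rpow_pos_of_pos hθ (3 / 2 : ℝ)
  unfold entropyRho entropyDensity pressureTheta
  field_simp
  ring

theorem hasFDerivAt_sqrt_snd {ρ θ : ℝ} (hθ : 0 < θ) :
    HasFDerivAt (fun y : ℝ × ℝ => √y.2) ((1 / (2 * √θ)) • ContinuousLinearMap.snd ℝ ℝ ℝ) (ρ, θ) :=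
  (Real.hasDerivAt_sqrt hθ.ne').comp_hasFDerivAt (ρ, θ) hasFDerivAt_snd

theorem hasFDerivAt_ratio {ρ θ : ℝ} (hθ : 0 < θ) :
    HasFDerivAt (fun y : ℝ × ℝ => y.1 / y.2 ^ (3 / 2 : ℝ))
      ((1 / √θ ^ 3) • ContinuousLinearMap.fst ℝ ℝ ℝ
        - (3 / 2 * ρ / √θ ^ 5) • ContinuousLinearMap.snd ℝ ℝ ℝ) (ρ, θ) := by
  have hs : 0 < √θ := Real.sqrt_pos.2 hθ
  have h0 : HasDerivAt (fun s : ℝ => (s ^ 3)⁻¹) (-(3 * √θ ^ 2) / (√θ ^ 3) ^ 2) (√θ) := by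
    simpa using (hasDerivAt_pow 3 (√θ)).fun_inv (pow_pos hs 3).ne'
  have h1 := (hasFDerivAt_fst (𝕜 := ℝ) (p := (ρ, θ))).fun_mul
    (h0.comp_hasFDerivAt (ρ, θ) (hasFDerivAt_sqrt_snd hθ))
  have hev : (fun y : ℝ × ℝ => y.1 / y.2 ^ (3 / 2 : ℝ)) =ᶠ[𝓝 (ρ, θ)]
      fun y : ℝ × ℝ => y.1 * (√y.2 ^ 3)⁻¹ := by
    filter_upwards [continuous_snd.continuousAt.eventually (lt_mem_nhds hθ)] with y hy
    rw [rpow_three_halves hy, div_eq_mul_inv]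
  refine (h1.congr_of_eventuallyEq hev).congr_fderiv ?_
  ext
  · simp
  · simp
    field_simp

theorem hasFDerivAt_p_ratio (hM : M.Admissible) {ρ θ : ℝ} (hρ : 0 < ρ) (hθ : 0 < θ) :
    HasFDerivAt (fun y : ℝ × ℝ => M.p (y.1 / y.2 ^ (3 / 2 : ℝ)))
      (deriv M.p (ρ / θ ^ (3 / 2 : ℝ)) • ((1 / √θ ^ 3) • ContinuousLinearMap.fst ℝ ℝ ℝ
        - (3 / 2 * ρ / √θ ^ 5) • ContinuousLinearMap.snd ℝ ℝ ℝ)) (ρ, θ) :=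
  (hM.hasDerivAt_p (div_pos hρ (Real.rpow_pos_of_pos hθ _))).comp_hasFDerivAt (ρ, θ)
    (hasFDerivAt_ratio hθ)

theorem hasFDerivAt_S_ratio (hM : M.Admissible) {ρ θ : ℝ} (hρ : 0 < ρ) (hθ : 0 < θ) :
    HasFDerivAt (fun y : ℝ × ℝ => M.S (y.1 / y.2 ^ (3 / 2 : ℝ)))
      ((-(3 / 2) * (M.heatFun (ρ / θ ^ (3 / 2 : ℝ)) / (ρ / θ ^ (3 / 2 : ℝ)) ^ 2)) •
        ((1 / √θ ^ 3) • ContinuousLinearMap.fst ℝ ℝ ℝ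
        - (3 / 2 * ρ / √θ ^ 5) • ContinuousLinearMap.snd ℝ ℝ ℝ)) (ρ, θ) :=
  (hM.S_deriv _ (div_pos hρ (Real.rpow_pos_of_pos hθ _))).comp_hasFDerivAt (ρ, θ)
    (hasFDerivAt_ratio hθ)

theorem hasFDerivAt_pressureF (hM : M.Admissible) {ρ θ : ℝ} (hρ : 0 < ρ) (hθ : 0 < θ) :
    HasFDerivAt (fun y : ℝ × ℝ => M.pressureF y.1 y.2)
      (M.pressureRho ρ θ • ContinuousLinearMap.fst ℝ ℝ ℝ
        + (3 / 2 * (θ ^ (3 / 2 : ℝ) * M.heatFun (ρ / θ ^ (3 / 2 : ℝ)))) •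
          ContinuousLinearMap.snd ℝ ℝ ℝ) (ρ, θ) := by
  have hs : 0 < √θ := Real.sqrt_pos.2 hθ
  have h1 := ((hasDerivAt_pow 5 (√θ)).comp_hasFDerivAt (ρ, θ)
      (hasFDerivAt_sqrt_snd hθ)).mul (hasFDerivAt_p_ratio hM hρ hθ)
  have hev : (fun y : ℝ × ℝ => M.pressureF y.1 y.2) =ᶠ[𝓝 (ρ, θ)]
      fun y : ℝ × ℝ => √y.2 ^ 5 * M.p (y.1 / y.2 ^ (3 / 2 : ℝ)) := by
    filter_upwards [continuous_snd.continuousAt.eventually (lt_mem_nhds hθ)] with y hy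
    rw [pressureF, rpow_five_halves hy]
  refine (h1.congr_of_eventuallyEq hev).congr_fderiv ?_
  obtain ⟨s, hs', rfl⟩ : ∃ s : ℝ, 0 < s ∧ θ = s ^ 2 := ⟨√θ, hs, (Real.sq_sqrt hθ.le).symm⟩
  ext
  · simp [pressureRho, rpow_three_halves hθ, Real.sqrt_sq hs'.le]
    field_simp
  · simp [heatFun, rpow_three_halves hθ, Real.sqrt_sq hs'.le]
    field_simp
    ring

theorem hasFDerivAt_pressure (hM : M.Admissible) {ρ θ : ℝ} (hρ : 0 < ρ) (hθ : 0 < θ) :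
    HasFDerivAt (fun y : ℝ × ℝ => M.pressure y.1 y.2)
      (M.pressureRho ρ θ • ContinuousLinearMap.fst ℝ ℝ ℝ
        + M.pressureTheta ρ θ • ContinuousLinearMap.snd ℝ ℝ ℝ) (ρ, θ) := by
  have h1 := (hasFDerivAt_pressureF hM hρ hθ).add
    (((hasDerivAt_pow 4 θ).const_mul (M.a / 3)).comp_hasFDerivAt (ρ, θ) hasFDerivAt_snd)
  refine HasFDerivAt.congr_fderiv (f := fun y : ℝ × ℝ => M.pressure y.1 y.2) h1 ?_
  ext
  · simp
  · simp [pressureTheta]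
    ring

theorem hasFDerivAt_entropyDensity (hM : M.Admissible) {ρ θ : ℝ} (hρ : 0 < ρ) (hθ : 0 < θ) :
    HasFDerivAt (fun y : ℝ × ℝ => M.entropyDensity y.1 y.2)
      (M.entropyRho ρ θ • ContinuousLinearMap.fst ℝ ℝ ℝ
        + M.entropyTheta ρ θ • ContinuousLinearMap.snd ℝ ℝ ℝ) (ρ, θ) := by
  have hs : 0 < √θ := Real.sqrt_pos.2 hθ
  have h1 := (hasFDerivAt_fst.mul (hasFDerivAt_S_ratio hM hρ hθ)).add
    (((hasDerivAt_pow 3 θ).const_mul (4 * M.a / 3)).comp_hasFDerivAt (ρ, θ) hasFDerivAt_snd)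
  refine HasFDerivAt.congr_fderiv (f := fun y : ℝ × ℝ => M.entropyDensity y.1 y.2) h1 ?_
  have hZ : ρ / θ ^ (3 / 2 : ℝ) = ρ / √θ ^ 3 := by rw [rpow_three_halves hθ]
  ext
  · simp [entropyRho, hZ]
    field_simp
    ring
  · simp [entropyTheta, hZ]
    field_simp
    ring

/-- The Gibbs–Duhem relation dg = dP/ρ − s dθ. Through it the mass balance, tested with the chemical
potential, produces the pressure gradient of the classical solution. -/
theorem hasFDerivAt_chemPot (hM : M.Admissible) {ρ θ : ℝ} (hρ : 0 < ρ) (hθ : 0 < θ) :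
    HasFDerivAt (fun y : ℝ × ℝ => M.chemPot y.1 y.2)
      ((M.pressureRho ρ θ / ρ) • ContinuousLinearMap.fst ℝ ℝ ℝ
        + ((M.pressureTheta ρ θ - M.entropyDensity ρ θ) / ρ) • ContinuousLinearMap.snd ℝ ℝ ℝ)
      (ρ, θ) := by
  have hs : 0 < √θ := Real.sqrt_pos.2 hθ
  have h1 := (((hasFDerivAt_pressureF hM hρ hθ).const_mul (5 / 2)).fun_mul
    ((hasDerivAt_inv hρ.ne').comp_hasFDerivAt (ρ, θ) (hasFDerivAt_fst (𝕜 := ℝ)))).fun_sub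
    (hasFDerivAt_snd.fun_mul (hasFDerivAt_S_ratio hM hρ hθ))
  refine HasFDerivAt.congr_fderiv (f := fun y : ℝ × ℝ => M.chemPot y.1 y.2) h1 ?_
  obtain ⟨s, hs', rfl⟩ : ∃ s : ℝ, 0 < s ∧ θ = s ^ 2 := ⟨√θ, hs, (Real.sq_sqrt hθ.le).symm⟩
  ext
  · simp [pressureRho, pressureF, heatFun, rpow_five_halves hθ, rpow_three_halves hθ,
      Real.sqrt_sq hs'.le]
    field_simp
    ring
  · simp [pressureTheta, entropyDensity, heatFun, rpow_three_halves hθ, Real.sqrt_sq hs'.le]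
    field_simp
    ring

end Model

/-! ### C^{1,1} regularity of the state functions -/

namespace Model

variable {M : Model}

/-- The positive quadrant of states `(ρ, θ)`. -/
def quadrant : Set (ℝ × ℝ) := Ioi 0 ×ˢ Ioi 0

theorem contDiffOn_fst_quadrant : ContDiffOn ℝ 1 (fun y : ℝ × ℝ => y.1) quadrant :=
  contDiff_fst.contDiffOn

theorem contDiffOn_snd_quadrant : ContDiffOn ℝ 1 (fun y : ℝ × ℝ => y.2) quadrant :=
  contDiff_snd.contDiffOn

theorem contDiffOn_snd_rpow (q : ℝ) : ContDiffOn ℝ 1 (fun y : ℝ × ℝ => y.2 ^ q) quadrant :=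
  contDiffOn_snd_quadrant.rpow_const_of_ne fun _ hy => ne_of_gt hy.2

theorem contDiffOn_ratio :
    ContDiffOn ℝ 1 (fun y : ℝ × ℝ => y.1 / y.2 ^ (3 / 2 : ℝ)) quadrant :=
  contDiffOn_fst_quadrant.div (contDiffOn_snd_rpow _) fun _ hy =>
    (Real.rpow_pos_of_pos hy.2 _).ne'

theorem mapsTo_ratio : MapsTo (fun y : ℝ × ℝ => y.1 / y.2 ^ (3 / 2 : ℝ)) quadrant (Ioi 0) :=
  fun _ hy => div_pos hy.1 (Real.rpow_pos_of_pos hy.2 _)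

theorem Admissible.contDiffOn_S (hM : M.Admissible) : ContDiffOn ℝ 1 M.S (Ioi 0) := by
  have h := contDiffOn_succ_iff_deriv_of_isOpen (𝕜 := ℝ) (f := M.S) (n := 0) (isOpen_Ioi (a := 0))
  rw [zero_add] at h
  refine h.2 ⟨fun Z hZ => (hM.S_deriv Z hZ).differentiableAt.differentiableWithinAt,
    by simp, contDiffOn_zero.2 ?_⟩
  have hc : ContinuousOn
      (fun Z => -(3 / 2) * ((5 / 3 * M.p Z - deriv M.p Z * Z) / Z ^ 2)) (Ioi 0) := by
    refine continuousOn_const.mul (ContinuousOn.div ?_ (by fun_prop) fun Z hZ => ?_)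
    · exact (continuousOn_const.mul (hM.p_C1.continuousOn.mono Ioi_subset_Ici_self)).sub
        (hM.continuousOn_deriv_p.mul continuousOn_id)
    · exact pow_ne_zero _ (ne_of_gt hZ)
  exact hc.congr fun Z hZ => (hM.S_deriv Z hZ).deriv

theorem Admissible.contDiffOn_p_ratio (hM : M.Admissible) :
    ContDiffOn ℝ 1 (fun y : ℝ × ℝ => M.p (y.1 / y.2 ^ (3 / 2 : ℝ))) quadrant :=
  (hM.p_C1.mono Ioi_subset_Ici_self).comp contDiffOn_ratio mapsTo_ratio

theorem Admissible.contDiffOn_S_ratio (hM : M.Admissible) :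
    ContDiffOn ℝ 1 (fun y : ℝ × ℝ => M.S (y.1 / y.2 ^ (3 / 2 : ℝ))) quadrant :=
  hM.contDiffOn_S.comp contDiffOn_ratio mapsTo_ratio

theorem Admissible.contDiffOn_pressureF (hM : M.Admissible) :
    ContDiffOn ℝ 1 (fun y : ℝ × ℝ => M.pressureF y.1 y.2) quadrant :=
  (contDiffOn_snd_rpow _).mul hM.contDiffOn_p_ratio

theorem Admissible.contDiffOn_pressure (hM : M.Admissible) :
    ContDiffOn ℝ 1 (fun y : ℝ × ℝ => M.pressure y.1 y.2) quadrant :=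
  hM.contDiffOn_pressureF.add (contDiffOn_const.mul (contDiffOn_snd_quadrant.pow 4))

theorem Admissible.contDiffOn_entropyDensity (hM : M.Admissible) :
    ContDiffOn ℝ 1 (fun y : ℝ × ℝ => M.entropyDensity y.1 y.2) quadrant :=
  (contDiffOn_fst_quadrant.mul hM.contDiffOn_S_ratio).add
    (contDiffOn_const.mul (contDiffOn_snd_quadrant.pow 3))

theorem Admissible.contDiffOn_chemPot (hM : M.Admissible) :
    ContDiffOn ℝ 1 (fun y : ℝ × ℝ => M.chemPot y.1 y.2) quadrant :=
  ((contDiffOn_const.mul hM.contDiffOn_pressureF).div contDiffOn_fst_quadrant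
    fun _ hy => ne_of_gt hy.1).sub (contDiffOn_snd_quadrant.mul hM.contDiffOn_S_ratio)

theorem exists_lipschitzOnWith_mul_of_isCompact {α : Type*} [PseudoMetricSpace α] {K : Set α}
    (hK : IsCompact K) {f g : α → ℝ} (hf : ∃ C, LipschitzOnWith C f K)
    (hg : ∃ C, LipschitzOnWith C g K) : ∃ C, LipschitzOnWith C (fun x => f x * g x) K := by
  obtain ⟨C, hC⟩ := hf
  obtain ⟨D, hD⟩ := hg
  obtain ⟨A, hA⟩ := hK.exists_bound_of_continuousOn hC.continuousOn
  obtain ⟨B, hB⟩ := hK.exists_bound_of_continuousOn hD.continuousOn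
  refine ⟨Real.toNNReal (|A| * D + |B| * C), LipschitzOnWith.of_dist_le_mul fun x hx y hy => ?_⟩
  rw [Real.coe_toNNReal _ (by positivity)]
  have h1 := hC.dist_le_mul x hx y hy
  have h2 := hD.dist_le_mul x hx y hy
  rw [Real.dist_eq] at h1 h2 ⊢
  have e : f x * g x - f y * g y = f x * (g x - g y) + (f x - f y) * g y := by ring
  have hA' : |f x| ≤ |A| := (hA x hx).trans (le_abs_self A)
  have hB' : |g y| ≤ |B| := (hB y hy).trans (le_abs_self B)
  calc |f x * g x - f y * g y| ≤ |f x| * |g x - g y| + |f x - f y| * |g y| := by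
        rw [e, ← abs_mul, ← abs_mul]; exact abs_add_le _ _
    _ ≤ |A| * (D * dist x y) + (C * dist x y) * |B| := by gcongr
    _ = _ := by ring

/-- A compact convex set of positive states. -/
structure IsStateBox (K : Set (ℝ × ℝ)) : Prop where
  compact : IsCompact K
  convex : Convex ℝ K
  subset : K ⊆ quadrant

theorem IsStateBox.exists_lipschitz {K : Set (ℝ × ℝ)} (hK : IsStateBox K) {f : ℝ × ℝ → ℝ}
    (hf : ContDiffOn ℝ 1 f quadrant) : ∃ C, LipschitzOnWith C f K :=
  (hf.mono hK.subset).exists_lipschitzOnWith one_ne_zero hK.convex hK.compact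

/-- The local Lipschitz continuity of p' enters here. Compactness upgrades it to a Lipschitz bound
on the image of the box under Z = ρ/θ^{3/2}. -/
theorem IsStateBox.exists_lipschitz_deriv_p (hM : M.Admissible) {K : Set (ℝ × ℝ)}
    (hK : IsStateBox K) :
    ∃ C, LipschitzOnWith C (fun y : ℝ × ℝ => deriv M.p (y.1 / y.2 ^ (3 / 2 : ℝ))) K := by
  obtain ⟨C, hC⟩ := hK.exists_lipschitz contDiffOn_ratio
  have hi : IsCompact ((fun y : ℝ × ℝ => y.1 / y.2 ^ (3 / 2 : ℝ)) '' K) :=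
    hK.compact.image_of_continuousOn hC.continuousOn
  obtain ⟨D, hD⟩ := (hM.p_deriv_lip.mono
    ((mapsTo_ratio.mono_left hK.subset).image_subset)).exists_lipschitzOnWith_of_compact hi
  exact ⟨_, hD.comp hC (mapsTo_image _ _)⟩

/-- All first derivatives of P and ρs are affine in p'(Z) with C¹ coefficients, because S' is itself
expressed by p and p'. One Lipschitz statement therefore covers them. -/
theorem IsStateBox.exists_lipschitz_affine (hM : M.Admissible) {K : Set (ℝ × ℝ)}
    (hK : IsStateBox K) {A B f : ℝ × ℝ → ℝ} (hA : ContDiffOn ℝ 1 A quadrant)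
    (hB : ContDiffOn ℝ 1 B quadrant)
    (hf : ∀ y ∈ quadrant, f y = A y + B y * deriv M.p (y.1 / y.2 ^ (3 / 2 : ℝ))) :
    ∃ C, LipschitzOnWith C f K := by
  obtain ⟨C, hC⟩ := hK.exists_lipschitz hA
  obtain ⟨D, hD⟩ := exists_lipschitzOnWith_mul_of_isCompact hK.compact (hK.exists_lipschitz hB)
    (hK.exists_lipschitz_deriv_p hM)
  refine ⟨C + D, fun x hx y hy => ?_⟩
  rw [hf x (hK.subset hx), hf y (hK.subset hy)]
  exact (hC.add hD) hx hy

/-- The mean value inequality on the segment for F minus its linear part at x: the derivative of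
this difference is at most (C + D) times the distance to x. -/
theorem abs_sub_sub_le_of_lipschitz {K : Set (ℝ × ℝ)} (hK : Convex ℝ K) {F f₁ f₂ : ℝ × ℝ → ℝ}
    (hF : ∀ y ∈ K, HasFDerivAt F (f₁ y • ContinuousLinearMap.fst ℝ ℝ ℝ
      + f₂ y • ContinuousLinearMap.snd ℝ ℝ ℝ) y) {C D : NNReal}
    (h₁ : LipschitzOnWith C f₁ K) (h₂ : LipschitzOnWith D f₂ K) {x y : ℝ × ℝ} (hx : x ∈ K)
    (hy : y ∈ K) :
    |F y - F x - f₁ x * (y.1 - x.1) - f₂ x * (y.2 - x.2)| ≤ (C + D) * ‖y - x‖ ^ 2 := by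
  have hseg : segment ℝ x y ⊆ K := hK.segment_subset hx hy
  have hd : ∀ z ∈ segment ℝ x y, dist z x ≤ ‖y - x‖ := by
    intro z hz
    have := segment_subset_closedBall_left x y hz
    rwa [Metric.mem_closedBall, dist_comm x y, dist_eq_norm y x] at this
  have hb : ∀ z ∈ segment ℝ x y, ‖(f₁ z • ContinuousLinearMap.fst ℝ ℝ ℝ
      + f₂ z • ContinuousLinearMap.snd ℝ ℝ ℝ) - (f₁ x • ContinuousLinearMap.fst ℝ ℝ ℝ
      + f₂ x • ContinuousLinearMap.snd ℝ ℝ ℝ)‖ ≤ (C + D) * ‖y - x‖ := by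
    intro z hz
    have e : (f₁ z • ContinuousLinearMap.fst ℝ ℝ ℝ
      + f₂ z • ContinuousLinearMap.snd ℝ ℝ ℝ) - (f₁ x • ContinuousLinearMap.fst ℝ ℝ ℝ
      + f₂ x • ContinuousLinearMap.snd ℝ ℝ ℝ) = (f₁ z - f₁ x) • ContinuousLinearMap.fst ℝ ℝ ℝ
      + (f₂ z - f₂ x) • ContinuousLinearMap.snd ℝ ℝ ℝ := by module
    have i1 := h₁.dist_le_mul z (hseg hz) x hx
    have i2 := h₂.dist_le_mul z (hseg hz) x hx
    rw [Real.dist_eq] at i1 i2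
    rw [e]
    refine (norm_add_le _ _).trans ?_
    rw [norm_smul, norm_smul, Real.norm_eq_abs, Real.norm_eq_abs]
    have n1 := ContinuousLinearMap.norm_fst_le ℝ ℝ ℝ
    have n2 := ContinuousLinearMap.norm_snd_le ℝ ℝ ℝ
    calc _ ≤ (C * dist z x) * 1 + (D * dist z x) * 1 := by gcongr
      _ = (C + D) * dist z x := by ring
      _ ≤ _ := by gcongr; exact hd z hz
  have := (convex_segment x y).norm_image_sub_le_of_norm_hasFDerivWithin_le'
    (fun z hz => (hF z (hseg hz)).hasFDerivWithinAt) hb (left_mem_segment ℝ x y)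
    (right_mem_segment ℝ x y)
  rw [Real.norm_eq_abs] at this
  calc _ = |F y - F x - (f₁ x • ContinuousLinearMap.fst ℝ ℝ ℝ
      + f₂ x • ContinuousLinearMap.snd ℝ ℝ ℝ) (y - x)| := by
        simp [sub_sub, add_assoc]
    _ ≤ _ := this
    _ = _ := by ring

theorem Admissible.exists_lipschitz_pressure_derivs (hM : M.Admissible) {K : Set (ℝ × ℝ)}
    (hK : IsStateBox K) :
    (∃ C, LipschitzOnWith C (fun y : ℝ × ℝ => M.pressureRho y.1 y.2) K) ∧
      ∃ C, LipschitzOnWith C (fun y : ℝ × ℝ => M.pressureTheta y.1 y.2) K := by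
  constructor
  · refine hK.exists_lipschitz_affine hM (A := fun _ => 0) contDiffOn_const
      contDiffOn_snd_quadrant fun y _ => ?_
    simp [pressureRho]
  · refine hK.exists_lipschitz_affine hM
      (A := fun y => 3 / 2 * (y.2 ^ (3 / 2 : ℝ) * (5 / 3 * M.p (y.1 / y.2 ^ (3 / 2 : ℝ))))
        + 4 * M.a / 3 * y.2 ^ 3)
      (B := fun y => -(3 / 2) * (y.2 ^ (3 / 2 : ℝ) * (y.1 / y.2 ^ (3 / 2 : ℝ)))) ?_ ?_ fun y _ => ?_
    · exact (contDiffOn_const.mul ((contDiffOn_snd_rpow _).mul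
        (contDiffOn_const.mul hM.contDiffOn_p_ratio))).add
        (contDiffOn_const.mul (contDiffOn_snd_quadrant.pow 3))
    · exact contDiffOn_const.mul ((contDiffOn_snd_rpow _).mul contDiffOn_ratio)
    · simp only [pressureTheta, heatFun]
      ring

theorem Admissible.exists_lipschitz_entropy_derivs (hM : M.Admissible) {K : Set (ℝ × ℝ)}
    (hK : IsStateBox K) :
    (∃ C, LipschitzOnWith C (fun y : ℝ × ℝ => M.entropyRho y.1 y.2) K) ∧
      ∃ C, LipschitzOnWith C (fun y : ℝ × ℝ => M.entropyTheta y.1 y.2) K := by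
  constructor
  · refine hK.exists_lipschitz_affine hM
      (A := fun y => M.S (y.1 / y.2 ^ (3 / 2 : ℝ)) -
        5 / 2 * (M.p (y.1 / y.2 ^ (3 / 2 : ℝ)) / (y.1 / y.2 ^ (3 / 2 : ℝ))))
      (B := fun y => 3 / 2) ?_ contDiffOn_const fun y hy => ?_
    · exact hM.contDiffOn_S_ratio.sub (contDiffOn_const.mul
        (hM.contDiffOn_p_ratio.div contDiffOn_ratio fun y hy => ne_of_gt (mapsTo_ratio hy)))
    · have h := mapsTo_ratio hy
      simp only [mem_Ioi] at h
      simp only [entropyRho, heatFun]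
      rw [sub_div, mul_div_assoc (deriv M.p _), div_self h.ne']
      ring
  · refine hK.exists_lipschitz_affine hM
      (A := fun y => 9 / 4 * (y.2 ^ (1 / 2 : ℝ) * (5 / 3 * M.p (y.1 / y.2 ^ (3 / 2 : ℝ))))
        + 4 * M.a * y.2 ^ 2)
      (B := fun y => -(9 / 4) * (y.2 ^ (1 / 2 : ℝ) * (y.1 / y.2 ^ (3 / 2 : ℝ)))) ?_ ?_ fun y _ => ?_
    · exact (contDiffOn_const.mul ((contDiffOn_snd_rpow _).mul
        (contDiffOn_const.mul hM.contDiffOn_p_ratio))).add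
        (contDiffOn_const.mul (contDiffOn_snd_quadrant.pow 2))
    · exact contDiffOn_const.mul ((contDiffOn_snd_rpow _).mul contDiffOn_ratio)
    · simp only [entropyTheta, heatFun, Real.sqrt_eq_rpow]
      ring

end Model

/-! ### Coercivity of the relative energy -/

namespace Model

variable {M : Model}

theorem Admissible.heatFun_pos (hM : M.Admissible) {Z : ℝ} (hZ : 0 < Z) : 0 < M.heatFun Z := by
  obtain ⟨c, hc⟩ := hM.p_bound
  have := (hc Z hZ).1
  exact (div_pos_iff_of_pos_right hZ).1 this

/-- The free energy at unit temperature. -/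
noncomputable def freeEnergy (M : Model) (Z : ℝ) : ℝ := 3 / 2 * M.p Z - Z * M.S Z

/-- The derivative of the free energy at unit temperature. -/
noncomputable def freeEnergyDeriv (M : Model) (Z : ℝ) : ℝ := 5 / 2 * (M.p Z / Z) - M.S Z

theorem Admissible.hasDerivAt_freeEnergy (hM : M.Admissible) {Z : ℝ} (hZ : 0 < Z) :
    HasDerivAt M.freeEnergy (M.freeEnergyDeriv Z) Z := by
  have h := ((hM.hasDerivAt_p hZ).const_mul (3 / 2)).fun_sub
    ((hasDerivAt_id Z).fun_mul (hM.S_deriv Z hZ))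
  refine h.congr_deriv ?_
  simp only [freeEnergyDeriv, id]
  field_simp
  ring

/-- The second derivative of the free energy is p'(Z)/Z, so p' > 0 means strict convexity. -/
theorem Admissible.hasDerivAt_freeEnergyDeriv (hM : M.Admissible) {Z : ℝ} (hZ : 0 < Z) :
    HasDerivAt M.freeEnergyDeriv (deriv M.p Z / Z) Z := by
  have h := (((hM.hasDerivAt_p hZ).fun_div (hasDerivAt_id Z) hZ.ne').const_mul (5 / 2)).fun_sub
    (hM.S_deriv Z hZ)
  refine h.congr_deriv ?_
  simp only [id]
  field_simp
  ring

theorem le_of_deriv_sign {φ φ' : ℝ → ℝ} {z x : ℝ} (hz : 0 < z) (hx : 0 < x)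
    (hd : ∀ y, 0 < y → HasDerivAt φ (φ' y) y) (h₁ : ∀ y, 0 < y → y < z → φ' y ≤ 0)
    (h₂ : ∀ y, z < y → y < x → 0 ≤ φ' y) : φ z ≤ φ x := by
  rcases le_total x z with h | h
  · refine antitoneOn_of_deriv_nonpos (convex_Icc x z)
      (fun y hy => (hd y (hx.trans_le hy.1)).continuousAt.continuousWithinAt)
      (fun y hy => ?_) (fun y hy => ?_) (left_mem_Icc.2 h) (right_mem_Icc.2 h) h
    · rw [interior_Icc] at hy
      exact (hd y (hx.trans hy.1)).differentiableAt.differentiableWithinAt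
    · rw [interior_Icc] at hy
      rw [(hd y (hx.trans hy.1)).deriv]
      exact h₁ y (hx.trans hy.1) hy.2
  · refine monotoneOn_of_deriv_nonneg (convex_Icc z x)
      (fun y hy => (hd y (hz.trans_le hy.1)).continuousAt.continuousWithinAt)
      (fun y hy => ?_) (fun y hy => ?_) (left_mem_Icc.2 h) (right_mem_Icc.2 h) h
    · rw [interior_Icc] at hy
      exact (hd y (hz.trans hy.1)).differentiableAt.differentiableWithinAt
    · rw [interior_Icc] at hy
      rw [(hd y (hz.trans hy.1)).deriv]
      exact h₂ y hy.1 hy.2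

/-- With f the free energy, f(z) − f'(z)z = −p(z), so the right-hand side is the Bregman distance
f(x) − f(z) − f'(z)(x − z). On (0, R] the second derivative p'/Z is bounded below, which gives a
quadratic bound. Past R the distance increases with x and keeps the value reached at R. -/
theorem Admissible.exists_bregman_lower (hM : M.Admissible) {z₁ z₂ : ℝ} (hz₁ : 0 < z₁) :
    ∃ c : ℝ, 0 < c ∧ ∀ z ∈ Icc z₁ z₂, ∀ x, 0 ≤ x →
      c * min 1 ((x - z) ^ 2) ≤ M.freeEnergy x - M.freeEnergyDeriv z * x + M.p z := by
  by_cases h12 : z₁ ≤ z₂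
  swap
  · exact ⟨1, one_pos, fun z hz => absurd (hz.1.trans hz.2) h12⟩
  have hz₂ : 0 < z₂ := hz₁.trans_le h12
  -- One unit to the right of all z, so that (R − z)² ≥ 1 and the minimum with 1 is already attained
  -- at R.
  set R : ℝ := z₂ + 1
  have hR : 0 < R := by positivity
  obtain ⟨c₀, C₀, hc₀, -, hb⟩ := hM.exists_deriv_p_bounds R hR
  set k := c₀ / R with hk
  have hk0 : 0 < k := by positivity
  have hmono : MonotoneOn (fun y => M.freeEnergyDeriv y - k * y) (Ioc 0 R) := by
    have hd : ∀ y, 0 < y → HasDerivAt (fun y => M.freeEnergyDeriv y - k * y)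
        (deriv M.p y / y - k) y := fun y hy => by
      simpa using (hM.hasDerivAt_freeEnergyDeriv hy).fun_sub ((hasDerivAt_id y).const_mul k)
    refine monotoneOn_of_deriv_nonneg (convex_Ioc 0 R)
      (fun y hy => (hd y hy.1).continuousAt.continuousWithinAt) (fun y hy => ?_) fun y hy => ?_
    · rw [interior_Ioc] at hy
      exact (hd y hy.1).differentiableAt.differentiableWithinAt
    · rw [interior_Ioc] at hy
      rw [(hd y hy.1).deriv, sub_nonneg, hk]
      exact div_le_div₀ (hM.deriv_p_pos hy.1).le (hb y hy.1 hy.2.le).1 hy.1 hy.2.le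
  have hmono' : ∀ y z, 0 < y → y ≤ z → M.freeEnergyDeriv y ≤ M.freeEnergyDeriv z := by
    intro y z hy hyz
    refine monotoneOn_of_deriv_nonneg (convex_Ioi 0)
      (fun y hy => (hM.hasDerivAt_freeEnergyDeriv hy).continuousAt.continuousWithinAt)
      (fun y hy => ?_) (fun y hy => ?_) hy (hy.trans_le hyz) hyz
    · rw [interior_Ioi] at hy
      exact (hM.hasDerivAt_freeEnergyDeriv hy).differentiableAt.differentiableWithinAt
    · rw [interior_Ioi] at hy
      rw [(hM.hasDerivAt_freeEnergyDeriv hy).deriv]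
      exact (div_pos (hM.deriv_p_pos hy) hy).le
  have hquad : ∀ z ∈ Icc z₁ z₂, ∀ x, 0 < x → x ≤ R →
      k / 2 * (x - z) ^ 2 ≤ M.freeEnergy x - M.freeEnergyDeriv z * x + M.p z := by
    intro z hz x hx hxR
    have hz0 : 0 < z := hz₁.trans_le hz.1
    have hzR : z ≤ R := hz.2.trans (by simp [R])
    have := le_of_deriv_sign
      (φ := fun y => M.freeEnergy y - M.freeEnergyDeriv z * y - k / 2 * (y - z) ^ 2)
      (φ' := fun y => M.freeEnergyDeriv y - M.freeEnergyDeriv z - k * (y - z)) hz0 hx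
      (fun y hy => ?_) (fun y hy hyz => ?_) (fun y hy hyx => ?_)
    · simp only [sub_self] at this
      have e : M.freeEnergy z - M.freeEnergyDeriv z * z = -M.p z := by
        simp only [freeEnergy, freeEnergyDeriv]
        field_simp
        ring
      nlinarith
    · have h := ((hM.hasDerivAt_freeEnergy hy).fun_sub
        ((hasDerivAt_id y).const_mul (M.freeEnergyDeriv z))).fun_sub
        ((((hasDerivAt_id y).sub_const z).fun_pow 2).const_mul (k / 2))
      refine h.congr_deriv ?_
      simp
      ring
    · have := hmono ⟨hy, hyz.le.trans hzR⟩ ⟨hz0, hzR⟩ hyz.le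
      simp only at this
      linarith
    · have := hmono ⟨hz0, hzR⟩ ⟨hz0.trans hy, hyx.le.trans hxR⟩ hy.le
      simp only at this
      linarith
  -- The value p(z₁) takes care of x = 0: there Z S(Z) is zero by convention and the Bregman
  -- distance is p(z).
  refine ⟨min (k / 2) (M.p z₁), lt_min (by positivity) (hM.p_pos hz₁), fun z hz x hx => ?_⟩
  have hz0 : 0 < z := hz₁.trans_le hz.1
  have hm0 : 0 ≤ min 1 ((x - z) ^ 2) := le_min zero_le_one (sq_nonneg _)
  rcases hx.eq_or_lt with h0 | h0
  · have h1 : M.p z₁ ≤ M.p z := hM.p_mono.monotoneOn hz₁.le hz0.le hz.1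
    rw [← h0]
    simp only [freeEnergy, hM.p_zero]
    calc _ ≤ M.p z₁ * 1 := mul_le_mul (min_le_right _ _) (min_le_left _ _)
          (le_min zero_le_one (sq_nonneg _)) (hM.p_pos hz₁).le
      _ ≤ _ := by simpa using h1
  · rcases le_or_gt x R with hxR | hxR
    · exact (mul_le_mul (min_le_left _ _) (min_le_right _ _) hm0 (by positivity)).trans
        (hquad z hz x h0 hxR)
    · have h1 := hquad z hz R hR le_rfl
      have h2 : 1 ≤ (R - z) ^ 2 := by
        have : 1 ≤ R - z := by simp only [R]; linarith [hz.2]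
        nlinarith
      have hmonoOn : MonotoneOn (fun y => M.freeEnergy y - M.freeEnergyDeriv z * y) (Icc R x) := by
        have hd : ∀ y, 0 < y → HasDerivAt (fun y => M.freeEnergy y - M.freeEnergyDeriv z * y)
            (M.freeEnergyDeriv y - M.freeEnergyDeriv z) y := fun y hy => by
          simpa using (hM.hasDerivAt_freeEnergy hy).fun_sub
            ((hasDerivAt_id y).const_mul (M.freeEnergyDeriv z))
        refine monotoneOn_of_deriv_nonneg (convex_Icc R x)
          (fun y hy => (hd y (hR.trans_le hy.1)).continuousAt.continuousWithinAt)
          (fun y hy => ?_) fun y hy => ?_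
        · rw [interior_Icc] at hy
          exact (hd y (hR.trans hy.1)).differentiableAt.differentiableWithinAt
        · rw [interior_Icc] at hy
          rw [(hd y (hR.trans hy.1)).deriv, sub_nonneg]
          exact hmono' z y hz0 ((hz.2.trans (by simp [R])).trans hy.1.le)
      have h4 := hmonoOn (left_mem_Icc.2 hxR.le) (right_mem_Icc.2 hxR.le) hxR.le
      simp only at h4
      have h5 : min (k / 2) (M.p z₁) * min 1 ((x - z) ^ 2) ≤ k / 2 * 1 :=
        mul_le_mul (min_le_left _ _) (min_le_left _ _) hm0 (by positivity)
      nlinarith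

/-- The relative thermodynamic energy of `(ρ, θ)` with respect to `(r, ϑ)`. -/
noncomputable def relEnergy (M : Model) (r ϑ ρ θ : ℝ) : ℝ :=
  M.energyDensity ρ θ - ϑ * M.entropyDensity ρ θ - ρ * M.chemPot r ϑ + M.pressure r ϑ

/-- As the heat function is positive, the derivative has the sign of θ − ϑ: at fixed density this
fluid part is smallest at the temperature ϑ. -/
theorem Admissible.hasDerivAt_fluid_part (hM : M.Admissible) {ρ ϑ θ : ℝ} (hρ : 0 < ρ)
    (hθ : 0 < θ) :
    HasDerivAt (fun y => 3 / 2 * M.pressureF ρ y - ϑ * (ρ * M.S (ρ / y ^ (3 / 2 : ℝ))))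
      (9 / 4 * (√θ * M.heatFun (ρ / θ ^ (3 / 2 : ℝ))) * (θ - ϑ)) θ := by
  have hc : HasDerivAt (fun y : ℝ => (ρ, y)) (0, 1) θ := (hasDerivAt_const θ ρ).prodMk (hasDerivAt_id θ)
  have h1 := (hasFDerivAt_pressureF hM hρ hθ).comp_hasDerivAt θ hc
  have h2 := (hasFDerivAt_S_ratio hM hρ hθ).comp_hasDerivAt θ hc
  refine ((h1.const_mul (3 / 2)).fun_sub ((h2.const_mul ρ).const_mul ϑ)).congr_deriv ?_
  obtain ⟨s, hs, rfl⟩ : ∃ s : ℝ, 0 < s ∧ θ = s ^ 2 :=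
    ⟨√θ, Real.sqrt_pos.2 hθ, (Real.sq_sqrt hθ.le).symm⟩
  simp [rpow_three_halves hθ, Real.sqrt_sq hs.le]
  field_simp
  ring

theorem chemPot_eq {r ϑ : ℝ} (hr : 0 < r) (hϑ : 0 < ϑ) :
    M.chemPot r ϑ = ϑ * M.freeEnergyDeriv (r / ϑ ^ (3 / 2 : ℝ)) := by
  obtain ⟨s, hs, rfl⟩ : ∃ s : ℝ, 0 < s ∧ ϑ = s ^ 2 :=
    ⟨√ϑ, Real.sqrt_pos.2 hϑ, (Real.sq_sqrt hϑ.le).symm⟩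
  simp only [chemPot, freeEnergyDeriv, pressureF, rpow_three_halves hϑ, rpow_five_halves hϑ,
    Real.sqrt_sq hs.le]
  field_simp

/-- In the fluid part θ is replaced by its minimizer ϑ, which leaves a Bregman distance at the
single temperature ϑ. The radiation part is computed exactly: aθ⁴ − (4a/3)ϑθ³ + (a/3)ϑ⁴ factors as
(a/3)(θ − ϑ)²(3θ² + 2θϑ + ϑ²). -/
theorem Admissible.relEnergy_lower (hM : M.Admissible) {r ϑ ρ θ : ℝ} (hr : 0 < r) (hϑ : 0 < ϑ)
    (hρ : 0 ≤ ρ) (hθ : 0 < θ) :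
    M.a / 3 * ((θ - ϑ) ^ 2 * (3 * θ ^ 2 + 2 * θ * ϑ + ϑ ^ 2))
      + ϑ ^ (5 / 2 : ℝ) * (M.freeEnergy (ρ / ϑ ^ (3 / 2 : ℝ))
        - M.freeEnergyDeriv (r / ϑ ^ (3 / 2 : ℝ)) * (ρ / ϑ ^ (3 / 2 : ℝ))
        + M.p (r / ϑ ^ (3 / 2 : ℝ))) ≤ M.relEnergy r ϑ ρ θ := by
  have key : 3 / 2 * M.pressureF ρ ϑ - ϑ * (ρ * M.S (ρ / ϑ ^ (3 / 2 : ℝ)))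
      ≤ 3 / 2 * M.pressureF ρ θ - ϑ * (ρ * M.S (ρ / θ ^ (3 / 2 : ℝ))) := by
    rcases hρ.eq_or_lt with h0 | h0
    · rw [← h0]
      simp [pressureF, hM.p_zero]
    · refine le_of_deriv_sign hϑ hθ (fun y hy => hM.hasDerivAt_fluid_part (ϑ := ϑ) h0 hy)
        (fun y hy hyz => ?_) (fun y hy _ => ?_)
      · have h1 := hM.heatFun_pos (div_pos h0 (Real.rpow_pos_of_pos hy (3 / 2)))
        exact mul_nonpos_of_nonneg_of_nonpos (by positivity) (by linarith)
      · have hy0 := hϑ.trans hy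
        have h1 := hM.heatFun_pos (div_pos h0 (Real.rpow_pos_of_pos hy0 (3 / 2)))
        exact mul_nonneg (by positivity) (by linarith)
  have e : ϑ ^ (5 / 2 : ℝ) * (M.freeEnergy (ρ / ϑ ^ (3 / 2 : ℝ))
        - M.freeEnergyDeriv (r / ϑ ^ (3 / 2 : ℝ)) * (ρ / ϑ ^ (3 / 2 : ℝ))
        + M.p (r / ϑ ^ (3 / 2 : ℝ))) = 3 / 2 * M.pressureF ρ ϑ
        - ϑ * (ρ * M.S (ρ / ϑ ^ (3 / 2 : ℝ))) - ρ * M.chemPot r ϑ + M.pressureF r ϑ := by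
    rw [chemPot_eq hr hϑ]
    obtain ⟨s, hs, rfl⟩ : ∃ s : ℝ, 0 < s ∧ ϑ = s ^ 2 :=
      ⟨√ϑ, Real.sqrt_pos.2 hϑ, (Real.sq_sqrt hϑ.le).symm⟩
    simp only [freeEnergy, pressureF, rpow_three_halves hϑ, rpow_five_halves hϑ,
      Real.sqrt_sq hs.le]
    field_simp
  rw [e]
  simp only [relEnergy, energyDensity, entropyDensity, pressure]
  linarith

/-- The temperature bound comes from radiation alone, and its weight 1 + θ² is what the heat
conduction estimate needs. The density part is capped at 1; large densities are handled by the
growth bound. -/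
theorem Admissible.exists_relEnergy_coercive (hM : M.Admissible) {r₁ r₂ θ₁ θ₂ : ℝ} (hr₁ : 0 < r₁)
    (hθ₁ : 0 < θ₁) : ∃ c : ℝ, 0 < c ∧ ∀ r ∈ Icc r₁ r₂, ∀ ϑ ∈ Icc θ₁ θ₂, ∀ ρ θ, 0 ≤ ρ → 0 < θ →
      c * ((θ - ϑ) ^ 2 * (1 + θ ^ 2) + min 1 ((ρ - r) ^ 2)) ≤ M.relEnergy r ϑ ρ θ := by
  by_cases h12 : θ₁ ≤ θ₂
  swap
  · exact ⟨1, one_pos, fun r _ ϑ hϑ => absurd (hϑ.1.trans hϑ.2) h12⟩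
  have hθ₂ : 0 < θ₂ := hθ₁.trans_le h12
  obtain ⟨c, hc, hb⟩ := hM.exists_bregman_lower (z₁ := r₁ / θ₂ ^ (3 / 2 : ℝ))
    (z₂ := r₂ / θ₁ ^ (3 / 2 : ℝ)) (by positivity)
  have ha := hM.a_pos
  set w := θ₂ ^ (3 / 2 : ℝ) with hw
  have hw0 : 0 < w := by positivity
  -- Both k ≤ 1 and k ≤ θ₁² hold, so k(1 + θ²) ≤ θ² + ϑ².
  set k := θ₁ ^ 2 / (1 + θ₁ ^ 2) with hk
  have hk0 : 0 < k := by positivity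
  have hk1 : k ≤ 1 := by rw [hk, div_le_one (by positivity)]; linarith
  have hk2 : k ≤ θ₁ ^ 2 := by
    rw [hk, div_le_iff₀ (by positivity)]
    nlinarith [sq_nonneg θ₁, sq_nonneg (θ₁ ^ 2)]
  set l := 1 / (1 + w ^ 2) with hl
  have hl0 : 0 < l := by positivity
  set c₁ := M.a / 3 * k with hc₁
  set c₂ := θ₁ ^ (5 / 2 : ℝ) * (c * l) with hc₂
  have hc₁0 : 0 < c₁ := by positivity
  have hc₂0 : 0 < c₂ := by positivity
  refine ⟨min c₁ c₂, lt_min hc₁0 hc₂0, fun r hr ϑ hϑ ρ θ hρ hθ => ?_⟩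
  have hϑ0 : 0 < ϑ := hθ₁.trans_le hϑ.1
  have hr0 : 0 < r := hr₁.trans_le hr.1
  refine le_trans ?_ (hM.relEnergy_lower hr0 hϑ0 hρ hθ)
  have hpow : 0 < ϑ ^ (3 / 2 : ℝ) := Real.rpow_pos_of_pos hϑ0 _
  have hpw : ϑ ^ (3 / 2 : ℝ) ≤ w := by rw [hw]; gcongr; exact hϑ.2
  have hpl : θ₁ ^ (3 / 2 : ℝ) ≤ ϑ ^ (3 / 2 : ℝ) := by gcongr; exact hϑ.1
  have hz : r / ϑ ^ (3 / 2 : ℝ) ∈ Icc (r₁ / w) (r₂ / θ₁ ^ (3 / 2 : ℝ)) :=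
    ⟨div_le_div₀ hr0.le hr.1 hpow hpw,
      div_le_div₀ (hr0.le.trans hr.2) hr.2 (by positivity) hpl⟩
  have h1 := hb _ hz (ρ / ϑ ^ (3 / 2 : ℝ)) (by positivity)
  rw [← sub_div, div_pow] at h1
  have h2 : l * min 1 ((ρ - r) ^ 2) ≤ min 1 ((ρ - r) ^ 2 / (ϑ ^ (3 / 2 : ℝ)) ^ 2) := by
    refine le_min ?_ ?_
    · have hl1 : l ≤ 1 := by rw [hl, div_le_one (by positivity)]; nlinarith [sq_nonneg w]
      calc _ ≤ (1 : ℝ) * 1 := mul_le_mul hl1 (min_le_left _ _)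
            (le_min zero_le_one (sq_nonneg _)) zero_le_one
        _ = 1 := one_mul 1
    · rw [hl, div_mul_eq_mul_div, one_mul]
      refine div_le_div₀ (sq_nonneg _) (min_le_right _ _) (by positivity) ?_
      have : (ϑ ^ (3 / 2 : ℝ)) ^ 2 ≤ w ^ 2 := by gcongr
      linarith
  have h3 : θ₁ ^ (5 / 2 : ℝ) ≤ ϑ ^ (5 / 2 : ℝ) := by gcongr; exact hϑ.1
  have hm0 : 0 ≤ min 1 ((ρ - r) ^ 2) := le_min zero_le_one (sq_nonneg _)
  have h4 : c₂ * min 1 ((ρ - r) ^ 2) ≤ ϑ ^ (5 / 2 : ℝ) * (M.freeEnergy (ρ / ϑ ^ (3 / 2 : ℝ))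
        - M.freeEnergyDeriv (r / ϑ ^ (3 / 2 : ℝ)) * (ρ / ϑ ^ (3 / 2 : ℝ))
        + M.p (r / ϑ ^ (3 / 2 : ℝ))) := by
    have h5 : c * (l * min 1 ((ρ - r) ^ 2)) ≤ _ := (mul_le_mul_of_nonneg_left h2 hc.le).trans h1
    calc c₂ * min 1 ((ρ - r) ^ 2) = θ₁ ^ (5 / 2 : ℝ) * (c * (l * min 1 ((ρ - r) ^ 2))) := by
          rw [hc₂]; ring
      _ ≤ _ := mul_le_mul h3 h5 (by positivity) (by positivity)
  have h6 : k * (1 + θ ^ 2) ≤ 3 * θ ^ 2 + 2 * θ * ϑ + ϑ ^ 2 := by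
    have : θ₁ ^ 2 ≤ ϑ ^ 2 := by gcongr; exact hϑ.1
    have h7 : k * θ ^ 2 ≤ 1 * θ ^ 2 := by gcongr
    have h8 : 0 < θ * ϑ := by positivity
    nlinarith [sq_nonneg θ]
  have h9 : c₁ * ((θ - ϑ) ^ 2 * (1 + θ ^ 2))
      ≤ M.a / 3 * ((θ - ϑ) ^ 2 * (3 * θ ^ 2 + 2 * θ * ϑ + ϑ ^ 2)) := by
    calc _ = M.a / 3 * ((θ - ϑ) ^ 2 * (k * (1 + θ ^ 2))) := by rw [hc₁]; ring
      _ ≤ _ := by gcongr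
  have h10 : 0 ≤ (θ - ϑ) ^ 2 * (1 + θ ^ 2) := by positivity
  calc _ = min c₁ c₂ * ((θ - ϑ) ^ 2 * (1 + θ ^ 2)) + min c₁ c₂ * min 1 ((ρ - r) ^ 2) := by ring
    _ ≤ c₁ * ((θ - ϑ) ^ 2 * (1 + θ ^ 2)) + c₂ * min 1 ((ρ - r) ^ 2) :=
      add_le_add (mul_le_mul_of_nonneg_right (min_le_left _ _) h10)
        (mul_le_mul_of_nonneg_right (min_le_right _ _) hm0)
    _ ≤ _ := add_le_add h9 h4

end Model

/-! ### Growth of pressure, entropy and relative energy -/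

namespace Model

variable {M : Model}

/-- The scaling of the monatomic gas: with Z = ρ/θ^{3/2}, the growth Z^{5/3} of p makes θ^{5/2} p(Z)
grow like ρ^{5/3}, independently of θ. -/
theorem rpow_mul_ratio_rpow {ρ θ : ℝ} (hρ : 0 ≤ ρ) (hθ : 0 < θ) :
    θ ^ (5 / 2 : ℝ) * (ρ / θ ^ (3 / 2 : ℝ)) ^ (5 / 3 : ℝ) = ρ ^ (5 / 3 : ℝ) := by
  have h : (θ ^ (3 / 2 : ℝ)) ^ (5 / 3 : ℝ) = θ ^ (5 / 2 : ℝ) := by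
    rw [← Real.rpow_mul hθ.le]; norm_num
  have h0 : 0 < θ ^ (5 / 2 : ℝ) := by positivity
  rw [Real.div_rpow hρ (by positivity), h, mul_div_cancel₀ _ h0.ne']

theorem exists_le_rpow_add {δ : ℝ} (hδ : 0 < δ) :
    ∃ C : ℝ, 0 < C ∧ ∀ x : ℝ, 0 ≤ x → x ≤ δ * x ^ (5 / 3 : ℝ) + C := by
  refine ⟨(1 / δ) ^ (3 / 2 : ℝ), by positivity, fun x hx => ?_⟩
  have h0 : 0 ≤ x ^ (5 / 3 : ℝ) := by positivity
  rcases le_or_gt x ((1 / δ) ^ (3 / 2 : ℝ)) with h | h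
  · nlinarith [mul_nonneg hδ.le h0]
  · have hx0 : 0 < x := lt_trans (by positivity) h
    have h1 : 1 / δ ≤ x ^ (2 / 3 : ℝ) := by
      calc 1 / δ = ((1 / δ) ^ (3 / 2 : ℝ)) ^ (2 / 3 : ℝ) := by
            rw [← Real.rpow_mul (by positivity)]; norm_num
        _ ≤ _ := by gcongr
    have h2 : x ^ (5 / 3 : ℝ) = x * x ^ (2 / 3 : ℝ) := by
      rw [← Real.rpow_one_add' hx (by norm_num)]; norm_num
    rw [div_le_iff₀ hδ] at h1
    have h3 : 0 < (1 / δ) ^ (3 / 2 : ℝ) := by positivity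
    rw [h2]
    nlinarith [mul_le_mul_of_nonneg_left h1 hx]

theorem exists_pow_three_le {δ : ℝ} (hδ : 0 < δ) :
    ∃ C : ℝ, 0 < C ∧ ∀ x : ℝ, 0 ≤ x → x ^ 3 ≤ δ * x ^ 4 + C := by
  refine ⟨(1 / δ) ^ 3, by positivity, fun x hx => ?_⟩
  rcases le_or_gt x (1 / δ) with h | h
  · have : x ^ 3 ≤ (1 / δ) ^ 3 := by gcongr
    have : 0 ≤ δ * x ^ 4 := by positivity
    linarith
  · rw [div_lt_iff₀ hδ] at h
    have h2 : 0 ≤ (1 / δ) ^ 3 := by positivity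
    nlinarith [mul_le_mul_of_nonneg_left h.le (pow_nonneg hx 3)]

theorem rpow_five_halves_le {θ : ℝ} (hθ : 0 < θ) : θ ^ (5 / 2 : ℝ) ≤ 1 + θ ^ 3 := by
  rcases le_or_gt θ 1 with h | h
  · have := Real.rpow_le_one hθ.le h (show (0 : ℝ) ≤ 5 / 2 by norm_num)
    have : 0 < θ ^ 3 := by positivity
    linarith
  · have := Real.rpow_le_rpow_of_exponent_le h.le (show (5 / 2 : ℝ) ≤ (3 : ℕ) by norm_num)
    rw [Real.rpow_natCast] at this
    linarith

theorem sqrt_pow_three_le {θ : ℝ} (hθ : 0 < θ) : √θ ^ 3 ≤ 1 + θ ^ 3 := by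
  have hs : 0 < √θ := Real.sqrt_pos.2 hθ
  have e : θ ^ 3 = (√θ ^ 3) ^ 2 := by
    rw [← pow_mul, mul_comm 3 2, pow_mul, Real.sq_sqrt hθ.le]
  rw [e]
  nlinarith [sq_nonneg (√θ ^ 3 - 1)]

theorem Admissible.pressureF_nonneg (hM : M.Admissible) {ρ θ : ℝ} (hρ : 0 ≤ ρ) (hθ : 0 < θ) :
    0 ≤ M.pressureF ρ θ :=
  mul_nonneg (by positivity) (hM.p_nonneg (by positivity))

theorem Admissible.pressure_nonneg (hM : M.Admissible) {ρ θ : ℝ} (hρ : 0 ≤ ρ) (hθ : 0 < θ) :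
    0 ≤ M.pressure ρ θ := by
  have := hM.pressureF_nonneg hρ hθ
  have := hM.a_pos
  unfold pressure
  positivity

theorem Admissible.exists_pressure_upper (hM : M.Admissible) :
    ∃ C : ℝ, 0 < C ∧ ∀ ρ θ, 0 ≤ ρ → 0 < θ →
      M.pressure ρ θ ≤ C * (1 + ρ ^ (5 / 3 : ℝ) + θ ^ 4) := by
  obtain ⟨C, hC, h⟩ := hM.exists_p_upper
  have ha := hM.a_pos
  refine ⟨3 * C + M.a, by positivity, fun ρ θ hρ hθ => ?_⟩
  have h1 := mul_le_mul_of_nonneg_left (h (ρ / θ ^ (3 / 2 : ℝ)) (by positivity))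
    (show 0 ≤ θ ^ (5 / 2 : ℝ) by positivity)
  have e1 : θ ^ (5 / 2 : ℝ) * (ρ / θ ^ (3 / 2 : ℝ)) = ρ * θ := by
    have : θ ^ (5 / 2 : ℝ) = θ ^ (3 / 2 : ℝ) * θ := by
      rw [← Real.rpow_add_one hθ.ne']; norm_num
    rw [this]
    field_simp
  have h2 : ρ * θ ≤ ρ ^ (5 / 3 : ℝ) + θ ^ (5 / 2 : ℝ) := by
    -- Young's inequality with the conjugate exponents 5/3 and 5/2.
    have hy := Real.young_inequality_of_nonneg hρ hθ.le
      (show (5 / 3 : ℝ).HolderConjugate (5 / 2) from by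
        rw [Real.holderConjugate_iff]; norm_num)
    have i1 : 0 ≤ ρ ^ (5 / 3 : ℝ) := by positivity
    have i2 : 0 ≤ θ ^ (5 / 2 : ℝ) := by positivity
    linarith
  have h3 := rpow_five_halves_le hθ
  have h4 : θ ^ 3 ≤ 1 + θ ^ 4 := by
    nlinarith [sq_nonneg (θ ^ 2 - θ), sq_nonneg (θ - 1), sq_nonneg (θ ^ 2 - 1), hθ,
      sq_nonneg (θ ^ 2)]
  have e2 := rpow_mul_ratio_rpow hρ hθ
  have i1 : 0 ≤ ρ ^ (5 / 3 : ℝ) := by positivity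
  have i4 : 0 ≤ θ ^ 4 := by positivity
  have h5 : M.pressureF ρ θ ≤ C * (ρ * θ + ρ ^ (5 / 3 : ℝ)) := by
    calc M.pressureF ρ θ ≤ _ := h1
      _ = C * (θ ^ (5 / 2 : ℝ) * (ρ / θ ^ (3 / 2 : ℝ))
          + θ ^ (5 / 2 : ℝ) * (ρ / θ ^ (3 / 2 : ℝ)) ^ (5 / 3 : ℝ)) := by ring
      _ = _ := by rw [e1, e2]
  have h6 : C * (ρ * θ + ρ ^ (5 / 3 : ℝ)) ≤ C * (2 * ρ ^ (5 / 3 : ℝ) + (2 + θ ^ 4)) :=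
    mul_le_mul_of_nonneg_left (by linarith) hC.le
  unfold pressure
  nlinarith [mul_nonneg hC.le i1, mul_nonneg hC.le i4, mul_nonneg ha.le i1, mul_nonneg ha.le i4]

theorem Admissible.exists_pressureF_lower (hM : M.Admissible) :
    ∃ c C : ℝ, 0 < c ∧ 0 < C ∧ ∀ ρ θ, 0 ≤ ρ → 0 < θ →
      c * ρ ^ (5 / 3 : ℝ) - C * (1 + θ ^ 3) ≤ M.pressureF ρ θ := by
  obtain ⟨c, C, hc, hC, h⟩ := hM.exists_p_lower
  refine ⟨c, C, hc, hC, fun ρ θ hρ hθ => ?_⟩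
  have h1 := mul_le_mul_of_nonneg_left (h (ρ / θ ^ (3 / 2 : ℝ)) (by positivity))
    (show 0 ≤ θ ^ (5 / 2 : ℝ) by positivity)
  have h2 := rpow_mul_ratio_rpow hρ hθ
  have h3 := mul_le_mul_of_nonneg_left (rpow_five_halves_le hθ) hC.le
  calc _ ≤ c * ρ ^ (5 / 3 : ℝ) - C * θ ^ (5 / 2 : ℝ) := by linarith
    _ = θ ^ (5 / 2 : ℝ) * (c * (ρ / θ ^ (3 / 2 : ℝ)) ^ (5 / 3 : ℝ) - C) := by rw [← h2]; ring
    _ ≤ _ := h1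

/-- It makes the density integrable on the space-time cylinder, given that the pressure is. The loss
in θ³ is absorbed by the radiation pressure. -/
theorem Admissible.exists_density_le_pressure (hM : M.Admissible) :
    ∃ C : ℝ, 0 < C ∧ ∀ ρ θ, 0 ≤ ρ → 0 < θ → ρ ≤ C * (1 + M.pressure ρ θ) := by
  obtain ⟨c, C, hc, hC, h⟩ := hM.exists_pressureF_lower
  obtain ⟨D, hD, h'⟩ := exists_le_rpow_add hc
  obtain ⟨B, hB, h3⟩ := exists_pow_three_le (show 0 < M.a / 3 / C by
    have := hM.a_pos; positivity)
  refine ⟨1 + D + C + C * B, by positivity, fun ρ θ hρ hθ => ?_⟩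
  have i1 := h ρ θ hρ hθ
  have i2 := h' ρ hρ
  have i3 := mul_le_mul_of_nonneg_left (h3 θ hθ.le) hC.le
  have e : C * (M.a / 3 / C * θ ^ 4 + B) = M.a / 3 * θ ^ 4 + C * B := by field_simp
  rw [e] at i3
  have i4 := hM.pressure_nonneg hρ hθ
  have i5 : 0 ≤ (D + C + C * B) * M.pressure ρ θ := by positivity
  have i6 : M.pressure ρ θ = M.pressureF ρ θ + M.a / 3 * θ ^ 4 := rfl
  nlinarith

theorem Admissible.entropyDensity_nonneg (hM : M.Admissible) {ρ θ : ℝ} (hρ : 0 ≤ ρ)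
    (hθ : 0 < θ) : 0 ≤ M.entropyDensity ρ θ := by
  have ha := hM.a_pos
  unfold entropyDensity
  rcases hρ.eq_or_lt with h0 | h0
  · rw [← h0, zero_mul]
    positivity
  · have := hM.S_nonneg (div_pos h0 (Real.rpow_pos_of_pos hθ (3 / 2)))
    positivity

/-- The middle term is √ρ θ^{3/4}, that is, ρ times Z^{−1/2}. -/
theorem Admissible.exists_entropyDensity_upper (hM : M.Admissible) :
    ∃ C : ℝ, 0 < C ∧ ∀ ρ θ, 0 ≤ ρ → 0 < θ →
      M.entropyDensity ρ θ ≤ C * (ρ + √ρ * √(√θ ^ 3) + θ ^ 3) := by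
  obtain ⟨C, hC, h⟩ := hM.exists_S_upper
  have ha := hM.a_pos
  refine ⟨C + 4 * M.a / 3, by positivity, fun ρ θ hρ hθ => ?_⟩
  have hs : 0 < √θ := Real.sqrt_pos.2 hθ
  have hθ3 : 0 < θ ^ 3 := by positivity
  unfold entropyDensity
  have key : ρ * M.S (ρ / θ ^ (3 / 2 : ℝ)) ≤ C * (ρ + √ρ * √(√θ ^ 3)) := by
    rcases hρ.eq_or_lt with h0 | h0
    · simp [← h0]
    · have h1 := mul_le_mul_of_nonneg_left
        (h (ρ / θ ^ (3 / 2 : ℝ)) (div_pos h0 (Real.rpow_pos_of_pos hθ _))) hρ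
      have hr : 0 < √ρ := Real.sqrt_pos.2 h0
      have hq : 0 < √(√θ ^ 3) := Real.sqrt_pos.2 (by positivity)
      rw [rpow_three_halves hθ, Real.sqrt_div hρ, one_div_div] at h1
      rw [rpow_three_halves hθ]
      have e : ρ * (√(√θ ^ 3) / √ρ) = √ρ * √(√θ ^ 3) := by
        have : ρ = √ρ * √ρ := (Real.mul_self_sqrt hρ).symm
        field_simp
        rw [Real.sq_sqrt hρ]
      calc _ ≤ _ := h1
        _ = C * (ρ + ρ * (√(√θ ^ 3) / √ρ)) := by ring
        _ = _ := by rw [e]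
  have i1 : 0 ≤ 4 * M.a / 3 * (ρ + √ρ * √(√θ ^ 3)) := by positivity
  have i2 : 0 ≤ C * θ ^ 3 := by positivity
  linarith

/-- The energy density grows like ρ^{5/3} + θ⁴, while ϑρs and ρ times the chemical potential are
bounded by multiples of 1 + ρ + θ³ and are absorbed. -/
theorem Admissible.exists_relEnergy_growth (hM : M.Admissible) {r₁ r₂ θ₁ θ₂ : ℝ} (hr₁ : 0 < r₁)
    (hθ₁ : 0 < θ₁) : ∃ c C : ℝ, 0 < c ∧ 0 < C ∧
      ∀ r ∈ Icc r₁ r₂, ∀ ϑ ∈ Icc θ₁ θ₂, ∀ ρ θ, 0 ≤ ρ → 0 < θ →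
      c * (ρ ^ (5 / 3 : ℝ) + θ ^ 4) - C ≤ M.relEnergy r ϑ ρ θ := by
  by_cases h12 : θ₁ ≤ θ₂
  swap
  · exact ⟨1, 1, one_pos, one_pos, fun r _ ϑ hϑ => absurd (hϑ.1.trans hϑ.2) h12⟩
  have hθ₂ : 0 < θ₂ := hθ₁.trans_le h12
  have ha := hM.a_pos
  have hsub : Icc r₁ r₂ ×ˢ Icc θ₁ θ₂ ⊆ quadrant := fun y hy =>
    ⟨hr₁.trans_le hy.1.1, hθ₁.trans_le hy.2.1⟩
  obtain ⟨G₀, hG⟩ := (isCompact_Icc.prod isCompact_Icc).exists_bound_of_continuousOn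
    (hM.contDiffOn_chemPot.continuousOn.mono hsub)
  set G := |G₀| with hGdef
  obtain ⟨c, C, hc, hC, hP⟩ := hM.exists_pressureF_lower
  obtain ⟨D, hD, hS⟩ := hM.exists_entropyDensity_upper
  set A := θ₂ * D * 2 + G + 1 with hA
  have hA0 : 0 < A := by positivity
  set B := 3 / 2 * C + θ₂ * D * 2 with hB
  have hB0 : 0 < B := by positivity
  -- A and B are the total coefficients of ρ and θ³. The choices c/(2A) and a/(2B) make these terms
  -- cost only c/2 · ρ^{5/3} and a/2 · θ⁴.
  obtain ⟨K, hK, h1⟩ := exists_le_rpow_add (show 0 < c / (2 * A) by positivity)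
  obtain ⟨L, hL, h3⟩ := exists_pow_three_le (show 0 < M.a / (2 * B) by positivity)
  refine ⟨min c (M.a / 2), A * K + B * L + B, lt_min hc (by positivity), by positivity,
    fun r hr ϑ hϑ ρ θ hρ hθ => ?_⟩
  have hϑ0 : 0 < ϑ := hθ₁.trans_le hϑ.1
  have hr0 : 0 < r := hr₁.trans_le hr.1
  have i1 : -G ≤ -|M.chemPot r ϑ| := by
    have := hG (r, ϑ) ⟨hr, hϑ⟩
    rw [Real.norm_eq_abs] at this
    exact neg_le_neg (this.trans (le_abs_self _))
  have i2 : ρ * M.chemPot r ϑ ≤ ρ * G :=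
    mul_le_mul_of_nonneg_left ((le_abs_self _).trans (by linarith)) hρ
  have hs0 : 0 ≤ √(√θ ^ 3) := Real.sqrt_nonneg _
  have i3 : √ρ * √(√θ ^ 3) ≤ ρ + 1 + θ ^ 3 := by
    have j1 := Real.sq_sqrt hρ
    have j2 := Real.sq_sqrt (show 0 ≤ √θ ^ 3 by positivity)
    have j3 := sqrt_pow_three_le hθ
    nlinarith [sq_nonneg (√ρ - √(√θ ^ 3)), Real.sqrt_nonneg ρ]
  have i4 : ϑ * M.entropyDensity ρ θ ≤ θ₂ * (D * (ρ + (ρ + 1 + θ ^ 3) + θ ^ 3)) := by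
    refine mul_le_mul hϑ.2 ((hS ρ θ hρ hθ).trans ?_) (hM.entropyDensity_nonneg hρ hθ) hθ₂.le
    gcongr
  have i5 := hM.pressure_nonneg hr0.le hϑ0
  have i6 := hP ρ θ hρ hθ
  have i7 := mul_le_mul_of_nonneg_left (h1 ρ hρ) hA0.le
  have i8 := mul_le_mul_of_nonneg_left (h3 θ hθ.le) hB0.le
  have e1 : A * (c / (2 * A) * ρ ^ (5 / 3 : ℝ) + K) = c / 2 * ρ ^ (5 / 3 : ℝ) + A * K := by
    field_simp
  have e2 : B * (M.a / (2 * B) * θ ^ 4 + L) = M.a / 2 * θ ^ 4 + B * L := by field_simp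
  rw [e1] at i7
  rw [e2] at i8
  have hX : 0 ≤ ρ ^ (5 / 3 : ℝ) := by positivity
  have hY : 0 ≤ θ ^ 4 := by positivity
  have i9 : min c (M.a / 2) * (ρ ^ (5 / 3 : ℝ) + θ ^ 4) ≤ c * ρ ^ (5 / 3 : ℝ) + M.a / 2 * θ ^ 4 := by
    rw [mul_add]
    exact add_le_add (mul_le_mul_of_nonneg_right (min_le_left _ _) hX)
      (mul_le_mul_of_nonneg_right (min_le_right _ _) hY)
  have hG0 : 0 ≤ G := abs_nonneg _
  have hθ3 : 0 ≤ θ ^ 3 := by positivity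
  unfold relEnergy energyDensity
  have hAe : A * ρ = θ₂ * D * 2 * ρ + G * ρ + ρ := by rw [hA]; ring
  have hBe : B * θ ^ 3 = 3 / 2 * C * θ ^ 3 + θ₂ * D * 2 * θ ^ 3 := by rw [hB]; ring
  have hBB : B = 3 / 2 * C + θ₂ * D * 2 := hB
  have hTD : 0 ≤ θ₂ * D := by positivity
  have e3 : θ₂ * (D * (ρ + (ρ + 1 + θ ^ 3) + θ ^ 3))
      = θ₂ * D * 2 * ρ + θ₂ * D + θ₂ * D * 2 * θ ^ 3 := by ring
  rw [e3] at i4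
  nlinarith

end Model

/-! ### Bounds of nonlinear terms by the relative energy -/

namespace Model

variable {M : Model}

theorem le_one_add_rpow {x : ℝ} (hx : 0 ≤ x) : x ≤ 1 + x ^ (5 / 3 : ℝ) := by
  have h0 : 0 ≤ x ^ (5 / 3 : ℝ) := by positivity
  rcases le_or_gt x 1 with h | h
  · linarith
  · have := Real.rpow_le_rpow_of_exponent_le h.le (show (1 : ℝ) ≤ 5 / 3 by norm_num)
    rw [Real.rpow_one] at this
    linarith

theorem pow_three_le {x : ℝ} (hx : 0 ≤ x) : x ^ 3 ≤ 1 + x ^ 4 := by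
  rcases le_or_gt x 1 with h | h
  · have := pow_le_one₀ (n := 3) hx h
    have : 0 ≤ x ^ 4 := by positivity
    linarith
  · have := pow_le_pow_right₀ h.le (show 3 ≤ 4 by norm_num)
    linarith

theorem le_one_add_pow_four (x : ℝ) : x ≤ 1 + x ^ 4 := by
  rcases le_or_gt x 1 with h | h
  · have : 0 ≤ x ^ 4 := by positivity
    linarith
  · have := pow_le_pow_right₀ h.le (show 1 ≤ 4 by norm_num)
    rw [pow_one] at this
    linarith

/-- A state is either close to the reference state, where the relative energy controls the square of
the distance, or else the relative energy controls all quantities of polynomial growth. -/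
theorem Admissible.exists_dichotomy (hM : M.Admissible) {r₁ r₂ θ₁ θ₂ : ℝ} (hr₁ : 0 < r₁)
    (hθ₁ : 0 < θ₁) : ∃ C : ℝ, 0 < C ∧
      ∀ r ∈ Icc r₁ r₂, ∀ ϑ ∈ Icc θ₁ θ₂, ∀ ρ θ, 0 ≤ ρ → 0 < θ →
      0 ≤ M.relEnergy r ϑ ρ θ ∧
      (θ - ϑ) ^ 2 * (1 + θ ^ 2) ≤ C * M.relEnergy r ϑ ρ θ ∧
      ((|ρ - r| ≤ r₁ / 2 ∧ |θ - ϑ| ≤ θ₁ / 2 ∧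
          (ρ - r) ^ 2 + (θ - ϑ) ^ 2 ≤ C * M.relEnergy r ϑ ρ θ) ∨
        1 + ρ ^ (5 / 3 : ℝ) + θ ^ 4 ≤ C * M.relEnergy r ϑ ρ θ) := by
  obtain ⟨c, hc, hco⟩ := hM.exists_relEnergy_coercive (r₂ := r₂) (θ₂ := θ₂) hr₁ hθ₁
  obtain ⟨d, D, hd, hD, hgr⟩ := hM.exists_relEnergy_growth (r₂ := r₂) (θ₂ := θ₂) hr₁ hθ₁
  set m := min 1 (min ((r₁ / 2) ^ 2) ((θ₁ / 2) ^ 2)) with hm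
  have hm0 : 0 < m := by positivity
  have hm1 : m ≤ 1 := min_le_left _ _
  have hm2 : m ≤ (r₁ / 2) ^ 2 := (min_le_right _ _).trans (min_le_left _ _)
  have hm3 : m ≤ (θ₁ / 2) ^ 2 := (min_le_right _ _).trans (min_le_right _ _)
  -- In A, the factor 1 + (r₁/2)² turns min(1, s²) back into s² for |s| ≤ r₁/2. In B, the additive
  -- constant of the growth bound is absorbed through E ≥ c m, valid away from the reference state.
  obtain ⟨A, hA⟩ : ∃ A, A = (1 + (r₁ / 2) ^ 2) / c := ⟨_, rfl⟩
  obtain ⟨B, hB⟩ : ∃ B, B = (1 / d) * (1 + (D + d) / (c * m)) := ⟨_, rfl⟩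
  have hA0 : 0 < A := by rw [hA]; positivity
  have hB0 : 0 < B := by rw [hB]; positivity
  refine ⟨A + B, by positivity, fun r hr ϑ hϑ ρ θ hρ hθ => ?_⟩
  have h1 := hco r hr ϑ hϑ ρ θ hρ hθ
  have h2 := hgr r hr ϑ hϑ ρ θ hρ hθ
  generalize M.relEnergy r ϑ ρ θ = E at h1 h2 ⊢
  have hmin : 0 ≤ min 1 ((ρ - r) ^ 2) := le_min zero_le_one (sq_nonneg _)
  have hth : 0 ≤ (θ - ϑ) ^ 2 * (1 + θ ^ 2) := by positivity
  have hE : 0 ≤ E := le_trans (by positivity) h1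
  have hAE : (1 + (r₁ / 2) ^ 2) * ((θ - ϑ) ^ 2 * (1 + θ ^ 2) + min 1 ((ρ - r) ^ 2)) ≤ A * E := by
    calc _ = A * (c * ((θ - ϑ) ^ 2 * (1 + θ ^ 2) + min 1 ((ρ - r) ^ 2))) := by
          rw [hA]; field_simp
      _ ≤ _ := by gcongr
  have hBE : 0 ≤ B * E := by positivity
  have hr2 : 0 ≤ (r₁ / 2) ^ 2 := sq_nonneg _
  refine ⟨hE, ?_, ?_⟩
  · linarith [mul_nonneg hr2 (add_nonneg hth hmin)]
  by_cases hbox : |ρ - r| ≤ r₁ / 2 ∧ |θ - ϑ| ≤ θ₁ / 2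
  · refine Or.inl ⟨hbox.1, hbox.2, ?_⟩
    have i1 : (ρ - r) ^ 2 ≤ (r₁ / 2) ^ 2 := by
      rw [← sq_abs (ρ - r)]; gcongr; exact hbox.1
    have i2 : (ρ - r) ^ 2 ≤ (1 + (r₁ / 2) ^ 2) * min 1 ((ρ - r) ^ 2) := by
      rcases min_cases 1 ((ρ - r) ^ 2) with ⟨h, -⟩ | ⟨h, -⟩ <;> rw [h]
      · linarith
      · linarith [mul_nonneg hr2 (sq_nonneg (ρ - r))]
    have i3 : (θ - ϑ) ^ 2 ≤ (1 + (r₁ / 2) ^ 2) * ((θ - ϑ) ^ 2 * (1 + θ ^ 2)) := by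
      have j1 : (θ - ϑ) ^ 2 ≤ (θ - ϑ) ^ 2 * (1 + θ ^ 2) := by
        linarith [mul_nonneg (sq_nonneg (θ - ϑ)) (sq_nonneg θ)]
      linarith [mul_nonneg hr2 hth]
    rw [mul_add] at hAE
    linarith
  · right
    -- Outside the box one of the two differences is bounded below, hence so is the relative energy.
    have hcm : c * m ≤ E := by
      refine le_trans ?_ h1
      gcongr
      rw [not_and_or, not_le, not_le] at hbox
      rcases hbox with h | h
      · have : m ≤ min 1 ((ρ - r) ^ 2) := by
          refine le_min hm1 (hm2.trans ?_)
          rw [← sq_abs (ρ - r)]; gcongr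
        linarith
      · have : m ≤ (θ - ϑ) ^ 2 := by
          refine hm3.trans ?_
          rw [← sq_abs (θ - ϑ)]; gcongr
        linarith [mul_nonneg (sq_nonneg (θ - ϑ)) (sq_nonneg θ)]
    have i1 : d * (1 + ρ ^ (5 / 3 : ℝ) + θ ^ 4) ≤ E + (D + d) := by linarith
    have i2 : D + d ≤ (D + d) / (c * m) * E := by
      rw [div_mul_eq_mul_div, le_div_iff₀ (by positivity)]
      gcongr
    have i3 : 1 + ρ ^ (5 / 3 : ℝ) + θ ^ 4 ≤ B * E := by
      calc _ = (1 / d) * (d * (1 + ρ ^ (5 / 3 : ℝ) + θ ^ 4)) := by field_simp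
        _ ≤ (1 / d) * (E + (D + d) / (c * m) * E) := by gcongr; linarith
        _ = B * E := by rw [hB]; ring
    have : 0 ≤ A * E := by positivity
    linarith

theorem isStateBox_Icc {r₁ r₂ θ₁ θ₂ : ℝ} (hr₁ : 0 < r₁) (hθ₁ : 0 < θ₁) :
    IsStateBox (Icc r₁ r₂ ×ˢ Icc θ₁ θ₂) where
  compact := isCompact_Icc.prod isCompact_Icc
  convex := (convex_Icc _ _).prod (convex_Icc _ _)
  subset _ hy := ⟨hr₁.trans_le hy.1.1, hθ₁.trans_le hy.2.1⟩

theorem mem_enlarged_box {r₁ r₂ θ₁ θ₂ r ϑ ρ θ : ℝ} (hr : r ∈ Icc r₁ r₂) (hϑ : ϑ ∈ Icc θ₁ θ₂)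
    (h₁ : |ρ - r| ≤ r₁ / 2) (h₂ : |θ - ϑ| ≤ θ₁ / 2) :
    (ρ, θ) ∈ Icc (r₁ / 2) (r₂ + r₁ / 2) ×ˢ Icc (θ₁ / 2) (θ₂ + θ₁ / 2) := by
  rw [abs_le] at h₁ h₂
  exact ⟨⟨by linarith [hr.1], by linarith [hr.2]⟩, ⟨by linarith [hϑ.1], by linarith [hϑ.2]⟩⟩

theorem norm_sub_sq_le (ρ θ r ϑ : ℝ) : ‖(ρ, θ) - (r, ϑ)‖ ^ 2 ≤ (ρ - r) ^ 2 + (θ - ϑ) ^ 2 := by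
  rw [Prod.mk_sub_mk, Prod.norm_mk, Real.norm_eq_abs, Real.norm_eq_abs]
  rcases max_cases |ρ - r| |θ - ϑ| with ⟨h, -⟩ | ⟨h, -⟩ <;> rw [h, sq_abs] <;>
    nlinarith [sq_nonneg (ρ - r), sq_nonneg (θ - ϑ)]

/-- The first order Taylor remainder at a positive state is controlled by the relative energy. -/
theorem Admissible.exists_taylor_bound (hM : M.Admissible) {r₁ r₂ θ₁ θ₂ : ℝ} (hr₁ : 0 < r₁)
    (hθ₁ : 0 < θ₁) {F f₁ f₂ : ℝ × ℝ → ℝ}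
    (hF : ∀ y ∈ quadrant, HasFDerivAt F (f₁ y • ContinuousLinearMap.fst ℝ ℝ ℝ
      + f₂ y • ContinuousLinearMap.snd ℝ ℝ ℝ) y)
    (hl : ∀ K, IsStateBox K → (∃ C, LipschitzOnWith C f₁ K) ∧ ∃ C, LipschitzOnWith C f₂ K)
    (hg : ∃ C : ℝ, ∀ ρ θ, 0 ≤ ρ → 0 < θ → |F (ρ, θ)| ≤ C * (1 + ρ ^ (5 / 3 : ℝ) + θ ^ 4)) :
    ∃ C : ℝ, 0 < C ∧ ∀ r ∈ Icc r₁ r₂, ∀ ϑ ∈ Icc θ₁ θ₂, ∀ ρ θ, 0 ≤ ρ → 0 < θ →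
      |F (ρ, θ) - F (r, ϑ) - f₁ (r, ϑ) * (ρ - r) - f₂ (r, ϑ) * (θ - ϑ)|
        ≤ C * M.relEnergy r ϑ ρ θ := by
  obtain ⟨C, hC, hdi⟩ := hM.exists_dichotomy (r₂ := r₂) (θ₂ := θ₂) hr₁ hθ₁
  have hK := isStateBox_Icc (r₂ := r₂ + r₁ / 2) (θ₂ := θ₂ + θ₁ / 2) (half_pos hr₁) (half_pos hθ₁)
  have hK' := isStateBox_Icc (r₂ := r₂) (θ₂ := θ₂) hr₁ hθ₁
  obtain ⟨⟨L₁, h₁⟩, ⟨L₂, h₂⟩⟩ := hl _ hK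
  obtain ⟨⟨L₁', h₁'⟩, ⟨L₂', h₂'⟩⟩ := hl _ hK'
  obtain ⟨B₁, hB₁⟩ := hK'.compact.exists_bound_of_continuousOn h₁'.continuousOn
  obtain ⟨B₂, hB₂⟩ := hK'.compact.exists_bound_of_continuousOn h₂'.continuousOn
  obtain ⟨G₀, hG₀⟩ := hg
  set G := |G₀|
  set b₁ := |B₁|
  set b₂ := |B₂|
  have hG : 0 ≤ G := abs_nonneg _
  have hb₁ : 0 ≤ b₁ := abs_nonneg _
  have hb₂ : 0 ≤ b₂ := abs_nonneg _
  set N := G + G * (1 + |r₂| ^ (5 / 3 : ℝ) + |θ₂| ^ 4) + b₁ * (1 + |r₂|) + b₂ * (1 + |θ₂|)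
  have hN : 0 ≤ N := by positivity
  refine ⟨(L₁ + L₂) * C + N * C + 1, by positivity, fun r hr ϑ hϑ ρ θ hρ hθ => ?_⟩
  have hr0 : 0 < r := hr₁.trans_le hr.1
  have hϑ0 : 0 < ϑ := hθ₁.trans_le hϑ.1
  obtain ⟨hE, -, h | h⟩ := hdi r hr ϑ hϑ ρ θ hρ hθ
  · obtain ⟨k1, k2, k3⟩ := h
    have hmem := mem_enlarged_box hr hϑ k1 k2
    have hmem' : (r, ϑ) ∈ Icc (r₁ / 2) (r₂ + r₁ / 2) ×ˢ Icc (θ₁ / 2) (θ₂ + θ₁ / 2) :=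
      mem_enlarged_box hr hϑ (by simp; positivity) (by simp; positivity)
    have := abs_sub_sub_le_of_lipschitz hK.convex (fun y hy => hF y (hK.subset hy)) h₁ h₂ hmem' hmem
    refine this.trans ?_
    calc ((L₁ : ℝ) + L₂) * ‖(ρ, θ) - (r, ϑ)‖ ^ 2 ≤ (L₁ + L₂) * (C * M.relEnergy r ϑ ρ θ) := by
          gcongr
          exact (norm_sub_sq_le ρ θ r ϑ).trans k3
      _ ≤ _ := by
          have : 0 ≤ N * C * M.relEnergy r ϑ ρ θ := by positivity
          nlinarith
  -- Away from the reference state no cancellation is needed: each of the four terms is at most a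
  -- multiple of X, which the relative energy controls.
  · set X := 1 + ρ ^ (5 / 3 : ℝ) + θ ^ 4 with hX
    have x1 : 0 ≤ ρ ^ (5 / 3 : ℝ) := by positivity
    have x2 : 0 ≤ θ ^ 4 := by positivity
    have hX1 : 1 ≤ X := by linarith
    have hX0 : 0 ≤ X := by linarith
    have i1 : |F (ρ, θ)| ≤ G * X := (hG₀ ρ θ hρ hθ).trans (by gcongr; exact le_abs_self _)
    have i2 : |F (r, ϑ)| ≤ G * (1 + |r₂| ^ (5 / 3 : ℝ) + |θ₂| ^ 4) * X := by
      refine (hG₀ r ϑ hr0.le hϑ0).trans ?_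
      calc G₀ * (1 + r ^ (5 / 3 : ℝ) + ϑ ^ 4)
          ≤ G * (1 + |r₂| ^ (5 / 3 : ℝ) + |θ₂| ^ 4) := by
            gcongr
            · exact le_abs_self _
            · exact hr.2.trans (le_abs_self _)
            · exact hϑ.2.trans (le_abs_self _)
        _ ≤ _ := le_mul_of_one_le_right (by positivity) hX1
    have i3 : |f₁ (r, ϑ) * (ρ - r)| ≤ b₁ * (1 + |r₂|) * X := by
      rw [abs_mul, mul_assoc]
      refine mul_le_mul ((hB₁ _ ⟨hr, hϑ⟩).trans (le_abs_self _)) ?_ (abs_nonneg _) hb₁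
      have j1 := le_one_add_rpow hρ
      have j2 : r ≤ |r₂| := hr.2.trans (le_abs_self _)
      have j3 : |ρ - r| ≤ ρ + r := by
        rw [abs_le]; constructor <;> linarith
      have j4 : |r₂| ≤ |r₂| * X := le_mul_of_one_le_right (abs_nonneg _) hX1
      nlinarith
    have i4 : |f₂ (r, ϑ) * (θ - ϑ)| ≤ b₂ * (1 + |θ₂|) * X := by
      rw [abs_mul, mul_assoc]
      refine mul_le_mul ((hB₂ _ ⟨hr, hϑ⟩).trans (le_abs_self _)) ?_ (abs_nonneg _) hb₂
      have j1 := le_one_add_pow_four θ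
      have j2 : ϑ ≤ |θ₂| := hϑ.2.trans (le_abs_self _)
      have j3 : |θ - ϑ| ≤ θ + ϑ := by
        rw [abs_le]; constructor <;> linarith
      have j4 : |θ₂| ≤ |θ₂| * X := le_mul_of_one_le_right (abs_nonneg _) hX1
      nlinarith
    have i5 : |F (ρ, θ) - F (r, ϑ) - f₁ (r, ϑ) * (ρ - r) - f₂ (r, ϑ) * (θ - ϑ)| ≤ N * X := by
      have t1 := abs_sub (F (ρ, θ) - F (r, ϑ) - f₁ (r, ϑ) * (ρ - r)) (f₂ (r, ϑ) * (θ - ϑ))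
      have t2 := abs_sub (F (ρ, θ) - F (r, ϑ)) (f₁ (r, ϑ) * (ρ - r))
      have t3 := abs_sub (F (ρ, θ)) (F (r, ϑ))
      have : N * X = G * X + G * (1 + |r₂| ^ (5 / 3 : ℝ) + |θ₂| ^ 4) * X + b₁ * (1 + |r₂|) * X
        + b₂ * (1 + |θ₂|) * X := by simp only [N]; ring
      linarith
    refine i5.trans ((mul_le_mul_of_nonneg_left h hN).trans ?_)
    have : 0 ≤ ((L₁ : ℝ) + L₂) * C * M.relEnergy r ϑ ρ θ := by positivity
    nlinarith

theorem Admissible.exists_pressure_taylor (hM : M.Admissible) {r₁ r₂ θ₁ θ₂ : ℝ} (hr₁ : 0 < r₁)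
    (hθ₁ : 0 < θ₁) :
    ∃ C : ℝ, 0 < C ∧ ∀ r ∈ Icc r₁ r₂, ∀ ϑ ∈ Icc θ₁ θ₂, ∀ ρ θ, 0 ≤ ρ → 0 < θ →
      |M.pressure ρ θ - M.pressure r ϑ - M.pressureRho r ϑ * (ρ - r)
        - M.pressureTheta r ϑ * (θ - ϑ)| ≤ C * M.relEnergy r ϑ ρ θ := by
  refine hM.exists_taylor_bound hr₁ hθ₁ (F := fun y => M.pressure y.1 y.2)
    (f₁ := fun y => M.pressureRho y.1 y.2) (f₂ := fun y => M.pressureTheta y.1 y.2)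
    (fun y hy => hasFDerivAt_pressure hM hy.1 hy.2)
    (fun K hK => hM.exists_lipschitz_pressure_derivs hK) ?_
  obtain ⟨C, -, h⟩ := hM.exists_pressure_upper
  refine ⟨C, fun ρ θ hρ hθ => ?_⟩
  rw [abs_of_nonneg (hM.pressure_nonneg hρ hθ)]
  exact h ρ θ hρ hθ

theorem sqrt_mul_sqrt_le {ρ θ : ℝ} (hρ : 0 ≤ ρ) (hθ : 0 < θ) :
    √ρ * √(√θ ^ 3) ≤ ρ + 1 + θ ^ 3 := by
  have j1 := Real.sq_sqrt hρ
  have j2 := Real.sq_sqrt (show 0 ≤ √θ ^ 3 by positivity)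
  have j3 := sqrt_pow_three_le hθ
  nlinarith [sq_nonneg (√ρ - √(√θ ^ 3)), Real.sqrt_nonneg ρ, Real.sqrt_nonneg (√θ ^ 3)]

theorem Admissible.exists_entropy_taylor (hM : M.Admissible) {r₁ r₂ θ₁ θ₂ : ℝ} (hr₁ : 0 < r₁)
    (hθ₁ : 0 < θ₁) :
    ∃ C : ℝ, 0 < C ∧ ∀ r ∈ Icc r₁ r₂, ∀ ϑ ∈ Icc θ₁ θ₂, ∀ ρ θ, 0 ≤ ρ → 0 < θ →
      |M.entropyDensity ρ θ - M.entropyDensity r ϑ - M.entropyRho r ϑ * (ρ - r)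
        - M.entropyTheta r ϑ * (θ - ϑ)| ≤ C * M.relEnergy r ϑ ρ θ := by
  refine hM.exists_taylor_bound hr₁ hθ₁ (F := fun y => M.entropyDensity y.1 y.2)
    (f₁ := fun y => M.entropyRho y.1 y.2) (f₂ := fun y => M.entropyTheta y.1 y.2)
    (fun y hy => hasFDerivAt_entropyDensity hM hy.1 hy.2)
    (fun K hK => hM.exists_lipschitz_entropy_derivs hK) ?_
  obtain ⟨C, hC, h⟩ := hM.exists_entropyDensity_upper
  refine ⟨C * 5, fun ρ θ hρ hθ => ?_⟩
  rw [abs_of_nonneg (hM.entropyDensity_nonneg hρ hθ), mul_assoc]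
  refine (h ρ θ hρ hθ).trans (mul_le_mul_of_nonneg_left ?_ hC.le)
  have := sqrt_mul_sqrt_le hρ hθ
  have := pow_three_le hθ.le
  have := le_one_add_rpow hρ
  have : 0 ≤ ρ ^ (5 / 3 : ℝ) := by positivity
  have : 0 ≤ θ ^ 4 := by positivity
  linarith

theorem mul_le_sq_add {x y δ : ℝ} (hδ : 0 < δ) : x * y ≤ 1 / (4 * δ) * x ^ 2 + δ * y ^ 2 := by
  have h : 1 / (4 * δ) * x ^ 2 + δ * y ^ 2 - x * y = δ * (y - x / (2 * δ)) ^ 2 := by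
    field_simp
    ring
  have : 0 ≤ δ * (y - x / (2 * δ)) ^ 2 := by positivity
  linarith

/-- Near the reference state this is Young's inequality. Far from it, ρy ≤ ρ + ρy², where ρ is
controlled by the relative energy, and ry is split by Young's inequality with r² bounded by a
multiple of the relative energy. -/
theorem Admissible.exists_density_flux_bound (hM : M.Admissible) {r₁ r₂ θ₁ θ₂ : ℝ} (hr₁ : 0 < r₁)
    (hθ₁ : 0 < θ₁) {δ : ℝ} (hδ : 0 < δ) :
    ∃ C : ℝ, 0 < C ∧ ∀ r ∈ Icc r₁ r₂, ∀ ϑ ∈ Icc θ₁ θ₂, ∀ ρ θ y, 0 ≤ ρ → 0 < θ → 0 ≤ y →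
      |ρ - r| * y ≤ C * (M.relEnergy r ϑ ρ θ + ρ * y ^ 2) + δ * y ^ 2 := by
  obtain ⟨C, hC, hdi⟩ := hM.exists_dichotomy (r₂ := r₂) (θ₂ := θ₂) hr₁ hθ₁
  refine ⟨1 / (4 * δ) * C + (1 / (4 * δ) * r₂ ^ 2 + 1) * C + 1, by positivity,
    fun r hr ϑ hϑ ρ θ y hρ hθ hy => ?_⟩
  have hr0 : 0 < r := hr₁.trans_le hr.1
  obtain ⟨hE, -, h | h⟩ := hdi r hr ϑ hϑ ρ θ hρ hθ
  · obtain ⟨-, -, k3⟩ := h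
    have h1 := mul_le_sq_add (x := |ρ - r|) (y := y) hδ
    rw [sq_abs] at h1
    have h2 : 1 / (4 * δ) * (ρ - r) ^ 2 ≤ 1 / (4 * δ) * (C * M.relEnergy r ϑ ρ θ) := by
      gcongr
      linarith [sq_nonneg (θ - ϑ)]
    have h3 : 0 ≤ ((1 / (4 * δ) * r₂ ^ 2 + 1) * C + 1) * M.relEnergy r ϑ ρ θ := by positivity
    have h4 : 0 ≤ (1 / (4 * δ) * C + (1 / (4 * δ) * r₂ ^ 2 + 1) * C + 1) * (ρ * y ^ 2) := by
      positivity
    linarith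
  · have h1 := mul_le_sq_add (x := r) (y := y) hδ
    have h2 : |ρ - r| ≤ ρ + r := by rw [abs_le]; constructor <;> linarith
    have h3 := mul_le_mul_of_nonneg_right h2 hy
    have h4 : ρ * y ≤ ρ + ρ * y ^ 2 := by
      nlinarith [mul_nonneg hρ (sq_nonneg (y - 1)), mul_nonneg hρ (sq_nonneg y)]
    have h5 : ρ ≤ C * M.relEnergy r ϑ ρ θ := by
      have := le_one_add_rpow hρ
      have : 0 ≤ θ ^ 4 := by positivity
      linarith
    have h6 : 1 ≤ C * M.relEnergy r ϑ ρ θ := by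
      have : 0 ≤ ρ ^ (5 / 3 : ℝ) := by positivity
      have : 0 ≤ θ ^ 4 := by positivity
      linarith
    have h7 : 1 / (4 * δ) * r ^ 2 ≤ 1 / (4 * δ) * r₂ ^ 2 * (C * M.relEnergy r ϑ ρ θ) := by
      calc _ ≤ 1 / (4 * δ) * r₂ ^ 2 := by gcongr; exact hr.2
        _ ≤ _ := le_mul_of_one_le_right (by positivity) h6
    have h8 : 0 ≤ (1 / (4 * δ) * C + 1) * M.relEnergy r ϑ ρ θ := by positivity
    have h9 : 0 ≤ (1 / (4 * δ) * C + (1 / (4 * δ) * r₂ ^ 2 + 1) * C) * (ρ * y ^ 2) := by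
      positivity
    nlinarith

/-- Near the reference state the entropy difference is Lipschitz. Far from it the density parts are
handled through ρy², but the radiative part θ³y cannot be controlled by energy alone. Its excess
forces the weight θ²y² on the right, to be absorbed by viscosity. -/
theorem Admissible.exists_entropy_flux_bound (hM : M.Admissible) {r₁ r₂ θ₁ θ₂ : ℝ} (hr₁ : 0 < r₁)
    (hθ₁ : 0 < θ₁) {δ : ℝ} (hδ : 0 < δ) :
    ∃ C : ℝ, 0 < C ∧ ∀ r ∈ Icc r₁ r₂, ∀ ϑ ∈ Icc θ₁ θ₂, ∀ ρ θ y, 0 ≤ ρ → 0 < θ → 0 ≤ y →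
      |M.entropyDensity ρ θ - ρ * (M.entropyDensity r ϑ / r)| * y
        ≤ C * (M.relEnergy r ϑ ρ θ + ρ * y ^ 2) + δ * ((1 + θ ^ 2) * y ^ 2) := by
  obtain ⟨C, hC, hdi⟩ := hM.exists_dichotomy (r₂ := r₂) (θ₂ := θ₂) hr₁ hθ₁
  have hK := isStateBox_Icc (r₂ := r₂ + r₁ / 2) (θ₂ := θ₂ + θ₁ / 2) (half_pos hr₁) (half_pos hθ₁)
  have hK' := isStateBox_Icc (r₂ := r₂) (θ₂ := θ₂) hr₁ hθ₁
  obtain ⟨L, hL⟩ := hK.exists_lipschitz hM.contDiffOn_entropyDensity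
  obtain ⟨B₀, hB₀⟩ := hK'.compact.exists_bound_of_continuousOn
    (hM.contDiffOn_entropyDensity.continuousOn.mono hK'.subset)
  obtain ⟨D, hD, hup⟩ := hM.exists_entropyDensity_upper
  set B := |B₀| / r₁
  have hB : 0 ≤ B := by positivity
  obtain ⟨A, hA⟩ : ∃ A, A = 2 * ((L : ℝ) + B) ^ 2 / (4 * δ) * C := ⟨_, rfl⟩
  obtain ⟨R, hR⟩ : ∃ R, R = (D + B + D) * C + 2 * D * C + D ^ 2 / (4 * δ) * C + (2 * D + B) :=
    ⟨_, rfl⟩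
  have hA0 : 0 ≤ A := by rw [hA]; positivity
  have hR0 : 0 < R := by rw [hR]; positivity
  refine ⟨A + R, by positivity, fun r hr ϑ hϑ ρ θ y hρ hθ hy => ?_⟩
  have hr0 : 0 < r := hr₁.trans_le hr.1
  have hϑ0 : 0 < ϑ := hθ₁.trans_le hϑ.1
  have hs0 : 0 ≤ M.entropyDensity r ϑ / r := div_nonneg (hM.entropyDensity_nonneg hr0.le hϑ0) hr0.le
  have hsB : M.entropyDensity r ϑ / r ≤ B := by
    refine div_le_div₀ (abs_nonneg _) ?_ hr₁ hr.1
    exact (le_abs_self _).trans ((hB₀ (r, ϑ) ⟨hr, hϑ⟩).trans (le_abs_self _))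
  have hy2 : 0 ≤ ρ * y ^ 2 := by positivity
  have hty : 0 ≤ θ ^ 2 * y ^ 2 := by positivity
  obtain ⟨hE, -, h | h⟩ := hdi r hr ϑ hϑ ρ θ hρ hθ
  · obtain ⟨k1, k2, k3⟩ := h
    have hmem := mem_enlarged_box hr hϑ k1 k2
    have hmem' : (r, ϑ) ∈ Icc (r₁ / 2) (r₂ + r₁ / 2) ×ˢ Icc (θ₁ / 2) (θ₂ + θ₁ / 2) :=
      mem_enlarged_box hr hϑ (by simp; positivity) (by simp; positivity)
    have h1 := hL.dist_le_mul _ hmem _ hmem'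
    rw [Real.dist_eq, dist_eq_norm] at h1
    simp only at h1
    set n := ‖(ρ, θ) - (r, ϑ)‖ with hn
    have hn0 : 0 ≤ n := norm_nonneg _
    have hnr : |ρ - r| ≤ n := by
      rw [hn, Prod.mk_sub_mk, Prod.norm_mk, Real.norm_eq_abs]; exact le_max_left _ _
    have h2 : |M.entropyDensity ρ θ - ρ * (M.entropyDensity r ϑ / r)| ≤ (L + B) * n := by
      have e : M.entropyDensity ρ θ - ρ * (M.entropyDensity r ϑ / r)
          = (M.entropyDensity ρ θ - M.entropyDensity r ϑ)
            - (ρ - r) * (M.entropyDensity r ϑ / r) := by field_simp; ring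
      rw [e]
      refine (abs_sub _ _).trans ?_
      rw [abs_mul, abs_of_nonneg hs0]
      have := mul_le_mul hnr hsB hs0 hn0
      linarith
    have h3 := mul_le_mul_of_nonneg_right h2 hy
    have h4 := mul_le_sq_add (x := (L + B) * n) (y := y) hδ
    have h5 : 1 / (4 * δ) * ((L + B) * n) ^ 2 ≤ A * M.relEnergy r ϑ ρ θ := by
      have hnn := (norm_sub_sq_le ρ θ r ϑ).trans k3
      calc 1 / (4 * δ) * ((L + B) * n) ^ 2 = ((L : ℝ) + B) ^ 2 / (4 * δ) * n ^ 2 := by ring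
        _ ≤ ((L : ℝ) + B) ^ 2 / (4 * δ) * (C * M.relEnergy r ϑ ρ θ) := by gcongr
        _ ≤ 2 * (((L : ℝ) + B) ^ 2 / (4 * δ) * (C * M.relEnergy r ϑ ρ θ)) := by
            have : 0 ≤ ((L : ℝ) + B) ^ 2 / (4 * δ) * (C * M.relEnergy r ϑ ρ θ) := by positivity
            linarith
        _ = _ := by rw [hA]; ring
    have h6 : 0 ≤ R * M.relEnergy r ϑ ρ θ := by positivity
    have h7 : 0 ≤ (A + R) * (ρ * y ^ 2) := by positivity
    linarith [mul_nonneg hδ.le hty]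
  · have x1 : 0 ≤ ρ ^ (5 / 3 : ℝ) := by positivity
    have x2 : 0 ≤ θ ^ 4 := by positivity
    generalize M.relEnergy r ϑ ρ θ = E at h hE ⊢
    have hρE : ρ ≤ C * E := by linarith [le_one_add_rpow hρ]
    have hθE : θ ^ 4 ≤ C * E := by linarith
    have hsE : √θ ^ 3 ≤ 2 * (C * E) := by
      linarith [sqrt_pow_three_le hθ, pow_three_le hθ.le]
    have h1 : |M.entropyDensity ρ θ - ρ * (M.entropyDensity r ϑ / r)|
        ≤ D * (ρ + √ρ * √(√θ ^ 3) + θ ^ 3) + ρ * B := by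
      refine (abs_sub _ _).trans ?_
      rw [abs_of_nonneg (hM.entropyDensity_nonneg hρ hθ), abs_of_nonneg (mul_nonneg hρ hs0)]
      exact add_le_add (hup ρ θ hρ hθ) (mul_le_mul_of_nonneg_left hsB hρ)
    have h2 := mul_le_mul_of_nonneg_right h1 hy
    have h4 : ρ * y ≤ ρ + ρ * y ^ 2 := by
      nlinarith [mul_nonneg hρ (sq_nonneg (y - 1)), mul_nonneg hρ (sq_nonneg y)]
    have h5 : √ρ * √(√θ ^ 3) * y ≤ √θ ^ 3 + ρ * y ^ 2 := by
      have j1 := Real.sq_sqrt hρ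
      have j2 := Real.sq_sqrt (show 0 ≤ √θ ^ 3 by positivity)
      have j3 : 0 ≤ √ρ * √(√θ ^ 3) * y := by positivity
      have j4 := sq_nonneg (√ρ * y - √(√θ ^ 3))
      have e : (√ρ * y - √(√θ ^ 3)) ^ 2
          = √ρ ^ 2 * y ^ 2 + √(√θ ^ 3) ^ 2 - 2 * (√ρ * √(√θ ^ 3) * y) := by ring
      rw [e, j1, j2] at j4
      linarith
    -- The critical splitting θ³y = θ² · (θy).
    have h6 : D * θ ^ 3 * y ≤ D ^ 2 / (4 * δ) * θ ^ 4 + δ * (θ ^ 2 * y ^ 2) := by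
      have := mul_le_sq_add (x := D * θ ^ 2) (y := θ * y) hδ
      calc D * θ ^ 3 * y = D * θ ^ 2 * (θ * y) := by ring
        _ ≤ _ := this
        _ = _ := by ring
    have h7 : D ^ 2 / (4 * δ) * θ ^ 4 ≤ D ^ 2 / (4 * δ) * (C * E) := by gcongr
    have h8 : (D + B) * (ρ * y) ≤ (D + B) * (C * E + ρ * y ^ 2) :=
      mul_le_mul_of_nonneg_left (by linarith) (by positivity)
    have h9 : D * (√ρ * √(√θ ^ 3) * y) ≤ D * (2 * (C * E) + ρ * y ^ 2) :=
      mul_le_mul_of_nonneg_left (by linarith) hD.le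
    have e1 : (D * (ρ + √ρ * √(√θ ^ 3) + θ ^ 3) + ρ * B) * y
        = (D + B) * (ρ * y) + D * (√ρ * √(√θ ^ 3) * y) + D * θ ^ 3 * y := by ring
    have e2 : (D + B) * (C * E + ρ * y ^ 2) + D * (2 * (C * E) + ρ * y ^ 2)
        + D ^ 2 / (4 * δ) * (C * E)
        = (R - (2 * D + B) - D * C) * E + (2 * D + B) * (ρ * y ^ 2) := by rw [hR]; ring
    have h10 : 0 ≤ (A + (2 * D + B) + D * C) * E := by positivity
    have h11 : 0 ≤ (A + (R - (2 * D + B))) * (ρ * y ^ 2) := by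
      have : 0 ≤ R - (2 * D + B) := by
        have : 0 ≤ (D + B + D) * C + 2 * D * C + D ^ 2 / (4 * δ) * C := by positivity
        linarith
      positivity
    have h12 : 0 ≤ δ * y ^ 2 := by positivity
    rw [e1] at h2
    linarith

end Model

/-! ### Pointwise identities -/

/-- The values at one point of space-time of a classical solution and of its derivatives. -/
structure PointData where
  r : ℝ
  ϑ : ℝ
  U : V3
  K : V3
  rt : ℝ
  ϑt : ℝ
  Ut : V3
  Kt : V3
  gr : V3
  gϑ : V3
  A : Fin 3 → Fin 3 → ℝ
  B : Fin 3 → Fin 3 → ℝ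
  dS : V3
  Q : ℝ

namespace PointData

variable (M : Model) (D : PointData)

/-- The gradient of the pressure. -/
noncomputable def gradP : V3 := fun j =>
  M.pressureRho D.r D.ϑ * D.gr j + M.pressureTheta D.r D.ϑ * D.gϑ j

/-- The time derivative of the pressure. -/
noncomputable def dtP : ℝ := M.pressureRho D.r D.ϑ * D.rt + M.pressureTheta D.r D.ϑ * D.ϑt

/-- The specific entropy. -/
noncomputable def spec : ℝ := M.entropyDensity D.r D.ϑ / D.r

/-- The equations of motion in nonconservative form. -/
structure Eqs : Prop where
  mass : D.rt + D.U ⬝ᵥ D.gr + D.r * tr D.A = 0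
  momentum : ∀ i, D.r * (D.Ut i + ∑ j, D.U j * D.A i j) + D.gradP M i
    = D.dS i + crossProduct (curlOf D.B) D.K i
  entropy : M.entropyTheta D.r D.ϑ * (D.ϑt + D.U ⬝ᵥ D.gϑ) + M.pressureTheta D.r D.ϑ * tr D.A + D.Q
    = M.production D.ϑ D.A D.gϑ

/-- The mechanical part of the remainder. -/
noncomputable def mechanical (ρ θ : ℝ) (u : V3) : ℝ :=
  -(M.entropyDensity ρ θ * D.ϑt + M.entropyDensity ρ θ * (u ⬝ᵥ D.gϑ))
    + (ρ * (D.U ⬝ᵥ D.Ut - (D.dtP M / D.r - D.spec M * D.ϑt))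
      + ρ * (u ⬝ᵥ fun j => ∑ i, D.U i * D.A i j - (D.gradP M j / D.r - D.spec M * D.gϑ j)))
    - (ρ * (u ⬝ᵥ D.Ut) + ddot (fun i j => ρ * u i * u j) D.A + M.pressure ρ θ * tr D.A)
    + D.dtP M

/-- The added bracket is div(PU), which integrates to zero. The classical equations and the Maxwell
relation complete the linear parts of pressure and entropy to first order Taylor polynomials,
leaving their remainders. The force and entropy production terms that survive are later paired with
viscosity, heat conduction and the Lorentz force. -/
theorem mechanical_eq (h : D.Eqs M) (hr : 0 < D.r) (hϑ : 0 < D.ϑ) (ρ θ : ℝ) (u : V3) :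
    D.mechanical M ρ θ u + (D.U ⬝ᵥ D.gradP M + M.pressure D.r D.ϑ * tr D.A)
      = -(ρ * ddot (fun i j => (u i - D.U i) * (u j - D.U j)) D.A)
        - (M.pressure ρ θ - M.pressure D.r D.ϑ - M.pressureRho D.r D.ϑ * (ρ - D.r)
          - M.pressureTheta D.r D.ϑ * (θ - D.ϑ)) * tr D.A
        - (M.entropyDensity ρ θ - M.entropyDensity D.r D.ϑ - M.entropyRho D.r D.ϑ * (ρ - D.r)
          - M.entropyTheta D.r D.ϑ * (θ - D.ϑ)) * (D.ϑt + D.U ⬝ᵥ D.gϑ)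
        - (M.entropyDensity ρ θ - ρ * D.spec M) * ((u - D.U) ⬝ᵥ D.gϑ)
        - ρ / D.r * ((u - D.U) ⬝ᵥ (D.dS + crossProduct (curlOf D.B) D.K))
        - (θ - D.ϑ) * (M.production D.ϑ D.A D.gϑ - D.Q) := by
  have hmx := Model.maxwell (M := M) hr hϑ
  obtain ⟨h1, h2, h3⟩ := h
  -- The Maxwell relation eliminates the entropy, the mass balance eliminates ∂_t r, and the
  -- momentum and entropy equations eliminate force and production. What is left is a rational
  -- identity in independent quantities.
  have hσ : M.entropyDensity D.r D.ϑ = D.r * M.entropyRho D.r D.ϑ + M.pressureTheta D.r D.ϑ := by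
    linarith
  have hs : D.spec M = M.entropyRho D.r D.ϑ + M.pressureTheta D.r D.ϑ / D.r := by
    rw [spec, hσ]; field_simp
  have hrt : D.rt = -(D.U ⬝ᵥ D.gr) - D.r * tr D.A := by linarith
  have hL : ∀ i, (D.dS + crossProduct (curlOf D.B) D.K) i
      = D.r * (D.Ut i + ∑ j, D.U j * D.A i j) + D.gradP M i := fun i => by
    rw [h2 i]; rfl
  have hL' : (D.dS + crossProduct (curlOf D.B) D.K)
      = fun i => D.r * (D.Ut i + ∑ j, D.U j * D.A i j) + D.gradP M i := funext hL
  rw [hL', ← h3, mechanical, hs, hσ, dtP, hrt]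
  simp only [gradP, dotProduct, Fin.sum_univ_three, ddot, tr, Pi.sub_apply]
  generalize M.entropyDensity ρ θ = σ
  generalize M.pressure ρ θ = P
  generalize M.pressure D.r D.ϑ = P'
  generalize M.pressureRho D.r D.ϑ = Pr
  generalize M.pressureTheta D.r D.ϑ = Pt
  generalize M.entropyRho D.r D.ϑ = sr
  generalize M.entropyTheta D.r D.ϑ = st
  field_simp
  ring

/-- Pure algebra. The bracket added on the left is the weak form of the classical induction equation
tested with H − K; it makes the sum quadratic in the differences, apart from the Lorentz force at K.
-/
theorem magnetic_eq (u U H K J J' Kt : V3) (ν : ℝ) :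
    -(ν * (J ⬝ᵥ J)) - crossProduct J H ⬝ᵥ U
        - (H ⬝ᵥ Kt - (crossProduct H u + ν • J) ⬝ᵥ J') + K ⬝ᵥ Kt
        + ((H - K) ⬝ᵥ Kt - (J - J') ⬝ᵥ (crossProduct U K - ν • J'))
      = -(ν * ((J - J') ⬝ᵥ (J - J'))) + (J - J') ⬝ᵥ crossProduct U (H - K)
        + (u - U) ⬝ᵥ crossProduct J' (H - K) + (u - U) ⬝ᵥ crossProduct J' K := by
  simp only [dotProduct, Fin.sum_univ_three, cross_apply, Pi.sub_apply, Pi.add_apply,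
    Pi.smul_apply, smul_eq_mul, Matrix.cons_val_zero, Matrix.cons_val_one, Matrix.cons_val]
  ring

theorem stress_eq (hM : M.Admissible) {θ : ℝ} (hθ : 0 < θ) (A : Fin 3 → Fin 3 → ℝ) :
    M.stress θ A = fun i j => M.μ θ * devSym A i j := by
  funext i j
  simp only [Model.stress, devSym, hM.bulk_viscosity θ hθ]
  split_ifs <;> ring

theorem ddot_devSym (A B : Fin 3 → Fin 3 → ℝ) :
    ddot (devSym A) B = 1 / 2 * ddot (devSym A) (devSym B) := by
  simp only [ddot, devSym, tr, Fin.sum_univ_three]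
  simp
  ring

theorem ddot_stress (hM : M.Admissible) {θ : ℝ} (hθ : 0 < θ) (A B : Fin 3 → Fin 3 → ℝ) :
    ddot (M.stress θ A) B = 1 / 2 * M.μ θ * ddot (devSym A) (devSym B) := by
  rw [stress_eq M hM hθ, mul_right_comm, ← ddot_devSym]
  simp only [ddot, Finset.sum_mul]
  exact Finset.sum_congr rfl fun i _ => Finset.sum_congr rfl fun j _ => by ring

theorem devSym_sub (A B : Fin 3 → Fin 3 → ℝ) : devSym (A - B) = devSym A - devSym B := by
  funext i j
  simp only [devSym, tr, Pi.sub_apply, Finset.sum_sub_distrib]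
  split_ifs <;> ring

/-- The rearrangement groups heat conduction by the logarithmic gradients g/θ and g'/ϑ, and
viscosity by the traceless symmetric gradients, as the two dissipation estimates require. -/
theorem dissipation_eq (hM : M.Admissible) {θ ϑ : ℝ} (hθ : 0 < θ) (hϑ : 0 < ϑ)
    (A A' : Fin 3 → Fin 3 → ℝ) (g g' : V3) :
    ddot (M.stress θ A) A' + ddot (M.stress ϑ A') (A - A')
        - ϑ * M.production θ A g - (θ - ϑ) * M.production ϑ A' g'
        - (M.heatFlux θ g ⬝ᵥ g') / θ - (g - g') ⬝ᵥ ((1 / ϑ) • M.heatFlux ϑ g')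
      = 1 / 2 * ((M.μ θ + M.μ ϑ) * ddot (devSym A) (devSym A')
          - ϑ / θ * M.μ θ * ddot (devSym A) (devSym A)
          - θ / ϑ * M.μ ϑ * ddot (devSym A') (devSym A'))
        - (((1 / θ) • g - (1 / ϑ) • g') ⬝ᵥ
          ((ϑ * M.κ θ) • ((1 / θ) • g) - (θ * M.κ ϑ) • ((1 / ϑ) • g'))) := by
  have hc : ddot (devSym A') (devSym A) = ddot (devSym A) (devSym A') := by
    simp only [ddot]
    exact Finset.sum_congr rfl fun i _ => Finset.sum_congr rfl fun j _ => by ring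
  have e : ddot (devSym A') (devSym A - devSym A')
      = ddot (devSym A) (devSym A') - ddot (devSym A') (devSym A') := by
    rw [← hc]
    simp only [ddot, Pi.sub_apply, mul_sub, Finset.sum_sub_distrib]
  rw [Model.production, Model.production, ddot_stress M hM hθ, ddot_stress M hM hϑ,
    ddot_stress M hM hθ, ddot_stress M hM hϑ, devSym_sub, e]
  simp only [Model.heatFlux, dotProduct, Fin.sum_univ_three, Pi.sub_apply, Pi.smul_apply,
    smul_eq_mul]
  field_simp
  ring

end PointData

/-! ### Elementary inequalities and the dissipation estimates -/

theorem abs_dotProduct_le {v b : V3} {y N : ℝ} (hv : ∀ i, |v i| ≤ y) (hb : ∀ i, |b i| ≤ N) :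
    |v ⬝ᵥ b| ≤ 3 * N * y := by
  have hy : 0 ≤ y := (abs_nonneg _).trans (hv 0)
  calc |v ⬝ᵥ b| ≤ ∑ i, |v i * b i| := Finset.abs_sum_le_sum_abs _ _
    _ ≤ ∑ _i : Fin 3, y * N := Finset.sum_le_sum fun i _ => by
        rw [abs_mul]; exact mul_le_mul (hv i) (hb i) (abs_nonneg _) hy
    _ = 3 * N * y := by simp; ring

theorem abs_ddot_le {A B : Fin 3 → Fin 3 → ℝ} {y N : ℝ} (hA : ∀ i j, |A i j| ≤ y)
    (hB : ∀ i j, |B i j| ≤ N) : |ddot A B| ≤ 9 * N * y := by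
  have hy : 0 ≤ y := (abs_nonneg _).trans (hA 0 0)
  calc |ddot A B| ≤ ∑ i, |∑ j, A i j * B i j| := Finset.abs_sum_le_sum_abs _ _
    _ ≤ ∑ i : Fin 3, 3 * N * y := Finset.sum_le_sum fun i _ => abs_dotProduct_le (hA i) (hB i)
    _ = 9 * N * y := by simp; ring

theorem abs_tr_le {A : Fin 3 → Fin 3 → ℝ} {N : ℝ} (hA : ∀ i j, |A i j| ≤ N) :
    |tr A| ≤ 3 * N := by
  calc |tr A| ≤ ∑ i, |A i i| := Finset.abs_sum_le_sum_abs _ _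
    _ ≤ ∑ i : Fin 3, N := Finset.sum_le_sum fun i _ => hA i i
    _ = 3 * N := by simp

theorem abs_apply_le_sqrt_dotProduct (v : V3) (i : Fin 3) : |v i| ≤ √(v ⬝ᵥ v) := by
  rw [← Real.sqrt_sq_eq_abs]
  refine Real.sqrt_le_sqrt ?_
  rw [sq]
  exact Finset.single_le_sum (f := fun i => v i * v i) (fun i _ => mul_self_nonneg (v i))
    (Finset.mem_univ i)

theorem dotProduct_self_nonneg' (v : V3) : 0 ≤ v ⬝ᵥ v :=
  Finset.sum_nonneg fun i _ => mul_self_nonneg (v i)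

theorem ddot_self_nonneg (A : Fin 3 → Fin 3 → ℝ) : 0 ≤ ddot A A :=
  Finset.sum_nonneg fun i _ => Finset.sum_nonneg fun j _ => mul_self_nonneg (A i j)

theorem dotProduct_le_young (v w : V3) {δ : ℝ} (hδ : 0 < δ) :
    v ⬝ᵥ w ≤ δ * (v ⬝ᵥ v) + 1 / (4 * δ) * (w ⬝ᵥ w) := by
  simp only [dotProduct, Finset.mul_sum, ← Finset.sum_add_distrib]
  refine Finset.sum_le_sum fun i _ => ?_
  have := Model.mul_le_sq_add (x := w i) (y := v i) hδ
  linarith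

theorem ddot_le_young (v w : Fin 3 → Fin 3 → ℝ) {δ : ℝ} (hδ : 0 < δ) :
    ddot v w ≤ δ * ddot v v + 1 / (4 * δ) * ddot w w := by
  simp only [ddot, Finset.mul_sum, ← Finset.sum_add_distrib]
  refine Finset.sum_le_sum fun i _ => Finset.sum_le_sum fun j _ => ?_
  have := Model.mul_le_sq_add (x := w i j) (y := v i j) hδ
  linarith

theorem cross_dotProduct_self_le (a b : V3) :
    crossProduct a b ⬝ᵥ crossProduct a b ≤ (a ⬝ᵥ a) * (b ⬝ᵥ b) := by
  have h : (a ⬝ᵥ a) * (b ⬝ᵥ b) - crossProduct a b ⬝ᵥ crossProduct a b = (a ⬝ᵥ b) ^ 2 := by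
    simp only [dotProduct, Fin.sum_univ_three, cross_apply, Matrix.cons_val_zero,
      Matrix.cons_val_one, Matrix.cons_val]
    ring
  nlinarith [sq_nonneg (a ⬝ᵥ b)]

theorem dotProduct_self_le {a : V3} {N : ℝ} (h : ∀ i, |a i| ≤ N) : a ⬝ᵥ a ≤ 3 * N ^ 2 := by
  have := abs_dotProduct_le h h
  calc a ⬝ᵥ a ≤ |a ⬝ᵥ a| := le_abs_self _
    _ ≤ _ := this
    _ = _ := by ring

theorem abs_curlOf_le {B : Fin 3 → Fin 3 → ℝ} {N : ℝ} (h : ∀ i j, |B i j| ≤ N) (i : Fin 3) :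
    |curlOf B i| ≤ 2 * N := by
  have key : ∀ i j k l, |B i j - B k l| ≤ 2 * N := fun i j k l =>
    (abs_sub _ _).trans (by linarith [h i j, h k l])
  fin_cases i
  · exact key 2 1 1 2
  · exact key 0 2 2 0
  · exact key 1 0 0 1

theorem abs_devSym_le {A : Fin 3 → Fin 3 → ℝ} {N : ℝ} (h : ∀ i j, |A i j| ≤ N) (i j : Fin 3) :
    |devSym A i j| ≤ 4 * N := by
  have hN : 0 ≤ N := (abs_nonneg _).trans (h 0 0)
  have h1 : |if i = j then 2 / 3 * tr A else 0| ≤ 2 * N := by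
    split_ifs
    · rw [abs_mul]
      have := abs_tr_le h
      rw [abs_of_pos (by norm_num : (0 : ℝ) < 2 / 3)]
      linarith
    · simpa using hN
  calc |devSym A i j| ≤ |A i j + A j i| + |if i = j then 2 / 3 * tr A else 0| := abs_sub _ _
    _ ≤ (|A i j| + |A j i|) + 2 * N := add_le_add (abs_add_le _ _) h1
    _ ≤ _ := by linarith [h i j, h j i]

/-- The weight ϑ/θ would destroy coercivity for large θ if μ were bounded. The part of μ
proportional to θ cancels it and leaves −ϑ|d|² + (θ − ϑ) d:b with d = a − b, which Young's
inequality handles. The constant part of μ contributes a negative multiple of |ϑa − θb|². -/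
theorem Model.Admissible.exists_viscous_bound {M : Model} (hM : M.Admissible) {θ₁ N : ℝ}
    (hθ₁ : 0 < θ₁) : ∃ c C : ℝ, 0 < c ∧ 0 < C ∧ ∀ θ ϑ (A A' : Fin 3 → Fin 3 → ℝ), 0 < θ → θ₁ ≤ ϑ →
      (∀ i j, |A' i j| ≤ N) →
      1 / 2 * ((M.μ θ + M.μ ϑ) * ddot (devSym A) (devSym A')
          - ϑ / θ * M.μ θ * ddot (devSym A) (devSym A)
          - θ / ϑ * M.μ ϑ * ddot (devSym A') (devSym A'))
        ≤ C * (θ - ϑ) ^ 2 - c * ddot (devSym (A - A')) (devSym (A - A')) := by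
  obtain ⟨μ₀, μ₁, hμ₀, hμ₁, hμ⟩ := hM.viscosity
  refine ⟨μ₁ * θ₁ / 4, μ₁ / (4 * θ₁) * (144 * N ^ 2) + 1, by positivity, by positivity,
    fun θ ϑ A A' hθ hϑ hA => ?_⟩
  have hϑ0 : 0 < ϑ := hθ₁.trans_le hϑ
  rw [PointData.devSym_sub, hμ θ hθ, hμ ϑ hϑ0]
  set a := devSym A
  set b := devSym A'
  set d := a - b with hd
  have ha : a = b + d := by rw [hd]; abel
  have hbb : ddot b b ≤ 144 * N ^ 2 :=
    (le_abs_self _).trans ((abs_ddot_le (abs_devSym_le hA) (abs_devSym_le hA)).trans (by linarith))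
  have e1 : ddot a b = ddot b b + ddot d b := by
    rw [ha]; simp only [ddot, Pi.add_apply, add_mul, Finset.sum_add_distrib]
  have e2 : ddot a a = ddot b b + 2 * ddot d b + ddot d d := by
    rw [ha]
    simp only [ddot, Pi.add_apply, Finset.mul_sum, ← Finset.sum_add_distrib]
    exact Finset.sum_congr rfl fun i _ => Finset.sum_congr rfl fun j _ => by ring
  have hsq : 0 ≤ ddot (fun i j => ϑ * a i j - θ * b i j) (fun i j => ϑ * a i j - θ * b i j) :=
    ddot_self_nonneg _
  have e3 : ddot (fun i j => ϑ * a i j - θ * b i j) (fun i j => ϑ * a i j - θ * b i j)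
      = ϑ ^ 2 * ddot a a - 2 * ϑ * θ * ddot a b + θ ^ 2 * ddot b b := by
    simp only [ddot, Finset.mul_sum, ← Finset.sum_add_distrib, ← Finset.sum_sub_distrib]
    exact Finset.sum_congr rfl fun i _ => Finset.sum_congr rfl fun j _ => by ring
  have hy : (θ - ϑ) * ddot d b ≤ θ₁ / 2 * ddot d d
      + 1 / (4 * (θ₁ / 2)) * ((θ - ϑ) ^ 2 * ddot b b) := by
    have := ddot_le_young d (fun i j => (θ - ϑ) * b i j) (half_pos hθ₁)
    have e4 : ddot d (fun i j => (θ - ϑ) * b i j) = (θ - ϑ) * ddot d b := by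
      simp only [ddot, Finset.mul_sum]
      exact Finset.sum_congr rfl fun i _ => Finset.sum_congr rfl fun j _ => by ring
    have e5 : ddot (fun i j => (θ - ϑ) * b i j) (fun i j => (θ - ϑ) * b i j)
        = (θ - ϑ) ^ 2 * ddot b b := by
      simp only [ddot, Finset.mul_sum]
      exact Finset.sum_congr rfl fun i _ => Finset.sum_congr rfl fun j _ => by ring
    rwa [e4, e5] at this
  have hid : 1 / 2 * ((μ₀ + μ₁ * θ + (μ₀ + μ₁ * ϑ)) * ddot a b
      - ϑ / θ * (μ₀ + μ₁ * θ) * ddot a a - θ / ϑ * (μ₀ + μ₁ * ϑ) * ddot b b)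
      = -(μ₀ / (2 * θ * ϑ)) * (ϑ ^ 2 * ddot a a - 2 * ϑ * θ * ddot a b + θ ^ 2 * ddot b b)
        + μ₁ / 2 * ((θ - ϑ) * ddot d b - ϑ * ddot d d) := by
    rw [e1, e2]
    field_simp
    ring
  rw [hid, ← e3]
  have h1 : -(μ₀ / (2 * θ * ϑ)) * ddot (fun i j => ϑ * a i j - θ * b i j)
      (fun i j => ϑ * a i j - θ * b i j) ≤ 0 :=
    mul_nonpos_of_nonpos_of_nonneg (by rw [neg_nonpos]; positivity) hsq
  have h2 : θ₁ * ddot d d ≤ ϑ * ddot d d := mul_le_mul_of_nonneg_right hϑ (ddot_self_nonneg d)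
  have h3 : (θ - ϑ) ^ 2 * ddot b b ≤ (θ - ϑ) ^ 2 * (144 * N ^ 2) :=
    mul_le_mul_of_nonneg_left hbb (sq_nonneg _)
  have h4 : (θ - ϑ) * ddot d b - ϑ * ddot d d
      ≤ 1 / (4 * (θ₁ / 2)) * ((θ - ϑ) ^ 2 * (144 * N ^ 2)) - θ₁ / 2 * ddot d d := by
    have : 1 / (4 * (θ₁ / 2)) * ((θ - ϑ) ^ 2 * ddot b b)
      ≤ 1 / (4 * (θ₁ / 2)) * ((θ - ϑ) ^ 2 * (144 * N ^ 2)) := by gcongr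
    linarith
  have h5 := mul_le_mul_of_nonneg_left h4 (half_pos hμ₁).le
  have e6 : μ₁ / 2 * (1 / (4 * (θ₁ / 2)) * ((θ - ϑ) ^ 2 * (144 * N ^ 2))
      - θ₁ / 2 * ddot d d)
      = μ₁ / (4 * θ₁) * (144 * N ^ 2) * (θ - ϑ) ^ 2 - μ₁ * θ₁ / 4 * ddot d d := by
    field_simp
    ring
  rw [e6] at h5
  nlinarith [sq_nonneg (θ - ϑ)]

theorem one_add_pow_four_le {θ : ℝ} (hθ : 0 < θ) :
    (1 + θ) ^ 4 ≤ 8 * (1 + θ ^ 3) * (1 + θ ^ 2) := by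
  have h1 : (1 + θ) ^ 4 ≤ 8 * (1 + θ ^ 4) := by
    have i1 : (1 + θ) ^ 2 ≤ 2 * (1 + θ ^ 2) := by nlinarith [sq_nonneg (θ - 1)]
    have i2 : ((1 + θ) ^ 2) ^ 2 ≤ (2 * (1 + θ ^ 2)) ^ 2 := by gcongr
    nlinarith [sq_nonneg (θ ^ 2 - 1)]
  have h2 : θ ^ 4 ≤ θ ^ 2 + θ ^ 5 := by
    rcases le_or_gt θ 1 with h | h
    · have := pow_le_pow_of_le_one hθ.le h (show 2 ≤ 4 by norm_num)
      have : 0 < θ ^ 5 := by positivity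
      linarith
    · have := pow_le_pow_right₀ h.le (show 4 ≤ 5 by norm_num)
      have : 0 < θ ^ 2 := by positivity
      linarith
  have h3 : 0 < θ ^ 3 := by positivity
  linarith

theorem abs_conductivity_factor_le {κ₀ κ₂ κ₃ θ ϑ t : ℝ} (h0 : 0 < κ₀) (h2 : 0 < κ₂) (h3 : 0 < κ₃)
    (hθ : 0 < θ) (hϑ : 0 < ϑ) (ht : ϑ ≤ t) :
    |(-κ₀ + κ₂ * θ * ϑ + κ₃ * θ * ϑ * (θ + ϑ))|
      ≤ (κ₀ + κ₂ * t + κ₃ * t + κ₃ * t ^ 2) * (1 + θ) ^ 2 := by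
  have ht0 : 0 < t := hϑ.trans_le ht
  have j0 : (1 + θ) ^ 2 = 1 + 2 * θ + θ ^ 2 := by ring
  have j1 : θ ^ 2 ≤ (1 + θ) ^ 2 := by linarith
  have j2 : θ ≤ (1 + θ) ^ 2 := by linarith [sq_nonneg θ]
  have j3 : 1 ≤ (1 + θ) ^ 2 := by linarith [sq_nonneg θ]
  have i1 : κ₂ * θ * ϑ ≤ κ₂ * t * (1 + θ) ^ 2 := by
    calc κ₂ * θ * ϑ = κ₂ * ϑ * θ := by ring
      _ ≤ _ := by gcongr
  have i2 : κ₃ * θ * ϑ * (θ + ϑ) ≤ κ₃ * t * (1 + θ) ^ 2 + κ₃ * t ^ 2 * (1 + θ) ^ 2 := by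
    calc κ₃ * θ * ϑ * (θ + ϑ) = κ₃ * ϑ * θ ^ 2 + κ₃ * ϑ ^ 2 * θ := by ring
      _ ≤ κ₃ * t * (1 + θ) ^ 2 + κ₃ * t ^ 2 * (1 + θ) ^ 2 := by gcongr
  have i3 : κ₀ ≤ κ₀ * (1 + θ) ^ 2 := le_mul_of_one_le_right h0.le j3
  have i4 : 0 ≤ κ₂ * θ * ϑ := by positivity
  have i5 : 0 ≤ κ₃ * θ * ϑ * (θ + ϑ) := by positivity
  rw [abs_le, add_mul, add_mul, add_mul]
  constructor <;> linarith

/-- With a = g/θ and b = g'/ϑ the expression is −ϑκ(θ)|a − b|² minus a cross term with coefficient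
ϑκ(θ) − θκ(ϑ). This coefficient is (θ − ϑ) times a factor of order (1 + θ)². After absorption of |a
− b|² its square is divided by ϑκ(θ), which is at least a multiple of 1 + θ³, and the quotient (1 +
θ)⁴/(1 + θ³) is at most of order 1 + θ². Radiation controls exactly this weight. -/
theorem Model.Admissible.exists_heat_bound {M : Model} (hM : M.Admissible) {θ₁ θ₂ N : ℝ}
    (hθ₁ : 0 < θ₁) : ∃ C : ℝ, 0 < C ∧ ∀ θ ϑ (g g' : V3), 0 < θ → ϑ ∈ Icc θ₁ θ₂ →
      (∀ i, |g' i| ≤ N) →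
      -(((1 / θ) • g - (1 / ϑ) • g') ⬝ᵥ
          ((ϑ * M.κ θ) • ((1 / θ) • g) - (θ * M.κ ϑ) • ((1 / ϑ) • g')))
        ≤ C * ((θ - ϑ) ^ 2 * (1 + θ ^ 2)) := by
  obtain ⟨κ₀, κ₂, κ₃, h0, h2, h3, hκ⟩ := hM.conductivity
  set m := min κ₀ κ₃ with hm
  have hm0 : 0 < m := lt_min h0 h3
  set W := κ₀ + κ₂ * |θ₂| + κ₃ * |θ₂| + κ₃ * |θ₂| ^ 2 with hW
  have hW0 : 0 < W := by positivity
  refine ⟨4 * W ^ 2 / (4 * (θ₁ * m)) * (3 * N ^ 2 / θ₁ ^ 2) * 2 + 1, by positivity,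
    fun θ ϑ g g' hθ hϑ hg => ?_⟩
  have hϑ0 : 0 < ϑ := hθ₁.trans_le hϑ.1
  rw [hκ θ hθ, hκ ϑ hϑ0]
  set a := (1 / θ) • g
  set b := (1 / ϑ) • g' with hb
  set k := κ₀ + κ₂ * θ ^ 2 + κ₃ * θ ^ 3 with hk
  set l := κ₀ + κ₂ * ϑ ^ 2 + κ₃ * ϑ ^ 3 with hl
  have hk0 : 0 < k := by positivity
  have e1 : (a - b) ⬝ᵥ ((ϑ * k) • a - (θ * l) • b)
      = ϑ * k * ((a - b) ⬝ᵥ (a - b)) + (a - b) ⬝ᵥ ((ϑ * k - θ * l) • b) := by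
    simp only [dotProduct, Fin.sum_univ_three, Pi.sub_apply, Pi.smul_apply, smul_eq_mul]
    ring
  have h4 := dotProduct_le_young (a - b) ((-(ϑ * k - θ * l)) • b) (show 0 < ϑ * k by positivity)
  have e2 : (a - b) ⬝ᵥ ((-(ϑ * k - θ * l)) • b) = -((a - b) ⬝ᵥ ((ϑ * k - θ * l) • b)) := by
    rw [neg_smul, dotProduct_neg]
  have e3 : ((-(ϑ * k - θ * l)) • b) ⬝ᵥ ((-(ϑ * k - θ * l)) • b)
      = (ϑ * k - θ * l) ^ 2 * (b ⬝ᵥ b) := by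
    simp only [dotProduct, Fin.sum_univ_three, Pi.smul_apply, smul_eq_mul]
    ring
  rw [e2, e3] at h4
  have hbb : b ⬝ᵥ b ≤ 3 * N ^ 2 / θ₁ ^ 2 := by
    have e : b ⬝ᵥ b = (g' ⬝ᵥ g') / ϑ ^ 2 := by
      rw [hb]
      simp only [dotProduct, Fin.sum_univ_three, Pi.smul_apply, smul_eq_mul]
      field_simp
    rw [e]
    refine div_le_div₀ (by positivity) (dotProduct_self_le hg) (by positivity) ?_
    gcongr
    exact hϑ.1
  have e4 : ϑ * k - θ * l = (θ - ϑ) * (-κ₀ + κ₂ * θ * ϑ + κ₃ * θ * ϑ * (θ + ϑ)) := by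
    rw [hk, hl]; ring
  have hϑ2 : ϑ ≤ |θ₂| := hϑ.2.trans (le_abs_self _)
  have h5 := abs_conductivity_factor_le h0 h2 h3 hθ hϑ0 hϑ2
  rw [← hW] at h5
  have h6 : (ϑ * k - θ * l) ^ 2 ≤ (θ - ϑ) ^ 2 * (W ^ 2 * (1 + θ) ^ 4) := by
    rw [e4, mul_pow]
    refine mul_le_mul_of_nonneg_left ?_ (sq_nonneg _)
    rw [← sq_abs]
    calc _ ≤ (W * (1 + θ) ^ 2) ^ 2 := by gcongr
      _ = _ := by ring
  have h7 : θ₁ * m * (1 + θ ^ 3) ≤ ϑ * k := by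
    have i1 : m * (1 + θ ^ 3) ≤ k := by
      have j1 : m ≤ κ₀ := min_le_left _ _
      have j2 : m * θ ^ 3 ≤ κ₃ * θ ^ 3 := by gcongr; exact min_le_right _ _
      have j3 : 0 ≤ κ₂ * θ ^ 2 := by positivity
      rw [hk]; linarith
    rw [mul_assoc]
    exact mul_le_mul hϑ.1 i1 (by positivity) hϑ0.le
  have h8 : 1 / (4 * (ϑ * k)) * (1 + θ) ^ 4 ≤ 4 / (4 * (θ₁ * m)) * (2 * (1 + θ ^ 2)) := by
    calc 1 / (4 * (ϑ * k)) * (1 + θ) ^ 4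
        ≤ 1 / (4 * (θ₁ * m * (1 + θ ^ 3))) * (8 * (1 + θ ^ 3) * (1 + θ ^ 2)) := by
          gcongr
          exact one_add_pow_four_le hθ
      _ = _ := by field_simp; norm_num
  have h9 : 1 / (4 * (ϑ * k)) * ((ϑ * k - θ * l) ^ 2 * (b ⬝ᵥ b))
      ≤ 4 * W ^ 2 / (4 * (θ₁ * m)) * (3 * N ^ 2 / θ₁ ^ 2) * 2 * ((θ - ϑ) ^ 2 * (1 + θ ^ 2)) := by
    calc 1 / (4 * (ϑ * k)) * ((ϑ * k - θ * l) ^ 2 * (b ⬝ᵥ b))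
        ≤ 1 / (4 * (ϑ * k)) * ((θ - ϑ) ^ 2 * (W ^ 2 * (1 + θ) ^ 4) * (3 * N ^ 2 / θ₁ ^ 2)) := by
          have := dotProduct_self_nonneg' b
          gcongr
      _ = (1 / (4 * (ϑ * k)) * (1 + θ) ^ 4) * ((θ - ϑ) ^ 2 * W ^ 2 * (3 * N ^ 2 / θ₁ ^ 2)) := by
          ring
      _ ≤ (4 / (4 * (θ₁ * m)) * (2 * (1 + θ ^ 2)))
          * ((θ - ϑ) ^ 2 * W ^ 2 * (3 * N ^ 2 / θ₁ ^ 2)) := by gcongr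
      _ = _ := by ring
  rw [e1]
  have h10 : 0 ≤ (θ - ϑ) ^ 2 * (1 + θ ^ 2) := by positivity
  linarith

/-! ### The remainder and its pointwise bound -/

namespace PointData

variable (M : Model) (D : PointData)

/-- The integrand on the right-hand side of the relative energy inequality. -/
noncomputable def remainder (ρ θ : ℝ) (u H : V3) (A B : Fin 3 → Fin 3 → ℝ) (g : V3) : ℝ :=
  -(M.ν * (curlOf B ⬝ᵥ curlOf B)) - D.ϑ * M.production θ A g
    - (M.entropyDensity ρ θ * D.ϑt + M.entropyDensity ρ θ * (u ⬝ᵥ D.gϑ)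
      + (M.heatFlux θ g ⬝ᵥ D.gϑ) / θ)
    + (ρ * (D.U ⬝ᵥ D.Ut - (D.dtP M / D.r - D.spec M * D.ϑt))
      + ρ * (u ⬝ᵥ fun j => ∑ i, D.U i * D.A i j - (D.gradP M j / D.r - D.spec M * D.gϑ j)))
    - (ρ * (u ⬝ᵥ D.Ut) + ddot (fun i j => ρ * u i * u j) D.A + M.pressure ρ θ * tr D.A
      - ddot (M.stress θ A) D.A + crossProduct (curlOf B) H ⬝ᵥ D.U)
    - (H ⬝ᵥ D.Kt - (crossProduct H u + M.ν • curlOf B) ⬝ᵥ curlOf D.B)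
    + (D.dtP M + D.K ⬝ᵥ D.Kt)

/-- The terms that integrate to zero over the domain. -/
noncomputable def nullTerms (θ : ℝ) (u H : V3) (A B : Fin 3 → Fin 3 → ℝ) (g : V3) : ℝ :=
  (ddot (M.stress D.ϑ D.A) (A - D.A) + (u - D.U) ⬝ᵥ D.dS)
    - ((θ - D.ϑ) * D.Q + (g - D.gϑ) ⬝ᵥ ((1 / D.ϑ) • M.heatFlux D.ϑ D.gϑ))
    + (D.U ⬝ᵥ D.gradP M + M.pressure D.r D.ϑ * tr D.A)
    + ((H - D.K) ⬝ᵥ D.Kt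
      - (curlOf B - curlOf D.B) ⬝ᵥ (crossProduct D.U D.K - M.ν • curlOf D.B))

/-- The sum of the mechanical, magnetic and dissipation identities. The viscous force of the null
terms and the Lorentz force of the magnetic identity turn the factor −ρ/r of the force into −(ρ −
r)/r, so that this term too is quadratic in the differences. -/
theorem remainder_add_nullTerms (hM : M.Admissible) (h : D.Eqs M) (hr : 0 < D.r) (hϑ : 0 < D.ϑ)
    {ρ θ : ℝ} (hθ : 0 < θ) (u H : V3) (A B : Fin 3 → Fin 3 → ℝ) (g : V3) :
    D.remainder M ρ θ u H A B g + D.nullTerms M θ u H A B g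
      = -(ρ * ddot (fun i j => (u i - D.U i) * (u j - D.U j)) D.A)
        - (M.pressure ρ θ - M.pressure D.r D.ϑ - M.pressureRho D.r D.ϑ * (ρ - D.r)
          - M.pressureTheta D.r D.ϑ * (θ - D.ϑ)) * tr D.A
        - (M.entropyDensity ρ θ - M.entropyDensity D.r D.ϑ - M.entropyRho D.r D.ϑ * (ρ - D.r)
          - M.entropyTheta D.r D.ϑ * (θ - D.ϑ)) * (D.ϑt + D.U ⬝ᵥ D.gϑ)
        - (M.entropyDensity ρ θ - ρ * D.spec M) * ((u - D.U) ⬝ᵥ D.gϑ)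
        - (ρ - D.r) / D.r * ((u - D.U) ⬝ᵥ (D.dS + crossProduct (curlOf D.B) D.K))
        + (-(M.ν * ((curlOf B - curlOf D.B) ⬝ᵥ (curlOf B - curlOf D.B)))
          + (curlOf B - curlOf D.B) ⬝ᵥ crossProduct D.U (H - D.K))
        + (u - D.U) ⬝ᵥ crossProduct (curlOf D.B) (H - D.K)
        + 1 / 2 * ((M.μ θ + M.μ D.ϑ) * ddot (devSym A) (devSym D.A)
          - D.ϑ / θ * M.μ θ * ddot (devSym A) (devSym A)
          - θ / D.ϑ * M.μ D.ϑ * ddot (devSym D.A) (devSym D.A))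
        + -(((1 / θ) • g - (1 / D.ϑ) • D.gϑ) ⬝ᵥ
          ((D.ϑ * M.κ θ) • ((1 / θ) • g) - (θ * M.κ D.ϑ) • ((1 / D.ϑ) • D.gϑ))) := by
  have h1 := mechanical_eq M D h hr hϑ ρ θ u
  have h2 := magnetic_eq u D.U H D.K (curlOf B) (curlOf D.B) D.Kt M.ν
  have h3 := dissipation_eq M hM hθ hϑ A D.A g D.gϑ
  have h4 : (u - D.U) ⬝ᵥ (D.dS + crossProduct (curlOf D.B) D.K)
      = (u - D.U) ⬝ᵥ D.dS + (u - D.U) ⬝ᵥ crossProduct (curlOf D.B) D.K := dotProduct_add _ _ _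
  have h5 : (ρ - D.r) / D.r = ρ / D.r - 1 := by field_simp
  rw [h5, remainder, nullTerms]
  rw [mechanical] at h1
  linarith

/-- Uniform bounds for the data of a classical solution. -/
structure Bdd (N : ℝ) : Prop where
  U : ∀ i, |D.U i| ≤ N
  A : ∀ i j, |D.A i j| ≤ N
  B : ∀ i j, |D.B i j| ≤ N
  gϑ : ∀ i, |D.gϑ i| ≤ N
  ϑt : |D.ϑt| ≤ N
  force : ∀ i, |(D.dS + crossProduct (curlOf D.B) D.K) i| ≤ N

/-- The relative energy density. -/
noncomputable def relDensity (ρ θ : ℝ) (u H : V3) : ℝ :=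
  1 / 2 * ρ * ((u - D.U) ⬝ᵥ (u - D.U)) + M.relEnergy D.r D.ϑ ρ θ
    + 1 / 2 * ((H - D.K) ⬝ᵥ (H - D.K))

/-- The order of quantifiers matters: the viscous constant c comes from the model and the bounds
alone, before δ, so that δ can later be chosen small relative to c and the Poincaré constant. Only C
depends on δ. -/
theorem exists_remainder_bound (hM : M.Admissible) {r₁ r₂ θ₁ θ₂ N : ℝ} (hr₁ : 0 < r₁)
    (hθ₁ : 0 < θ₁) (hN : 0 < N) : ∃ c : ℝ, 0 < c ∧ ∀ δ : ℝ, 0 < δ → ∃ C : ℝ, 0 < C ∧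
      ∀ D : PointData, D.Eqs M → D.Bdd N → D.r ∈ Icc r₁ r₂ → D.ϑ ∈ Icc θ₁ θ₂ →
      ∀ (ρ θ : ℝ) (u H : V3) (A B : Fin 3 → Fin 3 → ℝ) (g : V3), 0 ≤ ρ → 0 < θ →
        D.remainder M ρ θ u H A B g + D.nullTerms M θ u H A B g
          ≤ C * D.relDensity M ρ θ u H + δ * ((1 + θ ^ 2) * ((u - D.U) ⬝ᵥ (u - D.U)))
            - c * ddot (devSym (A - D.A)) (devSym (A - D.A)) := by
  obtain ⟨c, C₁, hc, hC₁, hvisc⟩ := hM.exists_viscous_bound (N := N) hθ₁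
  refine ⟨c, hc, fun δ hδ => ?_⟩
  obtain ⟨C₂, hC₂, hheat⟩ := hM.exists_heat_bound (θ₂ := θ₂) (N := N) hθ₁
  obtain ⟨C₃, hC₃, hP⟩ := hM.exists_pressure_taylor (r₂ := r₂) (θ₂ := θ₂) hr₁ hθ₁
  obtain ⟨C₄, hC₄, hS⟩ := hM.exists_entropy_taylor (r₂ := r₂) (θ₂ := θ₂) hr₁ hθ₁
  -- The entropy flux, the density flux and the magnetic force each receive δ/3. The factors 9N and
  -- r₁ undo the bounds 3N on the gradient and the force and the division by r.
  obtain ⟨C₅, hC₅, hfl⟩ := hM.exists_entropy_flux_bound (r₂ := r₂) (θ₂ := θ₂) hr₁ hθ₁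
    (show 0 < δ / (9 * N) by positivity)
  obtain ⟨C₆, hC₆, hde⟩ := hM.exists_density_flux_bound (r₂ := r₂) (θ₂ := θ₂) hr₁ hθ₁
    (show 0 < δ * r₁ / (9 * N) by positivity)
  obtain ⟨C₇, hC₇, hdi⟩ := hM.exists_dichotomy (r₂ := r₂) (θ₂ := θ₂) hr₁ hθ₁
  have hν := hM.ν_pos
  -- The total coefficients of E, ρ|u − U|² and |H − K|². The last two are doubled below because
  -- these quantities carry the factor ½ in the relative density.
  obtain ⟨kE, hkE⟩ : ∃ k, k = 3 * N * C₃ + (N + 3 * N * N) * C₄ + 3 * N * C₅ + 3 * N / r₁ * C₆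
    + (C₁ + C₂) * C₇ := ⟨_, rfl⟩
  obtain ⟨kv, hkv⟩ : ∃ k, k = 9 * N + 3 * N * C₅ + 3 * N / r₁ * C₆ := ⟨_, rfl⟩
  obtain ⟨kh, hkh⟩ : ∃ k, k = 1 / (4 * M.ν) * (3 * N ^ 2)
    + 1 / (4 * (δ / 3)) * (3 * (2 * N) ^ 2) := ⟨_, rfl⟩
  have hkE0 : 0 < kE := by rw [hkE]; positivity
  have hkv0 : 0 < kv := by rw [hkv]; positivity
  have hkh0 : 0 < kh := by rw [hkh]; positivity
  refine ⟨kE + 2 * kv + 2 * kh, by positivity, fun D heq hb hr hϑ ρ θ u H A B g hρ hθ => ?_⟩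
  have hr0 : 0 < D.r := hr₁.trans_le hr.1
  have hϑ0 : 0 < D.ϑ := hθ₁.trans_le hϑ.1
  rw [remainder_add_nullTerms M D hM heq hr0 hϑ0 hθ, relDensity]
  obtain ⟨hE, hE2, -⟩ := hdi D.r hr D.ϑ hϑ ρ θ hρ hθ
  set v := u - D.U with hv
  set h := H - D.K
  set j := curlOf B - curlOf D.B
  set y := √(v ⬝ᵥ v) with hy
  have hy0 : 0 ≤ y := Real.sqrt_nonneg _
  have hyy : y ^ 2 = v ⬝ᵥ v := Real.sq_sqrt (dotProduct_self_nonneg' v)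
  have hvy : ∀ i, |v i| ≤ y := fun i => abs_apply_le_sqrt_dotProduct v i
  have hhh : 0 ≤ h ⬝ᵥ h := dotProduct_self_nonneg' h
  have hP' := hP D.r hr D.ϑ hϑ ρ θ hρ hθ
  have hS' := hS D.r hr D.ϑ hϑ ρ θ hρ hθ
  have hfl' := hfl D.r hr D.ϑ hϑ ρ θ y hρ hθ hy0
  have hde' := hde D.r hr D.ϑ hϑ ρ θ y hρ hθ hy0
  have hvisc' := hvisc θ D.ϑ A D.A hθ hϑ.1 hb.A
  have hheat' := hheat θ D.ϑ g D.gϑ hθ hϑ hb.gϑ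
  have hvg := abs_dotProduct_le hvy hb.gϑ
  have hvF := abs_dotProduct_le hvy hb.force
  have htr := abs_tr_le hb.A
  have hUg := abs_dotProduct_le hb.U hb.gϑ
  have hϑt := hb.ϑt
  have hJ' : ∀ i, |curlOf D.B i| ≤ 2 * N := abs_curlOf_le hb.B
  have hUU := dotProduct_self_le hb.U
  have hJJ := dotProduct_self_le hJ'
  change |_ - ρ * D.spec M| * y ≤ _ at hfl'
  generalize M.relEnergy D.r D.ϑ ρ θ = E at hE hE2 hP' hS' hfl' hde' ⊢
  generalize M.entropyDensity ρ θ - ρ * D.spec M = F₁ at hfl' ⊢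
  generalize M.pressure ρ θ - M.pressure D.r D.ϑ - M.pressureRho D.r D.ϑ * (ρ - D.r)
          - M.pressureTheta D.r D.ϑ * (θ - D.ϑ) = F₂ at hP' ⊢
  generalize M.entropyDensity ρ θ - M.entropyDensity D.r D.ϑ - M.entropyRho D.r D.ϑ * (ρ - D.r)
          - M.entropyTheta D.r D.ϑ * (θ - D.ϑ) = F₃ at hS' ⊢
  have t1 : -(ρ * ddot (fun i j => (u i - D.U i) * (u j - D.U j)) D.A) ≤ 9 * N * (ρ * y ^ 2) := by
    have := abs_ddot_le (A := fun i j => v i * v j) (y := y * y) (fun i j => by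
      rw [abs_mul]; exact mul_le_mul (hvy i) (hvy j) (abs_nonneg _) hy0) hb.A
    have h1 := mul_le_mul_of_nonneg_left ((neg_le_abs _).trans this) hρ
    calc _ = ρ * -(ddot (fun i j => v i * v j) D.A) := by rw [mul_neg]; rfl
      _ ≤ _ := h1
      _ = _ := by ring
  have t2 : -(F₂ * tr D.A) ≤ C₃ * E * (3 * N) :=
    (neg_le_abs _).trans (by
      rw [abs_mul]; exact mul_le_mul hP' htr (abs_nonneg _) (by positivity))
  have t3 : -(F₃ * (D.ϑt + D.U ⬝ᵥ D.gϑ)) ≤ C₄ * E * (N + 3 * N * N) :=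
    (neg_le_abs _).trans (by
      rw [abs_mul]
      exact mul_le_mul hS' ((abs_add_le _ _).trans (add_le_add hϑt hUg)) (abs_nonneg _)
        (by positivity))
  have t4 : -(F₁ * (v ⬝ᵥ D.gϑ)) ≤ 3 * N * (C₅ * (E + ρ * y ^ 2))
      + δ / 3 * ((1 + θ ^ 2) * y ^ 2) := by
    calc -(F₁ * (v ⬝ᵥ D.gϑ)) ≤ |F₁| * |v ⬝ᵥ D.gϑ| := by rw [← abs_mul]; exact neg_le_abs _
      _ ≤ |F₁| * (3 * N * y) := by gcongr
      _ = 3 * N * (|F₁| * y) := by ring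
      _ ≤ 3 * N * (C₅ * (E + ρ * y ^ 2) + δ / (9 * N) * ((1 + θ ^ 2) * y ^ 2)) := by gcongr
      _ = _ := by field_simp; ring
  have t5 : -((ρ - D.r) / D.r * (v ⬝ᵥ (D.dS + crossProduct (curlOf D.B) D.K)))
      ≤ 3 * N / r₁ * (C₆ * (E + ρ * y ^ 2)) + δ / 3 * y ^ 2 := by
    calc _ ≤ |(ρ - D.r) / D.r| * |v ⬝ᵥ (D.dS + crossProduct (curlOf D.B) D.K)| := by
          rw [← abs_mul]; exact neg_le_abs _
      _ ≤ |ρ - D.r| / r₁ * (3 * N * y) := by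
          rw [abs_div, abs_of_pos hr0]
          gcongr
          exact hr.1
      _ = 3 * N / r₁ * (|ρ - D.r| * y) := by ring
      _ ≤ 3 * N / r₁ * (C₆ * (E + ρ * y ^ 2) + δ * r₁ / (9 * N) * y ^ 2) := by gcongr
      _ = _ := by field_simp; ring
  -- The resistive dissipation is spent entirely on the coupling of curl(H − K) with U × (H − K).
  have t6 : -(M.ν * (j ⬝ᵥ j)) + j ⬝ᵥ crossProduct D.U h
      ≤ 1 / (4 * M.ν) * (3 * N ^ 2) * (h ⬝ᵥ h) := by
    have h1 := dotProduct_le_young j (crossProduct D.U h) hν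
    have h2 : 1 / (4 * M.ν) * (crossProduct D.U h ⬝ᵥ crossProduct D.U h)
        ≤ 1 / (4 * M.ν) * ((3 * N ^ 2) * (h ⬝ᵥ h)) := by
      refine mul_le_mul_of_nonneg_left ?_ (by positivity)
      exact (cross_dotProduct_self_le _ _).trans (mul_le_mul_of_nonneg_right hUU hhh)
    linarith
  have t7 : v ⬝ᵥ crossProduct (curlOf D.B) h
      ≤ δ / 3 * y ^ 2 + 1 / (4 * (δ / 3)) * (3 * (2 * N) ^ 2) * (h ⬝ᵥ h) := by
    have h1 := dotProduct_le_young v (crossProduct (curlOf D.B) h) (show 0 < δ / 3 by positivity)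
    have h2 : 1 / (4 * (δ / 3))
        * (crossProduct (curlOf D.B) h ⬝ᵥ crossProduct (curlOf D.B) h)
        ≤ 1 / (4 * (δ / 3)) * ((3 * (2 * N) ^ 2) * (h ⬝ᵥ h)) := by
      refine mul_le_mul_of_nonneg_left ?_ (by positivity)
      exact (cross_dotProduct_self_le _ _).trans (mul_le_mul_of_nonneg_right hJJ hhh)
    rw [← hyy] at h1
    linarith
  have hE3 : (θ - D.ϑ) ^ 2 ≤ C₇ * E :=
    (le_mul_of_one_le_right (sq_nonneg _) (by linarith [sq_nonneg θ])).trans hE2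
  have t8 := mul_le_mul_of_nonneg_left hE3 hC₁.le
  have t9 := mul_le_mul_of_nonneg_left hE2 hC₂.le
  rw [← hyy]
  have hθy : 0 ≤ θ ^ 2 * y ^ 2 := by positivity
  have t10 : δ / 3 * ((1 + θ ^ 2) * y ^ 2) + δ / 3 * y ^ 2 + δ / 3 * y ^ 2
      ≤ δ * ((1 + θ ^ 2) * y ^ 2) := by
    have := mul_nonneg hδ.le hθy
    linarith
  have hρy : 0 ≤ ρ * y ^ 2 := by positivity
  have t11 : (kE + 2 * kv + 2 * kh) * (1 / 2 * ρ * y ^ 2 + E + 1 / 2 * (h ⬝ᵥ h))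
      = (1 / 2 * kE + kv + kh) * (ρ * y ^ 2) + (kE + 2 * kv + 2 * kh) * E
        + (1 / 2 * kE + kv + kh) * (h ⬝ᵥ h) := by ring
  have t12 : kv * (ρ * y ^ 2) + kE * E + kh * (h ⬝ᵥ h)
      ≤ (1 / 2 * kE + kv + kh) * (ρ * y ^ 2) + (kE + 2 * kv + 2 * kh) * E
        + (1 / 2 * kE + kv + kh) * (h ⬝ᵥ h) := by
    gcongr <;> linarith
  have t13 : kv * (ρ * y ^ 2) + kE * E + kh * (h ⬝ᵥ h)
      = 9 * N * (ρ * y ^ 2) + C₃ * E * (3 * N) + C₄ * E * (N + 3 * N * N)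
        + 3 * N * (C₅ * (E + ρ * y ^ 2)) + 3 * N / r₁ * (C₆ * (E + ρ * y ^ 2))
        + 1 / (4 * M.ν) * (3 * N ^ 2) * (h ⬝ᵥ h)
        + 1 / (4 * (δ / 3)) * (3 * (2 * N) ^ 2) * (h ⬝ᵥ h)
        + (C₁ * (C₇ * E) + C₂ * (C₇ * E)) := by
    rw [hkv, hkE, hkh]; ring
  rw [t11]
  linarith

end PointData

/-! ### The classical solution -/

theorem pd_apply {f : E3 → V3} {x : E3} (hf : DifferentiableAt ℝ f x) (j i : Fin 3) :
    pd j (fun y => f y i) x = pd j f x i := by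
  have h := (hasFDerivAt_pi'.1 hf.hasFDerivAt i).fderiv
  simp only [pd, h]
  rfl

theorem pd_mul {f g : E3 → ℝ} {x : E3} (hf : DifferentiableAt ℝ f x)
    (hg : DifferentiableAt ℝ g x) (j : Fin 3) :
    pd j (fun y => f y * g y) x = f x * pd j g x + pd j f x * g x := by
  simp only [pd, (hf.hasFDerivAt.fun_mul hg.hasFDerivAt).fderiv]
  simp
  ring

theorem pd_congr {F : Type} [NormedAddCommGroup F] [NormedSpace ℝ F] {f g : E3 → F} {Ω : Set E3}
    (hΩ : IsOpen Ω) {x : E3} (hx : x ∈ Ω) (h : ∀ y ∈ Ω, f y = g y) (j : Fin 3) :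
    pd j f x = pd j g x := by
  have : f =ᶠ[𝓝 x] g := by
    filter_upwards [hΩ.mem_nhds hx] with y hy using h y hy
  rw [pd, pd, this.fderiv_eq]

theorem pd_comp_state {F : ℝ × ℝ → ℝ} {a b : ℝ} {f g : E3 → ℝ} {x : E3}
    (hF : HasFDerivAt F (a • ContinuousLinearMap.fst ℝ ℝ ℝ + b • ContinuousLinearMap.snd ℝ ℝ ℝ)
      (f x, g x)) (hf : DifferentiableAt ℝ f x) (hg : DifferentiableAt ℝ g x) (j : Fin 3) :
    pd j (fun y => F (f y, g y)) x = a * pd j f x + b * pd j g x := by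
  have h := hF.comp (f := fun y => (f y, g y)) x (hf.hasFDerivAt.prodMk hg.hasFDerivAt)
  have h' : fderiv ℝ (fun y => F (f y, g y)) x = _ := h.fderiv
  simp [pd, h']

theorem deriv_comp_state {F : ℝ × ℝ → ℝ} {a b : ℝ} {f g : ℝ → ℝ} {t : ℝ}
    (hF : HasFDerivAt F (a • ContinuousLinearMap.fst ℝ ℝ ℝ + b • ContinuousLinearMap.snd ℝ ℝ ℝ)
      (f t, g t)) (hf : DifferentiableAt ℝ f t) (hg : DifferentiableAt ℝ g t) :
    deriv (fun s => F (f s, g s)) t = a * deriv f t + b * deriv g t := by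
  have h := hF.comp_hasDerivAt t (hf.hasDerivAt.prodMk hg.hasDerivAt)
  have h' : deriv (fun s => F (f s, g s)) t = _ := h.deriv
  simp [h']

/-- The data of a classical solution at a point of space-time. -/
noncomputable def pointData (M : Model) (ρ : ℝ → E3 → ℝ) (u : ℝ → E3 → V3) (θ : ℝ → E3 → ℝ)
    (H : ℝ → E3 → V3) (t : ℝ) (x : E3) : PointData where
  r := ρ t x
  ϑ := θ t x
  U := u t x
  K := H t x
  rt := deriv (fun s => ρ s x) t
  ϑt := deriv (fun s => θ s x) t
  Ut := deriv (fun s => u s x) t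
  Kt := deriv (fun s => H s x) t
  gr := grad (ρ t) x
  gϑ := grad (θ t) x
  A := jac (u t) x
  B := jac (H t) x
  dS := fun i => ∑ j, pd j (fun y => M.stress (θ t y) (jac (u t) y) i j) x
  Q := divg (fun y => (1 / θ t y) • M.heatFlux (θ t y) (grad (θ t) y)) x

namespace IsClassicalSolution

variable {M : Model} {T : ℝ} {Ω : Set E3} {ρ : ℝ → E3 → ℝ} {u : ℝ → E3 → V3} {θ : ℝ → E3 → ℝ}
  {H : ℝ → E3 → V3}

theorem density_pos (h : IsClassicalSolution M T Ω ρ u θ H) {t : ℝ} (ht : t ∈ Icc (0 : ℝ) T)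
    {x : E3} (hx : x ∈ closure Ω) : 0 < ρ t x := by
  obtain ⟨c, hc, h'⟩ := h.density_lower
  exact hc.trans_le (h' t ht x hx)

theorem temperature_pos (h : IsClassicalSolution M T Ω ρ u θ H) {t : ℝ} (ht : t ∈ Icc (0 : ℝ) T)
    {x : E3} (hx : x ∈ closure Ω) : 0 < θ t x := by
  obtain ⟨c, hc, h'⟩ := h.temperature_lower
  exact hc.trans_le (h' t ht x hx)

theorem isC1_comp_state (h : IsClassicalSolution M T Ω ρ u θ H) {F : ℝ × ℝ → ℝ}
    (hF : ContDiffOn ℝ 1 F Model.quadrant) : IsC1 T Ω (fun t x => F (ρ t x, θ t x)) :=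
  hF.comp (g := F) (f := fun z : ℝ × E3 => (ρ z.1 z.2, θ z.1 z.2))
    (ContDiffOn.prodMk h.density_reg h.temperature_reg.c1)
    fun _ hz => ⟨h.density_pos hz.1 hz.2, h.temperature_pos hz.1 hz.2⟩

theorem isC1_pressure (h : IsClassicalSolution M T Ω ρ u θ H) (hM : M.Admissible) :
    IsC1 T Ω (fun t x => M.pressure (ρ t x) (θ t x)) :=
  h.isC1_comp_state hM.contDiffOn_pressure

theorem isC1_chemPot (h : IsClassicalSolution M T Ω ρ u θ H) (hM : M.Admissible) :
    IsC1 T Ω (fun t x => M.chemPot (ρ t x) (θ t x)) :=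
  h.isC1_comp_state hM.contDiffOn_chemPot

variable (h : IsClassicalSolution M T Ω ρ u θ H) (hΩ : IsBoundedLipschitzDomain Ω)

section
variable {t : ℝ} (ht : t ∈ Ioo (0 : ℝ) T) {x : E3} (hx : x ∈ Ω)
include h hΩ ht hx

theorem pd_pressure (hM : M.Admissible) (j : Fin 3) :
    pd j (fun y => M.pressure (ρ t y) (θ t y)) x = (pointData M ρ u θ H t x).gradP M j :=
  pd_comp_state (F := fun y => M.pressure y.1 y.2)
    (Model.hasFDerivAt_pressure hM (h.density_pos (Ioo_subset_Icc_self ht) (subset_closure hx))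
      (h.temperature_pos (Ioo_subset_Icc_self ht) (subset_closure hx)))
    (h.density_reg.hasFDerivAt_slice hΩ ht hx).differentiableAt
    (h.temperature_reg.c1.hasFDerivAt_slice hΩ ht hx).differentiableAt j

theorem deriv_pressure (hM : M.Admissible) :
    deriv (fun s => M.pressure (ρ s x) (θ s x)) t = (pointData M ρ u θ H t x).dtP M :=
  deriv_comp_state (F := fun y => M.pressure y.1 y.2) (f := fun s => ρ s x) (g := fun s => θ s x)
    (Model.hasFDerivAt_pressure hM (h.density_pos (Ioo_subset_Icc_self ht) (subset_closure hx))
      (h.temperature_pos (Ioo_subset_Icc_self ht) (subset_closure hx)))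
    (h.density_reg.hasDerivAt hΩ ht hx).differentiableAt
    (h.temperature_reg.c1.hasDerivAt hΩ ht hx).differentiableAt

theorem pd_chemPot (hM : M.Admissible) (j : Fin 3) :
    pd j (fun y => M.chemPot (ρ t y) (θ t y)) x
      = (pointData M ρ u θ H t x).gradP M j / ρ t x
        - (pointData M ρ u θ H t x).spec M * grad (θ t) x j := by
  have hr := h.density_pos (Ioo_subset_Icc_self ht) (subset_closure hx)
  rw [pd_comp_state (F := fun y => M.chemPot y.1 y.2)
    (Model.hasFDerivAt_chemPot hM hr
      (h.temperature_pos (Ioo_subset_Icc_self ht) (subset_closure hx)))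
    (h.density_reg.hasFDerivAt_slice hΩ ht hx).differentiableAt
    (h.temperature_reg.c1.hasFDerivAt_slice hΩ ht hx).differentiableAt j]
  simp only [PointData.gradP, PointData.spec, pointData, grad]
  field_simp
  ring

theorem deriv_chemPot (hM : M.Admissible) :
    deriv (fun s => M.chemPot (ρ s x) (θ s x)) t
      = (pointData M ρ u θ H t x).dtP M / ρ t x
        - (pointData M ρ u θ H t x).spec M * deriv (fun s => θ s x) t := by
  have hr := h.density_pos (Ioo_subset_Icc_self ht) (subset_closure hx)
  rw [deriv_comp_state (F := fun y => M.chemPot y.1 y.2) (f := fun s => ρ s x)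
    (g := fun s => θ s x)
    (Model.hasFDerivAt_chemPot hM hr
      (h.temperature_pos (Ioo_subset_Icc_self ht) (subset_closure hx)))
    (h.density_reg.hasDerivAt hΩ ht hx).differentiableAt
    (h.temperature_reg.c1.hasDerivAt hΩ ht hx).differentiableAt]
  simp only [PointData.dtP, PointData.spec, pointData]
  field_simp
  ring

/-- The conservative equations minus multiples of the mass balance: U times it for the momentum,
∂_ρ(ρs) times it for the entropy. In the entropy equation the Maxwell relation then turns the
coefficient of div U into ∂_θ P. -/
theorem pointData_eqs (hM : M.Admissible) : (pointData M ρ u θ H t x).Eqs M := by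
  have hti := Ioo_subset_Icc_self ht
  have hr := h.density_pos hti (subset_closure hx)
  have hϑ := h.temperature_pos hti (subset_closure hx)
  have dρ := (h.density_reg.hasFDerivAt_slice hΩ ht hx).differentiableAt
  have dθ := (h.temperature_reg.c1.hasFDerivAt_slice hΩ ht hx).differentiableAt
  have du := (h.velocity_reg.c1.hasFDerivAt_slice hΩ ht hx).differentiableAt
  have dui : ∀ i, DifferentiableAt ℝ (fun y => u t y i) x := fun i =>
    differentiableAt_pi.1 du i
  have tρ := (h.density_reg.hasDerivAt hΩ ht hx).differentiableAt
  have tθ := (h.temperature_reg.c1.hasDerivAt hΩ ht hx).differentiableAt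
  have tu := (h.velocity_reg.c1.hasDerivAt hΩ ht hx).differentiableAt
  have tui : ∀ i, HasDerivAt (fun s => u s x i) (deriv (fun s => u s x) t i) t := fun i =>
    hasDerivAt_pi.1 tu.hasDerivAt i
  have hdiv : ∀ f : E3 → ℝ, DifferentiableAt ℝ f x →
      divg (fun y => f y • u t y) x = f x * tr (jac (u t) x) + u t x ⬝ᵥ grad f x := by
    intro f hf
    have e : ∀ i, pd i (fun y => f y • u t y) x i = f x * pd i (u t) x i + pd i f x * u t x i := by
      intro i
      rw [← pd_apply (hf.fun_smul du), ← pd_apply du]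
      exact pd_mul hf (dui i) i
    simp only [divg, tr, jac, e, dotProduct, grad, Finset.sum_add_distrib, Finset.mul_sum]
    congr 1
    exact Finset.sum_congr rfl fun i _ => mul_comm _ _
  have hmass : deriv (fun s => ρ s x) t + u t x ⬝ᵥ grad (ρ t) x
      + ρ t x * tr (jac (u t) x) = 0 := by
    have := h.mass t ht x hx
    rw [hdiv _ dρ] at this
    linarith
  refine ⟨hmass, fun i => ?_, ?_⟩
  · have h1 := h.momentum t ht x hx i
    rw [h.pd_pressure hΩ ht hx hM i, (tρ.hasDerivAt.fun_mul (tui i)).deriv] at h1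
    have e : ∀ j, pd j (fun y => ρ t y * u t y i * u t y j) x
        = ρ t x * u t x i * pd j (u t) x j
          + (ρ t x * pd j (u t) x i + pd j (ρ t) x * u t x i) * u t x j := by
      intro j
      rw [pd_mul (dρ.fun_mul (dui i)) (dui j), pd_mul dρ (dui i), pd_apply du, pd_apply du]
    simp only [e] at h1
    change ρ t x * (deriv (fun s => u s x) t i + ∑ j, u t x j * pd j (u t) x i)
      + (pointData M ρ u θ H t x).gradP M i
      = (∑ j, pd j (fun y => M.stress (θ t y) (jac (u t) y) i j) x)
        + crossProduct (curl (H t) x) (H t x) i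
    generalize (pointData M ρ u θ H t x).gradP M i = gp at h1 ⊢
    generalize ∑ j, pd j (fun y => M.stress (θ t y) (jac (u t) y) i j) x = ds at h1 ⊢
    simp only [tr, jac, dotProduct, grad, Fin.sum_univ_three] at hmass h1 ⊢
    linear_combination h1 - u t x i * hmass
  · have h1 := h.entropy t ht x hx
    have e1 : deriv (fun s => ρ s x * M.entropy (ρ s x) (θ s x)) t
        = M.entropyRho (ρ t x) (θ t x) * deriv (fun s => ρ s x) t
          + M.entropyTheta (ρ t x) (θ t x) * deriv (fun s => θ s x) t := by
      have hev : (fun s => ρ s x * M.entropy (ρ s x) (θ s x)) =ᶠ[𝓝 t]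
          fun s => M.entropyDensity (ρ s x) (θ s x) := by
        filter_upwards [Ioo_mem_nhds ht.1 ht.2] with s hs
        rw [M.entropyDensity_eq _ _ (h.density_pos (Ioo_subset_Icc_self hs) (subset_closure hx))]
      rw [hev.deriv_eq]
      exact deriv_comp_state (F := fun y => M.entropyDensity y.1 y.2) (f := fun s => ρ s x)
        (g := fun s => θ s x) (Model.hasFDerivAt_entropyDensity hM hr hϑ) tρ tθ
    have e2 : divg (fun y => (ρ t y * M.entropy (ρ t y) (θ t y)) • u t y) x
        = divg (fun y => M.entropyDensity (ρ t y) (θ t y) • u t y) x := by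
      simp only [divg, tr, jac]
      refine Finset.sum_congr rfl fun i _ => ?_
      rw [pd_congr hΩ.isOpen hx fun y hy => by
        rw [← M.entropyDensity_eq _ _ (h.density_pos hti (subset_closure hy))]]
    have dσ : DifferentiableAt ℝ (fun y => M.entropyDensity (ρ t y) (θ t y)) x :=
      (Model.hasFDerivAt_entropyDensity hM hr hϑ).differentiableAt.comp
        (f := fun y => (ρ t y, θ t y)) x (dρ.prodMk dθ)
    have e3 : ∀ j, pd j (fun y => M.entropyDensity (ρ t y) (θ t y)) x
        = M.entropyRho (ρ t x) (θ t x) * pd j (ρ t) x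
          + M.entropyTheta (ρ t x) (θ t x) * pd j (θ t) x := fun j =>
      pd_comp_state (F := fun y => M.entropyDensity y.1 y.2)
        (Model.hasFDerivAt_entropyDensity hM hr hϑ) dρ dθ j
    rw [e1, e2, hdiv _ dσ] at h1
    have hmx := Model.maxwell (M := M) hr hϑ
    simp only [pointData]
    simp only [dotProduct, grad, Fin.sum_univ_three, e3] at h1 hmass ⊢
    linear_combination h1 - M.entropyRho (ρ t x) (θ t x) * hmass
      + tr (jac (u t) x) * hmx

end

include h hΩ in
theorem exists_pointData_bdd (hM : M.Admissible) (hT : 0 < T) :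
    ∃ r₁ r₂ θ₁ θ₂ N : ℝ, 0 < r₁ ∧ 0 < θ₁ ∧ 0 < N ∧ ∀ t ∈ Ioo (0 : ℝ) T, ∀ x ∈ Ω,
      (pointData M ρ u θ H t x).Bdd N ∧ ρ t x ∈ Icc r₁ r₂ ∧ θ t x ∈ Icc θ₁ θ₂ := by
  obtain ⟨r₁, hr₁, hr₁'⟩ := h.density_lower
  obtain ⟨θ₁, hθ₁, hθ₁'⟩ := h.temperature_lower
  obtain ⟨Nr, hNr, br, br'⟩ := h.density_reg.exists_bound hT hΩ
  obtain ⟨Nθ, hNθ, bθ, bθ'⟩ := h.temperature_reg.c1.exists_bound hT hΩ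
  obtain ⟨Nu, hNu, bu, bu'⟩ := h.velocity_reg.c1.exists_bound hT hΩ
  obtain ⟨NH, hNH, bH, bH'⟩ := h.magnetic_reg.c1.exists_bound hT hΩ
  obtain ⟨NP, hNP, bP, bP'⟩ := (h.isC1_pressure hM).exists_bound hT hΩ
  have hpd : ∀ (f : E3 → V3) (x : E3) (i j : Fin 3), |pd j f x i| ≤ ‖fderiv ℝ f x‖ := by
    intro f x i j
    have h1 := (fderiv ℝ f x).le_opNorm (EuclideanSpace.single j (1 : ℝ))
    rw [PiLp.norm_single, norm_one, mul_one] at h1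
    exact (norm_le_pi_norm (fderiv ℝ f x (EuclideanSpace.single j (1 : ℝ))) i).trans h1
  set N := 1 + Nθ + Nu + NH + (Nr * (Nu + 3 * (Nu * Nu)) + NP) with hN
  have hN' : 0 ≤ Nr * (Nu + 3 * (Nu * Nu)) + NP := by positivity
  refine ⟨r₁, Nr, θ₁, Nθ, N, hr₁, hθ₁, by positivity, fun t ht x hx => ⟨?_, ?_, ?_⟩⟩
  · have hti := Ioo_subset_Icc_self ht
    have hxc := subset_closure hx
    have hU : ∀ i, |u t x i| ≤ Nu := fun i => (norm_le_pi_norm (u t x) i).trans (bu t hti x hxc)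
    have hA : ∀ i j, |jac (u t) x i j| ≤ Nu := fun i j =>
      (hpd (u t) x i j).trans (bu' t ht x hx).2
    refine ⟨fun i => (hU i).trans (by linarith), fun i j => (hA i j).trans (by linarith),
      fun i j => ((hpd (H t) x i j).trans (bH' t ht x hx).2).trans (by linarith),
      fun i => ((abs_pd_le (θ t) x i).trans (bθ' t ht x hx).2).trans (by linarith),
      ((bθ' t ht x hx).1).trans (by linarith), fun i => ?_⟩
    -- The force div S + curl K × K is bounded through the momentum equation, which involves only
    -- first derivatives.
    have he := (h.pointData_eqs hΩ ht hx hM).momentum i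
    have e : ((pointData M ρ u θ H t x).dS + crossProduct (curlOf (pointData M ρ u θ H t x).B)
      (pointData M ρ u θ H t x).K) i = ρ t x * (deriv (fun s => u s x) t i
        + ∑ j, u t x j * jac (u t) x i j) + pd i (fun y => M.pressure (ρ t y) (θ t y)) x := by
      rw [h.pd_pressure hΩ ht hx hM i]
      exact he.symm
    rw [e]
    have h1 : |pd i (fun y => M.pressure (ρ t y) (θ t y)) x| ≤ NP :=
      (abs_pd_le _ x i).trans (bP' t ht x hx).2
    have h2 : |ρ t x| ≤ Nr := br t hti x hxc
    have h3 : |deriv (fun s => u s x) t i| ≤ Nu :=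
      (norm_le_pi_norm (deriv (fun s => u s x) t) i).trans (bu' t ht x hx).1
    have h4 : |∑ j, u t x j * jac (u t) x i j| ≤ 3 * Nu * Nu := abs_dotProduct_le hU (hA i)
    refine (abs_add_le _ _).trans ?_
    rw [abs_mul]
    have h5 : |ρ t x| * |deriv (fun s => u s x) t i + ∑ j, u t x j * jac (u t) x i j|
        ≤ Nr * (Nu + 3 * (Nu * Nu)) :=
      mul_le_mul h2 ((abs_add_le _ _).trans (by linarith)) (abs_nonneg _) hNr
    linarith
  · exact ⟨hr₁' t (Ioo_subset_Icc_self ht) x (subset_closure hx),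
      (le_abs_self _).trans (br t (Ioo_subset_Icc_self ht) x (subset_closure hx))⟩
  · exact ⟨hθ₁' t (Ioo_subset_Icc_self ht) x (subset_closure hx),
      (le_abs_self _).trans (bθ t (Ioo_subset_Icc_self ht) x (subset_closure hx))⟩

end IsClassicalSolution

/-! ### Integration by parts against the classical solution -/

section C1BddAlgebra

variable {Ω : Set E3} {f g : E3 → ℝ}

theorem C1Bdd.congr (hΩ : IsOpen Ω) (hf : C1Bdd Ω f) (h : ∀ x ∈ Ω, g x = f x) : C1Bdd Ω g := by
  have hev : ∀ x ∈ Ω, g =ᶠ[𝓝 x] f := fun x hx => by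
    filter_upwards [hΩ.mem_nhds hx] with y hy using h y hy
  obtain ⟨N, hN⟩ := hf.bdd
  refine ⟨fun x hx => (hf.diff x hx).congr_of_eventuallyEq (hev x hx),
    hf.cont.congr fun x hx => (hev x hx).fderiv_eq, N, fun x hx => ?_⟩
  rw [h x hx, (hev x hx).fderiv_eq]
  exact hN x hx

theorem C1Bdd.mul (hf : C1Bdd Ω f) (hg : C1Bdd Ω g) : C1Bdd Ω (fun x => f x * g x) := by
  obtain ⟨A, hA⟩ := hf.bdd
  obtain ⟨B, hB⟩ := hg.bdd
  have e : ∀ x ∈ Ω, fderiv ℝ (fun x => f x * g x) x = f x • fderiv ℝ g x + g x • fderiv ℝ f x :=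
    fun x hx => ((hf.diff x hx).hasFDerivAt.fun_mul (hg.diff x hx).hasFDerivAt).fderiv
  refine ⟨fun x hx => (hf.diff x hx).fun_mul (hg.diff x hx), ?_, 2 * |A| * |B|, fun x hx => ?_⟩
  · have cf : ContinuousOn f Ω := fun x hx => (hf.diff x hx).continuousAt.continuousWithinAt
    have cg : ContinuousOn g Ω := fun x hx => (hg.diff x hx).continuousAt.continuousWithinAt
    exact ((cf.smul hg.cont).add (cg.smul hf.cont)).congr e
  · have a1 := (hA x hx).1.trans (le_abs_self A)
    have a2 := (hA x hx).2.trans (le_abs_self A)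
    have b1 := (hB x hx).1.trans (le_abs_self B)
    have b2 := (hB x hx).2.trans (le_abs_self B)
    have hAB : 0 ≤ |A| * |B| := by positivity
    constructor
    · rw [abs_mul]
      have := mul_le_mul a1 b1 (abs_nonneg _) (abs_nonneg _)
      linarith
    · rw [e x hx]
      refine (norm_add_le _ _).trans ?_
      rw [norm_smul, norm_smul, Real.norm_eq_abs, Real.norm_eq_abs]
      have h1 := mul_le_mul a1 b2 (norm_nonneg _) (abs_nonneg _)
      have h2 := mul_le_mul b1 a2 (norm_nonneg _) (abs_nonneg _)
      linarith

theorem C1Bdd.add (hf : C1Bdd Ω f) (hg : C1Bdd Ω g) : C1Bdd Ω (fun x => f x + g x) := by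
  obtain ⟨A, hA⟩ := hf.bdd
  obtain ⟨B, hB⟩ := hg.bdd
  have e : ∀ x ∈ Ω, fderiv ℝ (fun x => f x + g x) x = fderiv ℝ f x + fderiv ℝ g x :=
    fun x hx => ((hf.diff x hx).hasFDerivAt.fun_add (hg.diff x hx).hasFDerivAt).fderiv
  refine ⟨fun x hx => (hf.diff x hx).fun_add (hg.diff x hx), (hf.cont.add hg.cont).congr e,
    A + B, fun x hx => ⟨(abs_add_le _ _).trans (add_le_add (hA x hx).1 (hB x hx).1), ?_⟩⟩
  rw [e x hx]
  exact (norm_add_le _ _).trans (add_le_add (hA x hx).2 (hB x hx).2)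

theorem C1Bdd.const (Ω : Set E3) (c : ℝ) : C1Bdd Ω (fun _ => c) := by
  refine ⟨fun x _ => differentiableAt_const c, ?_, |c|, fun x _ => ⟨le_rfl, ?_⟩⟩
  · exact (continuousOn_const (c := (0 : E3 →L[ℝ] ℝ))).congr fun x _ => by simp
  · simp

theorem C1Bdd.const_mul (hf : C1Bdd Ω f) (c : ℝ) : C1Bdd Ω (fun x => c * f x) :=
  (C1Bdd.const Ω c).mul hf

theorem C1Bdd.sub (hf : C1Bdd Ω f) (hg : C1Bdd Ω g) : C1Bdd Ω (fun x => f x - g x) := by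
  simpa [sub_eq_add_neg] using hf.add (hg.const_mul (-1))

end C1BddAlgebra

/-- The second derivatives extend continuously to the compact closed cylinder and are therefore
bounded. Thus stress, heat flux and curl are admissible factors in integrations by parts. -/
theorem IsC12.c1Bdd_fderiv {F : Type} [NormedAddCommGroup F] [NormedSpace ℝ F] {T : ℝ} {Ω : Set E3}
    {f : ℝ → E3 → F} (hf : IsC12 T Ω f) (hΩ : IsBoundedLipschitzDomain Ω) {t : ℝ}
    (ht : t ∈ Ioo (0 : ℝ) T) (L : F →L[ℝ] ℝ) (e : E3) :
    C1Bdd Ω (fun x => L (fderiv ℝ (f t) x e)) := by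
  obtain ⟨D2, hc, hd⟩ := hf.second
  obtain ⟨N, -, -, hN⟩ := hf.c1.exists_bound (ht.1.trans ht.2) hΩ
  have hc' : ContinuousOn (fun z : ℝ × E3 => L.comp ((ContinuousLinearMap.apply ℝ F e).comp
      (D2 z.1 z.2))) (closedCyl T Ω) :=
    continuousOn_const.clm_comp (continuousOn_const.clm_comp hc)
  obtain ⟨N', hN'⟩ := (isCompact_closedCyl T hΩ).exists_bound_of_continuousOn hc'
  have hder : ∀ x ∈ Ω, HasFDerivAt (fun x => L (fderiv ℝ (f t) x e))
      (L.comp ((ContinuousLinearMap.apply ℝ F e).comp (D2 t x))) x := fun x hx =>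
    L.hasFDerivAt.comp x ((ContinuousLinearMap.apply ℝ F e).hasFDerivAt.comp x (hd t ht x hx))
  refine ⟨fun x hx => (hder x hx).differentiableAt, ?_,
    max (‖L‖ * (N * ‖e‖)) N', fun x hx => ⟨?_, ?_⟩⟩
  · exact (hc'.comp (f := fun x => (t, x)) (by fun_prop)
      fun x hx => ⟨Ioo_subset_Icc_self ht, subset_closure hx⟩).congr
      fun x hx => (hder x hx).fderiv
  · refine le_max_of_le_left ((L.le_opNorm _).trans ?_)
    refine mul_le_mul_of_nonneg_left (((fderiv ℝ (f t) x).le_opNorm e).trans ?_) (norm_nonneg _)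
    exact mul_le_mul_of_nonneg_right (hN t ht x hx).2 (norm_nonneg _)
  · refine le_max_of_le_right ?_
    rw [(hder x hx).fderiv]
    exact (hN' (t, x) ⟨Ioo_subset_Icc_self ht, subset_closure hx⟩)

theorem IsC12.c1Bdd_pd {T : ℝ} {Ω : Set E3} {f : ℝ → E3 → ℝ} (hf : IsC12 T Ω f)
    (hΩ : IsBoundedLipschitzDomain Ω) {t : ℝ} (ht : t ∈ Ioo (0 : ℝ) T) (j : Fin 3) :
    C1Bdd Ω (pd j (f t)) :=
  hf.c1Bdd_fderiv hΩ ht (ContinuousLinearMap.id ℝ ℝ) _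

theorem IsC12.c1Bdd_jac {T : ℝ} {Ω : Set E3} {f : ℝ → E3 → V3} (hf : IsC12 T Ω f)
    (hΩ : IsBoundedLipschitzDomain Ω) {t : ℝ} (ht : t ∈ Ioo (0 : ℝ) T) (i j : Fin 3) :
    C1Bdd Ω (fun x => jac (f t) x i j) :=
  hf.c1Bdd_fderiv hΩ ht (ContinuousLinearMap.proj i) _

/-- `f` is integrable with vanishing integral. -/
def IsNull (Ω : Set E3) (f : E3 → ℝ) : Prop :=
  Integrable f (volume.restrict Ω) ∧ ∫ x in Ω, f x = 0

namespace IsNull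

variable {Ω : Set E3} {f g : E3 → ℝ}

theorem add (hf : IsNull Ω f) (hg : IsNull Ω g) : IsNull Ω (fun x => f x + g x) :=
  ⟨hf.1.add hg.1, by rw [integral_add hf.1 hg.1, hf.2, hg.2, add_zero]⟩

theorem sub (hf : IsNull Ω f) (hg : IsNull Ω g) : IsNull Ω (fun x => f x - g x) :=
  ⟨hf.1.sub hg.1, by rw [integral_sub hf.1 hg.1, hf.2, hg.2, sub_zero]⟩

theorem sum {f : Fin 3 → E3 → ℝ} (hf : ∀ i, IsNull Ω (f i)) :
    IsNull Ω (fun x => ∑ i, f i x) := by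
  refine ⟨integrable_finsetSum _ fun i _ => (hf i).1, ?_⟩
  rw [integral_finsetSum _ fun i _ => (hf i).1]
  exact Finset.sum_eq_zero fun i _ => (hf i).2

theorem congr (hΩ : IsOpen Ω) (hf : IsNull Ω f) (h : ∀ x ∈ Ω, g x = f x) : IsNull Ω g := by
  refine ⟨hf.1.congr ?_, (setIntegral_congr_fun hΩ.measurableSet h).trans hf.2⟩
  filter_upwards [ae_restrict_mem hΩ.measurableSet] with x hx using (h x hx).symm

end IsNull

section Parts

variable {Ω : Set E3} (hΩ : IsOpen Ω) (hfin : volume Ω ≠ ⊤)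
include hΩ hfin

theorem MemW12Zero.isNull {w : E3 → ℝ} {G : E3 → V3} (h : MemW12Zero Ω w G) {F : E3 → ℝ}
    (hF : C1Bdd Ω F) (j : Fin 3) : IsNull Ω (fun x => G x j * F x + w x * pd j F x) := by
  have i1 : Integrable (fun x => G x j * F x) (volume.restrict Ω) :=
    (h.memLp_grad.eval j).integrable_mul (hF.memLp hΩ hfin 2)
  have i2 : Integrable (fun x => w x * pd j F x) (volume.restrict Ω) :=
    h.memLp.integrable_mul (hF.memLp_pd hΩ hfin 2 j)
  refine ⟨i1.add i2, ?_⟩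
  rw [integral_add i1 i2, h.integral_mul_pd hΩ hfin hF j]
  ring

theorem isNull_stress {v : E3 → V3} {A : E3 → Fin 3 → Fin 3 → ℝ}
    (h : ∀ i, MemW12Zero Ω (fun x => v x i) (fun x => A x i)) {S : E3 → Fin 3 → Fin 3 → ℝ}
    (hS : ∀ i j, C1Bdd Ω (fun x => S x i j)) :
    IsNull Ω (fun x => ddot (S x) (A x) + v x ⬝ᵥ fun i => ∑ j, pd j (fun y => S y i j) x) := by
  refine (IsNull.sum fun i => IsNull.sum fun j => (h i).isNull hΩ hfin (hS i j) j).congr hΩ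
    fun x _ => ?_
  simp only [ddot, dotProduct, Finset.mul_sum, Finset.sum_add_distrib, mul_comm]

theorem isNull_pressure {U : E3 → V3} {A : E3 → Fin 3 → Fin 3 → ℝ}
    (h : ∀ i, MemW12Zero Ω (fun x => U x i) (fun x => A x i)) {P : E3 → ℝ} (hP : C1Bdd Ω P) :
    IsNull Ω (fun x => U x ⬝ᵥ grad P x + P x * tr (A x)) := by
  refine (IsNull.sum fun i => (h i).isNull hΩ hfin hP i).congr hΩ fun x _ => ?_
  simp only [tr, grad, dotProduct, Finset.mul_sum, Finset.sum_add_distrib]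
  rw [add_comm]
  simp only [mul_comm]

theorem isNull_curl {v : E3 → V3} {B : E3 → Fin 3 → Fin 3 → ℝ}
    (h : ∀ i, MemW12Zero Ω (fun x => v x i) (fun x => B x i)) {W : E3 → V3}
    (hW : ∀ i, C1Bdd Ω (fun x => W x i)) :
    IsNull Ω (fun x => v x ⬝ᵥ curl W x - curlOf (B x) ⬝ᵥ W x) := by
  have hb := fun i j k => (h i).isNull hΩ hfin (hW k) j
  refine (((hb 0 1 2).sub (hb 0 2 1)).add (((hb 1 2 0).sub (hb 1 0 2)).add
    ((hb 2 0 1).sub (hb 2 1 0)))).congr hΩ fun x hx => ?_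
  have hd : DifferentiableAt ℝ W x := differentiableAt_pi.2 fun i => (hW i).diff x hx
  simp only [pd_apply hd, curl, dotProduct, Fin.sum_univ_three, curlOf, jac,
    Matrix.cons_val_zero, Matrix.cons_val_one, Matrix.cons_val]
  ring

end Parts

theorem MemW12Zero.congr_grad {Ω : Set E3} (hΩ : IsOpen Ω) {f : E3 → ℝ} {F G : E3 → V3}
    (hf : MemW12Zero Ω f F) (h : ∀ x ∈ Ω, F x = G x) : MemW12Zero Ω f G := by
  have hae : ∀ᵐ x ∂(volume.restrict Ω), F x = G x :=
    (ae_restrict_mem hΩ.measurableSet).mono h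
  obtain ⟨ψ, h1, h2, h3⟩ := hf.approx
  refine ⟨⟨hf.memLp, hf.memLp_grad.ae_eq hae, fun ψ a b c j => ?_⟩, ψ, h1, h2, ?_⟩
  · rw [hf.weak_grad ψ a b c j]
    congr 1
    exact setIntegral_congr_fun hΩ.measurableSet fun x hx => by simp only [h x hx]
  · refine h3.congr fun n => eLpNorm_congr_ae ?_
    filter_upwards [hae] with x hx using by rw [hx]

theorem curl_sub {f g : E3 → V3} {x : E3} (hf : DifferentiableAt ℝ f x)
    (hg : DifferentiableAt ℝ g x) : curl (fun y => f y - g y) x = curl f x - curl g x := by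
  have e : ∀ j, pd j (fun y => f y - g y) x = pd j f x - pd j g x := fun j => by
    simp only [pd, fderiv_fun_sub hf hg]
    rfl
  funext i
  simp only [curl, curlOf, jac, e, Pi.sub_apply]
  fin_cases i <;> simp <;> ring

namespace IsClassicalSolution

variable {M : Model} {T : ℝ} {Ω : Set E3} {ρ : ℝ → E3 → ℝ} {u : ℝ → E3 → V3} {θ : ℝ → E3 → ℝ}
  {H : ℝ → E3 → V3} (h : IsClassicalSolution M T Ω ρ u θ H) (hΩ : IsBoundedLipschitzDomain Ω)
  {t : ℝ} (ht : t ∈ Ioo (0 : ℝ) T)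
include h hΩ ht

theorem c1Bdd_stress (hM : M.Admissible) (i j : Fin 3) :
    C1Bdd Ω (fun x => M.stress (θ t x) (jac (u t) x) i j) := by
  obtain ⟨μ₀, μ₁, -, -, hμ⟩ := hM.viscosity
  have hA := h.velocity_reg.c1Bdd_jac hΩ ht
  have hθ := h.temperature_reg.c1.c1Bdd hΩ ht
  have htr : C1Bdd Ω (fun x => tr (jac (u t) x)) := by
    simp only [tr, Fin.sum_univ_three]
    exact ((hA 0 0).add (hA 1 1)).add (hA 2 2)
  have h1 : C1Bdd Ω (fun x => (μ₀ + μ₁ * θ t x) * ((jac (u t) x i j + jac (u t) x j i)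
      - (if i = j then 2 / 3 else 0) * tr (jac (u t) x))) :=
    ((C1Bdd.const Ω μ₀).add (hθ.const_mul μ₁)).mul
      (((hA i j).add (hA j i)).sub (htr.const_mul _))
  refine h1.congr hΩ.isOpen fun x hx => ?_
  have hpos := h.temperature_pos (Ioo_subset_Icc_self ht) (subset_closure hx)
  simp only [Model.stress, hμ _ hpos, hM.bulk_viscosity _ hpos]
  split_ifs <;> ring

theorem memW12Zero_velocity (i : Fin 3) :
    MemW12Zero Ω (fun x => u t x i) (fun x => jac (u t) x i) :=
  (MemW12Zero.of_C1Bdd hΩ.isOpen hΩ.isBounded ((h.velocity_reg.c1.apply i).c1Bdd hΩ ht)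
    ((h.velocity_reg.c1.apply i).continuousOn_slice (Ioo_subset_Icc_self ht))
    fun x hx => by rw [h.velocity_bdry t ht x hx]; rfl).congr_grad hΩ.isOpen fun x hx =>
      funext fun j => pd_apply (h.velocity_reg.c1.hasFDerivAt_slice hΩ ht hx).differentiableAt j i

theorem memW12Zero_magnetic (i : Fin 3) :
    MemW12Zero Ω (fun x => H t x i) (fun x => jac (H t) x i) :=
  (MemW12Zero.of_C1Bdd hΩ.isOpen hΩ.isBounded ((h.magnetic_reg.c1.apply i).c1Bdd hΩ ht)
    ((h.magnetic_reg.c1.apply i).continuousOn_slice (Ioo_subset_Icc_self ht))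
    fun x hx => by rw [h.magnetic_bdry t ht x hx]; rfl).congr_grad hΩ.isOpen fun x hx =>
      funext fun j => pd_apply (h.magnetic_reg.c1.hasFDerivAt_slice hΩ ht hx).differentiableAt j i

/-- The tested function w does not vanish on the boundary, so the condition q·n = 0 has to be used,
through the divergence theorem for tangential fields. -/
theorem isNull_heat (hM : M.Admissible) {w : E3 → ℝ} {g : E3 → V3} (hw : MemW12 Ω w g) :
    IsNull Ω (fun x => w x * divg (fun y => (1 / θ t y) • M.heatFlux (θ t y) (grad (θ t) y)) x
      + g x ⬝ᵥ ((1 / θ t x) • M.heatFlux (θ t x) (grad (θ t) x))) := by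
  obtain ⟨κ₀, κ₂, κ₃, -, -, -, hκ⟩ := hM.conductivity
  have hT : 0 < T := ht.1.trans ht.2
  have hti := Ioo_subset_Icc_self ht
  have hF : IsC1 T Ω (fun t x => -((κ₀ + κ₂ * θ t x ^ 2 + κ₃ * θ t x ^ 3) / θ t x)) := by
    refine h.isC1_comp_state (F := fun y => -((κ₀ + κ₂ * y.2 ^ 2 + κ₃ * y.2 ^ 3) / y.2)) ?_
    refine (ContDiffOn.div (by fun_prop) (by fun_prop) fun y hy => ?_).neg
    exact hy.2.ne'
  -- The flux q/θ is written with the derivative relative to the closed cylinder, so that it is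
  -- continuous up to the boundary; inside Ω it agrees with the ordinary flux.
  obtain ⟨X, hXdef⟩ : ∃ X : E3 → V3, X = fun x j =>
      -((κ₀ + κ₂ * θ t x ^ 2 + κ₃ * θ t x ^ 3) / θ t x)
        * stDeriv T Ω θ (t, x) (0, EuclideanSpace.single j 1) := ⟨_, rfl⟩
  have hXc : ∀ j, ContinuousOn (fun x => X x j) (closure Ω) := fun j => by
    rw [hXdef]
    refine (hF.continuousOn_slice hti).mul (ContinuousOn.clm_apply ?_ continuousOn_const)
    exact (h.temperature_reg.c1.continuousOn_stDeriv hT hΩ).comp (f := fun x => (t, x))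
      (by fun_prop) fun _ hx => ⟨hti, hx⟩
  have hXΩ : ∀ x ∈ Ω, ∀ j, X x j
      = -((κ₀ + κ₂ * θ t x ^ 2 + κ₃ * θ t x ^ 3) / θ t x) * pd j (θ t) x := fun x hx j => by
    rw [hXdef, pd, (h.temperature_reg.c1.hasFDerivAt_slice hΩ ht hx).fderiv]
    rfl
  have hXq : ∀ x ∈ Ω, X x = (1 / θ t x) • M.heatFlux (θ t x) (grad (θ t) x) := fun x hx => by
    funext j
    rw [hXΩ x hx, Pi.smul_apply, smul_eq_mul, Model.heatFlux,
      hκ _ (h.temperature_pos hti (subset_closure hx)), grad]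
    ring
  have hX : ∀ j, C1Bdd Ω (fun x => X x j) := fun j =>
    ((hF.c1Bdd hΩ ht).mul (h.temperature_reg.c1Bdd_pd hΩ ht j)).congr hΩ.isOpen
      fun x hx => hXΩ x hx j
  have hb : ∀ y ∈ frontier Ω, ∀ n, IsOuterNormal Ω y n → ∑ j, X y j * n j = 0 := by
    intro y hy n hn
    have hyc := frontier_subset_closure hy
    have h1 := h.heat_flux_bdry t ht y hy n hn
    rw [(h.temperature_reg.c1.hasFDerivWithinAt_slice hti hyc).fderivWithin
      (hΩ.uniqueDiffOn_closure y hyc)] at h1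
    have e : ∑ j, X y j * n j = 1 / θ t y * ∑ j, M.heatFlux (θ t y) (fun k =>
        ((stDeriv T Ω θ (t, y)).comp (ContinuousLinearMap.inr ℝ ℝ E3))
          (EuclideanSpace.single k (1 : ℝ))) j * n j := by
      rw [Finset.mul_sum]
      refine Finset.sum_congr rfl fun j _ => ?_
      simp only [hXdef, Model.heatFlux, hκ _ (h.temperature_pos hti hyc),
        ContinuousLinearMap.comp_apply, ContinuousLinearMap.inr_apply]
      ring
    rw [e, h1, mul_zero]
  have hintg : Integrable (fun x => w x * ∑ j, pd j (fun y => X y j) x + ∑ j, g x j * X x j)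
      (volume.restrict Ω) := by
    simp only [Finset.mul_sum]
    exact (integrable_finsetSum _ fun j _ => hw.memLp.integrable_mul
      ((hX j).memLp_pd hΩ.isOpen hΩ.measure_ne_top 2 j)).add
      (integrable_finsetSum _ fun j _ => (hw.memLp_grad.eval j).integrable_mul
      ((hX j).memLp hΩ.isOpen hΩ.measure_ne_top 2))
  refine IsNull.congr hΩ.isOpen ⟨hintg, integral_mul_div_add_grad_eq_zero hΩ hw hX hXc hb⟩
    fun x hx => ?_
  rw [← hXq x hx]
  congr 2
  simp only [divg, tr, jac]
  refine Finset.sum_congr rfl fun i _ => ?_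
  rw [pd_apply (differentiableAt_pi.2 fun i => (hX i).diff x hx)]
  exact congrFun (pd_congr hΩ.isOpen hx (fun y hy => (hXq y hy).symm) i) i

/-- Four integrations by parts: stress against u − U, heat flux against θ − ϑ, pressure against U,
and the induction equation against H − K. All tested functions except θ − ϑ vanish on the boundary.
-/
theorem isNull_nullTerms (hM : M.Admissible) {v K : E3 → V3} {w : E3 → ℝ}
    {A B : E3 → Fin 3 → Fin 3 → ℝ} {g : E3 → V3}
    (hv : ∀ i, MemW12Zero Ω (fun x => v x i) (fun x => A x i)) (hw : MemW12 Ω w g)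
    (hK : ∀ i, MemW12Zero Ω (fun x => K x i) (fun x => B x i)) :
    IsNull Ω (fun x => (pointData M ρ u θ H t x).nullTerms M (w x) (v x) (K x) (A x) (B x)
      (g x)) := by
  have hfin := hΩ.measure_ne_top
  have hv' := fun i => (hv i).sub (h.memW12Zero_velocity hΩ ht i) hfin
  have hK' := fun i => (hK i).sub (h.memW12Zero_magnetic hΩ ht i) hfin
  have hθ := h.temperature_reg.c1.c1Bdd hΩ ht
  have hui := fun i => (h.velocity_reg.c1.apply i).c1Bdd hΩ ht
  have hHi := fun i => (h.magnetic_reg.c1.apply i).c1Bdd hΩ ht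
  have hJ := h.magnetic_reg.c1Bdd_jac hΩ ht
  have hJc : ∀ i, C1Bdd Ω (fun x => (M.ν • curl (H t) x) i) := by
    intro i
    simp only [curl, curlOf, Pi.smul_apply, smul_eq_mul]
    refine C1Bdd.const_mul ?_ _
    fin_cases i
    · exact (hJ 2 1).sub (hJ 1 2)
    · exact (hJ 0 2).sub (hJ 2 0)
    · exact (hJ 1 0).sub (hJ 0 1)
  have hC : ∀ i, C1Bdd Ω (fun x => crossProduct (u t x) (H t x) i) := by
    intro i
    simp only [cross_apply]
    fin_cases i
    · exact ((hui 1).mul (hHi 2)).sub ((hui 2).mul (hHi 1))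
    · exact ((hui 2).mul (hHi 0)).sub ((hui 0).mul (hHi 2))
    · exact ((hui 0).mul (hHi 1)).sub ((hui 1).mul (hHi 0))
  have I1 := isNull_stress hΩ.isOpen hfin hv' (h.c1Bdd_stress hΩ ht hM)
  have I2 := (h.isNull_heat hΩ ht hM hw).sub
    (h.isNull_heat hΩ ht hM (MemW12.of_C1Bdd hΩ.isOpen hfin hθ))
  have I3 := isNull_pressure hΩ.isOpen hfin (h.memW12Zero_velocity hΩ ht)
    ((h.isC1_pressure hM).c1Bdd hΩ ht)
  have I4 := isNull_curl hΩ.isOpen hfin hK' (fun i => (hC i).sub (hJc i))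
    (W := fun x => crossProduct (u t x) (H t x) - M.ν • curl (H t) x)
  refine (((I1.sub I2).add I3).add I4).congr hΩ.isOpen fun x hx => ?_
  -- By the induction equation the time derivative of the magnetic field is a curl, so it can be
  -- moved onto the difference of the magnetic fields.
  have hKt : deriv (fun s => H s x) t
      = curl (fun y => crossProduct (u t y) (H t y) - M.ν • curl (H t) y) x := by
    rw [curl_sub (differentiableAt_pi.2 fun i => (hC i).diff x hx)
      (differentiableAt_pi.2 fun i => (hJc i).diff x hx)]
    have := h.induction_eq t ht x hx
    rw [sub_add, sub_eq_zero] at this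
    exact this
  have hcurl : curlOf (B x) - curlOf (jac (H t) x) = curlOf (fun i => B x i - jac (H t) x i) := by
    funext i
    simp only [curlOf, Pi.sub_apply]
    fin_cases i <;> simp <;> ring
  have hgP : (pointData M ρ u θ H t x).gradP M = grad (fun y => M.pressure (ρ t y) (θ t y)) x :=
    funext fun j => (h.pd_pressure hΩ ht hx hM j).symm
  rw [PointData.nullTerms, hgP]
  simp only [pointData]
  have hsplit : ∀ (a b c : ℝ) (p q r : V3), (a - b) * c + (p - q) ⬝ᵥ r
      = (a * c + p ⬝ᵥ r) - (b * c + q ⬝ᵥ r) := fun a b c p q r => by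
    rw [sub_mul, sub_dotProduct]
    ring
  rw [hKt, hcurl, hsplit]
  rfl

end IsClassicalSolution

/-! ### Integrability on the cylinder -/

theorem integrable_mul_memLp_top {α : Type*} [MeasurableSpace α] {μ : Measure α} {f g : α → ℝ}
    (hf : Integrable f μ) (hg : MemLp g ⊤ μ) : Integrable (fun z => f z * g z) μ :=
  hf.mul_of_top_left hg

section TestFunctions

variable {F : Type} [NormedAddCommGroup F] [NormedSpace ℝ F] {T : ℝ} {Ω : Set E3} {f : ℝ → E3 → F}
  (hf : IsC1 T Ω f) (hT : 0 < T) (hΩ : IsBoundedLipschitzDomain Ω)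
include hf hT hΩ

theorem IsC1.memLp_top : MemLp (fun z : ℝ × E3 => f z.1 z.2) ⊤ (cylMeasure T Ω) := by
  obtain ⟨N, -, h1, -⟩ := hf.exists_bound hT hΩ
  exact memLp_top_cyl hΩ (hf.continuousOn.mono (prod_mono Ioo_subset_Icc_self subset_closure))
    fun z hz => h1 z.1 (Ioo_subset_Icc_self hz.1) z.2 (subset_closure hz.2)

theorem IsC1.memLp_top_deriv :
    MemLp (fun z : ℝ × E3 => deriv (fun s => f s z.2) z.1) ⊤ (cylMeasure T Ω) := by
  obtain ⟨N, -, -, h2⟩ := hf.exists_bound hT hΩ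
  exact memLp_top_cyl hΩ (hf.continuousOn_deriv hT hΩ) fun z hz => (h2 z.1 hz.1 z.2 hz.2).1

theorem IsC1.memLp_top_pd (j : Fin 3) :
    MemLp (fun z : ℝ × E3 => pd j (f z.1) z.2) ⊤ (cylMeasure T Ω) := by
  obtain ⟨N, -, -, h2⟩ := hf.exists_bound hT hΩ
  refine memLp_top_cyl hΩ ((hf.continuousOn_fderiv hT hΩ).clm_apply continuousOn_const) (N := N)
    fun z hz => ?_
  have h1 := (fderiv ℝ (f z.1) z.2).le_opNorm (EuclideanSpace.single j (1 : ℝ))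
  rw [PiLp.norm_single, norm_one, mul_one] at h1
  exact h1.trans (h2 z.1 hz.1 z.2 hz.2).2

theorem IsC1.memLp_top_slice {t : ℝ} (ht : t ∈ Icc (0 : ℝ) T) :
    MemLp (f t) ⊤ (volume.restrict Ω) := by
  obtain ⟨N, -, h1, -⟩ := hf.exists_bound hT hΩ
  refine memLp_top_of_bound (((hf.continuousOn_slice ht).mono
    subset_closure).aestronglyMeasurable hΩ.isOpen.measurableSet) N ?_
  exact (ae_restrict_mem hΩ.isOpen.measurableSet).mono fun x hx => h1 t ht x (subset_closure hx)

end TestFunctions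

namespace WeakSolutionProps

variable {M : Model} {lam T : ℝ} {Ω : Set E3} {ρ₀ : E3 → ℝ} {u₀ : E3 → V3} {θ₀ : E3 → ℝ}
  {H₀ : E3 → V3} {ρ : ℝ → E3 → ℝ} {u : ℝ → E3 → V3} {θ : ℝ → E3 → ℝ} {H : ℝ → E3 → V3}
  {m : ℝ → E3 → V3} {Du : ℝ → E3 → Fin 3 → Fin 3 → ℝ} {Dθ : ℝ → E3 → V3}
  {DH : ℝ → E3 → Fin 3 → Fin 3 → ℝ}
  (hw : WeakSolutionProps M lam T Ω ρ₀ u₀ θ₀ H₀ ρ u θ H m Du Dθ DH)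
include hw

/-- Nonnegativity is known on each time slice up to a null set. Passing to the product measure
requires a measurable set, hence a measurable representative of the density. -/
theorem density_nonneg_cyl : ∀ᵐ z ∂(cylMeasure T Ω), 0 ≤ ρ z.1 z.2 := by
  obtain ⟨k, hk, hke⟩ := hw.density_meas
  have h1 := ae_ae_of_ae_cylMeasure hke
  have h2 : ∀ᵐ z ∂(cylMeasure T Ω), 0 ≤ k z := by
    rw [cylMeasure_eq_prod]
    refine (Measure.ae_prod_iff_ae_ae (measurableSet_le measurable_const hk.measurable)).2 ?_
    filter_upwards [h1, ae_restrict_mem measurableSet_Ioo] with t ht hti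
    filter_upwards [ht, hw.density_nonneg t (Ioo_subset_Icc_self hti)] with x hx h0
    rw [← hx]
    exact h0
  filter_upwards [h2, hke] with z h3 h4
  rw [h4]
  exact h3

theorem integrable_density (hM : M.Admissible) (hfin : volume Ω ≠ ⊤) :
    Integrable (fun z : ℝ × E3 => ρ z.1 z.2) (cylMeasure T Ω) := by
  have := isFiniteMeasure_cylMeasure T hfin
  obtain ⟨C, -, hC⟩ := hM.exists_density_le_pressure
  refine (((integrable_const (1 : ℝ)).add hw.int_pressure).const_mul C).mono' hw.density_meas ?_
  filter_upwards [hw.density_nonneg_cyl, hw.temperature_pos] with z h1 h2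
  rw [Real.norm_eq_abs, abs_of_nonneg h1]
  exact hC _ _ h1 h2

/-- The fluid pressure is nonnegative, so the total pressure dominates the radiation pressure. The
integrability of the internal energy then follows, as it is a combination of P and θ⁴. -/
theorem integrable_temperature_pow_four (hM : M.Admissible) :
    Integrable (fun z : ℝ × E3 => θ z.1 z.2 ^ 4) (cylMeasure T Ω) := by
  have ha := hM.a_pos
  refine (hw.int_pressure.const_mul (3 / M.a)).mono'
    (hw.temperature_space.memLp.aestronglyMeasurable.pow 4) ?_
  filter_upwards [hw.density_nonneg_cyl, hw.temperature_pos] with z h1 h2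
  rw [Real.norm_eq_abs, abs_of_nonneg (by positivity), Model.pressure, mul_add]
  have h3 := mul_nonneg (by positivity : 0 ≤ 3 / M.a) (hM.pressureF_nonneg h1 h2)
  have e : 3 / M.a * (M.a / 3 * θ z.1 z.2 ^ 4) = θ z.1 z.2 ^ 4 := by field_simp
  linarith

theorem integrable_energyDensity (hM : M.Admissible) :
    Integrable (fun z : ℝ × E3 => M.energyDensity (ρ z.1 z.2) (θ z.1 z.2)) (cylMeasure T Ω) := by
  refine ((hw.int_pressure.const_mul (3 / 2)).add
    ((hw.integrable_temperature_pow_four hM).const_mul (M.a / 2))).congr ?_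
  refine Eventually.of_forall fun z => ?_
  simp only [Pi.add_apply, Model.energyDensity, Model.pressure]
  ring

theorem integrable_totalEnergy (hM : M.Admissible) :
    Integrable (fun z : ℝ × E3 => M.totalEnergy (ρ z.1 z.2) (u z.1 z.2) (θ z.1 z.2) (H z.1 z.2))
      (cylMeasure T Ω) := by
  have h1 : Integrable (fun z : ℝ × E3 => 1 / 2 * ρ z.1 z.2 * (u z.1 z.2 ⬝ᵥ u z.1 z.2))
      (cylMeasure T Ω) := by
    refine ((integrable_finsetSum Finset.univ fun i _ =>
      hw.int_convection i i).const_mul (1 / 2)).congr (Eventually.of_forall fun z => ?_)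
    simp only [dotProduct, Finset.mul_sum]
    exact Finset.sum_congr rfl fun i _ => by ring
  have h2 : Integrable (fun z : ℝ × E3 => 1 / 2 * (H z.1 z.2 ⬝ᵥ H z.1 z.2)) (cylMeasure T Ω) :=
    Integrable.const_mul (integrable_finsetSum Finset.univ fun i _ =>
      (hw.magnetic_space.memLp.eval i).integrable_mul (hw.magnetic_space.memLp.eval i)) _
  exact (h1.add (hw.integrable_energyDensity hM)).add h2

theorem integrable_curl_sq : Integrable (fun z : ℝ × E3 =>
    M.ν * (curlOf (DH z.1 z.2) ⬝ᵥ curlOf (DH z.1 z.2))) (cylMeasure T Ω) := by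
  have hD := fun i j => (hw.magnetic_space.memLp_grad.eval i).eval j
  have hJ : ∀ i, MemLp (fun z : ℝ × E3 => curlOf (DH z.1 z.2) i) 2 (cylMeasure T Ω) := by
    intro i
    simp only [curlOf]
    fin_cases i
    · exact (hD 2 1).sub (hD 1 2)
    · exact (hD 0 2).sub (hD 2 0)
    · exact (hD 1 0).sub (hD 0 1)
  exact Integrable.const_mul (integrable_finsetSum Finset.univ fun i _ =>
    (hJ i).integrable_mul (hJ i)) _

theorem integrable_curl_apply (hfin : volume Ω ≠ ⊤) (i : Fin 3) :
    Integrable (fun z : ℝ × E3 => curlOf (DH z.1 z.2) i) (cylMeasure T Ω) := by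
  have := isFiniteMeasure_cylMeasure T hfin
  have hD := fun i j => ((hw.magnetic_space.memLp_grad.eval i).eval j).integrable one_le_two
  simp only [curlOf]
  fin_cases i
  · exact (hD 2 1).sub (hD 1 2)
  · exact (hD 0 2).sub (hD 2 0)
  · exact (hD 1 0).sub (hD 0 1)

theorem integrable_grad_sq : Integrable (fun z : ℝ × E3 =>
    lam * ddot (Du z.1 z.2) (Du z.1 z.2)) (cylMeasure T Ω) := by
  have hD := fun i j => (hw.velocity_space.memLp_grad.eval i).eval j
  exact Integrable.const_mul (integrable_finsetSum Finset.univ fun i _ =>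
    integrable_finsetSum Finset.univ fun j _ => (hD i j).integrable_mul (hD i j)) _

/-- Here and in the next lemmas each term is an integrable quantity of the weak solution times a
bounded value or derivative of the test function. Integrability is what allows the iterated
integrals to be combined into one over the cylinder. -/
theorem integrable_massFlux (hM : M.Admissible) (hT : 0 < T) (hΩ : IsBoundedLipschitzDomain Ω)
    {φ : ℝ → E3 → ℝ} (hφ : IsC1 T Ω φ) :
    Integrable (fun z : ℝ × E3 => ρ z.1 z.2 * deriv (fun s => φ s z.2) z.1
      + ρ z.1 z.2 * (u z.1 z.2 ⬝ᵥ grad (φ z.1) z.2)) (cylMeasure T Ω) := by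
  refine (integrable_mul_memLp_top (hw.integrable_density hM hΩ.measure_ne_top)
    (hφ.memLp_top_deriv hT hΩ)).add ?_
  refine (integrable_finsetSum Finset.univ fun j _ => integrable_mul_memLp_top
    (hw.int_momentum.eval j) (hφ.memLp_top_pd hT hΩ j)).congr (Eventually.of_forall fun z => ?_)
  simp only [dotProduct, Finset.mul_sum, Pi.smul_apply, smul_eq_mul, grad]
  exact Finset.sum_congr rfl fun i _ => by ring

theorem integrable_momentumFlux (hT : 0 < T) (hΩ : IsBoundedLipschitzDomain Ω)
    {φ : ℝ → E3 → V3} (hφ : IsC1 T Ω φ) :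
    Integrable (fun z : ℝ × E3 => ρ z.1 z.2 * (u z.1 z.2 ⬝ᵥ deriv (fun s => φ s z.2) z.1)
          + ddot (fun i j => ρ z.1 z.2 * u z.1 z.2 i * u z.1 z.2 j) (jac (φ z.1) z.2)
          + M.pressure (ρ z.1 z.2) (θ z.1 z.2) * divg (φ z.1) z.2
          - ddot (M.stress (θ z.1 z.2) (Du z.1 z.2)) (jac (φ z.1) z.2)
          + crossProduct (curlOf (DH z.1 z.2)) (H z.1 z.2) ⬝ᵥ φ z.1 z.2) (cylMeasure T Ω) := by
  have hp : ∀ i j, MemLp (fun z : ℝ × E3 => jac (φ z.1) z.2 i j) ⊤ (cylMeasure T Ω) :=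
    fun i j => (hφ.memLp_top_pd hT hΩ j).eval i
  refine ((((?_ : Integrable _ _).add ?_).add ?_).sub ?_).add ?_
  · refine (integrable_finsetSum Finset.univ fun j _ => integrable_mul_memLp_top
      (hw.int_momentum.eval j) ((hφ.memLp_top_deriv hT hΩ).eval j)).congr
      (Eventually.of_forall fun z => ?_)
    simp only [dotProduct, Finset.mul_sum, Pi.smul_apply, smul_eq_mul]
    exact Finset.sum_congr rfl fun i _ => by ring
  · exact integrable_finsetSum Finset.univ fun i _ => integrable_finsetSum Finset.univ fun j _ =>
      integrable_mul_memLp_top (hw.int_convection i j) (hp i j)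
  · refine integrable_mul_memLp_top hw.int_pressure ?_
    exact memLp_finsetSum Finset.univ fun i _ => hp i i
  · exact integrable_finsetSum Finset.univ fun i _ => integrable_finsetSum Finset.univ fun j _ =>
      integrable_mul_memLp_top ((hw.int_stress.eval i).eval j) (hp i j)
  · exact integrable_finsetSum Finset.univ fun i _ => integrable_mul_memLp_top
      (hw.int_lorentz.eval i) ((hφ.memLp_top hT hΩ).eval i)

theorem integrable_entropyFlux (hT : 0 < T) (hΩ : IsBoundedLipschitzDomain Ω)
    {φ : ℝ → E3 → ℝ} (hφ : IsC1 T Ω φ) :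
    Integrable (fun z : ℝ × E3 =>
      M.entropyDensity (ρ z.1 z.2) (θ z.1 z.2) * deriv (fun s => φ s z.2) z.1
        + M.entropyDensity (ρ z.1 z.2) (θ z.1 z.2) * (u z.1 z.2 ⬝ᵥ grad (φ z.1) z.2)
        + (M.heatFlux (θ z.1 z.2) (Dθ z.1 z.2) ⬝ᵥ grad (φ z.1) z.2) / θ z.1 z.2)
      (cylMeasure T Ω) := by
  refine ((integrable_mul_memLp_top hw.int_entropy (hφ.memLp_top_deriv hT hΩ)).add ?_).add ?_
  · refine (integrable_finsetSum Finset.univ fun j _ => integrable_mul_memLp_top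
      (hw.int_entropy_flux.eval j) (hφ.memLp_top_pd hT hΩ j)).congr
      (Eventually.of_forall fun z => ?_)
    simp only [dotProduct, Finset.mul_sum, Pi.smul_apply, smul_eq_mul, grad]
    exact Finset.sum_congr rfl fun i _ => by ring
  · refine (integrable_finsetSum Finset.univ fun j _ => integrable_mul_memLp_top
      (hw.int_heat_flux.eval j) (hφ.memLp_top_pd hT hΩ j)).congr
      (Eventually.of_forall fun z => ?_)
    simp only [dotProduct, Finset.sum_div, Pi.smul_apply, smul_eq_mul, grad]
    exact Finset.sum_congr rfl fun i _ => by ring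

theorem integrable_production_mul (hT : 0 < T) (hΩ : IsBoundedLipschitzDomain Ω)
    {φ : ℝ → E3 → ℝ} (hφ : IsC1 T Ω φ) :
    Integrable (fun z : ℝ × E3 => φ z.1 z.2 * M.production (θ z.1 z.2) (Du z.1 z.2) (Dθ z.1 z.2))
      (cylMeasure T Ω) := by
  simp only [mul_comm (φ _ _)]
  exact integrable_mul_memLp_top hw.int_production (hφ.memLp_top hT hΩ)

theorem integrable_inductionFlux (hT : 0 < T) (hΩ : IsBoundedLipschitzDomain Ω)
    {φ : ℝ → E3 → V3} (hφ : IsC1 T Ω φ) :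
    Integrable (fun z : ℝ × E3 => H z.1 z.2 ⬝ᵥ deriv (fun s => φ s z.2) z.1
      - (crossProduct (H z.1 z.2) (u z.1 z.2) + M.ν • curlOf (DH z.1 z.2)) ⬝ᵥ curl (φ z.1) z.2)
      (cylMeasure T Ω) := by
  have := isFiniteMeasure_cylMeasure T hΩ.measure_ne_top
  have hp : ∀ i j, MemLp (fun z : ℝ × E3 => jac (φ z.1) z.2 i j) ⊤ (cylMeasure T Ω) :=
    fun i j => (hφ.memLp_top_pd hT hΩ j).eval i
  have hc : ∀ i, MemLp (fun z : ℝ × E3 => curl (φ z.1) z.2 i) ⊤ (cylMeasure T Ω) := by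
    intro i
    simp only [curl, curlOf]
    fin_cases i
    · exact (hp 2 1).sub (hp 1 2)
    · exact (hp 0 2).sub (hp 2 0)
    · exact (hp 1 0).sub (hp 0 1)
  refine Integrable.sub ?_ ?_
  · exact integrable_finsetSum Finset.univ fun i _ => integrable_mul_memLp_top
      ((hw.magnetic_space.memLp.eval i).integrable one_le_two)
      ((hφ.memLp_top_deriv hT hΩ).eval i)
  · exact integrable_finsetSum Finset.univ fun i _ => integrable_mul_memLp_top
      ((hw.int_electric.eval i).add ((hw.integrable_curl_apply hΩ.measure_ne_top i).const_mul _))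
      (hc i)

end WeakSolutionProps

/-! ### The relative energy inequality -/

theorem integral_sub_add_sub_sub_add {α : Type*} [MeasurableSpace α] {μ : Measure α} {f₁ f₂ f₃ f₄ f₅ f₆ : α → ℝ}
    (i₁ : Integrable f₁ μ) (i₂ : Integrable f₂ μ) (i₃ : Integrable f₃ μ) (i₄ : Integrable f₄ μ)
    (i₅ : Integrable f₅ μ) (i₆ : Integrable f₆ μ) :
    ∫ x, (f₁ x - f₂ x + f₃ x - f₄ x - f₅ x + f₆ x) ∂μ
      = ∫ x, f₁ x ∂μ - ∫ x, f₂ x ∂μ + ∫ x, f₃ x ∂μ - ∫ x, f₄ x ∂μ - ∫ x, f₅ x ∂μ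
        + ∫ x, f₆ x ∂μ := by
  refine (integral_add' ((((i₁.sub i₂).add i₃).sub i₄).sub i₅) i₆).trans ?_
  rw [integral_sub' (((i₁.sub i₂).add i₃).sub i₄) i₅, integral_sub' ((i₁.sub i₂).add i₃) i₄,
    integral_add' (i₁.sub i₂) i₃, integral_sub' i₁ i₂]

theorem deriv_half_dotProduct {f : ℝ → V3} {t : ℝ} (hf : DifferentiableAt ℝ f t) :
    deriv (fun s => 1 / 2 * (f s ⬝ᵥ f s)) t = f t ⬝ᵥ deriv f t := by
  have h := fun i => hasDerivAt_pi.1 hf.hasDerivAt i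
  have h1 : HasDerivAt (fun s => f s ⬝ᵥ f s)
      (∑ i, (deriv f t i * f t i + f t i * deriv f t i)) t :=
    HasDerivAt.fun_sum fun i _ => (h i).fun_mul (h i)
  rw [(h1.const_mul (1 / 2)).deriv, Finset.mul_sum]
  exact Finset.sum_congr rfl fun i _ => by ring

theorem pd_half_dotProduct {f : E3 → V3} {x : E3} (hf : DifferentiableAt ℝ f x) (j : Fin 3) :
    pd j (fun y => 1 / 2 * (f y ⬝ᵥ f y)) x = ∑ i, f x i * pd j f x i := by
  have h := fun i => differentiableAt_pi.1 hf i
  have h1 : HasFDerivAt (fun y => f y ⬝ᵥ f y) (∑ i, (f x i • fderiv ℝ (fun y => f y i) x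
      + f x i • fderiv ℝ (fun y => f y i) x)) x :=
    HasFDerivAt.fun_sum fun i _ => (h i).hasFDerivAt.fun_mul (h i).hasFDerivAt
  rw [pd, (h1.const_mul (1 / 2)).fderiv]
  simp only [smul_apply, sum_apply, add_apply, smul_eq_mul, Finset.mul_sum]
  refine Finset.sum_congr rfl fun i _ => ?_
  rw [← pd_apply hf j i, pd]
  ring

theorem IsC1.half_dotProduct {T : ℝ} {Ω : Set E3} {f : ℝ → E3 → V3} (hf : IsC1 T Ω f) :
    IsC1 T Ω (fun t x => 1 / 2 * (f t x ⬝ᵥ f t x)) :=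
  contDiffOn_const.mul (ContDiffOn.sum fun i _ =>
    ContDiffOn.mul (hf.apply i) (hf.apply i))

namespace IsClassicalSolution

variable {M : Model} {T : ℝ} {Ω : Set E3} {r : ℝ → E3 → ℝ} {U : ℝ → E3 → V3} {ϑ : ℝ → E3 → ℝ}
  {K : ℝ → E3 → V3} (hs : IsClassicalSolution M T Ω r U ϑ K)
include hs

/-- The boundary condition is known for 0 < t < T, while test functions must vanish on the boundary
also at the end times; continuity in time closes the gap. -/
theorem velocity_eq_zero (hT : 0 < T) {t : ℝ} (ht : t ∈ Icc (0 : ℝ) T) {x : E3}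
    (hx : x ∈ frontier Ω) : U t x = 0 := by
  have hc : ContinuousOn (fun s => U s x) (Icc 0 T) :=
    hs.velocity_reg.c1.continuousOn.comp (f := fun s => (s, x)) (by fun_prop)
      fun _ hs => ⟨hs, frontier_subset_closure hx⟩
  refine EqOn.of_subset_closure (s := Ioo 0 T) (f := fun s => U s x) (g := fun _ => 0)
    (fun s hs' => hs.velocity_bdry s hs' x hx) hc continuousOn_const Ioo_subset_Icc_self ?_ ht
  rw [closure_Ioo hT.ne]

theorem magnetic_eq_zero (hT : 0 < T) {t : ℝ} (ht : t ∈ Icc (0 : ℝ) T) {x : E3}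
    (hx : x ∈ frontier Ω) : K t x = 0 := by
  have hc : ContinuousOn (fun s => K s x) (Icc 0 T) :=
    hs.magnetic_reg.c1.continuousOn.comp (f := fun s => (s, x)) (by fun_prop)
      fun _ hs => ⟨hs, frontier_subset_closure hx⟩
  refine EqOn.of_subset_closure (s := Ioo 0 T) (f := fun s => K s x) (g := fun _ => 0)
    (fun s hs' => hs.magnetic_bdry s hs' x hx) hc continuousOn_const Ioo_subset_Icc_self ?_ ht
  rw [closure_Ioo hT.ne]

/-- This function is the test function for the mass balance. -/
theorem isC1_potential (hM : M.Admissible) :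
    IsC1 T Ω (fun t x => 1 / 2 * (U t x ⬝ᵥ U t x) - M.chemPot (r t x) (ϑ t x)) :=
  ContDiffOn.sub hs.velocity_reg.c1.half_dotProduct (hs.isC1_chemPot hM)

theorem isC1_pressure_add (hM : M.Admissible) :
    IsC1 T Ω (fun t x => M.pressure (r t x) (ϑ t x) + 1 / 2 * (K t x ⬝ᵥ K t x)) :=
  ContDiffOn.add (hs.isC1_pressure hM) hs.magnetic_reg.c1.half_dotProduct

/-- It identifies the algebraic remainder with the combination of integrands that the weak
formulation yields for the test functions ϑ, ½|U|² − g, U and K. The Gibbs–Duhem relation supplies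
the derivatives of g. -/
theorem remainder_eq (hΩ : IsBoundedLipschitzDomain Ω) (hM : M.Admissible) {t : ℝ}
    (ht : t ∈ Ioo (0 : ℝ) T) {x : E3} (hx : x ∈ Ω) (ρ θ : ℝ) (u H : V3)
    (A B : Fin 3 → Fin 3 → ℝ) (g : V3) :
    (pointData M r U ϑ K t x).remainder M ρ θ u H A B g =
      -(M.ν * (curlOf B ⬝ᵥ curlOf B)) - ϑ t x * M.production θ A g
        - (M.entropyDensity ρ θ * deriv (fun s => ϑ s x) t
          + M.entropyDensity ρ θ * (u ⬝ᵥ grad (ϑ t) x) + (M.heatFlux θ g ⬝ᵥ grad (ϑ t) x) / θ)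
        + (ρ * deriv (fun s => 1 / 2 * (U s x ⬝ᵥ U s x) - M.chemPot (r s x) (ϑ s x)) t
          + ρ * (u ⬝ᵥ grad (fun y => 1 / 2 * (U t y ⬝ᵥ U t y) - M.chemPot (r t y) (ϑ t y)) x))
        - (ρ * (u ⬝ᵥ deriv (fun s => U s x) t) + ddot (fun i j => ρ * u i * u j) (jac (U t) x)
          + M.pressure ρ θ * divg (U t) x - ddot (M.stress θ A) (jac (U t) x)
          + crossProduct (curlOf B) H ⬝ᵥ U t x)
        - (H ⬝ᵥ deriv (fun s => K s x) t
          - (crossProduct H u + M.ν • curlOf B) ⬝ᵥ curl (K t) x)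
        + deriv (fun s => M.pressure (r s x) (ϑ s x) + 1 / 2 * (K s x ⬝ᵥ K s x)) t := by
  have dU := (hs.velocity_reg.c1.hasFDerivAt_slice hΩ ht hx).differentiableAt
  have tU := (hs.velocity_reg.c1.hasDerivAt hΩ ht hx).differentiableAt
  have tK := (hs.magnetic_reg.c1.hasDerivAt hΩ ht hx).differentiableAt
  have e1 : deriv (fun s => 1 / 2 * (U s x ⬝ᵥ U s x) - M.chemPot (r s x) (ϑ s x)) t
      = U t x ⬝ᵥ deriv (fun s => U s x) t - deriv (fun s => M.chemPot (r s x) (ϑ s x)) t := by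
    rw [deriv_fun_sub, deriv_half_dotProduct tU]
    · exact (hs.velocity_reg.c1.half_dotProduct.hasDerivAt hΩ ht hx).differentiableAt
    · exact ((hs.isC1_chemPot hM).hasDerivAt hΩ ht hx).differentiableAt
  have e2 : grad (fun y => 1 / 2 * (U t y ⬝ᵥ U t y) - M.chemPot (r t y) (ϑ t y)) x
      = fun j => ∑ i, U t x i * jac (U t) x i j
        - pd j (fun y => M.chemPot (r t y) (ϑ t y)) x := by
    funext j
    rw [grad, pd, fderiv_fun_sub, sub_apply]
    · exact congrArg (· - _) (pd_half_dotProduct dU j)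
    · exact (hs.velocity_reg.c1.half_dotProduct.hasFDerivAt_slice hΩ ht hx).differentiableAt
    · exact ((hs.isC1_chemPot hM).hasFDerivAt_slice hΩ ht hx).differentiableAt
  have e3 : deriv (fun s => M.pressure (r s x) (ϑ s x) + 1 / 2 * (K s x ⬝ᵥ K s x)) t
      = (pointData M r U ϑ K t x).dtP M + K t x ⬝ᵥ deriv (fun s => K s x) t := by
    rw [deriv_fun_add, deriv_half_dotProduct tK, hs.deriv_pressure hΩ ht hx hM]
    · exact ((hs.isC1_pressure hM).hasDerivAt hΩ ht hx).differentiableAt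
    · exact (hs.magnetic_reg.c1.half_dotProduct.hasDerivAt hΩ ht hx).differentiableAt
  rw [e1, e2, e3, hs.deriv_chemPot hΩ ht hx hM]
  simp only [hs.pd_chemPot hΩ ht hx hM]
  rfl

end IsClassicalSolution

/-- Apart from the total energy, every occurrence of the weak solution is linear in ρs, ρ, ρu or H,
with a classical coefficient. This is why the weak relations suffice to follow the relative energy
in time. -/
theorem relDensity_eq (M : Model) (D : PointData) (ρ θ : ℝ) (u H : V3) :
    D.relDensity M ρ θ u H = M.totalEnergy ρ u θ H - M.entropyDensity ρ θ * D.ϑ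
      + ρ * (1 / 2 * (D.U ⬝ᵥ D.U) - M.chemPot D.r D.ϑ) - (ρ • u) ⬝ᵥ D.U - H ⬝ᵥ D.K
      + (M.pressure D.r D.ϑ + 1 / 2 * (D.K ⬝ᵥ D.K)) := by
  simp only [PointData.relDensity, Model.relEnergy, Model.totalEnergy, dotProduct,
    Fin.sum_univ_three, Pi.sub_apply, Pi.smul_apply, smul_eq_mul]
  ring

theorem relDensity_self (M : Model) (D : PointData) (hr : 0 < D.r) :
    D.relDensity M D.r D.ϑ D.U D.K = 0 := by
  simp only [PointData.relDensity, sub_self, dotProduct_zero, Model.relEnergy, Model.energyDensity,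
    Model.entropyDensity, Model.chemPot, Model.pressure]
  field_simp
  ring

section

variable {M : Model} {lam T : ℝ} {Ω : Set E3} {ρ₀ : E3 → ℝ} {u₀ : E3 → V3} {θ₀ : E3 → ℝ}
  {H₀ : E3 → V3} {ρ : ℝ → E3 → ℝ} {u : ℝ → E3 → V3} {θ : ℝ → E3 → ℝ} {H : ℝ → E3 → V3}
  {m : ℝ → E3 → V3} {Du : ℝ → E3 → Fin 3 → Fin 3 → ℝ} {Dθ : ℝ → E3 → V3}
  {DH : ℝ → E3 → Fin 3 → Fin 3 → ℝ}
  (hw : WeakSolutionProps M lam T Ω ρ₀ u₀ θ₀ H₀ ρ u θ H m Du Dθ DH)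
  {r : ℝ → E3 → ℝ} {U : ℝ → E3 → V3} {ϑ : ℝ → E3 → ℝ} {K : ℝ → E3 → V3}
  (hs : IsClassicalSolution M T Ω r U ϑ K) (hM : M.Admissible) (hT : 0 < T)
  (hΩ : IsBoundedLipschitzDomain Ω)
include hw hs hM hT hΩ

theorem integrable_remainder : Integrable (fun z : ℝ × E3 =>
    (pointData M r U ϑ K z.1 z.2).remainder M (ρ z.1 z.2) (θ z.1 z.2) (u z.1 z.2) (H z.1 z.2)
      (Du z.1 z.2) (DH z.1 z.2) (Dθ z.1 z.2)) (cylMeasure T Ω) := by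
  have := isFiniteMeasure_cylMeasure T hΩ.measure_ne_top
  have hm : MeasurableSet (Ioo (0 : ℝ) T ×ˢ Ω) := measurableSet_Ioo.prod hΩ.isOpen.measurableSet
  refine (((((((hw.integrable_curl_sq.neg).sub
    (hw.integrable_production_mul hT hΩ hs.temperature_reg.c1)).sub
    (hw.integrable_entropyFlux hT hΩ hs.temperature_reg.c1)).add
    (hw.integrable_massFlux hM hT hΩ (hs.isC1_potential hM))).sub
    (hw.integrable_momentumFlux hT hΩ hs.velocity_reg.c1)).sub
    (hw.integrable_inductionFlux hT hΩ hs.magnetic_reg.c1)).add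
    (((hs.isC1_pressure_add hM).memLp_top_deriv hT hΩ).integrable le_top)).congr ?_
  filter_upwards [ae_restrict_mem hm] with z hz
  rw [hs.remainder_eq hΩ hM hz.1 hz.2]
  rfl

theorem integral_remainder {τ : ℝ} (hτ : τ ∈ Icc (0 : ℝ) T) :
    ∫ z, (pointData M r U ϑ K z.1 z.2).remainder M (ρ z.1 z.2) (θ z.1 z.2) (u z.1 z.2)
      (H z.1 z.2) (Du z.1 z.2) (DH z.1 z.2) (Dθ z.1 z.2) ∂(cylMeasure τ Ω)
    = -(∫ t in (0 : ℝ)..τ, ∫ x in Ω, M.ν * (curlOf (DH t x) ⬝ᵥ curlOf (DH t x)))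
      - (∫ t in (0 : ℝ)..τ, ∫ x in Ω, ϑ t x * M.production (θ t x) (Du t x) (Dθ t x))
      - (∫ t in (0 : ℝ)..τ, ∫ x in Ω,
          (M.entropyDensity (ρ t x) (θ t x) * deriv (fun s => ϑ s x) t
            + M.entropyDensity (ρ t x) (θ t x) * (u t x ⬝ᵥ grad (ϑ t) x)
            + (M.heatFlux (θ t x) (Dθ t x) ⬝ᵥ grad (ϑ t) x) / θ t x))
      + (∫ t in (0 : ℝ)..τ, ∫ x in Ω,
          (ρ t x * deriv (fun s => 1 / 2 * (U s x ⬝ᵥ U s x) - M.chemPot (r s x) (ϑ s x)) t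
            + ρ t x * (u t x ⬝ᵥ
              grad (fun y => 1 / 2 * (U t y ⬝ᵥ U t y) - M.chemPot (r t y) (ϑ t y)) x)))
      - (∫ t in (0 : ℝ)..τ, ∫ x in Ω,
          (ρ t x * (u t x ⬝ᵥ deriv (fun s => U s x) t)
            + ddot (fun i j => ρ t x * u t x i * u t x j) (jac (U t) x)
            + M.pressure (ρ t x) (θ t x) * divg (U t) x
            - ddot (M.stress (θ t x) (Du t x)) (jac (U t) x)
            + crossProduct (curlOf (DH t x)) (H t x) ⬝ᵥ U t x))
      - (∫ t in (0 : ℝ)..τ, ∫ x in Ω,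
          (H t x ⬝ᵥ deriv (fun s => K s x) t
            - (crossProduct (H t x) (u t x) + M.ν • curlOf (DH t x)) ⬝ᵥ curl (K t) x))
      + (∫ t in (0 : ℝ)..τ, ∫ x in Ω,
          deriv (fun s => M.pressure (r s x) (ϑ s x) + 1 / 2 * (K s x ⬝ᵥ K s x)) t) := by
  have := isFiniteMeasure_cylMeasure T hΩ.measure_ne_top
  have hm : MeasurableSet (Ioo (0 : ℝ) τ ×ˢ Ω) := measurableSet_Ioo.prod hΩ.isOpen.measurableSet
  have i1 := hw.integrable_curl_sq
  have i2 := hw.integrable_production_mul hT hΩ hs.temperature_reg.c1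
  have i3 := hw.integrable_entropyFlux hT hΩ hs.temperature_reg.c1
  have i4 := hw.integrable_massFlux hM hT hΩ (hs.isC1_potential hM)
  have i5 := hw.integrable_momentumFlux hT hΩ hs.velocity_reg.c1
  have i6 := hw.integrable_inductionFlux hT hΩ hs.magnetic_reg.c1
  have i7 := ((hs.isC1_pressure_add hM).memLp_top_deriv hT hΩ).integrable le_top
  rw [intervalIntegral_integral_eq hτ i1, intervalIntegral_integral_eq hτ i2,
    intervalIntegral_integral_eq hτ i3, intervalIntegral_integral_eq hτ i4,
    intervalIntegral_integral_eq hτ i5, intervalIntegral_integral_eq hτ i6,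
    intervalIntegral_integral_eq hτ i7]
  have hle := cylMeasure_mono hτ.2 Ω
  replace i1 := i1.mono_measure hle
  replace i2 := i2.mono_measure hle
  replace i3 := i3.mono_measure hle
  replace i4 := i4.mono_measure hle
  replace i5 := i5.mono_measure hle
  replace i6 := i6.mono_measure hle
  replace i7 := i7.mono_measure hle
  rw [← integral_neg]
  refine Eq.trans ?_ ((integral_add' (i1.neg.sub i2) ((((i4.sub i3).sub i5).sub i6).add i7)).trans
    ?_)
  swap
  · rw [integral_sub' i1.neg i2, integral_add' (((i4.sub i3).sub i5).sub i6) i7,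
      integral_sub' ((i4.sub i3).sub i5) i6, integral_sub' (i4.sub i3) i5, integral_sub' i4 i3]
    simp only [Pi.neg_apply]
    ring
  refine integral_congr_ae ?_
  filter_upwards [ae_restrict_mem hm] with z hz
  rw [hs.remainder_eq hΩ hM ⟨hz.1.1, hz.1.2.trans_le hτ.2⟩ hz.2]
  simp only [Pi.add_apply, Pi.sub_apply, Pi.neg_apply]
  ring

theorem integrable_relDensity : Integrable (fun z : ℝ × E3 =>
    (pointData M r U ϑ K z.1 z.2).relDensity M (ρ z.1 z.2) (θ z.1 z.2) (u z.1 z.2) (H z.1 z.2))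
      (cylMeasure T Ω) := by
  have := isFiniteMeasure_cylMeasure T hΩ.measure_ne_top
  simp only [relDensity_eq]
  refine (((((hw.integrable_totalEnergy hM).sub ?_).add ?_).sub ?_).sub ?_).add ?_
  · exact integrable_mul_memLp_top hw.int_entropy (hs.temperature_reg.c1.memLp_top hT hΩ)
  · exact integrable_mul_memLp_top (hw.integrable_density hM hΩ.measure_ne_top)
      ((hs.isC1_potential hM).memLp_top hT hΩ)
  · exact integrable_finsetSum _ fun i _ => integrable_mul_memLp_top (hw.int_momentum.eval i)
      ((hs.velocity_reg.c1.memLp_top hT hΩ).eval i)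
  · exact integrable_finsetSum _ fun i _ => integrable_mul_memLp_top
      ((hw.magnetic_space.memLp.eval i).integrable one_le_two)
      ((hs.magnetic_reg.c1.memLp_top hT hΩ).eval i)
  · exact ((hs.isC1_pressure_add hM).memLp_top hT hΩ).integrable le_top

theorem integral_initial (hinit : ∀ x ∈ Ω, r 0 x = ρ₀ x ∧ U 0 x = u₀ x ∧ ϑ 0 x = θ₀ x ∧
    K 0 x = H₀ x) :
    (∫ x in Ω, M.totalEnergy (ρ₀ x) (u₀ x) (θ₀ x) (H₀ x))
      - (∫ x in Ω, M.entropyDensity (ρ₀ x) (θ₀ x) * ϑ 0 x)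
      + (∫ x in Ω, ρ₀ x * (1 / 2 * (U 0 x ⬝ᵥ U 0 x) - M.chemPot (r 0 x) (ϑ 0 x)))
      - (∫ x in Ω, ρ₀ x * (u₀ x ⬝ᵥ U 0 x)) - (∫ x in Ω, H₀ x ⬝ᵥ K 0 x)
      + (∫ x in Ω, (M.pressure (r 0 x) (ϑ 0 x) + 1 / 2 * (K 0 x ⬝ᵥ K 0 x))) = 0 := by
  have : IsFiniteMeasure (volume.restrict Ω) := ⟨by simpa using hΩ.measure_ne_top.lt_top⟩
  have h0 : (0 : ℝ) ∈ Icc (0 : ℝ) T := ⟨le_rfl, hT.le⟩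
  have i1 := hw.initial.int_energy
  have i2 := integrable_mul_memLp_top hw.initial.int_entropy
    (hs.temperature_reg.c1.memLp_top_slice hT hΩ h0)
  have i3 := integrable_mul_memLp_top hw.initial.int_density
    ((hs.isC1_potential hM).memLp_top_slice hT hΩ h0)
  have i4 : Integrable (fun x => ρ₀ x * (u₀ x ⬝ᵥ U 0 x)) (volume.restrict Ω) := by
    refine (integrable_finsetSum Finset.univ fun i _ => integrable_mul_memLp_top
      (hw.initial.int_momentum.eval i) ((hs.velocity_reg.c1.memLp_top_slice hT hΩ h0).eval i)).congr
      (Eventually.of_forall fun x => ?_)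
    simp only [dotProduct, Finset.mul_sum, Pi.smul_apply, smul_eq_mul]
    exact Finset.sum_congr rfl fun i _ => by ring
  have i5 : Integrable (fun x => H₀ x ⬝ᵥ K 0 x) (volume.restrict Ω) :=
    integrable_finsetSum Finset.univ fun i _ => integrable_mul_memLp_top
      (hw.initial.int_magnetic.eval i) ((hs.magnetic_reg.c1.memLp_top_slice hT hΩ h0).eval i)
  have i6 := ((hs.isC1_pressure_add hM).memLp_top_slice hT hΩ h0).integrable le_top
  rw [← integral_sub_add_sub_sub_add i1 i2 i3 i4 i5 i6]
  refine setIntegral_eq_zero_of_forall_eq_zero fun x hx => ?_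
  obtain ⟨e1, e2, e3, e4⟩ := hinit x hx
  have h1 := relDensity_self M (pointData M r U ϑ K 0 x) (hs.density_pos h0 (subset_closure hx))
  rw [relDensity_eq] at h1
  rw [← e1, ← e2, ← e3, ← e4]
  refine Eq.trans ?_ h1
  simp only [pointData, smul_dotProduct, smul_eq_mul]

/-- The relative energy inequality. -/
theorem ae_integral_relDensity_le (hlam : 0 ≤ lam)
    (hinit : ∀ x ∈ Ω, r 0 x = ρ₀ x ∧ U 0 x = u₀ x ∧ ϑ 0 x = θ₀ x ∧ K 0 x = H₀ x) :
    ∀ᵐ τ ∂(volume.restrict (Ioo (0 : ℝ) T)),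
      ∫ x in Ω, (pointData M r U ϑ K τ x).relDensity M (ρ τ x) (θ τ x) (u τ x) (H τ x)
        ≤ ∫ z, (pointData M r U ϑ K z.1 z.2).remainder M (ρ z.1 z.2) (θ z.1 z.2) (u z.1 z.2)
          (H z.1 z.2) (Du z.1 z.2) (DH z.1 z.2) (Dθ z.1 z.2) ∂(cylMeasure τ Ω) := by
  have : IsFiniteMeasure (volume.restrict Ω) := ⟨by simpa using hΩ.measure_ne_top.lt_top⟩
  have hE := hw.energy
  have hEi := hw.int_energy
  -- The classical temperature is an admissible test function in the entropy inequality because it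
  -- is positive.
  have hS := hw.entropy ϑ hs.temperature_reg.c1 fun t ht x hx => (hs.temperature_pos ht hx).le
  rw [← Measure.restrict_congr_set Ioo_ae_eq_Icc] at hE hEi hS
  have hmom := ae_ae_of_ae_cylMeasure hw.momentum_eq
  have hσi := integrable_slice hw.int_entropy
  filter_upwards [hE, hEi, hS, hmom, hσi, ae_restrict_mem measurableSet_Ioo]
    with τ hE i1 hS hmom hσi hτ
  have hτ := Ioo_subset_Icc_self hτ
  have hmass := hw.mass _ (hs.isC1_potential hM) τ hτ
  have hmo := hw.momentum U hs.velocity_reg.c1 (fun t ht x hx => hs.velocity_eq_zero hT ht hx) τ hτ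
  have hind := hw.induction_eq K hs.magnetic_reg.c1
    (fun t ht x hx => hs.magnetic_eq_zero hT ht hx) τ hτ
  have hftc := (hs.isC1_pressure_add hM).integral_sub_integral hT hΩ hτ
  have h0 := integral_initial hw hs hM hT hΩ hinit
  rw [integral_remainder hw hs hM hT hΩ hτ]
  -- The contribution of λ|∇u|² has a favourable sign and is discarded.
  have hJ : ∫ t in (0 : ℝ)..τ, ∫ x in Ω, M.ν * (curlOf (DH t x) ⬝ᵥ curlOf (DH t x))
      ≤ ∫ t in (0 : ℝ)..τ, ∫ x in Ω,
        (lam * ddot (Du t x) (Du t x) + M.ν * (curlOf (DH t x) ⬝ᵥ curlOf (DH t x))) := by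
    have j1 := hw.integrable_curl_sq
    have j2 := hw.integrable_grad_sq.add hw.integrable_curl_sq
    have hle := cylMeasure_mono hτ.2 Ω
    rw [intervalIntegral_integral_eq hτ j1]
    refine (integral_mono (j1.mono_measure hle) (j2.mono_measure hle) fun z => ?_).trans
      (intervalIntegral_integral_eq hτ j2).ge
    exact le_add_of_nonneg_left (mul_nonneg hlam (ddot_self_nonneg _))
  have i2 := integrable_mul_memLp_top hσi (hs.temperature_reg.c1.memLp_top_slice hT hΩ hτ)
  have i3 := integrable_mul_memLp_top ((hw.density_space.memLp τ hτ).integrable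
      (by rw [ENNReal.le_div_iff_mul_le (by simp) (by simp)]; norm_num))
    ((hs.isC1_potential hM).memLp_top_slice hT hΩ hτ)
  have i4 : Integrable (fun x => m τ x ⬝ᵥ U τ x) (volume.restrict Ω) :=
    integrable_finsetSum Finset.univ fun i _ => integrable_mul_memLp_top
      (((hw.momentum_space i).memLp τ hτ).integrable
      (by rw [ENNReal.le_div_iff_mul_le (by simp) (by simp)]; norm_num))
      ((hs.velocity_reg.c1.memLp_top_slice hT hΩ hτ).eval i)
  have i5 : Integrable (fun x => H τ x ⬝ᵥ K τ x) (volume.restrict Ω) :=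
    integrable_finsetSum Finset.univ fun i _ => integrable_mul_memLp_top
      ((hw.int_magnetic τ hτ).eval i) ((hs.magnetic_reg.c1.memLp_top_slice hT hΩ hτ).eval i)
  have i6 := ((hs.isC1_pressure_add hM).memLp_top_slice hT hΩ hτ).integrable le_top
  -- The momentum balance is stated for the weakly continuous representative m, which agrees with ρu
  -- for almost every τ.
  have hsplit : ∫ x in Ω, (pointData M r U ϑ K τ x).relDensity M (ρ τ x) (θ τ x) (u τ x) (H τ x)
      = (∫ x in Ω, M.totalEnergy (ρ τ x) (u τ x) (θ τ x) (H τ x))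
        - (∫ x in Ω, M.entropyDensity (ρ τ x) (θ τ x) * ϑ τ x)
        + (∫ x in Ω, ρ τ x * (1 / 2 * (U τ x ⬝ᵥ U τ x) - M.chemPot (r τ x) (ϑ τ x)))
        - (∫ x in Ω, m τ x ⬝ᵥ U τ x) - (∫ x in Ω, H τ x ⬝ᵥ K τ x)
        + (∫ x in Ω, (M.pressure (r τ x) (ϑ τ x) + 1 / 2 * (K τ x ⬝ᵥ K τ x))) := by
    rw [← integral_sub_add_sub_sub_add i1 i2 i3 i4 i5 i6]
    refine integral_congr_ae ?_
    filter_upwards [hmom] with x hx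
    simp only [relDensity_eq, pointData]
    rw [hx]
  -- The energy and entropy inequalities bound the first two terms; the mass, momentum and induction
  -- balances and the fundamental theorem of calculus give the others. The values at time 0 add up
  -- to the initial relative energy, which is zero.
  rw [hsplit]
  linarith

end

/-! ### Absorption of the remainder -/

instance holderTriple_four_four_two : ENNReal.HolderTriple 4 4 2 := by
  refine ⟨?_⟩
  rw [← two_mul, show (4 : ℝ≥0∞) = 2 * 2 by norm_num,
    ENNReal.mul_inv (Or.inl two_ne_zero) (Or.inl ENNReal.ofNat_ne_top), ← mul_assoc,
    ENNReal.mul_inv_cancel two_ne_zero ENNReal.ofNat_ne_top, one_mul]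

theorem integral_sq_le_of_eLpNorm_le {α : Type*} [MeasurableSpace α] {μ : Measure α} {f : α → ℝ}
    {G : α → V3} (hf : AEStronglyMeasurable f μ) (hG : MemLp G 2 μ) {B : NNReal}
    (h : eLpNorm f 2 μ ≤ B * eLpNorm G 2 μ) :
    Integrable (fun x => f x ^ 2) μ ∧ ∫ x, f x ^ 2 ∂μ ≤ B ^ 2 * ∫ x, ∑ j, G x j ^ 2 ∂μ := by
  have hf2 : MemLp f 2 μ := ⟨hf, h.trans_lt (ENNReal.mul_lt_top (by simp) hG.2)⟩
  refine ⟨hf2.integrable_sq, ?_⟩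
  have hGi : Integrable (fun x => ∑ j, G x j ^ 2) μ :=
    integrable_finsetSum _ fun j _ => (hG.eval j).integrable_sq
  -- The norm on `V3` is the sup norm, attained at one component, so its square is at most the sum
  -- of the squares.
  have hle : ∫ x, ‖G x‖ ^ 2 ∂μ ≤ ∫ x, ∑ j, G x j ^ 2 ∂μ := by
    refine integral_mono (hG.integrable_norm_pow two_ne_zero) hGi fun x => ?_
    obtain ⟨j, -, hj⟩ := Finset.exists_mem_eq_sup' Finset.univ_nonempty fun j => ‖G x j‖₊
    have e : ‖G x‖ = |G x j| := by
      rw [Pi.norm_def, ← Finset.sup'_eq_sup Finset.univ_nonempty, hj]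
      rfl
    simp only [e, sq_abs]
    exact Finset.single_le_sum (f := fun j => G x j ^ 2) (fun i _ => sq_nonneg _)
      (Finset.mem_univ j)
  rw [hf2.eLpNorm_eq_integral_rpow_norm two_ne_zero ENNReal.ofNat_ne_top,
    hG.eLpNorm_eq_integral_rpow_norm two_ne_zero ENNReal.ofNat_ne_top,
    ← ENNReal.ofReal_coe_nnreal, ← ENNReal.ofReal_mul B.coe_nonneg] at h
  simp only [ENNReal.toReal_ofNat, Real.rpow_two, Real.norm_eq_abs, sq_abs] at h
  have hb : 0 ≤ ∫ x, ‖G x‖ ^ 2 ∂μ := integral_nonneg fun x => by positivity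
  have ha : 0 ≤ ∫ x, f x ^ 2 ∂μ := integral_nonneg fun x => by positivity
  rw [ENNReal.ofReal_le_ofReal_iff (mul_nonneg B.coe_nonneg (Real.rpow_nonneg hb _)),
    inv_eq_one_div, ← Real.sqrt_eq_rpow, ← Real.sqrt_eq_rpow] at h
  have h2 := mul_self_le_mul_self (Real.sqrt_nonneg _) h
  rw [Real.mul_self_sqrt ha, mul_mul_mul_comm, Real.mul_self_sqrt hb] at h2
  refine h2.trans ?_
  rw [sq]
  exact mul_le_mul_of_nonneg_left hle (by positivity)

/-- The weighted Poincaré inequality `∫ (1 + θ²) |v|² ≤ C ∫ |∇ v|²` on `W^{1,2}_0`, uniform for `θ`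
in a bounded subset of `L⁴`. -/
theorem exists_weighted_poincare {Ω : Set E3} (hΩ : IsBoundedLipschitzDomain Ω) (C : NNReal) :
    ∃ S : ℝ, 0 ≤ S ∧ ∀ θ : E3 → ℝ, AEStronglyMeasurable θ (volume.restrict Ω) →
      eLpNorm θ 4 (volume.restrict Ω) ≤ C → ∀ (v : E3 → V3) (D : E3 → Fin 3 → Fin 3 → ℝ),
      (∀ i, MemW12Zero Ω (fun x => v x i) (fun x => D x i)) →
      Integrable (fun x => (1 + θ x ^ 2) * (v x ⬝ᵥ v x)) (volume.restrict Ω) ∧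
        ∫ x in Ω, (1 + θ x ^ 2) * (v x ⬝ᵥ v x) ≤ S * ∫ x in Ω, ddot (D x) (D x) := by
  have hfm : IsFiniteMeasure (volume.restrict Ω) := ⟨by simpa using hΩ.measure_ne_top.lt_top⟩
  obtain ⟨P, hP⟩ := exists_eLpNorm_four_le hΩ.isBounded
  -- The summand 1 of the weight is treated like θ², as the square of the constant function 1 in L⁴.
  obtain ⟨C₁, hC₁⟩ : ∃ C₁ : NNReal, eLpNorm (fun _ : E3 => (1 : ℝ)) 4 (volume.restrict Ω) = C₁ :=
    ⟨_, (ENNReal.coe_toNNReal (memLp_const (1 : ℝ)).2.ne).symm⟩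
  have key : ∀ (B : NNReal) (k : E3 → ℝ), AEStronglyMeasurable k (volume.restrict Ω) →
      eLpNorm k 4 (volume.restrict Ω) ≤ B → ∀ (w : E3 → ℝ) (G : E3 → V3), MemW12Zero Ω w G →
      Integrable (fun x => (k x * w x) ^ 2) (volume.restrict Ω) ∧ ∫ x in Ω, (k x * w x) ^ 2
        ≤ ((B * P : NNReal) : ℝ) ^ 2 * ∫ x in Ω, ∑ j, G x j ^ 2 := by
    intro B k hk hkB w G hw
    refine integral_sq_le_of_eLpNorm_le (hk.mul hw.memLp.1) hw.memLp_grad ?_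
    -- Hölder's inequality with 1/4 + 1/4 = 1/2, followed by the Sobolev embedding into L⁴.
    refine (eLpNorm_smul_le_mul_eLpNorm (p := 4) (q := 4) (r := 2) hw.memLp.1 hk).trans ?_
    rw [ENNReal.coe_mul, mul_assoc]
    exact mul_le_mul' hkB (hP w G hw)
  refine ⟨((C₁ * P : NNReal) : ℝ) ^ 2 + ((C * P : NNReal) : ℝ) ^ 2, by positivity,
    fun θ hθ hθC v D hD => ?_⟩
  have h1 := fun i => key C₁ (fun _ => 1) aestronglyMeasurable_const hC₁.le _ _ (hD i)
  have h2 := fun i => key C θ hθ hθC _ _ (hD i)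
  have e : ∀ x, (1 + θ x ^ 2) * (v x ⬝ᵥ v x)
      = ∑ i, ((1 * v x i) ^ 2 + (θ x * v x i) ^ 2) := fun x => by
    rw [dotProduct, Finset.mul_sum]
    exact Finset.sum_congr rfl fun i _ => by ring
  have hDi : ∀ i, Integrable (fun x => ∑ j, D x i j ^ 2) (volume.restrict Ω) := fun i =>
    integrable_finsetSum _ fun j _ => ((hD i).memLp_grad.eval j).integrable_sq
  have e' : ∀ x, ddot (D x) (D x) = ∑ i, ∑ j, D x i j ^ 2 := fun x => by simp only [ddot, sq]
  simp only [e, e']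
  have h3 : ∀ i, Integrable (fun x => (1 * v x i) ^ 2 + (θ x * v x i) ^ 2) (volume.restrict Ω) :=
    fun i => (h1 i).1.add (h2 i).1
  refine ⟨integrable_finsetSum _ fun i _ => h3 i, ?_⟩
  rw [integral_finsetSum _ fun i _ => h3 i, integral_finsetSum _ fun i _ => hDi i,
    Finset.mul_sum]
  refine Finset.sum_le_sum fun i _ => ?_
  rw [integral_add (h1 i).1 (h2 i).1, add_mul]
  exact add_le_add (h1 i).2 (h2 i).2

section

variable {M : Model} {lam T : ℝ} {Ω : Set E3} {ρ₀ : E3 → ℝ} {u₀ : E3 → V3} {θ₀ : E3 → ℝ}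
  {H₀ : E3 → V3} {ρ : ℝ → E3 → ℝ} {u : ℝ → E3 → V3} {θ : ℝ → E3 → ℝ} {H : ℝ → E3 → V3}
  {m : ℝ → E3 → V3} {Du : ℝ → E3 → Fin 3 → Fin 3 → ℝ} {Dθ : ℝ → E3 → V3}
  {DH : ℝ → E3 → Fin 3 → Fin 3 → ℝ}
  (hw : WeakSolutionProps M lam T Ω ρ₀ u₀ θ₀ H₀ ρ u θ H m Du Dθ DH)
  {r : ℝ → E3 → ℝ} {U : ℝ → E3 → V3} {ϑ : ℝ → E3 → ℝ} {K : ℝ → E3 → V3}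
  (hs : IsClassicalSolution M T Ω r U ϑ K) (hM : M.Admissible) (hT : 0 < T)
  (hΩ : IsBoundedLipschitzDomain Ω)
include hw hs hM hT hΩ

/-- The null terms are added at no cost, the pointwise bound is integrated, and the term with δ is
absorbed by viscosity through the weighted Poincaré and Korn inequalities. -/
theorem exists_integral_remainder_le : ∃ C : ℝ, 0 ≤ C ∧
    ∀ᵐ t ∂(volume.restrict (Ioo (0 : ℝ) T)),
      ∫ x in Ω, (pointData M r U ϑ K t x).remainder M (ρ t x) (θ t x) (u t x) (H t x)
          (Du t x) (DH t x) (Dθ t x)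
        ≤ C * ∫ x in Ω, (pointData M r U ϑ K t x).relDensity M (ρ t x) (θ t x) (u t x) (H t x) := by
  obtain ⟨r₁, r₂, θ₁, θ₂, N, hr₁, hθ₁, hN, hbd⟩ := hs.exists_pointData_bdd hΩ hM hT
  obtain ⟨c, hc, hrem⟩ := PointData.exists_remainder_bound M hM (r₂ := r₂) (θ₂ := θ₂) hr₁ hθ₁ hN
  obtain ⟨Cθ, hCθ⟩ := hw.temperature_bound
  obtain ⟨S, hS0, hS⟩ := exists_weighted_poincare hΩ Cθ
  -- With this δ one has δS ≤ 2c, so the weighted Poincaré term is at most 2c∫|∇(u − U)|², which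
  -- Korn's inequality bounds by the viscous dissipation. The denominator S + 1 also allows S = 0.
  obtain ⟨C, hC, hrem⟩ := hrem (2 * c / (S + 1)) (by positivity)
  refine ⟨C, hC.le, ?_⟩
  have hfin := hΩ.measure_ne_top
  filter_upwards [hCθ, hw.velocity_space.slice, hw.temperature_space.slice, hw.magnetic_space.slice,
    integrable_slice (integrable_remainder hw hs hM hT hΩ),
    integrable_slice (integrable_relDensity hw hs hM hT hΩ),
    ae_ae_of_ae_cylMeasure hw.temperature_pos, ae_restrict_mem measurableSet_Ioo]
    with t hθC hu hθ hH i1 i2 hθp ht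
  have hnull := hs.isNull_nullTerms hΩ ht hM hu hθ hH
  have hv := fun i => (hu i).sub (hs.memW12Zero_velocity hΩ ht i) hfin
  have hkorn := korn (v := fun x => u t x - U t x) (D := fun x => Du t x - jac (U t) x)
    hΩ.isOpen hfin hv
  obtain ⟨i3, hP⟩ := hS (θ t) hθ.memLp.1 hθC (fun x => u t x - U t x)
    (fun x => Du t x - jac (U t) x) hv
  have hD : ∀ i j, MemLp (fun x => (Du t x - jac (U t) x) i j) 2 (volume.restrict Ω) :=
    fun i j => (hv i).memLp_grad.eval j
  have hdev : ∀ i j, MemLp (fun x => devSym (Du t x - jac (U t) x) i j) 2 (volume.restrict Ω) := by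
    intro i j
    simp only [devSym]
    refine ((hD i j).add (hD j i)).sub ?_
    split_ifs
    · exact (memLp_finsetSum Finset.univ fun k _ => hD k k).const_mul _
    · exact MemLp.zero
  have i4 : Integrable (fun x => ddot (devSym (Du t x - jac (U t) x))
      (devSym (Du t x - jac (U t) x))) (volume.restrict Ω) :=
    integrable_finsetSum _ fun i _ => integrable_finsetSum _ fun j _ =>
      (hdev i j).integrable_mul (hdev i j)
  have hmono : ∫ x in Ω, ((pointData M r U ϑ K t x).remainder M (ρ t x) (θ t x) (u t x) (H t x)
          (Du t x) (DH t x) (Dθ t x)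
        + (pointData M r U ϑ K t x).nullTerms M (θ t x) (u t x) (H t x) (Du t x) (DH t x) (Dθ t x))
      ≤ ∫ x in Ω, (C * (pointData M r U ϑ K t x).relDensity M (ρ t x) (θ t x) (u t x) (H t x)
        + 2 * c / (S + 1) * ((1 + θ t x ^ 2) * ((u t x - U t x) ⬝ᵥ (u t x - U t x)))
        - c * ddot (devSym (Du t x - jac (U t) x)) (devSym (Du t x - jac (U t) x))) := by
    refine integral_mono_ae (i1.add hnull.1)
      (((i2.const_mul C).add (i3.const_mul _)).sub (i4.const_mul c)) ?_
    filter_upwards [hθp, hw.density_nonneg t (Ioo_subset_Icc_self ht),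
      ae_restrict_mem hΩ.isOpen.measurableSet] with x h1 h2 hx
    obtain ⟨b1, b2, b3⟩ := hbd t ht x hx
    exact hrem _ (hs.pointData_eqs hΩ ht hx hM) b1 b2 b3 _ _ _ _ _ _ _ h2 h1
  have i5 : Integrable (fun x =>
      C * (pointData M r U ϑ K t x).relDensity M (ρ t x) (θ t x) (u t x) (H t x)
        + 2 * c / (S + 1) * ((1 + θ t x ^ 2) * ((u t x - U t x) ⬝ᵥ (u t x - U t x))))
      (volume.restrict Ω) := (i2.const_mul C).add (i3.const_mul _)
  rw [integral_add i1 hnull.1, hnull.2, add_zero, integral_sub i5 (i4.const_mul c),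
    integral_add (i2.const_mul C) (i3.const_mul _), integral_const_mul, integral_const_mul,
    integral_const_mul] at hmono
  refine hmono.trans ?_
  have h0 : 0 ≤ ∫ x in Ω, ddot (Du t x - jac (U t) x) (Du t x - jac (U t) x) :=
    integral_nonneg fun x => ddot_self_nonneg _
  generalize ∫ x in Ω, ddot (Du t x - jac (U t) x) (Du t x - jac (U t) x) = I at *
  have h1 := mul_le_mul_of_nonneg_left hP (show 0 ≤ 2 * c / (S + 1) by positivity)
  have h2 := mul_le_mul_of_nonneg_left hkorn hc.le
  have h3 : 2 * c / (S + 1) * (S * I) ≤ 2 * c * I := by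
    rw [div_mul_eq_mul_div, div_le_iff₀ (by positivity)]
    have : 0 ≤ 2 * c * I := by positivity
    linarith
  linarith

theorem ae_relDensity_nonneg : ∀ᵐ z ∂(cylMeasure T Ω),
    0 ≤ (pointData M r U ϑ K z.1 z.2).relDensity M (ρ z.1 z.2) (θ z.1 z.2) (u z.1 z.2)
      (H z.1 z.2) := by
  obtain ⟨r₁, r₂, θ₁, θ₂, N, hr₁, hθ₁, hN, hbd⟩ := hs.exists_pointData_bdd hΩ hM hT
  obtain ⟨C, hC, hdi⟩ := hM.exists_dichotomy (r₂ := r₂) (θ₂ := θ₂) hr₁ hθ₁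
  have hm : MeasurableSet (Ioo (0 : ℝ) T ×ˢ Ω) := measurableSet_Ioo.prod hΩ.isOpen.measurableSet
  filter_upwards [hw.density_nonneg_cyl, hw.temperature_pos, ae_restrict_mem hm] with z h1 h2 hz
  obtain ⟨-, b2, b3⟩ := hbd z.1 hz.1 z.2 hz.2
  have h3 := (hdi _ b2 _ b3 _ _ h1 h2).1
  have h4 := mul_nonneg (mul_nonneg (by norm_num : (0 : ℝ) ≤ 1 / 2) h1)
    (dotProduct_self_nonneg' (u z.1 z.2 - U z.1 z.2))
  have h5 := dotProduct_self_nonneg' (H z.1 z.2 - K z.1 z.2)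
  simp only [PointData.relDensity, pointData]
  linarith

/-- The relative energy inequality and the bound on the remainder are the hypotheses of Grönwall's
inequality for the integrated relative density, and a nonnegative function of integral zero vanishes
almost everywhere. -/
theorem ae_relDensity_eq_zero (hlam : 0 ≤ lam)
    (hinit : ∀ x ∈ Ω, r 0 x = ρ₀ x ∧ U 0 x = u₀ x ∧ ϑ 0 x = θ₀ x ∧ K 0 x = H₀ x) :
    ∀ᵐ z ∂(cylMeasure T Ω), (pointData M r U ϑ K z.1 z.2).relDensity M (ρ z.1 z.2) (θ z.1 z.2)
      (u z.1 z.2) (H z.1 z.2) = 0 := by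
  obtain ⟨C, hC, hrem⟩ := exists_integral_remainder_le hw hs hM hT hΩ
  have hi := integrable_relDensity hw hs hM hT hΩ
  have hI := integrable_integral_slice hi
  have h0 := ae_relDensity_nonneg hw hs hM hT hΩ
  have hri := integrable_remainder hw hs hM hT hΩ
  have hgr := ae_eq_zero_of_le_integral hC hI
    (by filter_upwards [ae_ae_of_ae_cylMeasure h0] with t ht using integral_nonneg_of_ae ht) (by
      filter_upwards [ae_integral_relDensity_le hw hs hM hT hΩ hlam hinit,
        ae_restrict_mem measurableSet_Ioo] with τ hτ hτi
      have hτi := Ioo_subset_Icc_self hτi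
      refine hτ.trans ?_
      rw [← intervalIntegral_integral_eq hτi hri, ← intervalIntegral.integral_const_mul,
        intervalIntegral.integral_of_le hτi.1, intervalIntegral.integral_of_le hτi.1,
        integral_Ioc_eq_integral_Ioo, integral_Ioc_eq_integral_Ioo]
      have hsub : volume.restrict (Ioo 0 τ) ≤ volume.restrict (Ioo 0 T) :=
        Measure.restrict_mono (Ioo_subset_Ioo_right hτi.2) le_rfl
      exact integral_mono_ae ((integrable_integral_slice hri).mono_measure hsub)
        ((hI.const_mul C).mono_measure hsub) (ae_mono hsub hrem))
  have hz : ∫ z, (pointData M r U ϑ K z.1 z.2).relDensity M (ρ z.1 z.2) (θ z.1 z.2)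
      (u z.1 z.2) (H z.1 z.2) ∂(cylMeasure T Ω) = 0 := by
    rw [← intervalIntegral_integral_eq ⟨hT.le, le_rfl⟩ hi, intervalIntegral.integral_of_le hT.le,
      integral_Ioc_eq_integral_Ioo]
    exact integral_eq_zero_of_ae hgr
  exact (integral_eq_zero_iff_of_nonneg_ae h0 hi).1 hz

/-- All three parts of the relative density vanish, being nonnegative. Coercivity gives equality of
densities and temperatures. The kinetic part carries the factor ρ, so equality of velocities follows
only once ρ is known to equal the positive classical density. -/
theorem ae_eq_of_weak_of_classical (hlam : 0 ≤ lam)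
    (hinit : ∀ x ∈ Ω, r 0 x = ρ₀ x ∧ U 0 x = u₀ x ∧ ϑ 0 x = θ₀ x ∧ K 0 x = H₀ x) :
    ∀ᵐ z ∂(cylMeasure T Ω), ρ z.1 z.2 = r z.1 z.2 ∧ u z.1 z.2 = U z.1 z.2 ∧
      θ z.1 z.2 = ϑ z.1 z.2 ∧ H z.1 z.2 = K z.1 z.2 := by
  obtain ⟨r₁, r₂, θ₁, θ₂, N, hr₁, hθ₁, hN, hbd⟩ := hs.exists_pointData_bdd hΩ hM hT
  obtain ⟨c, hc, hco⟩ := hM.exists_relEnergy_coercive (r₂ := r₂) (θ₂ := θ₂) hr₁ hθ₁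
  have hm : MeasurableSet (Ioo (0 : ℝ) T ×ˢ Ω) := measurableSet_Ioo.prod hΩ.isOpen.measurableSet
  filter_upwards [ae_relDensity_eq_zero hw hs hM hT hΩ hlam hinit, hw.density_nonneg_cyl,
    hw.temperature_pos, ae_restrict_mem hm] with z h0 h1 h2 hz
  obtain ⟨-, b2, b3⟩ := hbd z.1 hz.1 z.2 hz.2
  have h3 := hco _ b2 _ b3 _ _ h1 h2
  have h4 := mul_nonneg (mul_nonneg (by norm_num : (0 : ℝ) ≤ 1 / 2) h1)
    (dotProduct_self_nonneg' (u z.1 z.2 - U z.1 z.2))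
  have h5 := dotProduct_self_nonneg' (H z.1 z.2 - K z.1 z.2)
  simp only [PointData.relDensity, pointData] at h0
  have h6 : 0 ≤ (θ z.1 z.2 - ϑ z.1 z.2) ^ 2 * (1 + θ z.1 z.2 ^ 2) := by positivity
  have h7 : 0 ≤ min 1 ((ρ z.1 z.2 - r z.1 z.2) ^ 2) := by positivity
  have h8 : (θ z.1 z.2 - ϑ z.1 z.2) ^ 2 * (1 + θ z.1 z.2 ^ 2)
      + min 1 ((ρ z.1 z.2 - r z.1 z.2) ^ 2) ≤ 0 := by
    by_contra hcon
    linarith [mul_pos hc (not_le.1 hcon)]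
  have h9 := mul_nonneg hc.le (add_nonneg h6 h7)
  have hρ : ρ z.1 z.2 = r z.1 z.2 := by
    have : min 1 ((ρ z.1 z.2 - r z.1 z.2) ^ 2) ≤ 0 := by linarith
    -- The cap 1 in the minimum cannot be nonpositive, so the square itself vanishes.
    rcases min_le_iff.1 this with h | h
    · linarith
    · exact sub_eq_zero.1 (pow_eq_zero_iff two_ne_zero |>.1 (le_antisymm h (sq_nonneg _)))
  have hrpos : 0 < ρ z.1 z.2 := hρ ▸ hr₁.trans_le b2.1
  refine ⟨hρ, ?_, ?_, ?_⟩
  · have : (u z.1 z.2 - U z.1 z.2) ⬝ᵥ (u z.1 z.2 - U z.1 z.2) = 0 := by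
      have e : 1 / 2 * ρ z.1 z.2 * ((u z.1 z.2 - U z.1 z.2) ⬝ᵥ (u z.1 z.2 - U z.1 z.2)) = 0 := by
        linarith
      exact (mul_eq_zero.1 e).resolve_left (by positivity)
    exact sub_eq_zero.1 (dotProduct_self_eq_zero.1 this)
  · have : (θ z.1 z.2 - ϑ z.1 z.2) ^ 2 * (1 + θ z.1 z.2 ^ 2) = 0 := by linarith
    have h10 := (mul_eq_zero.1 this).resolve_right (by positivity)
    exact sub_eq_zero.1 (pow_eq_zero_iff two_ne_zero |>.1 h10)
  · exact sub_eq_zero.1 (dotProduct_self_eq_zero.1 (by linarith))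

end

end MHD

theorem theorem1
    (M : MHD.Model) (hM : M.Admissible)
    (lam : ℝ) (hlam : 0 ≤ lam)
    (T : ℝ) (hT : 0 < T)
    (Ω : Set MHD.E3) (hΩ : MHD.IsBoundedLipschitzDomain Ω)
    (ρ₀ : MHD.E3 → ℝ) (u₀ : MHD.E3 → MHD.V3) (θ₀ : MHD.E3 → ℝ) (H₀ : MHD.E3 → MHD.V3)
    (ρ : ℝ → MHD.E3 → ℝ) (u : ℝ → MHD.E3 → MHD.V3)
    (θ : ℝ → MHD.E3 → ℝ) (H : ℝ → MHD.E3 → MHD.V3)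
    (hweak : MHD.IsWeakSolution M lam T Ω ρ₀ u₀ θ₀ H₀ ρ u θ H)
    (ρ' : ℝ → MHD.E3 → ℝ) (u' : ℝ → MHD.E3 → MHD.V3)
    (θ' : ℝ → MHD.E3 → ℝ) (H' : ℝ → MHD.E3 → MHD.V3)
    (hstrong : MHD.IsClassicalSolution M T Ω ρ' u' θ' H')
    (hinit : ∀ x ∈ Ω, ρ' 0 x = ρ₀ x ∧ u' 0 x = u₀ x ∧ θ' 0 x = θ₀ x ∧ H' 0 x = H₀ x) :
    ∀ᵐ z ∂(MeasureTheory.volume.restrict (Set.Ioo (0 : ℝ) T ×ˢ Ω)),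
      ρ z.1 z.2 = ρ' z.1 z.2 ∧ u z.1 z.2 = u' z.1 z.2 ∧
        θ z.1 z.2 = θ' z.1 z.2 ∧ H z.1 z.2 = H' z.1 z.2 := by
  obtain ⟨m, Du, Dθ, DH, hw⟩ := hweak
  exact MHD.ae_eq_of_weak_of_classical hw hstrong hM hT hΩ hlam hinit
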